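/- Fix $F,\nu>0$, $1\le r\le 2$, $0\le s\le 2$, and consider the viscous St. Venant equations in Lagrangian coordinates $$\tau_t-u_x=0,\qquad u_t+((2F)^{-1}\tau^{-2})_x=1-\tau^{s+1}u^r+\nu(\tau^{-2}u_x)_x .$$ Traveling waves $(\bar\tau,\bar u)(x-ct)$ with $c\ne0$ satisfy $\bar u=q-c\bar\tau$ for a constant $q$ and the profile equation $$c^2\bar\tau'+((2F)^{-1}\bar\tau^{-2})'=1-\bar\tau^{s+1}(q-c\bar\tau)^r-c\nu(\bar\tau^{-2}\bar\tau')'.\tag{1}$$ Let $(\tau_0,0)$, with $\tau_0>0$ and $u_0:=q-c\tau_0>0$, be a saddle equilibrium of (1) in the $(\tau,\tau')$-plane, and let $\bar\tau$ be a nonconstant solution of (1) with $\bar\tau>0$, $\bar u=q-c\bar\tau>0$ and $(\bar\tau,\bar\tau')\to(\tau_0,0)$ as $x\to\pm\infty$. **Evans function.** Linearizing about the wave, the eigenvalue equations for $W=(\tau,u,\bar\tau^{-2}u')^T$ are $W'=A(x,\lambda)W$ with $$A=\begin{pmatrix}\lambda/c&0&-\bar\tau^2/c\\0&0&\bar\tau^2\\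 \frac{(s+1)\bar\tau^s\bar u^r-\bar\alpha'-\bar\alpha\lambda/c}{\nu}&\frac{\lambda+r\bar\tau^{s+1}\bar u^{r-1}}{\nu}&\frac{-c\bar\tau^2+\bar\alpha\bar\tau^2/c}{\nu}\end{pmatrix},\qquad \bar\alpha=\bar\tau^{-3}(F^{-1}+2c\nu\bar\tau'),$$ and $A_0(\lambda)=\lim_{x\to\pm\infty}A(x,\lambda)$. The *region of extended consistent splitting* $\Lambda$ is the set of $\lambda\in\mathbb C$ that can be joined to real $+\infty$ by a connected set along which one eigenvalue of $A_0$ has real part strictly less than those of the other two. For $\lambda\in\Lambda$ let $V_3^+$ be an eigenvector of $A_0(\lambda)$ for the eigenvalue of least real part and $V_1^-,V_2^-$ a basis of the sum of the generalized eigenspaces of the other two, let $W_j^\pm$ solve $W'=A(x,\lambda)W$ with $W_j^\pm=(I+o(1))e^{A_0x}V_j^\pm$ as $x\to\pm\infty$ (the same matrix $I+o(1)$ for $j=1,2$), and set $$D(\lambda)=\frac{\det(W_1^-,W_2^-,W_3^+)|_{x=0}}{\det(V_1^-,V_2^-,V_3^+)} .$$ The point spectrum is $\{\lambda\in\Lambda: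 D(\lambda)=0\}$. It is *stable* if $D$ has no zeros in $\Lambda$ with $\Re\lambda\ge0$ other than $\lambda=0$, and $\lambda=0$ is a simple zero. *Extended consistent splitting* means $\{\Re\lambda\ge0\}\setminus\{0\}\subset\Lambda$. **Melnikov separation.** For $\tilde c$ near $c$ put $q(\tilde c)=u_0+\tilde c\tau_0$, so that the end state $(\tau_0,u_0)$ stays fixed. Let $(\bar\tau^+,(\bar\tau^+)')(\tilde c;x)$, $x\ge0$, and $(\bar\tau^-,(\bar\tau^-)')(\tilde c;x)$, $x\le0$, be orbits on the stable, respectively unstable, manifold of $(\tau_0,0)$ for (1) with parameters $(\tilde c,q(\tilde c))$, that is, solutions on these half-lines converging to $(\tau_0,0)$ as $x\to+\infty$, respectively $x\to-\infty$. Assume that for $\tilde c=c$ both coincide with $(\bar\tau,\bar\tau')$ and that they are differentiable in $\tilde c$ at $c$, uniformly in $x$. Let $$d(\tilde c)=\det\begin{pmatrix}\bar\tau'&\bar\tau^+-\bar\tau^-\\ \bar\tau''&(\bar\tau^+-\bar\tau^-)'\end{pmatrix}\Big|_{x=0},$$ where $\bar\tau',\bar\tau''$ are those of the given homoclinic; $\partial_cd$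 denotes the derivative of $d(\tilde c)=d(\tilde c,q(\tilde c))$ at $\tilde c=c$. **Corollary (stability index).** The function $D$ is well defined (independent of the choices) and analytic on $\Lambda$, and $[0,\infty)\subset\Lambda$; $d$ is differentiable at $c$. If the point spectrum of the homoclinic is stable, then $\partial_cd<0$. Moreover, under extended consistent splitting, $D$ has finitely many zeros with $\Re\lambda>0$, and their number, counted with multiplicity, is even if $\partial_cd<0$ and odd if $\partial_cd>0$. -/

import Mathlib

open Filter Topology

noncomputable section

namespace StVenant

/-- Parameters of the viscous St. Venant equations in Lagrangian coordinates
`τ_t - u_x = 0`, `u_t + ((2F)⁻¹ τ⁻²)_x = 1 - τ^(s+1) u^r + ν (τ⁻² u_x)_x`. -/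
structure Params where
  F : ℝ
  ν : ℝ
  r : ℝ
  s : ℝ
  F_pos : 0 < F
  ν_pos : 0 < ν
  one_le_r : 1 ≤ r
  r_le_two : r ≤ 2
  s_nonneg : 0 ≤ s
  s_le_two : s ≤ 2

/-- The phase-plane vector field, in the variables `(τ, τ')`, of the profile equation
`c² τ' + ((2F)⁻¹ τ⁻²)' = 1 - τ^(s+1) (q - c τ)^r - c ν (τ⁻² τ')'`, solved for `τ''`. -/
def profileField (P : Params) (c q : ℝ) (z : ℝ × ℝ) : ℝ × ℝ :=
  (z.2,
    z.1 ^ 2 / (c * P.ν) *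
        (1 - z.1 ^ (P.s + 1) * (q - c * z.1) ^ P.r - (c ^ 2 - 1 / (P.F * z.1 ^ 3)) * z.2)
      + 2 * z.2 ^ 2 / z.1)

/-- The differential form of the profile equation: if `τ' = p` everywhere and `p` is
differentiable at `x`, then `(τ, p)` follows `profileField` at `x` iff the profile equation holds
at `x`. -/
theorem profileField_iff (P : Params) {c q : ℝ} (hc : c ≠ 0) {τ p : ℝ → ℝ} {x p' : ℝ}
    (hτ0 : 0 < τ x) (hτ : ∀ y, HasDerivAt τ (p y) y) (hp : HasDerivAt p p' x) :
    (p x, p') = profileField P c q (τ x, p x) ↔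
      c ^ 2 * deriv τ x + deriv (fun y => (2 * P.F)⁻¹ * ((τ y) ^ 2)⁻¹) x
        = 1 - (τ x) ^ (P.s + 1) * (q - c * τ x) ^ P.r
          - c * P.ν * deriv (fun y => ((τ y) ^ 2)⁻¹ * deriv τ y) x := by
  have hF := P.F_pos.ne'
  have hν := P.ν_pos.ne'
  have ht := hτ0.ne'
  have hd : deriv τ = p := funext fun y => (hτ y).deriv
  have h2 : HasDerivAt (fun y => ((τ y) ^ 2)⁻¹) (-(2 * τ x * p x) / ((τ x) ^ 2) ^ 2) x := by
    have := ((hτ x).pow 2).inv (pow_ne_zero 2 ht)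
    have h3 : HasDerivAt (fun y => ((τ y) ^ 2)⁻¹) _ x := this
    simpa using h3
  have e1 := (h2.const_mul (2 * P.F)⁻¹).deriv
  have e2 := (h2.mul hp).deriv
  simp only [Pi.mul_def] at e2
  rw [hd, e1, e2]
  simp only [profileField, Prod.mk.injEq, true_and]
  generalize (τ x) ^ (P.s + 1) * (q - c * τ x) ^ P.r = g
  constructor
  · intro h
    rw [h]
    field_simp
    ring
  · intro h
    field_simp at h ⊢
    linarith

/-- `τ₀` is a saddle equilibrium: `(τ₀, 0)` is a rest point in the physical region `τ > 0`,
`u = q - c τ > 0`, and the linearization there has one negative and one positive eigenvalue. -/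
structure IsSaddle (P : Params) (c q τ₀ : ℝ) : Prop where
  tau_pos : 0 < τ₀
  u_pos : 0 < q - c * τ₀
  rest : profileField P c q (τ₀, 0) = 0
  neg_eigenvalue : ∃ μ : ℝ, μ < 0 ∧ Module.End.HasEigenvalue
    (fderiv ℝ (profileField P c q) (τ₀, 0)).toLinearMap μ
  pos_eigenvalue : ∃ μ : ℝ, 0 < μ ∧ Module.End.HasEigenvalue
    (fderiv ℝ (profileField P c q) (τ₀, 0)).toLinearMap μ

/-- `Z = (τ, τ')` is a (nontrivial) homoclinic orbit of the profile equation to `(τ₀, 0)`, lying in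
the physical region `τ > 0`, `u = q - c τ > 0`. -/
structure IsHomoclinic (P : Params) (c q τ₀ : ℝ) (Z : ℝ → ℝ × ℝ) : Prop where
  tau_pos : ∀ x, 0 < (Z x).1
  u_pos : ∀ x, 0 < q - c * (Z x).1
  ode : ∀ x, HasDerivAt Z (profileField P c q (Z x)) x
  tendsto_atTop : Tendsto Z atTop (𝓝 (τ₀, 0))
  tendsto_atBot : Tendsto Z atBot (𝓝 (τ₀, 0))
  nontrivial : ∃ x, Z x ≠ (τ₀, 0)

/-! ### The Evans function -/

/-- Coefficient matrix of the eigenvalue system `W' = A W` for `W = (τ, u, τ̄⁻² u')`, in terms of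
the values `t = τ̄`, `t₁ = τ̄'`, `t₂ = τ̄''` of the profile. -/
def coeffMatrix (P : Params) (c q : ℝ) (t t₁ t₂ : ℝ) (lam : ℂ) : Matrix (Fin 3) (Fin 3) ℂ :=
  let α : ℝ := (1 / P.F + 2 * c * P.ν * t₁) / t ^ 3
  let α₁ : ℝ := -3 * t₁ * (1 / P.F + 2 * c * P.ν * t₁) / t ^ 4 + 2 * c * P.ν * t₂ / t ^ 3
  let gτ : ℝ := (P.s + 1) * t ^ P.s * (q - c * t) ^ P.r
  let gu : ℝ := P.r * t ^ (P.s + 1) * (q - c * t) ^ (P.r - 1)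
  !![lam / c, 0, ((-(t ^ 2 / c) : ℝ) : ℂ);
     0, 0, ((t ^ 2 : ℝ) : ℂ);
     (gτ - α₁ - α * lam / c) / P.ν, (lam + gu) / P.ν,
       (((-c * t ^ 2 + α * t ^ 2 / c) / P.ν : ℝ) : ℂ)]

/-- The matrix `A(x, λ)` along the profile `Z = (τ̄, τ̄')`. -/
def profileMatrix (P : Params) (c q : ℝ) (Z : ℝ → ℝ × ℝ) (x : ℝ) (lam : ℂ) :
    Matrix (Fin 3) (Fin 3) ℂ :=
  coeffMatrix P c q (Z x).1 (Z x).2 (profileField P c q (Z x)).2 lam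

/-- The limiting matrix `A₀(λ)` at the end state. -/
def limitMatrix (P : Params) (c q τ₀ : ℝ) (lam : ℂ) : Matrix (Fin 3) (Fin 3) ℂ :=
  coeffMatrix P c q τ₀ 0 0 lam

/-- `μ 0, μ 1, μ 2` are the eigenvalues of `M` with multiplicity, and the real part of `μ 2` is
strictly smaller than those of `μ 0` and `μ 1`. -/
def IsGapSpectrum (M : Matrix (Fin 3) (Fin 3) ℂ) (μ : Fin 3 → ℂ) : Prop :=
  M.charpoly = ∏ j, (Polynomial.X - Polynomial.C (μ j)) ∧
    (μ 2).re < (μ 0).re ∧ (μ 2).re < (μ 1).re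

/-- The region of extended consistent splitting (one stable and two unstable directions): the
points that can be joined to real `+∞` by a connected set along which the eigenvalue continued from
the stable one at real `+∞` keeps its real part strictly below those of the other two. -/
def extendedSplittingRegion (P : Params) (c q τ₀ : ℝ) : Set ℂ :=
  {lam | ∃ S : Set ℂ, IsPreconnected S ∧ lam ∈ S ∧ (∃ R : ℝ, ∀ t : ℝ, R < t → (t : ℂ) ∈ S) ∧
    ∀ z ∈ S, ∃ μ, IsGapSpectrum (limitMatrix P c q τ₀ z) μ}

/-- Extended consistent splitting: the region contains the closed right half-plane minus `0`. -/
def ExtendedConsistentSplitting (P : Params) (c q τ₀ : ℝ) : Prop :=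
  {lam : ℂ | 0 ≤ lam.re} \ {0} ⊆ extendedSplittingRegion P c q τ₀

/-- `δ` is the quotient `det (W₁⁻, W₂⁻, W₃⁺)|_{x = 0} / det (V₁⁻, V₂⁻, V₃⁺)`, where `V₁⁻, V₂⁻` is a
basis of the sum of the generalized eigenspaces for the two eigenvalues of larger real part of `A₀`,
`V₃⁺` spans the eigenspace of the eigenvalue of least real part, and the `W_j^±` are solutions of
`W' = A(x) W` with `W_j^± ∼ exp(x A₀) V_j^±` as `x → ±∞`, that is, equal to
`(I + o(1)) exp(x A₀) V_j^±`. -/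
def IsEvansValue (A : ℝ → Matrix (Fin 3) (Fin 3) ℂ) (A₀ : Matrix (Fin 3) (Fin 3) ℂ) (δ : ℂ) :
    Prop :=
  ∃ (μ : Fin 3 → ℂ) (V : Fin 3 → Fin 3 → ℂ) (W : Fin 3 → ℝ → Fin 3 → ℂ)
    (Θm Θp : ℝ → Matrix (Fin 3) (Fin 3) ℂ),
    IsGapSpectrum A₀ μ ∧ LinearIndependent ℂ V ∧
    (∀ j : Fin 3, j ≠ 2 →
      ((A₀ - Matrix.scalar (Fin 3) (μ 0)) * (A₀ - Matrix.scalar (Fin 3) (μ 1))).mulVec (V j) = 0) ∧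
    A₀.mulVec (V 2) = μ 2 • V 2 ∧
    (∀ j x, HasDerivAt (W j) ((A x).mulVec (W j x)) x) ∧
    Tendsto Θm atBot (𝓝 1) ∧ Tendsto Θp atTop (𝓝 1) ∧
    (∀ j : Fin 3, j ≠ 2 → ∀ x,
      W j x = (Θm x * NormedSpace.exp ((x : ℂ) • A₀)).mulVec (V j)) ∧
    (∀ x, W 2 x = (Θp x * NormedSpace.exp ((x : ℂ) • A₀)).mulVec (V 2)) ∧
    δ = (Matrix.of fun i j => W j 0 i).det / (Matrix.of fun i j => V j i).det

open Classical in
/-- The Evans function of the linearization about the homoclinic `Z` (the value does not depend on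
the choice of bases). -/
def evans (P : Params) (c q τ₀ : ℝ) (Z : ℝ → ℝ × ℝ) (lam : ℂ) : ℂ :=
  if h : ∃ δ, IsEvansValue (fun x => profileMatrix P c q Z x lam) (limitMatrix P c q τ₀ lam) δ then
    h.choose
  else 0

/-- The (generalized) point spectrum: the zeros of the Evans function. -/
def pointSpectrum (P : Params) (c q τ₀ : ℝ) (Z : ℝ → ℝ × ℝ) : Set ℂ :=
  {lam | lam ∈ extendedSplittingRegion P c q τ₀ ∧ evans P c q τ₀ Z lam = 0}

/-- Stability of the point spectrum: no zeros with nonnegative real part except for a single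
(that is, simple) zero at the origin. -/
def StablePointSpectrum (P : Params) (c q τ₀ : ℝ) (Z : ℝ → ℝ × ℝ) : Prop :=
  (∀ lam ∈ pointSpectrum P c q τ₀ Z, 0 ≤ lam.re → lam = 0) ∧
    analyticOrderAt (evans P c q τ₀ Z) 0 = 1

/-- The elements of the point spectrum with positive real part. -/
def unstableRoots (P : Params) (c q τ₀ : ℝ) (Z : ℝ → ℝ × ℝ) : Set ℂ :=
  {lam | lam ∈ pointSpectrum P c q τ₀ Z ∧ 0 < lam.re}

/-- The number of roots with positive real part, counted with multiplicity. -/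
def unstableCount (P : Params) (c q τ₀ : ℝ) (Z : ℝ → ℝ × ℝ) : ℕ :=
  ∑ᶠ lam ∈ unstableRoots P c q τ₀ Z, analyticOrderNatAt (evans P c q τ₀ Z) lam

/-! ### The Melnikov separation function -/

/-- `Y c' x`, for `c'` near `c` and `x ∈ I`, parametrizes the branch through `Z` of the invariant
manifold at the saddle `(τ₀, 0)` of the profile equation with speed `c'` and integration constant
`q' = u₀ + c' τ₀`, where `u₀ = q - c τ₀`; so the end state `(τ₀, u₀)` stays fixed. It is the
stable manifold for `I = [0, ∞)`, `l = atTop`, and the unstable one for `I = (-∞, 0]`, `l = atBot`.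
The dependence on `c'` is differentiable at `c`, uniformly in `x`. -/
structure IsManifoldFamily (P : Params) (c q τ₀ : ℝ) (Z : ℝ → ℝ × ℝ) (I : Set ℝ) (l : Filter ℝ)
    (Y : ℝ → ℝ → ℝ × ℝ) : Prop where
  base : ∀ x ∈ I, Y c x = Z x
  ode : ∀ᶠ c' in 𝓝 c, ∀ x ∈ I,
    HasDerivWithinAt (Y c') (profileField P c' (q - c * τ₀ + c' * τ₀) (Y c' x)) I x
  tendsto : ∀ᶠ c' in 𝓝 c, Tendsto (Y c') l (𝓝 (τ₀, 0))
  smooth : ∃ dY : ℝ → ℝ × ℝ, ∀ ε > 0, ∀ᶠ c' in 𝓝 c, ∀ x ∈ I,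
    ‖Y c' x - Y c x - (c' - c) • dY x‖ ≤ ε * |c' - c|

/-- The Melnikov separation function: the determinant with columns `(τ̄', τ̄'')` and
`(τ⁺ - τ⁻, (τ⁺ - τ⁻)')` at `x = 0`. -/
def melnikov (P : Params) (c q : ℝ) (Z : ℝ → ℝ × ℝ) (Yp Ym : ℝ → ℝ → ℝ × ℝ) (c' : ℝ) : ℝ :=
  Matrix.det !![(profileField P c q (Z 0)).1, (Yp c' 0 - Ym c' 0).1;
                (profileField P c q (Z 0)).2, (Yp c' 0 - Ym c' 0).2]

end StVenant

end

noncomputable section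

set_option linter.unusedSectionVars false

open MeasureTheory Set

namespace StVenant

theorem differentiableOn_setIntegral_of_dominated {E : Type*} [NormedAddCommGroup E]
    [NormedSpace ℂ E] [CompleteSpace E] {U : Set ℂ} (hU : IsOpen U) {s : Set ℝ}
    (hs : MeasurableSet s) {F : ℂ → ℝ → E} {g : ℝ → ℝ} (hg : IntegrableOn g s)
    (hm : ∀ z ∈ U, AEStronglyMeasurable (F z) (volume.restrict s))
    (hb : ∀ z ∈ U, ∀ t ∈ s, ‖F z t‖ ≤ g t)
    (hd : ∀ t ∈ s, DifferentiableOn ℂ (fun z => F z t) U) :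
    DifferentiableOn ℂ (fun z => ∫ t in s, F z t) U := by
  intro z hz
  obtain ⟨r, hr, hrU⟩ := Metric.isOpen_iff.1 hU z hz
  have hr2 : 0 < r / 2 := by positivity
  have hball : ∀ w ∈ Metric.ball z (r / 2), Metric.closedBall w (r / 4) ⊆ U := by
    intro w hw y hy
    apply hrU
    rw [Metric.mem_ball] at hw ⊢
    rw [Metric.mem_closedBall] at hy
    have := dist_triangle y w z
    linarith
  have hself : ∀ w ∈ Metric.ball z (r / 2), w ∈ U := fun w hw =>
    hball w hw (Metric.mem_closedBall_self (by positivity))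
  have hzb : z ∈ Metric.ball z (r / 2) := Metric.mem_ball_self hr2
  have hmeas' : AEStronglyMeasurable (fun t => deriv (fun w => F w t) z) (volume.restrict s) := by
    let u : ℕ → ℂ := fun n => ((r / 4 : ℝ) / (n + 1 : ℝ) : ℝ)
    have hu0 : ∀ n, u n ≠ 0 := fun n => by
      simp only [u, ne_eq, Complex.ofReal_eq_zero]; positivity
    have hulim : Tendsto u atTop (𝓝[≠] 0) := by
      apply tendsto_nhdsWithin_iff.2 ⟨?_, Eventually.of_forall hu0⟩
      have h1 : Tendsto (fun n : ℕ => (r / 4 : ℝ) / (n + 1 : ℝ)) atTop (𝓝 0) := by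
        simpa [div_eq_mul_one_div (r / 4)] using
          (tendsto_one_div_add_atTop_nhds_zero_nat (𝕜 := ℝ)).const_mul (r / 4)
      have := (Complex.continuous_ofReal.tendsto 0).comp h1
      simp only [Complex.ofReal_zero] at this
      exact this
    have huU : ∀ n, z + u n ∈ U := fun n => by
      apply hrU
      have h2 : (r / 4) / (n + 1 : ℝ) ≤ r / 4 := div_le_self (by positivity) (by
        have : (0 : ℝ) ≤ n := n.cast_nonneg
        linarith)
      have h3 : 0 ≤ (r / 4) / (n + 1 : ℝ) := by positivity
      simp only [Metric.mem_ball, dist_eq_norm, add_sub_cancel_left, u, Complex.norm_real,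
        Real.norm_eq_abs]
      rw [abs_of_nonneg h3]
      linarith
    refine aestronglyMeasurable_of_tendsto_ae atTop
      (f := fun n t => (u n)⁻¹ • (F (z + u n) t - F z t)) (fun n => ?_) ?_
    · exact ((hm _ (huU n)).sub (hm _ hz)).const_smul _
    · refine (ae_restrict_iff' hs).2 (Eventually.of_forall fun t ht => ?_)
      have := ((hd t ht).differentiableAt (hU.mem_nhds hz)).hasDerivAt
      have := (hasDerivAt_iff_tendsto_slope_zero.1 this).comp hulim
      exact this
  have key := hasDerivAt_integral_of_dominated_loc_of_deriv_le (μ := volume.restrict s)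
    (F := F) (F' := fun w t => deriv (fun w => F w t) w) (x₀ := z)
    (bound := fun t => g t / (r / 4)) (Metric.ball_mem_nhds z hr2)
    (Filter.eventually_of_mem (Metric.ball_mem_nhds z hr2) fun w hw => hm w (hself w hw))
    (Integrable.mono' hg (hm z hz) ((ae_restrict_iff' hs).2 (Eventually.of_forall (hb z hz))))
    hmeas'
    ((ae_restrict_iff' hs).2 (Eventually.of_forall fun t ht w hw => ?_))
    (hg.div_const _)
    ((ae_restrict_iff' hs).2 (Eventually.of_forall fun t ht w hw => ?_))
  · exact key.2.differentiableAt.differentiableWithinAt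
  · apply Complex.norm_deriv_le_of_forall_mem_sphere_norm_le (by positivity)
    · refine DifferentiableOn.diffContOnCl ((hd t ht).mono ?_)
      exact (Metric.closure_ball_subset_closedBall).trans (hball w hw)
    · intro y hy
      exact hb y (hball w hw (Metric.sphere_subset_closedBall hy)) t ht
  · exact ((hd t ht).differentiableAt (hU.mem_nhds (hself w hw))).hasDerivAt

section Volterra

variable {E : Type*} [NormedAddCommGroup E] [NormedSpace ℂ E] [CompleteSpace E]

theorem hasDerivAt_complex_clm_apply {c : ℝ → E →L[ℂ] E} {c' : E →L[ℂ] E} {u : ℝ → E} {u' : E}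
    {x : ℝ} (hc : HasDerivAt c c' x) (hu : HasDerivAt u u' x) :
    HasDerivAt (fun t => c t (u t)) (c' (u x) + c x u') x :=
  (((ContinuousLinearMap.restrictScalarsL ℂ E E ℝ ℝ).hasFDerivAt.comp_hasDerivAt x hc).clm_apply hu)

/-- The exponential `exp (s 𝓐)` of a bounded operator, for real `s`. -/
def flow (𝓐 : E →L[ℂ] E) (s : ℝ) : E →L[ℂ] E := NormedSpace.exp (s • 𝓐)

theorem hasDerivAt_flow (𝓐 : E →L[ℂ] E) (s : ℝ) :
    HasDerivAt (flow 𝓐) (𝓐 * flow 𝓐 s) s :=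
  hasDerivAt_exp_smul_const' (𝕂 := ℝ) 𝓐 s

theorem flow_add (𝓐 : E →L[ℂ] E) (s t : ℝ) : flow 𝓐 (s + t) = flow 𝓐 s * flow 𝓐 t := by
  have hc : Commute (s • 𝓐) (t • 𝓐) := ((Commute.refl 𝓐).smul_left s).smul_right t
  unfold flow
  rw [add_smul]
  let +nondep : NormedAlgebra ℚ (E →L[ℂ] E) := .restrictScalars ℚ ℂ _
  exact NormedSpace.exp_add_of_commute hc

@[simp] theorem flow_zero (𝓐 : E →L[ℂ] E) : flow 𝓐 0 = 1 := by
  simp [flow]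

theorem continuous_flow (𝓐 : E →L[ℂ] E) : Continuous (flow 𝓐) :=
  continuous_iff_continuousAt.2 fun s => (hasDerivAt_flow 𝓐 s).continuousAt

theorem norm_flow_apply_le (𝓐 : E →L[ℂ] E) {s d : ℝ} (hs : 0 ≤ s) (hd : ‖𝓐‖ ≤ d) (v : E) :
    ‖flow 𝓐 s v‖ ≤ ‖v‖ * Real.exp (d * s) := by
  have hder : ∀ t, HasDerivAt (fun t => flow 𝓐 t v) (𝓐 (flow 𝓐 t v)) t := fun t => by
    simpa using hasDerivAt_complex_clm_apply (hasDerivAt_flow 𝓐 t) (hasDerivAt_const t v)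
  have := norm_le_gronwallBound_of_norm_deriv_right_le (f := fun t => flow 𝓐 t v)
    (f' := fun t => 𝓐 (flow 𝓐 t v)) (δ := ‖v‖) (K := d) (ε := 0) (a := 0) (b := s)
    (fun t _ => (hder t).continuousAt.continuousWithinAt) (fun t _ => (hder t).hasDerivWithinAt)
    (by simp) (fun t _ => by
      simpa using (𝓐.le_opNorm _).trans (mul_le_mul_of_nonneg_right hd (norm_nonneg _)))
    s ⟨hs, le_rfl⟩
  simpa [gronwallBound_ε0] using this

/-- The variation-of-constants operator
`X ↦ ∫_{-∞}^x exp((x-t)𝓐) Pr R(t) X(t) dt + ∫_M^x exp((x-t)𝓐) (1-Pr) R(t) X(t) dt`, in initial value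
form. -/
def volterra (𝓐 Pr : E →L[ℂ] E) (R : ℝ → E →L[ℂ] E) (M : ℝ) (X : ℝ → E) (x : ℝ) : E :=
  flow 𝓐 x ((∫ t in Iic M, flow 𝓐 (-t) (Pr (R t (X t)))) +
    ∫ t in M..x, flow 𝓐 (-t) (R t (X t)))

theorem continuous_flow_neg_apply {𝓐 : E →L[ℂ] E} {R : ℝ → E →L[ℂ] E} (hR : Continuous R)
    {X : ℝ → E} (hX : Continuous X) (B : E →L[ℂ] E) :
    Continuous fun t => flow 𝓐 (-t) (B (R t (X t))) :=
  ((continuous_flow 𝓐).comp continuous_neg).clm_apply (B.continuous.comp (hR.clm_apply hX))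

theorem hasDerivAt_volterra {𝓐 Pr : E →L[ℂ] E} {R : ℝ → E →L[ℂ] E} (hR : Continuous R) {M : ℝ}
    {X : ℝ → E} (hX : Continuous X) (x : ℝ) :
    HasDerivAt (volterra 𝓐 Pr R M X) (𝓐 (volterra 𝓐 Pr R M X x) + R x (X x)) x := by
  have hc := continuous_flow_neg_apply (𝓐 := 𝓐) hR hX 1
  simp only [one_apply_eq_self] at hc
  have h1 := (hc.integral_hasStrictDerivAt M x).hasDerivAt
  have h2 := hasDerivAt_complex_clm_apply (hasDerivAt_flow 𝓐 x)
    (h1.const_add (∫ t in Iic M, flow 𝓐 (-t) (Pr (R t (X t)))))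
  have h3 : flow 𝓐 x (flow 𝓐 (-x) (R x (X x))) = R x (X x) := by
    rw [← mul_apply_eq_comp, ← flow_add]; simp
  rw [h3] at h2
  exact h2

/-- Bounds under which the variation-of-constants operator is a contraction for the weight
`exp (L * max (x - M) 0)`. -/
structure DichotomyBound (𝓐 Pr : E →L[ℂ] E) (R : ℝ → E →L[ℂ] E) (K C θ ε κ d : ℝ) : Prop where
  cont : Continuous R
  norm_R : ∀ t, ‖R t‖ ≤ C * Real.exp (-θ * |t|)
  norm_gen : ‖𝓐‖ ≤ d
  forward : ∀ s, 0 ≤ s → ‖flow 𝓐 s * Pr‖ ≤ K * Real.exp (ε * s)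
  backward : ∀ s, s ≤ 0 → ‖flow 𝓐 s * (1 - Pr)‖ ≤ K * Real.exp (κ * s)

variable {𝓐 Pr : E →L[ℂ] E} {R : ℝ → E →L[ℂ] E} {K C θ ε κ d M L B : ℝ}

theorem DichotomyBound.integrableOn_bound (hεθ : ε < θ) (M x : ℝ) :
    IntegrableOn (fun t => K * Real.exp (ε * (x - t)) * (C * Real.exp (θ * t)) * B) (Iic M) ∧
    ∫ t in Iic M, K * Real.exp (ε * (x - t)) * (C * Real.exp (θ * t)) * B
      = K * C * B * Real.exp (ε * (x - M)) * Real.exp (θ * M) / (θ - ε) := by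
  have h : (fun t => K * Real.exp (ε * (x - t)) * (C * Real.exp (θ * t)) * B)
      = fun t => (K * C * B * Real.exp (ε * x)) * Real.exp ((θ - ε) * t) := by
    ext t
    have : Real.exp (ε * (x - t)) * Real.exp (θ * t)
        = Real.exp (ε * x) * Real.exp ((θ - ε) * t) := by
      rw [← Real.exp_add, ← Real.exp_add]; ring_nf
    linear_combination (K * C * B) * this
  rw [h]
  have hp : 0 < θ - ε := by linarith
  refine ⟨(integrableOn_exp_mul_Iic hp M).const_mul _, ?_⟩
  rw [integral_const_mul, integral_exp_mul_Iic hp]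
  have : Real.exp (ε * x) * Real.exp ((θ - ε) * M)
      = Real.exp (ε * (x - M)) * Real.exp (θ * M) := by
    rw [← Real.exp_add, ← Real.exp_add]; ring_nf
  linear_combination (K * C * B) / (θ - ε) * this

theorem DichotomyBound.norm_forward_le (h : DichotomyBound 𝓐 Pr R K C θ ε κ d) {X : ℝ → E}
    {x t : ℝ} (htx : t ≤ x) (ht : t ≤ 0) (hB : ‖X t‖ ≤ B) :
    ‖flow 𝓐 (x - t) (Pr (R t (X t)))‖
      ≤ K * Real.exp (ε * (x - t)) * (C * Real.exp (θ * t)) * B := by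
  have h1 := h.forward (x - t) (by linarith)
  have h2 := h.norm_R t
  rw [abs_of_nonpos ht] at h2
  simp only [neg_mul_neg] at h2
  rw [← mul_apply_eq_comp]
  refine (ContinuousLinearMap.le_opNorm _ _).trans ?_
  rw [mul_assoc]
  refine mul_le_mul h1 ?_ (norm_nonneg _) ((norm_nonneg _).trans h1)
  refine (ContinuousLinearMap.le_opNorm _ _).trans ?_
  exact mul_le_mul h2 hB (norm_nonneg _) ((norm_nonneg _).trans h2)

theorem flow_apply_flow_neg (𝓐 : E →L[ℂ] E) (x t : ℝ) (v : E) :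
    flow 𝓐 x (flow 𝓐 (-t) v) = flow 𝓐 (x - t) v := by
  rw [← mul_apply_eq_comp, ← flow_add, sub_eq_add_neg]

theorem DichotomyBound.integrableOn (h : DichotomyBound 𝓐 Pr R K C θ ε κ d) (hεθ : ε < θ)
    {X : ℝ → E} (hX : Continuous X) (hM : M ≤ 0) (hB : ∀ t ≤ M, ‖X t‖ ≤ B) :
    IntegrableOn (fun t => flow 𝓐 (-t) (Pr (R t (X t)))) (Iic M) := by
  have hb := (DichotomyBound.integrableOn_bound (K := K) (C := C) (B := B) hεθ M M).1
  have : IntegrableOn (fun t => flow 𝓐 (M - t) (Pr (R t (X t)))) (Iic M) := by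
    refine Integrable.mono' hb ?_ ?_
    · exact (((continuous_flow 𝓐).comp (continuous_const.sub continuous_id)).clm_apply
        (Pr.continuous.comp (h.cont.clm_apply hX))).aestronglyMeasurable
    · refine (ae_restrict_iff' measurableSet_Iic).2 (Eventually.of_forall fun t ht => ?_)
      exact h.norm_forward_le ht (le_trans ht hM) (hB t ht)
  have h2 := (flow 𝓐 (-M)).integrable_comp this
  refine h2.congr (Eventually.of_forall fun t => ?_)
  simp only
  rw [← mul_apply_eq_comp, ← flow_add]
  congr 2; ring

theorem DichotomyBound.norm_flow_integral_le (h : DichotomyBound 𝓐 Pr R K C θ ε κ d)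
    (hεθ : ε < θ) {X : ℝ → E} (hX : Continuous X) {x : ℝ} (hM : M ≤ 0) (hMx : M ≤ x)
    (hB : ∀ t ≤ M, ‖X t‖ ≤ B) :
    ‖flow 𝓐 x (∫ t in Iic M, flow 𝓐 (-t) (Pr (R t (X t))))‖
      ≤ K * C * B * Real.exp (ε * (x - M)) * Real.exp (θ * M) / (θ - ε) := by
  obtain ⟨h1, h2⟩ := DichotomyBound.integrableOn_bound (K := K) (C := C) (B := B) hεθ M x
  rw [← h2, ← ContinuousLinearMap.integral_comp_comm _ (h.integrableOn hεθ hX hM hB)]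
  refine norm_integral_le_of_norm_le h1 ?_
  refine (ae_restrict_iff' measurableSet_Iic).2 (Eventually.of_forall fun t ht => ?_)
  rw [flow_apply_flow_neg]
  exact h.norm_forward_le (le_trans ht hMx) (le_trans ht hM) (hB t ht)

/-- The decay of the variation-of-constants operator towards `-∞`. -/
theorem DichotomyBound.norm_volterra_le_of_le (h : DichotomyBound 𝓐 Pr R K C θ ε κ d)
    (hεθ : ε < θ) (hκθ : κ < θ) {X : ℝ → E} (hX : Continuous X) {x : ℝ} (hM : M ≤ 0) (hxM : x ≤ M)
    (hB : ∀ t ≤ M, ‖X t‖ ≤ B) :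
    ‖volterra 𝓐 Pr R M X x‖ ≤ K * C * B * Real.exp (θ * x) / (θ - ε) +
      K * C * B * Real.exp (κ * (x - M)) * Real.exp (θ * M) / (θ - κ) := by
  have hi : IntegrableOn (fun t => flow 𝓐 (-t) (Pr (R t (X t)))) (Iic M) :=
    h.integrableOn hεθ hX hM hB
  have hc1 := continuous_flow_neg_apply (𝓐 := 𝓐) h.cont hX Pr
  have hc2 := continuous_flow_neg_apply (𝓐 := 𝓐) h.cont hX (1 - Pr)
  have hc := continuous_flow_neg_apply (𝓐 := 𝓐) h.cont hX 1
  simp only [one_apply_eq_self] at hc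
  have hsplit : volterra 𝓐 Pr R M X x =
      flow 𝓐 x (∫ t in Iic x, flow 𝓐 (-t) (Pr (R t (X t)))) -
      flow 𝓐 x (∫ t in x..M, flow 𝓐 (-t) ((1 - Pr) (R t (X t)))) := by
    have e1 : ∫ t in Iic M, flow 𝓐 (-t) (Pr (R t (X t))) =
        (∫ t in Iic x, flow 𝓐 (-t) (Pr (R t (X t)))) +
          ∫ t in x..M, flow 𝓐 (-t) (Pr (R t (X t))) := by
      rw [← intervalIntegral.integral_Iic_sub_Iic (hi.mono_set (Iic_subset_Iic.2 hxM)) hi]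
      abel
    have e2 : ∫ t in x..M, flow 𝓐 (-t) ((1 - Pr) (R t (X t))) =
        (∫ t in x..M, flow 𝓐 (-t) (R t (X t))) - ∫ t in x..M, flow 𝓐 (-t) (Pr (R t (X t))) := by
      rw [← intervalIntegral.integral_sub (hc.intervalIntegrable _ _) (hc1.intervalIntegrable _ _)]
      simp
    rw [volterra, intervalIntegral.integral_symm, e1, e2, ← map_sub]
    congr 1
    abel
  rw [hsplit]
  refine (norm_sub_le _ _).trans (add_le_add ?_ ?_)
  · simpa using h.norm_flow_integral_le hεθ hX (hxM.trans hM) le_rfl (fun t ht => hB t (ht.trans hxM))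
  · obtain ⟨h1, h2⟩ := DichotomyBound.integrableOn_bound (K := K) (C := C) (B := B) hκθ M x
    rw [← h2, ← ContinuousLinearMap.intervalIntegral_comp_comm _ (hc2.intervalIntegrable _ _),
      intervalIntegral.integral_of_le hxM]
    have hpos : ∀ t, 0 ≤ K * Real.exp (κ * (x - t)) * (C * Real.exp (θ * t)) * B := by
      intro t
      have hK : 0 ≤ K := by
        have := (norm_nonneg _).trans (h.forward 0 le_rfl)
        simpa using this
      have hC : 0 ≤ C := by
        have := (norm_nonneg _).trans (h.norm_R 0)
        simpa using this
      have hB0 : 0 ≤ B := (norm_nonneg _).trans (hB M le_rfl)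
      positivity
    refine le_trans (norm_integral_le_of_norm_le (h1.mono_set Ioc_subset_Iic_self) ?_)
      (setIntegral_mono_set h1 (Eventually.of_forall hpos) Ioc_subset_Iic_self.eventuallyLE)
    refine (ae_restrict_iff' measurableSet_Ioc).2 (Eventually.of_forall fun t ht => ?_)
    rw [flow_apply_flow_neg]
    have h1 := h.backward (x - t) (by linarith [ht.1])
    have h2 := h.norm_R t
    rw [abs_of_nonpos (ht.2.trans hM)] at h2
    simp only [neg_mul_neg] at h2
    rw [← mul_apply_eq_comp]
    refine (ContinuousLinearMap.le_opNorm _ _).trans ?_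
    rw [mul_assoc]
    refine mul_le_mul h1 ?_ (norm_nonneg _) ((norm_nonneg _).trans h1)
    refine (ContinuousLinearMap.le_opNorm _ _).trans ?_
    exact mul_le_mul h2 (hB t ht.2) (norm_nonneg _) ((norm_nonneg _).trans h2)

/-- The growth of the variation-of-constants operator for `x ≥ M`. -/
theorem DichotomyBound.norm_volterra_le_of_ge (h : DichotomyBound 𝓐 Pr R K C θ ε κ d)
    (hεθ : ε < θ) (hθ : 0 ≤ θ) (hL : d < L) {X : ℝ → E} (hX : Continuous X) {x : ℝ} (hM : M ≤ 0)
    (hMx : M ≤ x) (hB : ∀ t, ‖X t‖ ≤ B * Real.exp (L * max (t - M) 0)) :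
    ‖volterra 𝓐 Pr R M X x‖ ≤ K * C * B * Real.exp (ε * (x - M)) * Real.exp (θ * M) / (θ - ε) +
      C * B * Real.exp (L * (x - M)) / (L - d) := by
  have hc := continuous_flow_neg_apply (𝓐 := 𝓐) h.cont hX 1
  simp only [one_apply_eq_self] at hc
  have hC : 0 ≤ C := by
    have := (norm_nonneg _).trans (h.norm_R 0)
    simpa using this
  have hB0 : 0 ≤ B := by
    have := (norm_nonneg _).trans (hB M)
    simpa using this
  rw [volterra, map_add]
  refine (norm_add_le _ _).trans (add_le_add ?_ ?_)
  · refine h.norm_flow_integral_le hεθ hX hM hMx fun t ht => ?_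
    simpa [max_eq_right (sub_nonpos.2 ht)] using hB t
  · rw [← ContinuousLinearMap.intervalIntegral_comp_comm _ (hc.intervalIntegrable _ _)]
    have hp : 0 < L - d := by linarith
    have hder : ∀ t, HasDerivAt (fun t => C * B * Real.exp (d * (x - t)) * Real.exp (L * (t - M))
        / (L - d)) (C * B * Real.exp (d * (x - t)) * Real.exp (L * (t - M))) t := by
      intro t
      have h1 : HasDerivAt (fun t => Real.exp (d * (x - t))) (Real.exp (d * (x - t)) * (d * -1)) t :=
        (((hasDerivAt_id t).const_sub x).const_mul d).exp
      have h2 : HasDerivAt (fun t => Real.exp (L * (t - M))) (Real.exp (L * (t - M)) * (L * 1)) t :=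
        (((hasDerivAt_id t).sub_const M).const_mul L).exp
      convert! ((h1.const_mul (C * B)).mul h2).div_const (L - d) using 1
      field_simp
      ring
    have hcont : Continuous fun t => C * B * Real.exp (d * (x - t)) * Real.exp (L * (t - M)) := by
      fun_prop
    have hint := intervalIntegral.integral_eq_sub_of_hasDerivAt (a := M) (b := x)
      (fun t _ => hder t) (hcont.intervalIntegrable _ _)
    have hle : ∫ t in M..x, C * B * Real.exp (d * (x - t)) * Real.exp (L * (t - M))
        ≤ C * B * Real.exp (L * (x - M)) / (L - d) := by
      rw [hint]
      simp only [sub_self, mul_zero, Real.exp_zero, mul_one]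
      have : 0 ≤ C * B * Real.exp (d * (x - M)) / (L - d) := by positivity
      linarith
    refine le_trans ?_ hle
    refine intervalIntegral.norm_integral_le_of_norm_le hMx
      (Eventually.of_forall fun t ht => ?_) (hcont.intervalIntegrable _ _)
    rw [flow_apply_flow_neg]
    have hxt : 0 ≤ x - t := by linarith [ht.2]
    refine (norm_flow_apply_le 𝓐 hxt h.norm_gen _).trans ?_
    have h2 : ‖R t‖ ≤ C := (h.norm_R t).trans (by
      have : Real.exp (-θ * |t|) ≤ 1 := Real.exp_le_one_iff.2 (by
        have := mul_nonneg hθ (abs_nonneg t); linarith)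
      nlinarith)
    have h3 := hB t
    rw [max_eq_left (by linarith [ht.1])] at h3
    have h4 : ‖R t (X t)‖ ≤ C * (B * Real.exp (L * (t - M))) :=
      ((R t).le_opNorm _).trans (mul_le_mul h2 h3 (norm_nonneg _) hC)
    calc _ ≤ C * (B * Real.exp (L * (t - M))) * Real.exp (d * (x - t)) :=
          mul_le_mul_of_nonneg_right h4 (Real.exp_pos _).le
      _ = _ := by ring

/-- The contraction estimate for the variation-of-constants operator. -/
theorem DichotomyBound.norm_volterra_le (h : DichotomyBound 𝓐 Pr R K C θ ε κ d)
    (hεθ : ε < θ) (hκθ : κ < θ) (hκ : 0 ≤ κ) (hθ : 0 ≤ θ) (hdL : d < L) (hεL : ε ≤ L)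
    (hM : M ≤ 0) (hM1 : K * C * Real.exp (θ * M) / (θ - ε) ≤ 1 / 4)
    (hM2 : K * C * Real.exp (θ * M) / (θ - κ) ≤ 1 / 4) (hL : C / (L - d) ≤ 1 / 4)
    {X : ℝ → E} (hX : Continuous X) (hB : ∀ t, ‖X t‖ ≤ B * Real.exp (L * max (t - M) 0)) (x : ℝ) :
    ‖volterra 𝓐 Pr R M X x‖ ≤ B / 2 * Real.exp (L * max (x - M) 0) := by
  have hC : 0 ≤ C := by
    have := (norm_nonneg _).trans (h.norm_R 0)
    simpa using this
  have hB0 : 0 ≤ B := by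
    have := (norm_nonneg _).trans (hB M)
    simpa using this
  have hK : 0 ≤ K := by
    have := (norm_nonneg _).trans (h.forward 0 le_rfl)
    simpa using this
  rcases le_total x M with hx | hx
  · have h1 := h.norm_volterra_le_of_le (B := B) hεθ hκθ hX hM hx fun t ht => by
      simpa [max_eq_right (sub_nonpos.2 ht)] using hB t
    rw [max_eq_right (sub_nonpos.2 hx)]
    have h2 : Real.exp (θ * x) ≤ Real.exp (θ * M) :=
      Real.exp_le_exp.2 (mul_le_mul_of_nonneg_left hx hθ)
    have h3 : Real.exp (κ * (x - M)) ≤ 1 := Real.exp_le_one_iff.2 (by nlinarith)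
    have hp1 : 0 < θ - ε := by linarith
    have hp2 : 0 < θ - κ := by linarith
    have h4 : K * C * B * Real.exp (θ * x) / (θ - ε) ≤ B * (1 / 4) := by
      calc _ ≤ K * C * B * Real.exp (θ * M) / (θ - ε) := by gcongr
        _ = B * (K * C * Real.exp (θ * M) / (θ - ε)) := by ring
        _ ≤ _ := by gcongr
    have h5 : K * C * B * Real.exp (κ * (x - M)) * Real.exp (θ * M) / (θ - κ) ≤ B * (1 / 4) := by
      calc _ ≤ K * C * B * 1 * Real.exp (θ * M) / (θ - κ) := by gcongr
        _ = B * (K * C * Real.exp (θ * M) / (θ - κ)) := by ring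
        _ ≤ _ := by gcongr
    simp only [mul_zero, Real.exp_zero, mul_one]
    linarith
  · have h1 := h.norm_volterra_le_of_ge hεθ hθ hdL hX hM hx hB
    rw [max_eq_left (sub_nonneg.2 hx)]
    have h2 : Real.exp (ε * (x - M)) ≤ Real.exp (L * (x - M)) :=
      Real.exp_le_exp.2 (mul_le_mul_of_nonneg_right hεL (sub_nonneg.2 hx))
    have hp1 : 0 < θ - ε := by linarith
    have hp2 : 0 < L - d := by linarith
    have h4 : K * C * B * Real.exp (ε * (x - M)) * Real.exp (θ * M) / (θ - ε)
        ≤ B * Real.exp (L * (x - M)) * (1 / 4) := by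
      calc _ ≤ K * C * B * Real.exp (L * (x - M)) * Real.exp (θ * M) / (θ - ε) := by gcongr
        _ = B * Real.exp (L * (x - M)) * (K * C * Real.exp (θ * M) / (θ - ε)) := by ring
        _ ≤ _ := by gcongr
    have h5 : C * B * Real.exp (L * (x - M)) / (L - d) ≤ B * Real.exp (L * (x - M)) * (1 / 4) := by
      calc _ = B * Real.exp (L * (x - M)) * (C / (L - d)) := by ring
        _ ≤ _ := by gcongr
    linarith

end Volterra

section Volterra

variable {E : Type*} [NormedAddCommGroup E] [NormedSpace ℂ E] [CompleteSpace E]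

theorem norm_flow_apply_le_abs (𝓐 : E →L[ℂ] E) {d : ℝ} (s : ℝ) (hd : ‖𝓐‖ ≤ d) (v : E) :
    ‖flow 𝓐 s v‖ ≤ ‖v‖ * Real.exp (d * |s|) := by
  rcases le_total 0 s with hs | hs
  · rw [abs_of_nonneg hs]; exact norm_flow_apply_le 𝓐 hs hd v
  · have h : flow 𝓐 s = flow (-𝓐) (-s) := by simp [flow]
    rw [abs_of_nonpos hs, h]
    exact norm_flow_apply_le _ (by linarith) (by rwa [norm_neg]) v

theorem differentiableOn_flow {U : Set ℂ} {𝓐 : ℂ → E →L[ℂ] E} (h : DifferentiableOn ℂ 𝓐 U)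
    (s : ℝ) : DifferentiableOn ℂ (fun z => flow (𝓐 z) s) U := by
  have hexp : Differentiable ℂ (NormedSpace.exp : (E →L[ℂ] E) → (E →L[ℂ] E)) := fun x =>
    (NormedSpace.exp_analytic (𝕂 := ℂ) x).differentiableAt
  exact hexp.comp_differentiableOn (h.const_smul s)

variable {U : Set ℂ} {𝓐 : ℂ → E →L[ℂ] E} {Pr : E →L[ℂ] E} {R : ℂ → ℝ → E →L[ℂ] E} {f : ℂ → E}
  {K C θ ε κ d F M B L : ℝ}

theorem differentiableOn_volterra (hU : IsOpen U)
    (h : ∀ z ∈ U, DichotomyBound (𝓐 z) Pr (R z) K C θ ε κ d) (hεθ : ε < θ) (hθ : 0 ≤ θ)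
    (h𝓐 : DifferentiableOn ℂ 𝓐 U) (hR : ∀ t, DifferentiableOn ℂ (fun z => R z t) U)
    {X : ℂ → ℝ → E} (hXc : ∀ z ∈ U, Continuous (X z)) (hM : M ≤ 0) (hL : 0 ≤ L)
    (hB : ∀ z ∈ U, ∀ t, ‖X z t‖ ≤ B * Real.exp (L * max (t - M) 0))
    (hX : ∀ t, DifferentiableOn ℂ (fun z => X z t) U) (x : ℝ) :
    DifferentiableOn ℂ (fun z => volterra (𝓐 z) Pr (R z) M (X z) x) U := by
  have hG : ∀ t, DifferentiableOn ℂ (fun z => R z t (X z t)) U := fun t => (hR t).clm_apply (hX t)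
  have hi : ∀ a b, DifferentiableOn ℂ
      (fun z => ∫ t in Ioc a b, flow (𝓐 z) (-t) (R z t (X z t))) U := by
    intro a b
    let D := |d| * (|a| + |b|)
    let b' := |B| * Real.exp (L * (|a| + |b| + |M|))
    refine differentiableOn_setIntegral_of_dominated hU measurableSet_Ioc
      (g := fun _ => |C| * b' * Real.exp D)
      (integrableOn_const (by simp)) ?_ ?_ ?_
    · intro z hz
      have := continuous_flow_neg_apply (𝓐 := 𝓐 z) (h z hz).cont (hXc z hz) 1
      simp only [one_apply_eq_self] at this
      exact this.aestronglyMeasurable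
    · intro z hz t ht
      have htab : |t| ≤ |a| + |b| := by
        rcases abs_cases t with h1 | h1 <;> rcases abs_cases a with h2 | h2 <;>
          rcases abs_cases b with h3 | h3 <;> linarith [ht.1, ht.2]
      refine (norm_flow_apply_le_abs _ _ (((h z hz).norm_gen).trans (le_abs_self d)) _).trans ?_
      refine mul_le_mul ?_ ?_ (Real.exp_pos _).le (by positivity)
      · have h2 : ‖R z t‖ ≤ |C| := ((h z hz).norm_R t).trans (by
          have h3 : Real.exp (-θ * |t|) ≤ 1 := Real.exp_le_one_iff.2 (by
            have := mul_nonneg hθ (abs_nonneg t); linarith)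
          have h4 := le_abs_self C
          have h5 := abs_nonneg C
          have := Real.exp_pos (-θ * |t|)
          nlinarith)
        refine ((R z t).le_opNorm _).trans (mul_le_mul h2 ?_ (norm_nonneg _) (abs_nonneg _))
        refine (hB z hz t).trans (mul_le_mul (le_abs_self B) ?_ (Real.exp_pos _).le (abs_nonneg _))
        refine Real.exp_le_exp.2 (mul_le_mul_of_nonneg_left ?_ hL)
        refine max_le ?_ (by positivity)
        linarith [le_abs_self t, neg_abs_le M]
      · refine Real.exp_le_exp.2 ?_
        rw [abs_neg]
        exact mul_le_mul_of_nonneg_left htab (abs_nonneg d)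
    · intro t _
      exact (differentiableOn_flow h𝓐 (-t)).clm_apply (hG t)
  have h1 : DifferentiableOn ℂ (fun z => ∫ t in M..x, flow (𝓐 z) (-t) (R z t (X z t))) U := by
    simp only [intervalIntegral]
    exact (hi M x).sub (hi x M)
  have h2 : DifferentiableOn ℂ (fun z => ∫ t in Iic M, flow (𝓐 z) (-t) (Pr (R z t (X z t)))) U := by
    have hb := (DichotomyBound.integrableOn_bound (K := K) (C := C) (B := B) hεθ M M).1
    refine differentiableOn_setIntegral_of_dominated hU measurableSet_Iic
      (hb.mul_const (Real.exp (|d| * |M|))) ?_ ?_ ?_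
    · intro z hz
      exact (continuous_flow_neg_apply (h z hz).cont (hXc z hz) Pr).aestronglyMeasurable
    · intro z hz t ht
      have e : flow (𝓐 z) (-t) (Pr (R z t (X z t)))
          = flow (𝓐 z) (-M) (flow (𝓐 z) (M - t) (Pr (R z t (X z t)))) := by
        rw [← mul_apply_eq_comp (flow (𝓐 z) (-M)), ← flow_add]
        congr 2; ring
      rw [e]
      refine (norm_flow_apply_le_abs _ _ (((h z hz).norm_gen).trans (le_abs_self d)) _).trans ?_
      rw [abs_neg]
      refine mul_le_mul_of_nonneg_right ?_ (Real.exp_pos _).le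
      refine (h z hz).norm_forward_le ht (le_trans ht hM) ?_
      simpa [max_eq_right (sub_nonpos.2 (mem_Iic.1 ht))] using hB z hz t
    · intro t _
      exact (differentiableOn_flow h𝓐 (-t)).clm_apply (Pr.differentiable.comp_differentiableOn (hG t))
  exact (differentiableOn_flow h𝓐 x).clm_apply (h2.add h1)

theorem volterra_sub {𝓐 : E →L[ℂ] E} {R : ℝ → E →L[ℂ] E}
    (h : DichotomyBound 𝓐 Pr R K C θ ε κ d) (hεθ : ε < θ) (hM : M ≤ 0) {X Y : ℝ → E}
    (hX : Continuous X) (hY : Continuous Y) {B₁ B₂ : ℝ} (h1 : ∀ t ≤ M, ‖X t‖ ≤ B₁)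
    (h2 : ∀ t ≤ M, ‖Y t‖ ≤ B₂) (x : ℝ) :
    volterra 𝓐 Pr R M X x - volterra 𝓐 Pr R M Y x = volterra 𝓐 Pr R M (fun t => X t - Y t) x := by
  have hcX := continuous_flow_neg_apply (𝓐 := 𝓐) h.cont hX 1
  have hcY := continuous_flow_neg_apply (𝓐 := 𝓐) h.cont hY 1
  simp only [one_apply_eq_self] at hcX hcY
  simp only [volterra, map_sub]
  rw [integral_sub (h.integrableOn hεθ hX hM h1) (h.integrableOn hεθ hY hM h2),
    intervalIntegral.integral_sub (hcX.intervalIntegrable _ _) (hcY.intervalIntegrable _ _),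
    ← map_sub]
  congr 1
  abel

theorem tendsto_exp_mul_atBot {a : ℝ} (ha : 0 < a) :
    Tendsto (fun x : ℝ => Real.exp (a * x)) atBot (𝓝 0) :=
  Real.tendsto_exp_atBot.comp (tendsto_id.const_mul_atBot ha)

theorem tendsto_volterra {𝓐 : E →L[ℂ] E} {R : ℝ → E →L[ℂ] E}
    (h : DichotomyBound 𝓐 Pr R K C θ ε κ d) (hεθ : ε < θ) (hκ : 0 < κ) (hκθ : κ < θ) {X : ℝ → E}
    (hX : Continuous X) (hM : M ≤ 0) (hB : ∀ t ≤ M, ‖X t‖ ≤ B) :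
    Tendsto (volterra 𝓐 Pr R M X) atBot (𝓝 0) := by
  have h1 : Tendsto (fun x => K * C * B * Real.exp (θ * x) / (θ - ε) +
      K * C * B * Real.exp (κ * (x - M)) * Real.exp (θ * M) / (θ - κ)) atBot (𝓝 0) := by
    have a1 := ((tendsto_exp_mul_atBot (hκ.trans hκθ)).const_mul (K * C * B)).div_const (θ - ε)
    have a2 := ((((tendsto_exp_mul_atBot hκ).comp (tendsto_atBot_add_const_right _ (-M)
      tendsto_id)).const_mul (K * C * B)).mul_const (Real.exp (θ * M))).div_const (θ - κ)
    simpa [← sub_eq_add_neg] using a1.add a2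
  rw [tendsto_zero_iff_norm_tendsto_zero]
  refine squeeze_zero' (Eventually.of_forall fun _ => norm_nonneg _) ?_ h1
  filter_upwards [eventually_le_atBot M] with x hx
  exact h.norm_volterra_le_of_le hεθ hκθ hX hM hx hB

/-- The gap lemma with parameters: a solution of `X' = (𝓐 + R(x)) X` that converges at `-∞` to a
given vector in the kernel of `𝓐`, holomorphic in the parameter. -/
theorem exists_solution_tendsto_atBot (hU : IsOpen U)
    (h : ∀ z ∈ U, DichotomyBound (𝓐 z) Pr (R z) K C θ ε κ d) (hεθ : ε < θ) (hκ : 0 < κ)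
    (hκθ : κ < θ) (h𝓐 : DifferentiableOn ℂ 𝓐 U)
    (hR : ∀ t, DifferentiableOn ℂ (fun z => R z t) U) (hf : DifferentiableOn ℂ f U)
    (hfF : ∀ z ∈ U, ‖f z‖ ≤ F) (hker : ∀ z ∈ U, 𝓐 z (f z) = 0) :
    ∃ X : ℂ → ℝ → E,
      (∀ z ∈ U, ∀ x, HasDerivAt (X z) (𝓐 z (X z x) + R z x (X z x)) x) ∧
      (∀ x, DifferentiableOn ℂ (fun z => X z x) U) ∧
      (∃ B, ∀ z ∈ U, ∀ x ≤ 0, ‖X z x‖ ≤ B) ∧ ∀ z ∈ U, Tendsto (X z) atBot (𝓝 (f z)) := by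
  have hθ : 0 < θ := hκ.trans hκθ
  obtain ⟨M, hM, hM1, hM2⟩ : ∃ M : ℝ, M ≤ 0 ∧ K * C * Real.exp (θ * M) / (θ - ε) ≤ 1 / 4 ∧
      K * C * Real.exp (θ * M) / (θ - κ) ≤ 1 / 4 := by
    have h1 : Tendsto (fun M : ℝ => K * C * Real.exp (θ * M) / (θ - ε)) atBot (𝓝 0) := by
      simpa using ((tendsto_exp_mul_atBot hθ).const_mul (K * C)).div_const (θ - ε)
    have h2 : Tendsto (fun M : ℝ => K * C * Real.exp (θ * M) / (θ - κ)) atBot (𝓝 0) := by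
      simpa using ((tendsto_exp_mul_atBot hθ).const_mul (K * C)).div_const (θ - κ)
    exact ((eventually_le_atBot 0).and ((h1.eventually_le_const (by norm_num)).and
      (h2.eventually_le_const (by norm_num)))).exists
  obtain ⟨L, hdL, hεL, hL0, hL⟩ : ∃ L : ℝ, d < L ∧ ε ≤ L ∧ 0 ≤ L ∧ C / (L - d) ≤ 1 / 4 := by
    have h1 : Tendsto (fun L : ℝ => C / (L - d)) atTop (𝓝 0) :=
      Tendsto.div_atTop tendsto_const_nhds (tendsto_atTop_add_const_right _ (-d) tendsto_id)
    exact ((eventually_gt_atTop d).and ((eventually_ge_atTop ε).and ((eventually_ge_atTop 0).and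
      (h1.eventually_le_const (by norm_num))))).exists
  let ω : ℝ → ℝ := fun x => Real.exp (L * max (x - M) 0)
  have hω1 : ∀ x, 1 ≤ ω x := fun x => Real.one_le_exp (by positivity)
  let S : ℕ → ℂ → ℝ → E := fun n => Nat.rec (fun _ _ => 0)
    (fun _ X z x => f z + volterra (𝓐 z) Pr (R z) M (X z) x) n
  have hS0 : ∀ z x, S 0 z x = 0 := fun _ _ => rfl
  have hS : ∀ n z x, S (n + 1) z x = f z + volterra (𝓐 z) Pr (R z) M (S n z) x :=
    fun _ _ _ => rfl
  have hcont : ∀ n, ∀ z ∈ U, Continuous (S n z) := by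
    intro n
    induction n with
    | zero => exact fun z _ => continuous_const
    | succ n ih =>
      intro z hz
      exact continuous_const.add (continuous_iff_continuousAt.2 fun x =>
        (hasDerivAt_volterra (h z hz).cont (ih z hz) x).continuousAt)
  have hbound : ∀ n, ∀ z ∈ U, ∀ x, ‖S n z x‖ ≤ 2 * F * ω x := by
    intro n
    induction n with
    | zero =>
      intro z hz x
      have : 0 ≤ F := (norm_nonneg _).trans (hfF z hz)
      rw [hS0, norm_zero]
      have := hω1 x
      positivity
    | succ n ih =>
      intro z hz x
      have hF : 0 ≤ F := (norm_nonneg _).trans (hfF z hz)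
      rw [hS]
      have := (h z hz).norm_volterra_le hεθ hκθ hκ.le hθ.le hdL hεL hM hM1 hM2 hL
        (hcont n z hz) (ih z hz) x
      have h3 : F ≤ F * ω x := le_mul_of_one_le_right hF (hω1 x)
      refine (norm_add_le _ _).trans ((add_le_add (hfF z hz) this).trans ?_)
      change F + 2 * F / 2 * ω x ≤ _
      linarith
  have hboundM : ∀ n, ∀ z ∈ U, ∀ t ≤ M, ‖S n z t‖ ≤ 2 * F := by
    intro n z hz t ht
    simpa [ω, max_eq_right (sub_nonpos.2 ht)] using hbound n z hz t
  have hdiff : ∀ n, ∀ z ∈ U, ∀ x, ‖S (n + 1) z x - S n z x‖ ≤ F * (1 / 2) ^ n * ω x := by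
    intro n
    induction n with
    | zero =>
      intro z hz x
      have hF : 0 ≤ F := (norm_nonneg _).trans (hfF z hz)
      have : volterra (𝓐 z) Pr (R z) M (S 0 z) x = 0 := by
        have : S 0 z = fun _ => 0 := rfl
        simp [volterra, this]
      rw [hS, this, hS0]
      simpa using (hfF z hz).trans (le_mul_of_one_le_right hF (hω1 x))
    | succ n ih =>
      intro z hz x
      rw [hS (n + 1), hS n, add_sub_add_left_eq_sub, volterra_sub (h z hz) hεθ hM
        (hcont (n + 1) z hz) (hcont n z hz) (hboundM (n + 1) z hz)
        (hboundM n z hz)]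
      refine ((h z hz).norm_volterra_le hεθ hκθ hκ.le hθ.le hdL hεL hM hM1 hM2 hL
        (X := fun t => S (n + 1) z t - S n z t)
        ((hcont (n + 1) z hz).sub (hcont n z hz)) (ih z hz) x).trans (le_of_eq ?_)
      simp only [ω]
      ring
  have hdiff' : ∀ z ∈ U, ∀ x n, dist (S n z x) (S (n + 1) z x) ≤ F * ω x * (1 / 2) ^ n := by
    intro z hz x n
    rw [dist_comm, dist_eq_norm]
    exact (hdiff n z hz x).trans (le_of_eq (by ring))
  have hlim : ∀ z ∈ U, ∀ x, ∃ a, Tendsto (fun n => S n z x) atTop (𝓝 a) := fun z hz x =>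
    cauchySeq_tendsto_of_complete (cauchySeq_of_le_geometric _ _ (by norm_num) (hdiff' z hz x))
  classical
  choose! X hX using hlim
  have hXS : ∀ n, ∀ z ∈ U, ∀ x, ‖X z x - S n z x‖ ≤ 2 * F * (1 / 2) ^ n * ω x := by
    intro n z hz x
    have := dist_le_of_le_geometric_of_tendsto _ _ (by norm_num) (hdiff' z hz x) (hX z hz x) n
    rw [dist_comm, dist_eq_norm] at this
    exact this.trans (le_of_eq (by ring))
  have hpow : ∀ c : ℝ, Tendsto (fun n : ℕ => c * (1 / 2 : ℝ) ^ n) atTop (𝓝 0) := fun c => by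
    simpa using (tendsto_pow_atTop_nhds_zero_of_lt_one (r := (1 / 2 : ℝ))
      (by norm_num) (by norm_num)).const_mul c
  have hωc : Continuous ω := by fun_prop
  have hXc : ∀ z ∈ U, Continuous (X z) := by
    intro z hz
    have : TendstoLocallyUniformly (fun n => S n z) (X z) atTop := by
      rw [Metric.tendstoLocallyUniformly_iff]
      intro e he x
      have h1 : ∀ᶠ y in 𝓝 x, ω y < ω x + 1 := hωc.continuousAt.eventually_lt_const (by linarith)
      refine ⟨_, h1, ?_⟩
      filter_upwards [(hpow (2 * F * (ω x + 1))).eventually_lt_const he] with n hn y hy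
      rw [dist_eq_norm]
      have hF : 0 ≤ F := (norm_nonneg _).trans (hfF z hz)
      refine lt_of_le_of_lt ((hXS n z hz y).trans ?_) hn
      calc 2 * F * (1 / 2) ^ n * ω y ≤ 2 * F * (1 / 2) ^ n * (ω x + 1) := by
            have := (show ω y < ω x + 1 from hy).le; gcongr
        _ = _ := by ring
    exact this.continuous (Frequently.of_forall fun n => hcont n z hz)
  have hXb : ∀ z ∈ U, ∀ x, ‖X z x‖ ≤ 2 * F * ω x := by
    intro z hz x
    simpa [hS0] using hXS 0 z hz x
  have hXbM : ∀ z ∈ U, ∀ t ≤ M, ‖X z t‖ ≤ 2 * F := by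
    intro z hz t ht
    simpa [ω, max_eq_right (sub_nonpos.2 ht)] using hXb z hz t
  have hfix : ∀ z ∈ U, ∀ x, X z x = f z + volterra (𝓐 z) Pr (R z) M (X z) x := by
    intro z hz x
    refine tendsto_nhds_unique ((hX z hz x).comp (tendsto_add_atTop_nat 1)) ?_
    have : Tendsto (fun n => volterra (𝓐 z) Pr (R z) M (S n z) x) atTop
        (𝓝 (volterra (𝓐 z) Pr (R z) M (X z) x)) := by
      rw [tendsto_iff_norm_sub_tendsto_zero]
      refine squeeze_zero (fun _ => norm_nonneg _) (fun n => ?_) (hpow (F * ω x))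
      rw [norm_sub_rev, volterra_sub (h z hz) hεθ hM (hXc z hz) (hcont _ z hz) (hXbM z hz)
        (hboundM _ z hz)]
      refine ((h z hz).norm_volterra_le hεθ hκθ hκ.le hθ.le hdL hεL hM hM1 hM2 hL
        ((hXc z hz).sub (hcont _ z hz)) (hXS n z hz) x).trans (le_of_eq ?_)
      simp only [ω]
      ring
    exact this.const_add (f z)
  refine ⟨X, ?_, ?_, ?_, ?_⟩
  · intro z hz x
    have h1 := (hasDerivAt_volterra (M := M) (Pr := Pr) (𝓐 := 𝓐 z) (h z hz).cont (hXc z hz)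
      x).const_add (f z)
    have h2 : (fun x => f z + volterra (𝓐 z) Pr (R z) M (X z) x) = X z :=
      funext fun x => (hfix z hz x).symm
    rw [h2] at h1
    convert! h1 using 2
    conv_lhs => rw [hfix z hz x]
    simp [hker z hz]
  · intro x
    have hSd : ∀ n x, DifferentiableOn ℂ (fun z => S n z x) U := by
      intro n
      induction n with
      | zero => exact fun x => differentiableOn_const _
      | succ n ih =>
        intro x
        exact hf.add (differentiableOn_volterra hU h hεθ hθ.le h𝓐 hR (hcont n) hM hL0 (hbound n)
          ih x)
    have : TendstoUniformlyOn (fun n z => S n z x) (fun z => X z x) atTop U := by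
      rw [Metric.tendstoUniformlyOn_iff]
      intro e he
      filter_upwards [(hpow (2 * F * ω x)).eventually_lt_const he] with n hn z hz
      rw [dist_eq_norm]
      exact lt_of_le_of_lt ((hXS n z hz x).trans (le_of_eq (by ring))) hn
    exact this.tendstoLocallyUniformlyOn.differentiableOn
      (Eventually.of_forall fun n => hSd n x) hU
  · refine ⟨2 * |F| * ω 0, fun z hz x hx => (hXb z hz x).trans ?_⟩
    have h1 : ω x ≤ ω 0 := Real.exp_le_exp.2 (mul_le_mul_of_nonneg_left
      (max_le_max (by linarith) le_rfl) hL0)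
    have h2 := le_abs_self F
    have h3 : 0 ≤ ω x := zero_le_one.trans (hω1 x)
    exact mul_le_mul (by linarith) h1 h3 (by positivity)
  · intro z hz
    have h1 := (tendsto_volterra (h z hz) hεθ hκ hκθ (hXc z hz) hM (hXbM z hz)).const_add (f z)
    rw [add_zero] at h1
    exact h1.congr fun x => (hfix z hz x).symm

/-- A solution of `X' = (𝓐 + R(x)) X` that tends to `0` at `-∞` vanishes, if `exp (s 𝓐)` is bounded
for `s ≥ 0`. -/
theorem eq_zero_of_tendsto_atBot {𝓐 : E →L[ℂ] E} {R : ℝ → E →L[ℂ] E} (hR : Continuous R)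
    (hθ : 0 < θ) (hRb : ∀ t, ‖R t‖ ≤ C * Real.exp (-θ * |t|))
    (hK : ∀ s, 0 ≤ s → ‖flow 𝓐 s‖ ≤ K) {X : ℝ → E}
    (hX : ∀ x, HasDerivAt X (𝓐 (X x) + R x (X x)) x) (h0 : Tendsto X atBot (𝓝 0)) (x : ℝ) :
    X x = 0 := by
  have hXc : Continuous X := continuous_iff_continuousAt.2 fun x => (hX x).continuousAt
  have hK0 : 0 ≤ K := (norm_nonneg _).trans (hK 0 le_rfl)
  have h : DichotomyBound 𝓐 1 R K C θ 0 (θ / 2) ‖𝓐‖ :=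
    ⟨hR, hRb, le_rfl, fun s hs => by simpa using hK s hs, fun s _ => by
      simpa using mul_nonneg hK0 (Real.exp_pos _).le⟩
  obtain ⟨M, hM, hM1, hM2, hXM⟩ : ∃ M : ℝ, M ≤ 0 ∧ K * C * Real.exp (θ * M) / (θ - 0) ≤ 1 / 4 ∧
      K * C * Real.exp (θ * M) / (θ - θ / 2) ≤ 1 / 4 ∧ ∀ t ≤ M, ‖X t‖ ≤ 1 := by
    have h1 : ∀ b, Tendsto (fun M : ℝ => K * C * Real.exp (θ * M) / b) atBot (𝓝 0) := fun b => by
      simpa using ((tendsto_exp_mul_atBot hθ).const_mul (K * C)).div_const b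
    have h2 : ∀ᶠ M in atBot, ∀ t ≤ M, ‖X t‖ ≤ 1 := eventually_forall_le_atBot.2
      ((tendsto_zero_iff_norm_tendsto_zero.1 h0).eventually_le_const one_pos)
    exact ((eventually_le_atBot 0).and (((h1 _).eventually_le_const (by norm_num)).and
      (((h1 _).eventually_le_const (by norm_num)).and h2))).exists
  obtain ⟨L, hdL, hL0, hL⟩ : ∃ L : ℝ, ‖𝓐‖ < L ∧ 0 ≤ L ∧ C / (L - ‖𝓐‖) ≤ 1 / 4 := by
    have h1 : Tendsto (fun L : ℝ => C / (L - ‖𝓐‖)) atTop (𝓝 0) :=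
      Tendsto.div_atTop tendsto_const_nhds (tendsto_atTop_add_const_right _ (-‖𝓐‖) tendsto_id)
    exact ((eventually_gt_atTop ‖𝓐‖).and ((eventually_ge_atTop 0).and
      (h1.eventually_le_const (by norm_num)))).exists
  have hV : ∀ x, X x = volterra 𝓐 1 R M X x := by
    set H : ℝ → E := fun x => X x - volterra 𝓐 1 R M X x with hH
    have hder : ∀ x, HasDerivAt H (𝓐 (H x)) x := fun x => by
      convert! (hX x).sub (hasDerivAt_volterra (M := M) (Pr := 1) (𝓐 := 𝓐) hR hXc x) using 1
      simp only [hH, map_sub]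
      abel
    have hH0 : Tendsto H atBot (𝓝 0) := by
      simpa [hH] using h0.sub (tendsto_volterra h hθ (by positivity) (by linarith) hXc hM hXM)
    have hconst : ∀ x y, H x = flow 𝓐 (x - y) (H y) := by
      intro x y
      have hd : ∀ t, HasDerivAt (fun t => flow 𝓐 (x - t) (H t)) 0 t := fun t => by
        have := hasDerivAt_complex_clm_apply ((hasDerivAt_flow 𝓐 (x - t)).scomp t
          ((hasDerivAt_id t).const_sub x)) (hder t)
        convert! this using 1
        have hc : flow 𝓐 (x - t) * 𝓐 = 𝓐 * flow 𝓐 (x - t) :=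
          (hasDerivAt_exp_smul_const (𝕂 := ℝ) 𝓐 (x - t)).unique (hasDerivAt_flow 𝓐 (x - t))
        simp only [neg_smul, one_smul, neg_apply, Function.comp_apply]
        rw [← mul_apply_eq_comp (flow 𝓐 (x - t)) 𝓐, hc]
        simp
      have := is_const_of_deriv_eq_zero (fun t => (hd t).differentiableAt)
        (fun t => (hd t).deriv) x y
      simpa using this
    intro x
    have hz : H x = 0 := by
      have h1 : Tendsto (fun y => K * ‖H y‖) atBot (𝓝 0) := by
        simpa using (tendsto_zero_iff_norm_tendsto_zero.1 hH0).const_mul K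
      refine norm_le_zero_iff.1 (ge_of_tendsto h1 ?_)
      filter_upwards [eventually_le_atBot x] with y hy
      rw [hconst x y]
      exact ((flow 𝓐 (x - y)).le_opNorm _).trans (mul_le_mul_of_nonneg_right
        (hK _ (by linarith)) (norm_nonneg _))
    exact sub_eq_zero.1 hz
  have hC : 0 ≤ C := by
    have := (norm_nonneg _).trans (hRb 0)
    simpa using this
  have hsmall : ∀ n : ℕ, ∀ t ≤ M, ‖X t‖ ≤ (1 / 2) ^ n := by
    intro n
    induction n with
    | zero => simpa using hXM
    | succ n ih =>
      intro t ht
      rw [hV t]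
      refine (h.norm_volterra_le_of_le hθ (by linarith) hXc hM ht ih).trans ?_
      have e1 : Real.exp (θ * t) ≤ Real.exp (θ * M) :=
        Real.exp_le_exp.2 (mul_le_mul_of_nonneg_left ht hθ.le)
      have e2 : Real.exp (θ / 2 * (t - M)) ≤ 1 := Real.exp_le_one_iff.2 (by nlinarith)
      have hp1 : 0 < θ - 0 := by linarith
      have hp2 : 0 < θ - θ / 2 := by linarith
      calc _ ≤ K * C * (1 / 2) ^ n * Real.exp (θ * M) / (θ - 0) +
            K * C * (1 / 2) ^ n * 1 * Real.exp (θ * M) / (θ - θ / 2) := by gcongr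
        _ = (K * C * Real.exp (θ * M) / (θ - 0) + K * C * Real.exp (θ * M) / (θ - θ / 2))
            * (1 / 2) ^ n := by ring
        _ ≤ (1 / 4 + 1 / 4) * (1 / 2) ^ n := by gcongr
        _ = _ := by ring
  have hXM0 : X M = 0 := norm_le_zero_iff.1 (ge_of_tendsto
    (tendsto_pow_atTop_nhds_zero_of_lt_one (r := (1 / 2 : ℝ)) (by norm_num) (by norm_num))
    (Eventually.of_forall fun n => hsmall n M le_rfl))
  have hlip : ∀ t, LipschitzWith (‖𝓐‖ + C).toNNReal (fun v => 𝓐 v + R t v) := fun t => by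
    refine LipschitzWith.of_dist_le_mul fun v w => ?_
    rw [dist_eq_norm, dist_eq_norm, Real.coe_toNNReal _ (by positivity)]
    have e : 𝓐 v + R t v - (𝓐 w + R t w) = (𝓐 + R t) (v - w) := by
      simp only [add_apply, map_sub]
    rw [e]
    refine ((𝓐 + R t).le_opNorm _).trans (mul_le_mul_of_nonneg_right ?_ (norm_nonneg _))
    refine (norm_add_le _ _).trans (add_le_add le_rfl ((hRb t).trans ?_))
    have : Real.exp (-θ * |t|) ≤ 1 := Real.exp_le_one_iff.2 (by
      have := mul_nonneg hθ.le (abs_nonneg t); linarith)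
    nlinarith
  have := ODE_solution_unique_univ (f := X) (g := fun _ => 0) (t₀ := M)
    (v := fun t v => 𝓐 v + R t v) (s := fun _ => univ)
    (fun t => (hlip t).lipschitzOnWith) (fun t => ⟨hX t, trivial⟩)
    (fun t => ⟨by simpa using hasDerivAt_const t (0 : E), trivial⟩) hXM0
  exact congrFun this x

end Volterra

section Growth

variable {E : Type*} [NormedAddCommGroup E] [NormedSpace ℂ E] [CompleteSpace E]

theorem norm_le_of_hasDerivAt_smul_add {y b : ℝ → E} {d : ℂ} {κ g B : ℝ} (hg : 0 < g)
    (hd : d.re ≤ κ - g) (hy : ∀ t, HasDerivAt y (d • y t + b t) t)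
    (hb : ∀ t, 0 ≤ t → ‖b t‖ ≤ B * Real.exp (κ * t)) {t : ℝ} (ht : 0 ≤ t) :
    ‖y t‖ ≤ (‖y 0‖ + B / g) * Real.exp (κ * t) := by
  have hB : 0 ≤ B := by simpa using (norm_nonneg _).trans (hb 0 le_rfl)
  let e : ℝ → ℂ := fun t => Complex.exp (-d * t)
  have he : ∀ t : ℝ, HasDerivAt e (Complex.exp (-d * t) * (-d)) t := fun t => by
    have : HasDerivAt (fun t : ℝ => -d * (t : ℂ)) (-d) t := by
      simpa using (Complex.ofRealCLM.hasDerivAt (x := t)).const_mul (-d)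
    exact this.cexp
  have hne : ∀ t, ‖e t‖ = Real.exp (-d.re * t) := fun t => by
    simp [e, Complex.norm_exp]
  have hG : ∀ t, HasDerivAt (fun t => e t • y t) (e t • b t) t := fun t => by
    convert! (he t).smul (hy t) using 1
    simp only [e, smul_add, smul_smul]
    module
  have hbd : ∀ s ∈ Ico 0 t, ‖e s • b s‖ ≤ B * Real.exp ((κ - d.re) * s) := fun s hs => by
    rw [norm_smul, hne]
    calc _ ≤ Real.exp (-d.re * s) * (B * Real.exp (κ * s)) := by
          gcongr; exact hb s hs.1
      _ = B * (Real.exp (-d.re * s) * Real.exp (κ * s)) := by ring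
      _ = _ := by rw [← Real.exp_add]; ring_nf
  have hp : 0 < κ - d.re := by linarith
  have hBder : ∀ s, HasDerivAt (fun s => ‖y 0‖ + B / (κ - d.re) * (Real.exp ((κ - d.re) * s) - 1))
      (B * Real.exp ((κ - d.re) * s)) s := fun s => by
    have := (((hasDerivAt_id s).const_mul (κ - d.re)).exp.sub_const 1).const_mul (B / (κ - d.re))
    convert! this.const_add ‖y 0‖ using 1
    simp only [id, mul_one]
    field_simp
  have key := image_norm_le_of_norm_deriv_right_le_deriv_boundary
    (f := fun t => e t • y t) (f' := fun t => e t • b t) (a := 0) (b := t)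
    (fun s _ => (hG s).continuousAt.continuousWithinAt) (fun s _ => (hG s).hasDerivWithinAt)
    (B := fun s => ‖y 0‖ + B / (κ - d.re) * (Real.exp ((κ - d.re) * s) - 1))
    (B' := fun s => B * Real.exp ((κ - d.re) * s)) (by simp [e])
    hBder hbd ⟨ht, le_rfl⟩
  rw [norm_smul, hne] at key
  have h1 : ‖y t‖ = Real.exp (d.re * t) * (Real.exp (-d.re * t) * ‖y t‖) := by
    rw [← mul_assoc, ← Real.exp_add]; simp
  rw [h1]
  have h2 : Real.exp (d.re * t) ≤ Real.exp (κ * t) :=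
    Real.exp_le_exp.2 (mul_le_mul_of_nonneg_right (by linarith) ht)
  have h3 : Real.exp (d.re * t) * Real.exp ((κ - d.re) * t) = Real.exp (κ * t) := by
    rw [← Real.exp_add]; ring_nf
  have h4 : B / (κ - d.re) ≤ B / g := div_le_div_of_nonneg_left hB hg (by linarith)
  have h5 : 0 ≤ B / (κ - d.re) := by positivity
  calc _ ≤ Real.exp (d.re * t) *
        (‖y 0‖ + B / (κ - d.re) * (Real.exp ((κ - d.re) * t) - 1)) := by gcongr
    _ ≤ Real.exp (d.re * t) * ‖y 0‖ + B / (κ - d.re) * Real.exp (κ * t) := by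
        rw [← h3]
        have := mul_nonneg h5 (Real.exp_pos (d.re * t)).le
        nlinarith
    _ ≤ Real.exp (κ * t) * ‖y 0‖ + B / g * Real.exp (κ * t) := by gcongr
    _ = _ := by ring

theorem norm_le_of_hasDerivAt_smul {y : ℝ → E} {d : ℂ} {κ : ℝ}
    (hd : d.re ≤ κ) (hy : ∀ t, HasDerivAt y (d • y t) t) {t : ℝ} (ht : 0 ≤ t) :
    ‖y t‖ ≤ ‖y 0‖ * Real.exp (κ * t) := by
  have h1 : ∀ n : ℕ, ‖y t‖ ≤ ‖y 0‖ * Real.exp ((κ + 1 / (n + 1 : ℝ)) * t) := fun n => by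
    have := norm_le_of_hasDerivAt_smul_add (b := fun _ => (0 : E)) (B := 0)
      (κ := κ + 1 / (n + 1 : ℝ)) (g := 1 / (n + 1 : ℝ)) (by positivity) (d := d) (by linarith)
      (y := y) (by simpa using hy) (by simp) ht
    simpa using this
  have h2 : Tendsto (fun n : ℕ => ‖y 0‖ * Real.exp ((κ + 1 / (n + 1 : ℝ)) * t)) atTop
      (𝓝 (‖y 0‖ * Real.exp ((κ + 0) * t))) :=
    ((Real.continuous_exp.tendsto _).comp (((tendsto_one_div_add_atTop_nhds_zero_nat
      (𝕜 := ℝ)).const_add κ).mul_const t)).const_mul _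
  simpa using ge_of_tendsto h2 (Eventually.of_forall h1)

theorem hasDerivAt_flow_apply (𝓐 : E →L[ℂ] E) (v : E) (t : ℝ) :
    HasDerivAt (fun t => flow 𝓐 t v) (𝓐 (flow 𝓐 t v)) t := by
  simpa using hasDerivAt_complex_clm_apply (hasDerivAt_flow 𝓐 t) (hasDerivAt_const t v)

/-- Growth of `exp (t 𝓐) v` when `v` is annihilated by a product of three linear factors in `𝓐`. -/
theorem norm_flow_apply_le_of_cubic {𝓐 : E →L[ℂ] E} {v : E} {d₀ d₁ d₂ : ℂ} {κ g D : ℝ}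
    (hg : 0 < g) (h0 : d₀.re ≤ κ) (h1 : d₁.re ≤ κ - g) (h2 : d₂.re ≤ κ - g)
    (hD1 : ‖𝓐‖ + ‖d₁‖ ≤ D) (hD2 : ‖𝓐‖ + ‖d₂‖ ≤ D)
    (hv : ((𝓐 - d₀ • 1) * (𝓐 - d₁ • 1) * (𝓐 - d₂ • 1)) v = 0) {t : ℝ} (ht : 0 ≤ t) :
    ‖flow 𝓐 t v‖ ≤ (1 + D / g + D ^ 2 / g ^ 2) * ‖v‖ * Real.exp (κ * t) := by
  have hD0 : 0 ≤ D := le_trans (by positivity) hD1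
  have hc : ∀ t, 𝓐 * flow 𝓐 t = flow 𝓐 t * 𝓐 := fun t =>
    (hasDerivAt_flow 𝓐 t).unique (hasDerivAt_exp_smul_const (𝕂 := ℝ) 𝓐 t)
  let a : ℝ → E := fun t => flow 𝓐 t (((𝓐 - d₁ • 1) * (𝓐 - d₂ • 1)) v)
  let b : ℝ → E := fun t => flow 𝓐 t ((𝓐 - d₂ • 1) v)
  let y : ℝ → E := fun t => flow 𝓐 t v
  have e : ∀ (d : ℂ) (w : E), 𝓐 w = d • w + (𝓐 - d • 1) w := fun d w => by simp
  have comm : ∀ (d : ℂ) (w : E) (t : ℝ), (𝓐 - d • 1) (flow 𝓐 t w) = flow 𝓐 t ((𝓐 - d • 1) w) := by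
    intro d w t
    have := DFunLike.congr_fun (hc t) w
    simp only [mul_apply_eq_comp] at this
    simp [this]
  have hv' : (𝓐 - d₀ • 1) (((𝓐 - d₁ • 1) * (𝓐 - d₂ • 1)) v) = 0 := by
    rw [← mul_apply_eq_comp, ← mul_assoc]; exact hv
  have ha : ∀ t, HasDerivAt a (d₀ • a t) t := fun t => by
    have := hasDerivAt_flow_apply 𝓐 (((𝓐 - d₁ • 1) * (𝓐 - d₂ • 1)) v) t
    rw [e d₀, comm, hv', map_zero, add_zero] at this
    exact this
  have hb : ∀ t, HasDerivAt b (d₁ • b t + a t) t := fun t => by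
    have := hasDerivAt_flow_apply 𝓐 ((𝓐 - d₂ • 1) v) t
    rw [e d₁, comm] at this
    exact this
  have hy : ∀ t, HasDerivAt y (d₂ • y t + b t) t := fun t => by
    have := hasDerivAt_flow_apply 𝓐 v t
    rw [e d₂, comm] at this
    exact this
  have n2 : ‖(𝓐 - d₂ • 1) v‖ ≤ D * ‖v‖ := by
    have : (𝓐 - d₂ • 1) v = 𝓐 v - d₂ • v := by simp
    rw [this]
    refine (norm_sub_le _ _).trans ?_
    rw [norm_smul]
    nlinarith [𝓐.le_opNorm v, norm_nonneg v]
  have n1 : ‖((𝓐 - d₁ • 1) * (𝓐 - d₂ • 1)) v‖ ≤ D * (D * ‖v‖) := by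
    rw [mul_apply_eq_comp]
    set w := (𝓐 - d₂ • 1) v
    have : (𝓐 - d₁ • 1) w = 𝓐 w - d₁ • w := by simp
    rw [this]
    refine (norm_sub_le _ _).trans ?_
    rw [norm_smul]
    have h3 : (‖𝓐‖ + ‖d₁‖) * ‖w‖ ≤ D * (D * ‖v‖) :=
      mul_le_mul hD1 n2 (norm_nonneg _) hD0
    nlinarith [𝓐.le_opNorm w, norm_nonneg w]
  have b0 : b 0 = (𝓐 - d₂ • 1) v := by simp [b]
  have a0 : a 0 = ((𝓐 - d₁ • 1) * (𝓐 - d₂ • 1)) v := by simp [a]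
  have y0 : y 0 = v := by simp [y]
  have A1 : ∀ t, 0 ≤ t → ‖a t‖ ≤ D * (D * ‖v‖) * Real.exp (κ * t) := fun t ht =>
    (norm_le_of_hasDerivAt_smul h0 ha ht).trans (by rw [a0]; gcongr)
  have A2 : ∀ t, 0 ≤ t → ‖b t‖ ≤ (D * ‖v‖ + D * (D * ‖v‖) / g) * Real.exp (κ * t) := fun t ht =>
    (norm_le_of_hasDerivAt_smul_add hg h1 hb A1 ht).trans (by rw [b0]; gcongr)
  have A3 := norm_le_of_hasDerivAt_smul_add hg h2 hy A2 ht
  rw [y0] at A3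
  refine A3.trans (le_of_eq ?_)
  field_simp
  ring

theorem norm_flow_mul_le_of_cubic {𝓐 Pr : E →L[ℂ] E} {d₀ d₁ d₂ : ℂ} {κ g D : ℝ}
    (hg : 0 < g) (h0 : d₀.re ≤ κ) (h1 : d₁.re ≤ κ - g) (h2 : d₂.re ≤ κ - g)
    (hD1 : ‖𝓐‖ + ‖d₁‖ ≤ D) (hD2 : ‖𝓐‖ + ‖d₂‖ ≤ D)
    (hv : (𝓐 - d₀ • 1) * (𝓐 - d₁ • 1) * (𝓐 - d₂ • 1) * Pr = 0) {t : ℝ} (ht : 0 ≤ t) :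
    ‖flow 𝓐 t * Pr‖ ≤ (1 + D / g + D ^ 2 / g ^ 2) * ‖Pr‖ * Real.exp (κ * t) := by
  have hD0 : 0 ≤ D := le_trans (by positivity) hD1
  refine ContinuousLinearMap.opNorm_le_bound _ (by positivity) fun w => ?_
  rw [mul_apply_eq_comp]
  refine (norm_flow_apply_le_of_cubic hg h0 h1 h2 hD1 hD2 (v := Pr w) ?_ ht).trans ?_
  · rw [← mul_apply_eq_comp, hv]; simp
  · calc _ ≤ (1 + D / g + D ^ 2 / g ^ 2) * (‖Pr‖ * ‖w‖) * Real.exp (κ * t) := by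
          gcongr; exact Pr.le_opNorm w
      _ = _ := by ring

end Growth

section GapAlgebra
open scoped Matrix.Norms.Operator

variable {M : Matrix (Fin 3) (Fin 3) ℂ} {μ μ' : Fin 3 → ℂ}

theorem charpoly_eval_fin_three (M : Matrix (Fin 3) (Fin 3) ℂ) (z : ℂ) :
    M.charpoly.eval z = z ^ 3 - (M 0 0 + M 1 1 + M 2 2) * z ^ 2
      + (M 0 0 * M 1 1 - M 0 1 * M 1 0 + (M 0 0 * M 2 2 - M 0 2 * M 2 0)
        + (M 1 1 * M 2 2 - M 1 2 * M 2 1)) * z - M.det := by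
  rw [Matrix.eval_charpoly, Matrix.det_fin_three, Matrix.det_fin_three]
  simp [Matrix.sub_apply]
  ring

theorem eq_prod_of_charpoly_coeffs (h1 : M 0 0 + M 1 1 + M 2 2 = μ 0 + μ 1 + μ 2)
    (h2 : M 0 0 * M 1 1 - M 0 1 * M 1 0 + (M 0 0 * M 2 2 - M 0 2 * M 2 0)
        + (M 1 1 * M 2 2 - M 1 2 * M 2 1) = μ 0 * μ 1 + μ 0 * μ 2 + μ 1 * μ 2)
    (h3 : M.det = μ 0 * μ 1 * μ 2) :
    M.charpoly = ∏ j, (Polynomial.X - Polynomial.C (μ j)) := by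
  refine Polynomial.funext fun z => ?_
  rw [charpoly_eval_fin_three, h1, h2, h3]
  simp [Fin.prod_univ_three]
  ring

theorem IsGapSpectrum.coeffs (h : IsGapSpectrum M μ) :
    M 0 0 + M 1 1 + M 2 2 = μ 0 + μ 1 + μ 2 ∧
    M 0 0 * M 1 1 - M 0 1 * M 1 0 + (M 0 0 * M 2 2 - M 0 2 * M 2 0)
        + (M 1 1 * M 2 2 - M 1 2 * M 2 1) = μ 0 * μ 1 + μ 0 * μ 2 + μ 1 * μ 2 ∧
    M.det = μ 0 * μ 1 * μ 2 := by
  have key : ∀ z : ℂ, z ^ 3 - (M 0 0 + M 1 1 + M 2 2) * z ^ 2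
      + (M 0 0 * M 1 1 - M 0 1 * M 1 0 + (M 0 0 * M 2 2 - M 0 2 * M 2 0)
        + (M 1 1 * M 2 2 - M 1 2 * M 2 1)) * z - M.det = (z - μ 0) * (z - μ 1) * (z - μ 2) := by
    intro z
    rw [← charpoly_eval_fin_three, h.1]
    simp [Fin.prod_univ_three]
  have k0 := key 0
  have k1 := key 1
  have k2 := key (-1)
  have h3 : M.det = μ 0 * μ 1 * μ 2 := by linear_combination -k0
  refine ⟨?_, ?_, h3⟩
  · linear_combination -(k1 + k2) / 2 - h3
  · linear_combination (k1 - k2) / 2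

theorem IsGapSpectrum.trace (h : IsGapSpectrum M μ) : M.trace = μ 0 + μ 1 + μ 2 := by
  rw [Matrix.trace_fin_three]; exact h.coeffs.1

theorem IsGapSpectrum.swap (h : IsGapSpectrum M μ) : IsGapSpectrum M ![μ 1, μ 0, μ 2] := by
  refine ⟨?_, h.2.2, h.2.1⟩
  rw [h.1, Fin.prod_univ_three, Fin.prod_univ_three]
  simp [mul_comm]

theorem IsGapSpectrum.cubic (h : IsGapSpectrum M μ) :
    (M - μ 0 • 1) * (M - μ 1 • 1) * (M - μ 2 • 1) = 0 := by
  have := M.aeval_self_charpoly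
  rw [h.1] at this
  simpa [Fin.prod_univ_three, Algebra.algebraMap_eq_smul_one] using this

theorem IsGapSpectrum.ne_zero (h : IsGapSpectrum M μ) : μ 2 ≠ μ 0 ∧ μ 2 ≠ μ 1 :=
  ⟨fun e => absurd h.2.1 (by rw [e]; exact lt_irrefl _),
    fun e => absurd h.2.2 (by rw [e]; exact lt_irrefl _)⟩

theorem IsGapSpectrum.unique (h : IsGapSpectrum M μ) (h' : IsGapSpectrum M μ') :
    μ' 2 = μ 2 ∧ μ' 0 + μ' 1 = μ 0 + μ 1 ∧ μ' 0 * μ' 1 = μ 0 * μ 1 := by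
  have key : ∀ z : ℂ, (z - μ' 0) * (z - μ' 1) * (z - μ' 2) = (z - μ 0) * (z - μ 1) * (z - μ 2) := by
    intro z
    have := congrArg (Polynomial.eval z) (h'.1.symm.trans h.1)
    simpa [Fin.prod_univ_three] using this
  have e2 : μ' 2 = μ 2 := by
    have a := (key (μ' 2)).symm
    have b := key (μ 2)
    simp only [sub_self, mul_zero, mul_eq_zero, sub_eq_zero] at a b
    rcases b with (b | b) | b
    · rcases a with (a | a) | a
      · exact absurd (lt_trans (a ▸ h.2.1) (b ▸ h'.2.1)) (lt_irrefl _)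
      · exact absurd (lt_trans (a ▸ h.2.2) (b ▸ h'.2.1)) (lt_irrefl _)
      · exact a
    · rcases a with (a | a) | a
      · exact absurd (lt_trans (a ▸ h.2.1) (b ▸ h'.2.2)) (lt_irrefl _)
      · exact absurd (lt_trans (a ▸ h.2.2) (b ▸ h'.2.2)) (lt_irrefl _)
      · exact a
    · exact b.symm
  have s1 : μ' 0 + μ' 1 + μ' 2 = μ 0 + μ 1 + μ 2 := h'.coeffs.1.symm.trans h.coeffs.1
  have s2 := h'.coeffs.2.1.symm.trans h.coeffs.2.1
  have s1' : μ' 0 + μ' 1 = μ 0 + μ 1 := by linear_combination s1 - e2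
  refine ⟨e2, s1', ?_⟩
  rw [e2] at s2
  linear_combination s2 - μ 2 * s1'

/-- The spectral projection of `M` on the eigenvalue of least real part. -/
def gapProj (M : Matrix (Fin 3) (Fin 3) ℂ) (μ : Fin 3 → ℂ) : Matrix (Fin 3) (Fin 3) ℂ :=
  ((μ 2 - μ 0) * (μ 2 - μ 1))⁻¹ • ((M - μ 0 • 1) * (M - μ 1 • 1))

theorem gapProj_eq (M : Matrix (Fin 3) (Fin 3) ℂ) (μ : Fin 3 → ℂ) :
    gapProj M μ = (μ 2 ^ 2 - (μ 0 + μ 1) * μ 2 + μ 0 * μ 1)⁻¹ •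
      (M * M - (μ 0 + μ 1) • M + (μ 0 * μ 1) • 1) := by
  unfold gapProj
  congr 1
  · congr 1; ring
  · simp only [mul_sub, sub_mul, mul_smul_comm, smul_mul_assoc, mul_one, one_mul]
    module

theorem IsGapSpectrum.gapProj_unique (h : IsGapSpectrum M μ) (h' : IsGapSpectrum M μ') :
    gapProj M μ' = gapProj M μ := by
  obtain ⟨e2, e1, e0⟩ := h.unique h'
  rw [gapProj_eq, gapProj_eq, e2, e1, e0]

theorem IsGapSpectrum.den_ne_zero (h : IsGapSpectrum M μ) : (μ 2 - μ 0) * (μ 2 - μ 1) ≠ 0 :=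
  mul_ne_zero (sub_ne_zero.2 h.ne_zero.1) (sub_ne_zero.2 h.ne_zero.2)

theorem commute_sub_smul_one (M : Matrix (Fin 3) (Fin 3) ℂ) (a b : ℂ) :
    Commute (M - a • 1) (M - b • 1) := by
  unfold Commute SemiconjBy
  simp only [mul_sub, sub_mul, mul_smul_comm, smul_mul_assoc, mul_one, one_mul]
  module

theorem IsGapSpectrum.sub_mul_gapProj (h : IsGapSpectrum M μ) :
    (M - μ 2 • 1) * gapProj M μ = 0 := by
  have := h.cubic
  rw [((commute_sub_smul_one M (μ 0) (μ 2)).mul_left (commute_sub_smul_one M (μ 1) (μ 2))).eq] at this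
  rw [gapProj, mul_smul_comm, this, smul_zero]

theorem IsGapSpectrum.gapProj_mul_sub (h : IsGapSpectrum M μ) :
    gapProj M μ * (M - μ 2 • 1) = 0 := by
  rw [gapProj, smul_mul_assoc, h.cubic, smul_zero]

theorem IsGapSpectrum.mul_gapProj (h : IsGapSpectrum M μ) :
    M * gapProj M μ = μ 2 • gapProj M μ := by
  simpa [sub_mul, sub_eq_zero] using h.sub_mul_gapProj

theorem IsGapSpectrum.gapProj_mul (h : IsGapSpectrum M μ) :
    gapProj M μ * M = μ 2 • gapProj M μ := by
  simpa [mul_sub, sub_eq_zero] using h.gapProj_mul_sub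

theorem IsGapSpectrum.gapProj_mul_self (h : IsGapSpectrum M μ) :
    gapProj M μ * gapProj M μ = gapProj M μ := by
  have e : ∀ a : ℂ, (M - a • 1) * gapProj M μ = (μ 2 - a) • gapProj M μ := fun a => by
    rw [sub_mul, h.mul_gapProj, sub_smul]; simp
  conv_lhs => arg 1; rw [gapProj]
  rw [smul_mul_assoc, mul_assoc, e, mul_smul_comm, e, smul_smul, smul_smul]
  have := h.den_ne_zero
  rw [mul_assoc, mul_comm (μ 2 - μ 1), inv_mul_cancel₀ this, one_smul]

theorem IsGapSpectrum.trace_gapProj (h : IsGapSpectrum M μ) : (gapProj M μ).trace = 1 := by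
  obtain ⟨h1, h2, -⟩ := h.coeffs
  rw [gapProj, Matrix.trace_smul, smul_eq_mul, inv_mul_eq_one₀ h.den_ne_zero]
  simp only [Matrix.trace_fin_three, Matrix.mul_apply, Fin.sum_univ_three, Matrix.sub_apply,
    Matrix.smul_apply, smul_eq_mul, Matrix.one_apply_eq, ne_eq, Fin.reduceEq, not_false_eq_true,
    Matrix.one_apply_ne]
  linear_combination (-(M 0 0 + M 1 1 + M 2 2) - (μ 0 + μ 1 + μ 2) + μ 0 + μ 1) * h1 + 2 * h2

theorem exists_eq_vecMulVec {P : Matrix (Fin 3) (Fin 3) ℂ} (hP : P * P = P) (ht : P.trace = 1) :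
    ∃ v l : Fin 3 → ℂ, P = Matrix.vecMulVec v l ∧ l ⬝ᵥ v = 1 := by
  have hid : IsIdempotentElem (Matrix.toLin' P) := by
    rw [IsIdempotentElem, Module.End.mul_eq_comp, ← Matrix.toLin'_mul, hP]
  have htr := (LinearMap.IsIdempotentElem.isProj_range _ hid).trace
  rw [Matrix.trace_toLin'_eq, ht] at htr
  have hfr : Module.finrank ℂ (LinearMap.range (Matrix.toLin' P)) = 1 := by exact_mod_cast htr.symm
  obtain ⟨v, -, hv⟩ := finrank_eq_one_iff'.1 hfr
  choose l hl using fun j : Fin 3 => hv ⟨Matrix.toLin' P (Pi.single j 1), LinearMap.mem_range_self _ _⟩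
  have hPv : P = Matrix.vecMulVec v l := by
    ext i j
    have := congrFun (congrArg Subtype.val (hl j)) i
    simp only [Matrix.toLin'_apply, Matrix.mulVec_single_one] at this
    rw [Matrix.vecMulVec_apply, mul_comm]
    exact this.symm
  refine ⟨v, l, hPv, ?_⟩
  rw [hPv, Matrix.trace_vecMulVec, dotProduct_comm] at ht
  exact ht

/-- The cross product, as the row vector `v ↦ det (a, b, v)`. -/
def crossRow (a b : Fin 3 → ℂ) : Fin 3 → ℂ :=
  ![a 1 * b 2 - a 2 * b 1, a 2 * b 0 - a 0 * b 2, a 0 * b 1 - a 1 * b 0]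

theorem crossRow_dotProduct (V : Fin 3 → Fin 3 → ℂ) :
    crossRow (V 0) (V 1) ⬝ᵥ V 2 = (Matrix.of fun i j => V j i).det := by
  simp [crossRow, Matrix.det_fin_three, dotProduct, Fin.sum_univ_three]
  ring

theorem crossRow_dotProduct_left (a b : Fin 3 → ℂ) : crossRow a b ⬝ᵥ a = 0 := by
  simp [crossRow, dotProduct, Fin.sum_univ_three]; ring

theorem crossRow_dotProduct_right (a b : Fin 3 → ℂ) : crossRow a b ⬝ᵥ b = 0 := by
  simp [crossRow, dotProduct, Fin.sum_univ_three]; ring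

theorem crossRow_mulVec (B : Matrix (Fin 3) (Fin 3) ℂ) (a b : Fin 3 → ℂ) :
    crossRow (B.mulVec a) (B.mulVec b) = Matrix.vecMul (crossRow a b) B.adjugate := by
  rw [Matrix.adjugate_fin_three]
  ext i
  fin_cases i <;>
    simp [crossRow, Matrix.mulVec, Matrix.vecMul, dotProduct, Fin.sum_univ_three] <;> ring

theorem crossRow_mulVec_add (B : Matrix (Fin 3) (Fin 3) ℂ) (a b : Fin 3 → ℂ) :
    crossRow (B.mulVec a) b + crossRow a (B.mulVec b)
      = B.trace • crossRow a b - Matrix.vecMul (crossRow a b) B := by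
  ext i
  fin_cases i <;>
    simp [crossRow, Matrix.mulVec, Matrix.vecMul, dotProduct, Fin.sum_univ_three,
      Matrix.trace_fin_three] <;> ring

theorem hasDerivAt_crossRow {a b : ℝ → Fin 3 → ℂ} {a' b' : Fin 3 → ℂ} {x : ℝ}
    (ha : HasDerivAt a a' x) (hb : HasDerivAt b b' x) :
    HasDerivAt (fun x => crossRow (a x) (b x)) (crossRow a' (b x) + crossRow (a x) b') x := by
  have ha' := fun i => hasDerivAt_pi.1 ha i
  have hb' := fun i => hasDerivAt_pi.1 hb i
  refine hasDerivAt_pi.2 fun i => ?_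
  fin_cases i
  · convert! ((ha' 1).mul (hb' 2)).sub ((ha' 2).mul (hb' 1)) using 1
    simp [crossRow]; ring
  · convert! ((ha' 2).mul (hb' 0)).sub ((ha' 0).mul (hb' 2)) using 1
    simp [crossRow]; ring
  · convert! ((ha' 0).mul (hb' 1)).sub ((ha' 1).mul (hb' 0)) using 1
    simp [crossRow]; ring

theorem isUnit_det_of_linearIndependent {V : Fin 3 → Fin 3 → ℂ} (hV : LinearIndependent ℂ V) :
    (Matrix.of fun i j => V j i).det ≠ 0 := by
  have h : IsUnit (Matrix.of fun i j => V j i) := by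
    rw [← Matrix.linearIndependent_cols_iff_isUnit]
    exact hV
  exact ((Matrix.isUnit_iff_isUnit_det _).1 h).ne_zero

/-- A projection of rank one in terms of a frame adapted to it. -/
theorem eq_vecMulVec_of_frame {P : Matrix (Fin 3) (Fin 3) ℂ} {V : Fin 3 → Fin 3 → ℂ}
    (hV : LinearIndependent ℂ V) (h0 : ∀ j, j ≠ 2 → P.mulVec (V j) = 0)
    (h2 : P.mulVec (V 2) = V 2) :
    P = Matrix.vecMulVec (V 2)
      ((Matrix.of fun i j => V j i).det⁻¹ • crossRow (V 0) (V 1)) := by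
  have hd := isUnit_det_of_linearIndependent hV
  set B := Matrix.of fun i j => V j i with hB
  have hcol : ∀ (N : Matrix (Fin 3) (Fin 3) ℂ) j, (N * B).col j = N.mulVec (V j) := by
    intro N j
    ext i
    simp [Matrix.mul_apply, Matrix.mulVec, dotProduct, hB, Matrix.col]
  have key : P * B = Matrix.vecMulVec (V 2) (B.det⁻¹ • crossRow (V 0) (V 1)) * B := by
    refine Matrix.ext_col fun j => ?_
    rw [hcol, hcol, Matrix.vecMulVec_mulVec, smul_dotProduct]
    fin_cases j
    · simp [h0 0 (by decide), crossRow_dotProduct_left]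
    · simp [h0 1 (by decide), crossRow_dotProduct_right]
    · simp [h2, crossRow_dotProduct, ← hB, hd]
  have := congrArg (· * B⁻¹) key
  simpa [Matrix.mul_assoc, Matrix.mul_nonsing_inv B (isUnit_iff_ne_zero.2 hd)] using this

theorem exists_frame {P : Matrix (Fin 3) (Fin 3) ℂ} (hP : P * P = P) (ht : P.trace = 1) :
    ∃ V : Fin 3 → Fin 3 → ℂ, LinearIndependent ℂ V ∧ (∀ j, j ≠ 2 → P.mulVec (V j) = 0) ∧
      P.mulVec (V 2) = V 2 := by
  obtain ⟨v, l, hPv, hlv⟩ := exists_eq_vecMulVec hP ht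
  let f : (Fin 3 → ℂ) →ₗ[ℂ] ℂ := dotProductBilin ℂ ℂ l
  have hf : ∀ w, f w = l ⬝ᵥ w := fun w => rfl
  have hsurj : Function.Surjective f := fun c => ⟨c • v, by rw [map_smul, hf, hlv]; simp⟩
  have hker : Module.finrank ℂ (LinearMap.ker f) = 2 := by
    have := LinearMap.finrank_range_add_finrank_ker f
    rw [LinearMap.range_eq_top.2 hsurj, finrank_top] at this
    simp at this
    omega
  let b := Module.finBasisOfFinrankEq ℂ (LinearMap.ker f) hker
  have hb : ∀ j, l ⬝ᵥ (b j : Fin 3 → ℂ) = 0 := fun j => LinearMap.mem_ker.1 (b j).2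
  have hbi : LinearIndependent ℂ (fun j => (b j : Fin 3 → ℂ)) :=
    b.linearIndependent.map' (Submodule.subtype _) (Submodule.ker_subtype _)
  have hv : v ∉ Submodule.span ℂ (range fun j => (b j : Fin 3 → ℂ)) := fun hmem => by
    have hle : Submodule.span ℂ (range fun j => (b j : Fin 3 → ℂ)) ≤ LinearMap.ker f :=
      Submodule.span_le.2 (by rintro _ ⟨j, rfl⟩; exact (b j).2)
    have := LinearMap.mem_ker.1 (hle hmem)
    rw [hf, hlv] at this
    exact one_ne_zero this
  refine ⟨Fin.snoc (fun j => (b j : Fin 3 → ℂ)) v, linearIndependent_finSnoc.2 ⟨hbi, hv⟩, ?_, ?_⟩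
  · intro j hj
    have : (Fin.snoc (fun j => (b j : Fin 3 → ℂ)) v : Fin 3 → Fin 3 → ℂ) j
        = b ⟨j, by omega⟩ := by
      fin_cases j <;> first | rfl | exact absurd rfl hj
    rw [this, hPv, Matrix.vecMulVec_mulVec, hb]
    simp
  · have : (Fin.snoc (fun j => (b j : Fin 3 → ℂ)) v : Fin 3 → Fin 3 → ℂ) 2 = v := rfl
    rw [this, hPv, Matrix.vecMulVec_mulVec, hlv]
    simp

end GapAlgebra

section Fast

variable {𝔸 : Type*} [NormedRing 𝔸] [NormedAlgebra ℂ 𝔸]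

/-- Left multiplication. -/
def lmul (M : 𝔸) : 𝔸 →L[ℂ] 𝔸 := ContinuousLinearMap.mul ℂ 𝔸 M

/-- Right multiplication. -/
def rmul (M : 𝔸) : 𝔸 →L[ℂ] 𝔸 := (ContinuousLinearMap.mul ℂ 𝔸).flip M

@[simp] theorem lmul_apply (M X : 𝔸) : lmul M X = M * X := rfl
@[simp] theorem rmul_apply (M X : 𝔸) : rmul M X = X * M := rfl

theorem norm_lmul_le (M : 𝔸) : ‖lmul M‖ ≤ ‖M‖ := ContinuousLinearMap.opNorm_mul_apply_le ℂ 𝔸 M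

theorem norm_rmul_le (M : 𝔸) : ‖rmul M‖ ≤ ‖M‖ :=
  ContinuousLinearMap.opNorm_le_bound _ (norm_nonneg _) fun X => by
    rw [rmul_apply, mul_comm ‖M‖]; exact norm_mul_le _ _

theorem continuous_lmul : Continuous (lmul : 𝔸 → 𝔸 →L[ℂ] 𝔸) :=
  (ContinuousLinearMap.mul ℂ 𝔸).continuous
theorem continuous_rmul : Continuous (rmul : 𝔸 → 𝔸 →L[ℂ] 𝔸) :=
  (ContinuousLinearMap.mul ℂ 𝔸).flip.continuous
theorem differentiable_lmul : Differentiable ℂ (lmul : 𝔸 → 𝔸 →L[ℂ] 𝔸) :=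
  (ContinuousLinearMap.mul ℂ 𝔸).differentiable
theorem differentiable_rmul : Differentiable ℂ (rmul : 𝔸 → 𝔸 →L[ℂ] 𝔸) :=
  (ContinuousLinearMap.mul ℂ 𝔸).flip.differentiable

theorem commute_sub_smul_one' (M : 𝔸) (a b : ℂ) : Commute (M - a • 1) (M - b • 1) := by
  unfold Commute SemiconjBy
  simp only [mul_sub, sub_mul, mul_smul_comm, smul_mul_assoc, mul_one, one_mul]
  module

/-- `A(x)` converges exponentially to `A₀` as `x → ±∞`. -/
structure AsymConst (A : ℝ → 𝔸) (A₀ : 𝔸) (C θ : ℝ) : Prop where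
  cont : Continuous A
  bound : ∀ x, ‖A x - A₀‖ ≤ C * Real.exp (-θ * |x|)

theorem exists_extremal {E : Type*} [NormedAddCommGroup E] [NormedSpace ℂ E] [CompleteSpace E]
    {U : Set ℂ} (hU : IsOpen U) {N : ℂ → E →L[ℂ] E} {R : ℂ → ℝ → E →L[ℂ] E} {f : ℂ → E}
    {a b : ℂ → ℂ} {C θ D g F : ℝ} (hθ : 0 < θ) (hg : 0 < g) (hN : DifferentiableOn ℂ N U)
    (hND : ∀ z ∈ U, ‖N z‖ ≤ D) (ha : ∀ z ∈ U, g ≤ (a z).re) (hb : ∀ z ∈ U, g ≤ (b z).re)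
    (haD : ∀ z ∈ U, ‖a z‖ ≤ D) (hbD : ∀ z ∈ U, ‖b z‖ ≤ D)
    (hcub : ∀ z ∈ U, N z * (N z - a z • 1) * (N z - b z • 1) = 0)
    (hRc : ∀ z ∈ U, Continuous (R z)) (hRb : ∀ z ∈ U, ∀ t, ‖R z t‖ ≤ C * Real.exp (-θ * |t|))
    (hR : ∀ t, DifferentiableOn ℂ (fun z => R z t) U) (hf : DifferentiableOn ℂ f U)
    (hfF : ∀ z ∈ U, ‖f z‖ ≤ F) (hker : ∀ z ∈ U, N z (f z) = 0) :
    ∃ X : ℂ → ℝ → E,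
      (∀ z ∈ U, ∀ x, HasDerivAt (X z) (-(N z (X z x)) + R z x (X z x)) x) ∧
      (∀ x, DifferentiableOn ℂ (fun z => X z x) U) ∧
      (∃ B, ∀ z ∈ U, ∀ x ≤ 0, ‖X z x‖ ≤ B) ∧ (∀ z ∈ U, Tendsto (X z) atBot (𝓝 (f z))) ∧
      ∀ z ∈ U, ∀ x : ℝ → E, (∀ t, HasDerivAt x (-(N z (x t)) + R z t (x t)) t) →
        Tendsto x atBot (𝓝 0) → ∀ t, x t = 0 := by
  have hK : ∀ z ∈ U, ∀ s, 0 ≤ s → ‖flow (-N z) s‖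
      ≤ (1 + 2 * D / g + (2 * D) ^ 2 / g ^ 2) * ‖(1 : E →L[ℂ] E)‖ := by
    intro z hz s hs
    have := norm_flow_mul_le_of_cubic (𝓐 := -N z) (Pr := 1) (d₀ := 0) (d₁ := -a z) (d₂ := -b z)
      (κ := 0) (g := g) (D := 2 * D) hg (by simp) (by simpa using ha z hz)
      (by simpa using hb z hz) (by rw [norm_neg, norm_neg]; linarith [hND z hz, haD z hz])
      (by rw [norm_neg, norm_neg]; linarith [hND z hz, hbD z hz]) (by
        have : (-N z - (0 : ℂ) • 1) * (-N z - (-a z) • 1) * (-N z - (-b z) • 1) * 1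
            = -(N z * (N z - a z • 1) * (N z - b z • 1)) := by
          have e1 : ∀ c : ℂ, -N z - (-c) • (1 : E →L[ℂ] E) = -(N z - c • 1) := fun c => by
            rw [neg_smul]; abel
          rw [e1, e1, zero_smul, sub_zero, mul_one, neg_mul_neg, mul_neg]
        rw [this, hcub z hz, neg_zero]) hs
    simpa using this
  set K := (1 + 2 * D / g + (2 * D) ^ 2 / g ^ 2) * ‖(1 : E →L[ℂ] E)‖
  have hdb : ∀ z ∈ U, DichotomyBound (-N z) 1 (R z) K C θ 0 (θ / 2) D := fun z hz =>
    ⟨hRc z hz, hRb z hz, by rw [norm_neg]; exact hND z hz, fun s hs => by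
      simpa using hK z hz s hs, fun s _ => by
      have := (norm_nonneg _).trans (hK z hz 0 le_rfl)
      simpa using mul_nonneg this (Real.exp_pos _).le⟩
  obtain ⟨X, h1, h2, h3, h4⟩ := exists_solution_tendsto_atBot hU hdb hθ (half_pos hθ)
    (half_lt_self hθ) hN.neg hR hf hfF (fun z hz => by simp [hker z hz])
  exact ⟨X, by simpa using h1, h2, h3, h4, fun z hz x hx h0 => eq_zero_of_tendsto_atBot (hRc z hz) hθ
    (hRb z hz) (hK z hz) (by simpa using hx) h0⟩

/-- Normalized fast solutions: `X` solves the system shifted by the least eigenvalue `m` and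
converges to the spectral projection `p` at `+∞`; `Y` solves the adjoint system and converges to it
at `-∞`. -/
structure FastPair (A : ℝ → 𝔸) (m : ℂ) (p : 𝔸) (X Y : ℝ → 𝔸) : Prop where
  derivX : ∀ x, HasDerivAt X ((A x - m • 1) * X x) x
  limX : Tendsto X atTop (𝓝 p)
  derivY : ∀ x, HasDerivAt Y (-(Y x * (A x - m • 1))) x
  limY : Tendsto Y atBot (𝓝 p)
  uniqueX : ∀ w : ℝ → 𝔸, (∀ x, HasDerivAt w ((A x - m • 1) * w x) x) →
    Tendsto w atTop (𝓝 0) → ∀ x, w x = 0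
  uniqueY : ∀ w : ℝ → 𝔸, (∀ x, HasDerivAt w (-(w x * (A x - m • 1))) x) →
    Tendsto w atBot (𝓝 0) → ∀ x, w x = 0

variable [CompleteSpace 𝔸]

theorem exists_fastPair {U : Set ℂ} (hU : IsOpen U) {A : ℂ → ℝ → 𝔸} {A₀ p : ℂ → 𝔸}
    {m a b : ℂ → ℂ} {C θ D g : ℝ} (hθ : 0 < θ) (hg : 0 < g)
    (hA : ∀ z ∈ U, AsymConst (A z) (A₀ z) C θ) (hAd : ∀ x, DifferentiableOn ℂ (fun z => A z x) U)
    (hA₀ : DifferentiableOn ℂ A₀ U)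
    (hcub' : ∀ z ∈ U, (A₀ z - a z • 1) * (A₀ z - b z • 1) * (A₀ z - m z • 1) = 0)
    (hp : ∀ z ∈ U, (A₀ z - m z • 1) * p z = 0) (hp' : ∀ z ∈ U, p z * (A₀ z - m z • 1) = 0)
    (hm : DifferentiableOn ℂ m U)
    (hP : DifferentiableOn ℂ p U)
    (hPD : ∀ z ∈ U, ‖p z‖ ≤ D)
    (hND : ∀ z ∈ U, ‖A₀ z - m z • 1‖ ≤ D)
    (h0 : ∀ z ∈ U, g ≤ (a z - m z).re) (h1 : ∀ z ∈ U, g ≤ (b z - m z).re)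
    (h0D : ∀ z ∈ U, ‖a z - m z‖ ≤ D) (h1D : ∀ z ∈ U, ‖b z - m z‖ ≤ D) :
    ∃ X Y : ℂ → ℝ → 𝔸, (∀ z ∈ U, FastPair (A z) (m z) (p z) (X z) (Y z)) ∧
      (∀ x, DifferentiableOn ℂ (fun z => X z x) U) ∧
      (∀ x, DifferentiableOn ℂ (fun z => Y z x) U) ∧
      ∃ B, ∀ z ∈ U, (∀ x, 0 ≤ x → ‖X z x‖ ≤ B) ∧ ∀ x ≤ 0, ‖Y z x‖ ≤ B := by
  have hNdiff : DifferentiableOn ℂ (fun z => A₀ z - m z • (1 : 𝔸)) U :=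
    hA₀.sub (hm.smul_const 1)
  have hshift : ∀ z (c : ℂ), A₀ z - m z • (1 : 𝔸) - (c - m z) • 1 = A₀ z - c • 1 :=
    fun z c => by rw [sub_smul]; abel
  have hcub : ∀ z ∈ U, (A₀ z - m z • 1) * (A₀ z - a z • 1) * (A₀ z - b z • 1) = 0 := by
    intro z hz
    rw [mul_assoc, ((commute_sub_smul_one' (A₀ z) (m z) (a z)).mul_right
      (commute_sub_smul_one' (A₀ z) (m z) (b z))).eq]
    exact hcub' z hz
  have hl : ∀ z (c : ℂ), lmul (A₀ z - m z • 1) - (c - m z) • 1 = lmul (A₀ z - c • 1) := by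
    intro z c
    rw [← hshift z c]
    ext1 X
    simp only [sub_apply, smul_apply, lmul_apply, one_apply_eq_self, sub_mul, smul_mul_assoc,
      one_mul]
  have hr : ∀ z (c : ℂ), rmul (A₀ z - m z • 1) - (c - m z) • 1 = rmul (A₀ z - c • 1) := by
    intro z c
    rw [← hshift z c]
    ext1 X
    simp only [sub_apply, smul_apply, rmul_apply, one_apply_eq_self, mul_sub, mul_smul_comm,
      mul_one]
  obtain ⟨Xh, x1, x2, ⟨BX, x3⟩, x4, x5⟩ := exists_extremal hU (C := C)
    (N := fun z => lmul (A₀ z - m z • 1)) (R := fun z x => -lmul (A z (-x) - A₀ z))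
    (f := p) (a := fun z => a z - m z)
    (b := fun z => b z - m z) hθ hg
    (differentiable_lmul.comp_differentiableOn hNdiff)
    (fun z hz => (norm_lmul_le _).trans (hND z hz)) h0 h1 h0D h1D
    (fun z hz => by
      simp only [hl]
      ext1 X
      simp only [mul_apply_eq_comp, lmul_apply, zero_apply, ← mul_assoc]
      rw [hcub z hz, zero_mul])
    (fun z hz => (continuous_lmul.comp (((hA z hz).cont.comp continuous_neg).sub
      continuous_const)).neg)
    (fun z hz t => by
      rw [norm_neg]
      have := (hA z hz).bound (-t)
      rw [abs_neg] at this
      exact (norm_lmul_le _).trans this)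
    (fun t => (differentiable_lmul.comp_differentiableOn ((hAd (-t)).sub hA₀)).neg) hP hPD
    hp
  obtain ⟨Y, y1, y2, ⟨BY, y3⟩, y4, y5⟩ := exists_extremal hU (C := C)
    (N := fun z => rmul (A₀ z - m z • 1)) (R := fun z x => -rmul (A z x - A₀ z))
    (f := fun z => p z) (a := fun z => b z - m z)
    (b := fun z => a z - m z) hθ hg
    (differentiable_rmul.comp_differentiableOn hNdiff)
    (fun z hz => (norm_rmul_le _).trans (hND z hz)) h1 h0 h1D h0D
    (fun z hz => by
      simp only [hr]
      ext1 X
      simp only [mul_apply_eq_comp, rmul_apply, zero_apply]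
      rw [mul_assoc, mul_assoc, ((commute_sub_smul_one' (A₀ z) (b z) (m z)).eq), ← mul_assoc,
        ← mul_assoc, mul_assoc X, mul_assoc X,
        (commute_sub_smul_one' (A₀ z) (a z) (m z)).eq, hcub z hz, mul_zero])
    (fun z hz => (continuous_rmul.comp ((hA z hz).cont.sub continuous_const)).neg)
    (fun z hz t => by
      rw [norm_neg]
      exact (norm_rmul_le _).trans ((hA z hz).bound t))
    (fun t => (differentiable_rmul.comp_differentiableOn ((hAd t).sub hA₀)).neg) hP hPD
    hp'
  have ex : ∀ z x (w : 𝔸), -(lmul (A₀ z - m z • 1) w) + (-lmul (A z x - A₀ z)) w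
      = -((A z x - m z • 1) * w) := fun z x w => by
    simp only [neg_apply, lmul_apply, sub_mul]; abel
  have ey : ∀ z x (w : 𝔸), -(rmul (A₀ z - m z • 1) w) + (-rmul (A z x - A₀ z)) w
      = -(w * (A z x - m z • 1)) := fun z x w => by
    simp only [neg_apply, rmul_apply, mul_sub]; abel
  simp only [ex] at x1 x5
  simp only [ey] at y1 y5
  refine ⟨fun z x => Xh z (-x), Y, fun z hz => ⟨fun x => ?_, (x4 z hz).comp tendsto_neg_atTop_atBot,
    y1 z hz, y4 z hz, fun w hw hw0 x => ?_, y5 z hz⟩, fun x => x2 (-x), y2, max BX BY,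
    fun z hz => ⟨fun x hx => (x3 z hz (-x) (by linarith)).trans (le_max_left _ _),
      fun x hx => (y3 z hz x hx).trans (le_max_right _ _)⟩⟩
  · have := (x1 z hz (-x)).scomp x (hasDerivAt_neg x)
    simpa [Function.comp_def] using this
  · have := x5 z hz (fun x => w (-x)) (fun t => by
      simpa [Function.comp_def] using (hw (-t)).scomp t (hasDerivAt_neg t)) (hw0.comp tendsto_neg_atBot_atTop) (-x)
    simpa using this

theorem flow_add_of_commute {M N : 𝔸 →L[ℂ] 𝔸} (h : Commute M N) (s : ℝ) :
    flow (M + N) s = flow M s * flow N s := by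
  let +nondep : NormedAlgebra ℚ (𝔸 →L[ℂ] 𝔸) := .restrictScalars ℚ ℂ _
  unfold flow
  have h' : Commute (s • M) (s • N) := by
    refine ContinuousLinearMap.ext fun x => ?_
    have := DFunLike.congr_fun h x
    simp only [mul_apply_eq_comp, smul_apply, ContinuousLinearMap.map_smul_of_tower] at this ⊢
    rw [this]
  rw [smul_add, NormedSpace.exp_add_of_commute h']

theorem norm_flow_sub_le {a a' : 𝔸} {μ₀ μ₁ m : ℂ}
    (hcub : (a - μ₀ • 1) * (a - μ₁ • 1) * (a - m • 1) = 0)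
    (ha' : (a' - μ₀ • 1) * (a' - μ₁ • 1) = 0) (hm : m.re ≤ μ₀.re) (hre : μ₀.re = μ₁.re) {ε : ℝ}
    (hε : 0 < ε) : ∃ K, ∀ s, 0 ≤ s → ‖flow (lmul a - rmul a') s‖ ≤ K * Real.exp (2 * ε * s) := by
  set D := max (‖lmul a‖ + ‖μ₀‖ + ‖μ₁‖ + ‖m‖) (‖rmul a'‖ + ‖μ₀‖ + ‖μ₁‖) with hD
  set G := (1 + D / ε + D ^ 2 / ε ^ 2) * ‖(1 : 𝔸 →L[ℂ] 𝔸)‖ with hG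
  have hl : ∀ c : ℂ, lmul a - c • 1 = lmul (a - c • 1) := fun c => by
    ext1 X; simp [sub_mul]
  have hr : ∀ c : ℂ, -rmul a' - (-c) • 1 = -rmul (a' - c • 1) := fun c => by
    ext1 X; simp [mul_sub]; abel
  have h1 : ∀ s, 0 ≤ s → ‖flow (lmul a) s‖ ≤ G * Real.exp ((μ₀.re + ε) * s) := by
    intro s hs
    have := norm_flow_mul_le_of_cubic (𝓐 := lmul a) (Pr := 1) (d₀ := μ₀) (d₁ := μ₁) (d₂ := m)
      (κ := μ₀.re + ε) (g := ε) (D := D) hε (by linarith) (by linarith) (by linarith)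
      (le_trans (by linarith [norm_nonneg m, norm_nonneg μ₀]) (le_max_left _ _))
      (le_trans (by linarith [norm_nonneg μ₁, norm_nonneg μ₀]) (le_max_left _ _)) (by
        rw [hl, hl, hl]
        ext1 X
        simp only [mul_apply_eq_comp, lmul_apply, ← mul_assoc, hcub]
        simp) hs
    simpa using this
  have h2 : ∀ s, 0 ≤ s → ‖flow (-rmul a') s‖ ≤ G * Real.exp ((-μ₀.re + ε) * s) := by
    intro s hs
    have := norm_flow_mul_le_of_cubic (𝓐 := -rmul a') (Pr := 1) (d₀ := -μ₀) (d₁ := -μ₁)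
      (d₂ := -μ₀) (κ := -μ₀.re + ε) (g := ε) (D := D) hε (by simp; linarith) (by simp; linarith)
      (by simp)
      (le_trans (by rw [norm_neg, norm_neg]; linarith [norm_nonneg μ₀]) (le_max_right _ _))
      (le_trans (by rw [norm_neg, norm_neg]; linarith [norm_nonneg μ₁]) (le_max_right _ _)) (by
        rw [hr, hr]
        ext1 X
        simp only [mul_apply_eq_comp, neg_apply, rmul_apply, mul_one, neg_mul, mul_neg, neg_neg]
        rw [mul_assoc, mul_assoc, ← mul_assoc (a' - μ₀ • 1), ha']
        simp) hs
    simpa using this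
  refine ⟨G * G, fun s hs => ?_⟩
  have hcomm : Commute (lmul a) (-rmul a') := by
    refine ContinuousLinearMap.ext fun X => ?_
    simp [mul_assoc]
  rw [sub_eq_add_neg, flow_add_of_commute hcomm]
  refine (norm_mul_le _ _).trans ((mul_le_mul (h1 s hs) (h2 s hs) (norm_nonneg _)
    ((norm_nonneg _).trans (h1 s hs))).trans (le_of_eq ?_))
  rw [mul_mul_mul_comm, ← Real.exp_add]
  ring_nf

theorem norm_flow_sub_apply_le {a a' v : 𝔸} {c d₀ d₁ d₂ : ℂ} {g D : ℝ} (hg : 0 < g)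
    (hv' : v * a' = c • v) (hv : (a - (c + d₀) • 1) * (a - (c + d₁) • 1) * (a - (c + d₂) • 1) * v = 0)
    (h0 : d₀.re ≤ 0) (h1 : d₁.re ≤ -g) (h2 : d₂.re ≤ -g)
    (hD1 : ‖lmul a - rmul a'‖ + ‖d₁‖ ≤ D) (hD2 : ‖lmul a - rmul a'‖ + ‖d₂‖ ≤ D) {s : ℝ}
    (hs : 0 ≤ s) :
    ‖flow (lmul a - rmul a') s v‖ ≤ (1 + D / g + D ^ 2 / g ^ 2) * ‖v‖ := by
  have key : ∀ (b : 𝔸) (d : ℂ), Commute b a → (lmul a - rmul a' - d • 1) (b * v)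
      = (a - (c + d) • 1) * b * v := by
    intro b d hb
    simp only [sub_apply, smul_apply, lmul_apply, rmul_apply, one_apply_eq_self, mul_assoc, hv']
    rw [sub_mul, add_smul, add_mul, mul_smul_comm]
    simp only [smul_mul_assoc, one_mul]
    abel
  have hc : ∀ x y : ℂ, Commute ((a - x • 1) * (a - y • 1)) a := fun x y => by
    have := (commute_sub_smul_one' a x 0).mul_left (commute_sub_smul_one' a y 0)
    simpa using this
  have hc1 : ∀ x : ℂ, Commute (a - x • 1) a := fun x => by
    simpa using commute_sub_smul_one' a x 0
  have := norm_flow_apply_le_of_cubic (𝓐 := lmul a - rmul a') (v := v) (κ := 0) hg h0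
    (by linarith) (by linarith) hD1 hD2 (by
      rw [mul_apply_eq_comp, mul_apply_eq_comp]
      have e := key 1 d₂ (Commute.one_left a)
      rw [one_mul, mul_one] at e
      rw [e, key _ d₁ (hc1 _), key _ d₀ (hc _ _), ← mul_assoc (a - _), hv]) hs
  simpa using this

/-- The dichotomy of `X ↦ a X - X a'` where `a'` arises from `a` by replacing the eigenvalue `m`
with `μ₀`. -/
theorem exists_dichotomy {a p : 𝔸} {μ₀ μ₁ m : ℂ} (h0 : m.re < μ₀.re) (h1 : μ₀.re ≤ μ₁.re)
    (hp : (a - m • 1) * p = 0) (hp' : p * (a - m • 1) = 0)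
    (hq : (a - μ₀ • 1) * (a - μ₁ • 1) = ((m - μ₀) * (m - μ₁)) • p) {θ : ℝ} (hθ : 0 < θ) :
    ∃ (Pr : 𝔸 →L[ℂ] 𝔸) (K ε κ : ℝ), ε < θ ∧ 0 < κ ∧ κ < θ ∧
      (∀ s, 0 ≤ s → ‖flow (lmul a - rmul (a + (μ₀ - m) • p)) s * Pr‖ ≤ K * Real.exp (ε * s)) ∧
      ∀ s, s ≤ 0 → ‖flow (lmul a - rmul (a + (μ₀ - m) • p)) s * (1 - Pr)‖ ≤ K * Real.exp (κ * s) := by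
  have hap : a * p = m • p := by simpa [sub_mul, sub_eq_zero] using hp
  have hpa : p * a = m • p := by simpa [mul_sub, sub_eq_zero] using hp'
  have hcub : (a - μ₀ • 1) * (a - μ₁ • 1) * (a - m • 1) = 0 := by
    rw [hq, smul_mul_assoc, hp', smul_zero]
  have hq' : a * a = ((m - μ₀) * (m - μ₁)) • p + (μ₀ + μ₁) • a - (μ₀ * μ₁) • 1 := by
    rw [← hq]
    simp only [mul_sub, sub_mul, mul_smul_comm, smul_mul_assoc, mul_one, one_mul]
    module
  set a' := a + (μ₀ - m) • p with ha'
  have hd : p * p = p := by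
    have e1 : ∀ c : ℂ, (a - c • 1) * p = (m - c) • p := fun c => by
      rw [sub_mul, hap, smul_mul_assoc, one_mul, sub_smul]
    have := congrArg (· * p) hq
    simp only [mul_assoc, e1, mul_smul_comm, smul_mul_assoc, smul_smul] at this
    have hne : (m - μ₁) * (m - μ₀) ≠ 0 := mul_ne_zero
      (sub_ne_zero.2 fun h => by rw [h] at h0; linarith)
      (sub_ne_zero.2 fun h => by rw [h] at h0; linarith)
    rw [mul_comm (m - μ₀)] at this
    exact (smul_right_injective 𝔸 hne this).symm
  rcases h1.eq_or_lt with he | hlt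
  · have h2 : (a' - μ₀ • 1) * (a' - μ₁ • 1) = 0 := by
      simp only [ha', mul_sub, sub_mul, mul_add, add_mul, mul_smul_comm, smul_mul_assoc, mul_one,
        one_mul, hap, hpa, hq', hd, smul_smul]
      module
    obtain ⟨K, hK⟩ := norm_flow_sub_le hcub h2 h0.le he (ε := θ / 4) (by linarith)
    refine ⟨1, K, 2 * (θ / 4), θ / 2, by linarith, by linarith, by linarith, fun s hs => by
      simpa using hK s hs, fun s _ => ?_⟩
    have := (norm_nonneg _).trans (hK 0 le_rfl)
    simp only [mul_zero, Real.exp_zero, mul_one] at this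
    simpa using mul_nonneg this (Real.exp_pos _).le
  have hne0 : μ₁ - m ≠ 0 := sub_ne_zero.2 fun h => by rw [h] at hlt; linarith
  have hne1 : μ₁ - μ₀ ≠ 0 := sub_ne_zero.2 fun h => by rw [h] at hlt; linarith
  obtain ⟨p₁, hp₁⟩ : ∃ p₁ : 𝔸, p₁ = (μ₁ - μ₀)⁻¹ • (a - μ₀ • 1 + (μ₀ - m) • p) := ⟨_, rfl⟩
  have hA : a' = μ₀ • 1 + (μ₁ - μ₀) • p₁ := by
    rw [hp₁, smul_smul, mul_inv_cancel₀ hne1, one_smul, ha']; abel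
  have hp₁' : (a - μ₀ • 1) * (a - m • 1) = ((μ₁ - μ₀) * (μ₁ - m)) • p₁ := by
    rw [hp₁, smul_smul, mul_right_comm, mul_inv_cancel₀ hne1, one_mul]
    simp only [mul_sub, sub_mul, mul_smul_comm, smul_mul_assoc, mul_one, one_mul, hq']
    module
  have hap₁ : a * p₁ = μ₁ • p₁ := by
    have e : (a - μ₁ • 1) * ((a - μ₀ • 1) * (a - m • 1)) = 0 := by
      rw [← mul_assoc, (commute_sub_smul_one' a μ₁ μ₀).eq, hcub]
    rw [hp₁', mul_smul_comm] at e
    have := (smul_eq_zero.1 e).resolve_left (mul_ne_zero hne1 hne0)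
    simpa [sub_mul, sub_eq_zero] using this
  have hpp₁ : p * p₁ = 0 := by
    rw [hp₁, mul_smul_comm, mul_add, mul_sub, hpa, mul_smul_comm, mul_smul_comm, hd, mul_one]
    module
  have hd₁ : p₁ * p₁ = p₁ := by
    conv_lhs => arg 1; rw [hp₁]
    rw [smul_mul_assoc, add_mul, sub_mul, hap₁, smul_mul_assoc, smul_mul_assoc, one_mul, hpp₁,
      smul_zero, add_zero, ← sub_smul, smul_smul, inv_mul_cancel₀ hne1, one_smul]
  have hd₁' : p₁ * (1 - p₁) = 0 := by rw [mul_sub, mul_one, hd₁, sub_self]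
  have hd₁'' : (1 - p₁) * p₁ = 0 := by rw [sub_mul, one_mul, hd₁, sub_self]
  have r1 : ∀ X : 𝔸, (X * p₁) * a' = μ₁ • (X * p₁) := fun X => by
    rw [hA, mul_add, mul_smul_comm, mul_one, mul_smul_comm, mul_assoc X, hd₁]; module
  have r0 : ∀ X : 𝔸, (X * (1 - p₁)) * a' = μ₀ • (X * (1 - p₁)) := fun X => by
    rw [hA, mul_add, mul_smul_comm, mul_one, mul_smul_comm, mul_assoc X, hd₁'']; simp
  set g := min (μ₁.re - μ₀.re) (min (μ₀.re - m.re) (μ₁.re - m.re)) with hg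
  have hg0 : 0 < g := lt_min (by linarith) (lt_min (by linarith) (by linarith))
  have g1 : g ≤ μ₁.re - μ₀.re := min_le_left _ _
  have g2 : g ≤ μ₀.re - m.re := (min_le_right _ _).trans (min_le_left _ _)
  have g3 : g ≤ μ₁.re - m.re := (min_le_right _ _).trans (min_le_right _ _)
  set N := lmul a - rmul a' with hN
  set D := ‖N‖ + ‖m - μ₀‖ + ‖μ₀ - μ₁‖ + ‖m - μ₁‖ with hD
  set G := 1 + D / g + D ^ 2 / g ^ 2 with hG
  have n0 := norm_nonneg N
  have n1 := norm_nonneg (m - μ₀)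
  have n2 := norm_nonneg (μ₀ - μ₁)
  have n3 := norm_nonneg (m - μ₁)
  have hG0 : 0 ≤ G := by positivity
  have f0 : ∀ X : 𝔸, ∀ s, 0 ≤ s → ‖flow N s ((1 - p₁) * X * (1 - p₁))‖
      ≤ G * ‖(1 - p₁) * X * (1 - p₁)‖ := fun X s hs =>
    norm_flow_sub_apply_le (c := μ₀) (d₀ := 0) (d₁ := m - μ₀) (d₂ := m - μ₀) hg0 (r0 _) (by
      have e : (a - (μ₀ + 0) • 1) * (a - (μ₀ + (m - μ₀)) • 1) * (a - (μ₀ + (m - μ₀)) • 1)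
          = (a - m • 1) * ((a - μ₀ • 1) * (a - m • 1)) := by
        rw [add_zero, add_sub_cancel, (commute_sub_smul_one' a μ₀ m).eq, mul_assoc,
          ← (commute_sub_smul_one' a μ₀ m).eq]
      rw [e, hp₁', mul_smul_comm, smul_mul_assoc, mul_assoc (1 - p₁), mul_assoc, ← mul_assoc p₁,
        hd₁', zero_mul, mul_zero, smul_zero]) (by simp) (by simp; linarith) (by simp; linarith)
      (by linarith) (by linarith) hs
  have f1 : ∀ X : 𝔸, ∀ s, 0 ≤ s → ‖flow N s (X * p₁)‖ ≤ G * ‖X * p₁‖ := fun X s hs =>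
    norm_flow_sub_apply_le (c := μ₁) (d₀ := 0) (d₁ := μ₀ - μ₁) (d₂ := m - μ₁) hg0 (r1 _) (by
      rw [add_zero, add_sub_cancel, add_sub_cancel, (commute_sub_smul_one' a μ₁ μ₀).eq, hcub,
        zero_mul]) (by simp) (by simp; linarith) (by simp; linarith)
      (by linarith) (by linarith) hs
  have f2 : ∀ X : 𝔸, ∀ s, s ≤ 0 → ‖flow N s (p₁ * X * (1 - p₁))‖
      ≤ ‖p₁ * X * (1 - p₁)‖ * Real.exp (g * s) := by
    intro X s hs
    have e : N (p₁ * X * (1 - p₁)) = (μ₁ - μ₀) • (p₁ * X * (1 - p₁)) := by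
      rw [hN, sub_apply, lmul_apply, rmul_apply, r0, ← mul_assoc, ← mul_assoc, hap₁]
      simp only [smul_mul_assoc]
      module
    have h := norm_le_of_hasDerivAt_smul (y := fun t => flow N (-t) (p₁ * X * (1 - p₁)))
      (d := -(μ₁ - μ₀)) (κ := -g) (by simp; linarith) (fun t => by
        have h1 : HasDerivAt (fun t => flow N t (p₁ * X * (1 - p₁)))
            ((μ₁ - μ₀) • flow N (-t) (p₁ * X * (1 - p₁))) (-t) := by
          have := hasDerivAt_complex_clm_apply (hasDerivAt_exp_smul_const (𝕂 := ℝ) N (-t))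
            (hasDerivAt_const (-t) (p₁ * X * (1 - p₁)))
          rw [map_zero, add_zero, mul_apply_eq_comp, e, map_smul] at this
          exact this
        convert! h1.scomp t (hasDerivAt_neg t) using 1
        rw [neg_smul, neg_smul, one_smul]) (t := -s) (by linarith)
    simpa using h
  refine ⟨1 - lmul p₁ * rmul (1 - p₁), max (G * (‖1 - p₁‖ * ‖1 - p₁‖ + ‖p₁‖)) (‖p₁‖ * ‖1 - p₁‖), 0,
    min (θ / 2) g, hθ, lt_min (by linarith) hg0, (min_le_left _ _).trans_lt (by linarith),
    fun s hs => ?_, fun s hs => ?_⟩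
  · rw [zero_mul, Real.exp_zero, mul_one]
    refine le_trans (ContinuousLinearMap.opNorm_le_bound _ (by positivity) fun X => ?_)
      (le_max_left _ _)
    have e : (1 - lmul p₁ * rmul (1 - p₁)) X = (1 - p₁) * X * (1 - p₁) + X * p₁ := by
      simp only [sub_apply, one_apply_eq_self, mul_apply_eq_comp, lmul_apply, rmul_apply, mul_sub,
        sub_mul, mul_one, one_mul, mul_assoc]
      abel
    rw [mul_apply_eq_comp, e, map_add]
    refine (norm_add_le _ _).trans ((add_le_add (f0 X s hs) (f1 X s hs)).trans ?_)
    rw [← mul_add, mul_assoc G]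
    refine mul_le_mul_of_nonneg_left ?_ hG0
    have a1 : ‖(1 - p₁) * X * (1 - p₁)‖ ≤ ‖1 - p₁‖ * ‖X‖ * ‖1 - p₁‖ :=
      (norm_mul_le _ _).trans (mul_le_mul_of_nonneg_right (norm_mul_le _ _) (norm_nonneg _))
    have a2 := norm_mul_le X p₁
    calc _ ≤ ‖1 - p₁‖ * ‖X‖ * ‖1 - p₁‖ + ‖X‖ * ‖p₁‖ := add_le_add a1 a2
      _ = _ := by ring
  · refine le_trans (ContinuousLinearMap.opNorm_le_bound _
      (M := ‖p₁‖ * ‖1 - p₁‖ * Real.exp (g * s)) (by positivity) fun X => ?_)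
      (mul_le_mul (le_max_right _ _) (Real.exp_le_exp.2 (mul_le_mul_of_nonpos_right
        (min_le_right _ _) hs)) (Real.exp_pos _).le (le_trans (by positivity) (le_max_right _ _)))
    rw [sub_sub_cancel, mul_apply_eq_comp, mul_apply_eq_comp, lmul_apply, rmul_apply, ← mul_assoc]
    refine (f2 X s hs).trans ?_
    have a1 : ‖p₁ * X * (1 - p₁)‖ ≤ ‖p₁‖ * ‖X‖ * ‖1 - p₁‖ :=
      (norm_mul_le _ _).trans (mul_le_mul_of_nonneg_right (norm_mul_le _ _) (norm_nonneg _))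
    calc _ ≤ ‖p₁‖ * ‖X‖ * ‖1 - p₁‖ * Real.exp (g * s) :=
          mul_le_mul_of_nonneg_right a1 (Real.exp_pos _).le
      _ = _ := by ring

theorem exists_slow_solution {A : ℝ → 𝔸} {a p : 𝔸} {C θ : ℝ} (hθ : 0 < θ) (hA : AsymConst A a C θ)
    {μ₀ μ₁ m : ℂ} (h0 : m.re < μ₀.re) (h1 : μ₀.re ≤ μ₁.re)
    (hp : (a - m • 1) * p = 0) (hp' : p * (a - m • 1) = 0) (hd : p * p = p)
    (hq : (a - μ₀ • 1) * (a - μ₁ • 1) = ((m - μ₀) * (m - μ₁)) • p) :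
    ∃ X : ℝ → 𝔸, (∀ x, HasDerivAt X (A x * X x - X x * (a + (μ₀ - m) • p)) x) ∧
      Tendsto X atBot (𝓝 (1 - p)) := by
  obtain ⟨Pr, K, ε, κ, e1, e2, e3, e4, e5⟩ := exists_dichotomy h0 h1 hp hp' hq hθ
  obtain ⟨X, x1, -, -, x4⟩ := exists_solution_tendsto_atBot (U := univ) (Pr := Pr) (K := K) (C := C)
    (ε := ε) (κ := κ) (θ := θ) (d := ‖lmul a - rmul (a + (μ₀ - m) • p)‖) (F := ‖1 - p‖)
    (𝓐 := fun _ => lmul a - rmul (a + (μ₀ - m) • p)) (R := fun _ x => lmul (A x - a))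
    (f := fun _ => 1 - p) isOpen_univ (fun z _ => ⟨continuous_lmul.comp (hA.cont.sub continuous_const),
      fun t => (norm_lmul_le _).trans (hA.bound t), le_rfl, e4, e5⟩) e1 e2 e3
    (differentiableOn_const _) (fun _ => differentiableOn_const _) (differentiableOn_const _)
    (fun _ _ => le_rfl) (fun _ _ => by
      have hap : a * p = m • p := by simpa [sub_mul, sub_eq_zero] using hp
      have hpa : p * a = m • p := by simpa [mul_sub, sub_eq_zero] using hp'
      simp only [sub_apply, lmul_apply, rmul_apply, mul_sub, sub_mul, mul_add, mul_one, one_mul,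
        hap, hpa, mul_smul_comm, hd]
      module)
  refine ⟨X 0, fun x => ?_, x4 0 trivial⟩
  have := x1 0 trivial x
  convert! this using 1
  simp only [sub_apply, lmul_apply, rmul_apply, sub_mul]
  abel

end Fast

section EvansValue
open scoped Matrix.Norms.Operator

/-- Complex `3 × 3` matrices. -/
abbrev Mat3 := Matrix (Fin 3) (Fin 3) ℂ

theorem hasDerivAt_matrix_iff {M : ℝ → Mat3} {M' : Mat3} {x : ℝ} :
    HasDerivAt M M' x ↔ ∀ i j, HasDerivAt (fun x => M x i j) (M' i j) x :=
  ⟨fun h i j => hasDerivAt_pi.1 (hasDerivAt_pi.1 h i) j,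
    fun h => hasDerivAt_pi.2 fun i => hasDerivAt_pi.2 fun j => h i j⟩

theorem hasDerivAt_mulVec {M : ℝ → Mat3} {M' : Mat3} {v : ℝ → Fin 3 → ℂ} {v' : Fin 3 → ℂ} {x : ℝ}
    (hM : HasDerivAt M M' x) (hv : HasDerivAt v v' x) :
    HasDerivAt (fun x => (M x).mulVec (v x)) (M'.mulVec (v x) + (M x).mulVec v') x := by
  refine hasDerivAt_pi.2 fun i => ?_
  have := HasDerivAt.fun_sum (u := Finset.univ) fun j _ =>
    (hasDerivAt_matrix_iff.1 hM i j).mul (hasDerivAt_pi.1 hv j)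
  simpa [Matrix.mulVec, dotProduct, Finset.sum_add_distrib] using this

theorem hasDerivAt_vecMul {M : ℝ → Mat3} {M' : Mat3} {v : ℝ → Fin 3 → ℂ} {v' : Fin 3 → ℂ} {x : ℝ}
    (hv : HasDerivAt v v' x) (hM : HasDerivAt M M' x) :
    HasDerivAt (fun x => (M x).vecMul (v x)) (Matrix.vecMul v' (M x) + Matrix.vecMul (v x) M') x := by
  refine hasDerivAt_pi.2 fun i => ?_
  have := HasDerivAt.fun_sum (u := Finset.univ) fun j _ =>
    (hasDerivAt_pi.1 hv j).mul (hasDerivAt_matrix_iff.1 hM j i)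
  simpa [Matrix.vecMul, dotProduct, Finset.sum_add_distrib] using this

theorem hasDerivAt_exp_ofReal_smul (M : Mat3) (x : ℝ) :
    HasDerivAt (fun x : ℝ => NormedSpace.exp ((x : ℂ) • M)) (M * NormedSpace.exp ((x : ℂ) • M)) x := by
  have h := hasDerivAt_exp_smul_const' (𝕂 := ℂ) M (x : ℂ)
  convert! h.scomp x Complex.ofRealCLM.hasDerivAt using 1
  exact (one_smul ℂ _).symm

theorem hasDerivAt_exp_ofReal_smul' (M : Mat3) (x : ℝ) :
    HasDerivAt (fun x : ℝ => NormedSpace.exp ((x : ℂ) • M)) (NormedSpace.exp ((x : ℂ) • M) * M) x := by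
  have h := hasDerivAt_exp_smul_const (𝕂 := ℂ) M (x : ℂ)
  convert! h.scomp x Complex.ofRealCLM.hasDerivAt using 1
  exact (one_smul ℂ _).symm

theorem hasDerivAt_cexp_mul (m : ℂ) (x : ℝ) :
    HasDerivAt (fun x : ℝ => Complex.exp (m * x)) (m * Complex.exp (m * x)) x := by
  have := ((Complex.ofRealCLM.hasDerivAt (x := x)).const_mul m).cexp
  simpa [mul_comm] using this

theorem eq_of_forall_hasDerivAt_zero {E : Type*} [NormedAddCommGroup E] [NormedSpace ℝ E]
    {f : ℝ → E} (h : ∀ x, HasDerivAt f 0 x) (x y : ℝ) : f x = f y :=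
  is_const_of_deriv_eq_zero (fun x => (h x).differentiableAt) (fun x => (h x).deriv) x y

theorem exp_mulVec_eigenvector {M : Mat3} {m : ℂ} {v : Fin 3 → ℂ} (h : M.mulVec v = m • v) (x : ℝ) :
    (NormedSpace.exp ((x : ℂ) • M)).mulVec v = Complex.exp (m * x) • v := by
  have h1 := eq_of_forall_hasDerivAt_zero
    (f := fun x : ℝ => Complex.exp (-m * x) • (NormedSpace.exp ((x : ℂ) • M)).mulVec v) (fun x => by
      have := (hasDerivAt_cexp_mul (-m) x).smul
        (hasDerivAt_mulVec (hasDerivAt_exp_ofReal_smul' M x) (hasDerivAt_const x v))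
      convert! this using 1
      rw [Matrix.mulVec_zero, ← Matrix.mulVec_mulVec, h, Matrix.mulVec_smul]
      module) x 0
  simp only [Complex.ofReal_zero, mul_zero, Complex.exp_zero, zero_smul, NormedSpace.exp_zero,
    Matrix.one_mulVec, one_smul] at h1
  rw [← congrArg (Complex.exp (m * x) • ·) h1]
  simp only [smul_smul, ← Complex.exp_add]
  simp

theorem vecMul_exp_eigenvector {M : Mat3} {m : ℂ} {v : Fin 3 → ℂ} (h : Matrix.vecMul v M = m • v)
    (x : ℝ) : Matrix.vecMul v (NormedSpace.exp ((x : ℂ) • M)) = Complex.exp (m * x) • v := by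
  have h1 := eq_of_forall_hasDerivAt_zero
    (f := fun x : ℝ => Complex.exp (-m * x) • Matrix.vecMul v (NormedSpace.exp ((x : ℂ) • M)))
    (fun x => by
      have := (hasDerivAt_cexp_mul (-m) x).smul
        (hasDerivAt_vecMul (hasDerivAt_const x v) (hasDerivAt_exp_ofReal_smul M x))
      convert! this using 1
      rw [Matrix.zero_vecMul, ← Matrix.vecMul_vecMul, h, Matrix.smul_vecMul]
      module) x 0
  simp only [Complex.ofReal_zero, mul_zero, Complex.exp_zero, zero_smul, NormedSpace.exp_zero,
    Matrix.vecMul_one, one_smul] at h1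
  rw [← congrArg (Complex.exp (m * x) • ·) h1]
  simp only [smul_smul, ← Complex.exp_add]
  simp

variable {A : ℝ → Mat3} {A₀ : Mat3} {μ : Fin 3 → ℂ} {X Y : ℝ → Mat3}

theorem FastPair.unique_col {m : ℂ} {p : Mat3} (h : FastPair A m p X Y) {w : ℝ → Fin 3 → ℂ}
    (hw : ∀ x, HasDerivAt w ((A x - m • 1).mulVec (w x)) x) (h0 : Tendsto w atTop (𝓝 0)) (x : ℝ) :
    w x = 0 := by
  let L : (Fin 3 → ℂ) →ₗ[ℝ] Mat3 :=
    { toFun := fun v => Matrix.vecMulVec v 1, map_add' := fun a b => Matrix.add_vecMulVec a b 1,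
      map_smul' := fun c a => by ext; simp [Matrix.vecMulVec] }
  have h1 := h.uniqueX (fun x => L.toContinuousLinearMap (w x)) (fun x => by
    convert! L.toContinuousLinearMap.hasFDerivAt.comp_hasDerivAt x (hw x) using 1
    exact Matrix.mul_vecMulVec _ _ _) (by
    have := (L.toContinuousLinearMap.continuous.tendsto 0).comp h0
    rwa [map_zero] at this) x
  ext i
  have := congrFun (congrFun h1 i) 0
  simpa [L, Matrix.vecMulVec] using this

theorem FastPair.unique_row {m : ℂ} {p : Mat3} (h : FastPair A m p X Y) {w : ℝ → Fin 3 → ℂ}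
    (hw : ∀ x, HasDerivAt w (-Matrix.vecMul (w x) (A x - m • 1)) x) (h0 : Tendsto w atBot (𝓝 0))
    (x : ℝ) : w x = 0 := by
  let L : (Fin 3 → ℂ) →ₗ[ℝ] Mat3 :=
    { toFun := fun v => Matrix.vecMulVec 1 v, map_add' := fun a b => Matrix.vecMulVec_add 1 a b,
      map_smul' := fun c a => by ext; simp [Matrix.vecMulVec] }
  have h1 := h.uniqueY (fun x => L.toContinuousLinearMap (w x)) (fun x => by
    convert! L.toContinuousLinearMap.hasFDerivAt.comp_hasDerivAt x (hw x) using 1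
    exact ((Matrix.vecMulVec_neg _ _).trans
      (congrArg Neg.neg (Matrix.vecMulVec_mul _ _ _).symm)).symm) (by
    have := (L.toContinuousLinearMap.continuous.tendsto 0).comp h0
    rwa [map_zero] at this) x
  ext i
  have := congrFun (congrFun h1 0) i
  simpa [L, Matrix.vecMulVec] using this

theorem gapProj_mulVec_eq_zero {v : Fin 3 → ℂ}
    (hv : ((A₀ - Matrix.scalar (Fin 3) (μ 0)) * (A₀ - Matrix.scalar (Fin 3) (μ 1))).mulVec v = 0) :
    (gapProj A₀ μ).mulVec v = 0 := by
  have e : ∀ c : ℂ, Matrix.scalar (Fin 3) c = c • (1 : Mat3) := fun c => by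
    rw [Matrix.smul_one_eq_diagonal]; rfl
  rw [e, e] at hv
  rw [gapProj, Matrix.smul_mulVec, hv, smul_zero]

theorem IsGapSpectrum.gapProj_mulVec_eq_self (h : IsGapSpectrum A₀ μ) {v : Fin 3 → ℂ}
    (hv : A₀.mulVec v = μ 2 • v) : (gapProj A₀ μ).mulVec v = v := by
  have e : ∀ c : ℂ, (A₀ - c • 1).mulVec v = (μ 2 - c) • v := fun c => by
    rw [Matrix.sub_mulVec, hv, Matrix.smul_mulVec, Matrix.one_mulVec, sub_smul]
  rw [gapProj, Matrix.smul_mulVec, ← Matrix.mulVec_mulVec, e, Matrix.mulVec_smul, e, smul_smul,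
    smul_smul, mul_assoc, mul_comm (μ 2 - μ 1), inv_mul_cancel₀ h.den_ne_zero, one_smul]

theorem FastPair.mul_right_eq {m : ℂ} {p : Mat3} (h : FastPair A m p X Y) (hp : p * p = p) (x : ℝ) :
    X x * p = X x := by
  have := h.uniqueX (fun x => X x * p - X x) (fun x => by
    convert! ((h.derivX x).mul_const p).sub (h.derivX x) using 1
    rw [mul_sub, mul_assoc]) (by
    simpa [hp] using (h.limX.mul_const p).sub h.limX) x
  exact sub_eq_zero.1 this

theorem FastPair.mul_left_eq {m : ℂ} {p : Mat3} (h : FastPair A m p X Y) (hp : p * p = p) (x : ℝ) :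
    p * Y x = Y x := by
  have := h.uniqueY (fun x => p * Y x - Y x) (fun x => by
    convert! ((h.derivY x).const_mul p).sub (h.derivY x) using 1
    rw [sub_mul, mul_neg, mul_assoc]; abel) (by
    simpa [hp] using (h.limY.const_mul p).sub h.limY) x
  exact sub_eq_zero.1 this

theorem IsGapSpectrum.crossRow_vecMul (h : IsGapSpectrum A₀ μ) {V : Fin 3 → Fin 3 → ℂ}
    (hV : LinearIndependent ℂ V) (h0 : ∀ j, j ≠ 2 → (gapProj A₀ μ).mulVec (V j) = 0)
    (h2 : (gapProj A₀ μ).mulVec (V 2) = V 2) :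
    Matrix.vecMul (crossRow (V 0) (V 1)) (gapProj A₀ μ) = crossRow (V 0) (V 1) ∧
    Matrix.vecMul (crossRow (V 0) (V 1)) A₀ = μ 2 • crossRow (V 0) (V 1) := by
  have hd := isUnit_det_of_linearIndependent hV
  have hP := eq_vecMulVec_of_frame hV h0 h2
  have e1 : Matrix.vecMul (crossRow (V 0) (V 1)) (gapProj A₀ μ) = crossRow (V 0) (V 1) := by
    rw [hP, Matrix.vecMul_vecMulVec, crossRow_dotProduct, smul_smul, mul_inv_cancel₀ hd, one_smul]
  refine ⟨e1, ?_⟩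
  rw [← e1, Matrix.vecMul_vecMul, h.gapProj_mul, Matrix.vecMul_smul]

theorem crossRow_exp {V : Fin 3 → Fin 3 → ℂ} {m : ℂ}
    (h : Matrix.vecMul (crossRow (V 0) (V 1)) A₀ = m • crossRow (V 0) (V 1)) (x : ℝ) :
    crossRow ((NormedSpace.exp ((x : ℂ) • A₀)).mulVec (V 0))
        ((NormedSpace.exp ((x : ℂ) • A₀)).mulVec (V 1))
      = Complex.exp ((A₀.trace - m) * x) • crossRow (V 0) (V 1) := by
  set E : ℝ → Mat3 := fun x => NormedSpace.exp ((x : ℂ) • A₀) with hE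
  set g : ℝ → Fin 3 → ℂ := fun x => crossRow ((E x).mulVec (V 0)) ((E x).mulVec (V 1)) with hg
  have hg' : ∀ x, HasDerivAt g (A₀.trace • g x - Matrix.vecMul (g x) A₀) x := fun x => by
    have hj : ∀ j, HasDerivAt (fun x => (E x).mulVec (V j)) (A₀.mulVec ((E x).mulVec (V j))) x :=
      fun j => by
        convert! hasDerivAt_mulVec (hasDerivAt_exp_ofReal_smul A₀ x) (hasDerivAt_const x (V j)) using 1
        rw [Matrix.mulVec_zero, add_zero, Matrix.mulVec_mulVec]
    convert! hasDerivAt_crossRow (hj 0) (hj 1) using 1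
    rw [crossRow_mulVec_add]
  have h1 := eq_of_forall_hasDerivAt_zero
    (f := fun x : ℝ => Complex.exp (-A₀.trace * x) • Matrix.vecMul (g x) (E x)) (fun x => by
      have := (hasDerivAt_cexp_mul (-A₀.trace) x).smul
        (hasDerivAt_vecMul (hg' x) (hasDerivAt_exp_ofReal_smul A₀ x))
      convert! this using 1
      rw [Matrix.sub_vecMul, Matrix.vecMul_vecMul, Matrix.smul_vecMul]
      module) x 0
  have h2 := vecMul_exp_eigenvector h x
  have h3 : Matrix.vecMul (g x) (E x)
      = Matrix.vecMul (Complex.exp ((A₀.trace - m) * x) • crossRow (V 0) (V 1)) (E x) := by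
    have e0 : g 0 = crossRow (V 0) (V 1) := by simp [hg, hE]
    have e1 : E 0 = 1 := by simp [hE]
    simp only [Complex.ofReal_zero, mul_zero, Complex.exp_zero, e0, e1, Matrix.vecMul_one,
      one_smul] at h1
    rw [Matrix.smul_vecMul, h2, ← h1]
    simp only [smul_smul, ← Complex.exp_add]
    ring_nf
    simp
  have hu : IsUnit (E x) := Matrix.isUnit_exp _
  obtain ⟨N, hN⟩ := hu.exists_right_inv
  have := congrArg (fun v => Matrix.vecMul v N) h3
  simp only [Matrix.vecMul_vecMul, hN, Matrix.vecMul_one] at this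
  exact this

/-- Any Evans value is given by the normalized fast solutions. -/
theorem IsEvansValue.eq_trace (h : IsGapSpectrum A₀ μ) (hF : FastPair A (μ 2) (gapProj A₀ μ) X Y)
    {k f : ℝ → ℂ} {K δ : ℂ} (hf : ∀ x, (A x).trace - A₀.trace = f x) (hk0 : k 0 = 1)
    (hk : ∀ x, HasDerivAt k (-(f x) * k x) x) (hK : Tendsto k atBot (𝓝 K))
    (hδ : IsEvansValue A A₀ δ) : δ = K * (Y 0 * X 0).trace := by
  obtain ⟨μ', V, W, Θm, Θp, h', hV, hV0, hV2, hW, hΘm, hΘp, hWm, hWp, rfl⟩ := hδ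
  obtain ⟨e2, -, -⟩ := h.unique h'
  have hPP := h.gapProj_unique h'
  have p0 : ∀ j, j ≠ 2 → (gapProj A₀ μ).mulVec (V j) = 0 := fun j hj => by
    rw [← hPP]; exact gapProj_mulVec_eq_zero (hV0 j hj)
  have p2 : (gapProj A₀ μ).mulVec (V 2) = V 2 := by
    rw [← hPP]; exact h'.gapProj_mulVec_eq_self hV2
  rw [e2] at hV2
  have hd := isUnit_det_of_linearIndependent hV
  have hP := eq_vecMulVec_of_frame hV p0 p2
  obtain ⟨r1, r2⟩ := h.crossRow_vecMul hV p0 p2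
  set m := μ 2 with hm
  set P := gapProj A₀ μ with hPdef
  set g := crossRow (V 0) (V 1) with hg
  have hpp : P * P = P := h.gapProj_mul_self
  have w2 : W 2 0 = (X 0).mulVec (V 2) := by
    have := hF.unique_col (w := fun x => Complex.exp (-m * x) • W 2 x - (X x).mulVec (V 2))
      (fun x => by
        convert! ((hasDerivAt_cexp_mul (-m) x).smul (hW 2 x)).sub
          (hasDerivAt_mulVec (hF.derivX x) (hasDerivAt_const x (V 2))) using 1
        rw [Matrix.mulVec_sub, Matrix.mulVec_smul, Matrix.sub_mulVec, Matrix.smul_mulVec,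
          Matrix.one_mulVec, Matrix.mulVec_zero, Matrix.mulVec_mulVec]
        module) (by
        have e : ∀ x : ℝ, Complex.exp (-m * x) • W 2 x = (Θp x).mulVec (V 2) := fun x => by
          rw [hWp, ← Matrix.mulVec_mulVec, exp_mulVec_eigenvector hV2, Matrix.mulVec_smul,
            smul_smul, ← Complex.exp_add]
          simp
        simp only [e]
        have t1 : Tendsto (fun x => (Θp x).mulVec (V 2) - (X x).mulVec (V 2)) atTop
            (𝓝 ((1 : Mat3).mulVec (V 2) - P.mulVec (V 2))) :=
          (((continuous_id.matrix_mulVec continuous_const).tendsto _).comp hΘp).sub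
          (((continuous_id.matrix_mulVec continuous_const).tendsto _).comp hF.limX)
        simpa [p2] using t1) 0
    simpa [sub_eq_zero] using this
  have hrow : crossRow (W 0 0) (W 1 0) = K • Matrix.vecMul g (Y 0) := by
    have := hF.unique_row (w := fun x => (k x * Complex.exp ((m - A₀.trace) * x)) •
      crossRow (W 0 x) (W 1 x) - K • Matrix.vecMul g (Y x)) (fun x => by
        convert! (((hk x).mul (hasDerivAt_cexp_mul (m - A₀.trace) x)).smul
          (hasDerivAt_crossRow (hW 0 x) (hW 1 x))).sub
          ((hasDerivAt_vecMul (hasDerivAt_const x g) (hF.derivY x)).const_smul K) using 1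
        rw [crossRow_mulVec_add, ← hf]
        simp only [Matrix.vecMul_sub, Matrix.sub_vecMul, Matrix.smul_vecMul, Matrix.vecMul_smul,
          Matrix.vecMul_one, Matrix.zero_vecMul, Matrix.vecMul_neg, ← Matrix.vecMul_vecMul,
          Pi.mul_apply]
        module) (by
        have e : ∀ x : ℝ, (k x * Complex.exp ((m - A₀.trace) * x)) • crossRow (W 0 x) (W 1 x)
            = k x • Matrix.vecMul g (Θm x).adjugate := fun x => by
          rw [hWm 0 (by decide), hWm 1 (by decide), ← Matrix.mulVec_mulVec, ← Matrix.mulVec_mulVec,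
            crossRow_mulVec, crossRow_exp r2, Matrix.smul_vecMul, smul_smul, mul_assoc,
            ← Complex.exp_add]
          ring_nf
          simp [hg]
        simp only [e]
        have t1 : Tendsto (fun x => k x • Matrix.vecMul g (Θm x).adjugate - K • Matrix.vecMul g (Y x))
            atBot (𝓝 (K • Matrix.vecMul g (1 : Mat3).adjugate - K • Matrix.vecMul g P)) :=
          (hK.smul (((continuous_const.matrix_vecMul
            (continuous_id.matrix_adjugate)).tendsto _).comp hΘm)).sub
          ((((continuous_const.matrix_vecMul continuous_id).tendsto _).comp hF.limY).const_smul K)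
        simpa [r1] using t1) 0
    simpa [sub_eq_zero, hk0] using this
  have hdet : (Matrix.of fun i j => W j 0 i).det = crossRow (W 0 0) (W 1 0) ⬝ᵥ W 2 0 :=
    (crossRow_dotProduct fun j => W j 0).symm
  have htr : (Y 0 * X 0).trace
      = (Matrix.of fun i j => V j i).det⁻¹ * (Matrix.vecMul g (Y 0) ⬝ᵥ (X 0).mulVec (V 2)) := by
    have e : Y 0 * X 0 = P * (Y 0 * X 0) * P := by
      rw [← mul_assoc, hF.mul_left_eq hpp, mul_assoc, hF.mul_right_eq hpp]
    rw [e, Matrix.trace_mul_comm, ← mul_assoc, hpp]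
    conv_lhs => arg 1; arg 1; rw [hP]
    rw [Matrix.vecMulVec_mul, Matrix.trace_vecMulVec, Matrix.smul_vecMul, dotProduct_comm,
      smul_dotProduct, smul_eq_mul, Matrix.dotProduct_mulVec, Matrix.vecMul_vecMul]
  rw [hdet, hrow, w2, htr, smul_dotProduct, smul_eq_mul, div_eq_inv_mul]
  ring

theorem exists_isEvansValue_of_le {C θ : ℝ} (hθ : 0 < θ) (hA : AsymConst A A₀ C θ)
    (h : IsGapSpectrum A₀ μ) (hF : FastPair A (μ 2) (gapProj A₀ μ) X Y) (hle : (μ 0).re ≤ (μ 1).re) :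
    ∃ δ, IsEvansValue A A₀ δ := by
  have e : ∀ c : ℂ, Matrix.scalar (Fin 3) c = c • (1 : Mat3) := fun c => by
    rw [Matrix.smul_one_eq_diagonal]; rfl
  have hq : (A₀ - μ 0 • 1) * (A₀ - μ 1 • 1) = ((μ 2 - μ 0) * (μ 2 - μ 1)) • gapProj A₀ μ := by
    rw [gapProj, smul_smul, mul_inv_cancel₀ h.den_ne_zero, one_smul]
  obtain ⟨T, hT, hT0⟩ := exists_slow_solution (𝔸 := Mat3) hθ hA h.2.1 hle h.sub_mul_gapProj
    h.gapProj_mul_sub h.gapProj_mul_self hq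
  obtain ⟨V, hV, p0, p2⟩ := exists_frame h.gapProj_mul_self h.trace_gapProj
  have hV2 : A₀.mulVec (V 2) = μ 2 • V 2 := by
    rw [← p2, Matrix.mulVec_mulVec, h.mul_gapProj, Matrix.smul_mulVec]
  set P := gapProj A₀ μ with hP
  set E : ℝ → Mat3 := fun x => NormedSpace.exp ((x : ℂ) • A₀) with hE
  have hPE : ∀ x j, j ≠ 2 → P.mulVec ((E x).mulVec (V j)) = 0 := fun x j hj => by
    have hc : Commute P (E x) := by
      have h1 : Commute P ((x : ℂ) • A₀) := by
        refine Commute.smul_right ?_ _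
        exact h.gapProj_mul.trans h.mul_gapProj.symm
      exact h1.exp_right
    rw [Matrix.mulVec_mulVec, hc.eq, ← Matrix.mulVec_mulVec, p0 j hj, Matrix.mulVec_zero]
  let Wm : Fin 3 → ℝ → Fin 3 → ℂ := fun j x => ((T x + P) * E x).mulVec (V j)
  let Wp : ℝ → Fin 3 → ℂ := fun x => ((X x + (1 - P)) * E x).mulVec (V 2)
  have hWm : ∀ j, j ≠ 2 → ∀ x, HasDerivAt (Wm j) ((A x).mulVec (Wm j x)) x := fun j hj x => by
    have e1 : Wm j = fun x => (T x).mulVec ((E x).mulVec (V j)) := funext fun x => by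
      simp only [Wm]
      rw [← Matrix.mulVec_mulVec, Matrix.add_mulVec, hPE x j hj, add_zero]
    rw [e1]
    convert! hasDerivAt_mulVec (hT x)
      (hasDerivAt_mulVec (hasDerivAt_exp_ofReal_smul A₀ x) (hasDerivAt_const x (V j))) using 1
    rw [Matrix.mulVec_zero, add_zero, Matrix.sub_mulVec, ← Matrix.mulVec_mulVec,
      ← Matrix.mulVec_mulVec, ← Matrix.mulVec_mulVec, Matrix.add_mulVec, Matrix.smul_mulVec,
      hPE x j hj, smul_zero, add_zero, sub_add_cancel]
  have hWp : ∀ x, HasDerivAt Wp ((A x).mulVec (Wp x)) x := fun x => by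
    have e1 : Wp = fun x : ℝ => Complex.exp (μ 2 * x) • (X x).mulVec (V 2) := funext fun x => by
      simp only [Wp, hE]
      rw [← Matrix.mulVec_mulVec, exp_mulVec_eigenvector hV2, Matrix.mulVec_smul, Matrix.add_mulVec,
        Matrix.sub_mulVec, p2, Matrix.one_mulVec, sub_self, add_zero]
    rw [e1]
    convert! (hasDerivAt_cexp_mul (μ 2) x).smul
      (hasDerivAt_mulVec (hF.derivX x) (hasDerivAt_const x (V 2))) using 1
    rw [Matrix.mulVec_zero, ← Matrix.mulVec_mulVec, Matrix.sub_mulVec, Matrix.smul_mulVec,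
      Matrix.one_mulVec, Matrix.mulVec_smul]
    module
  refine ⟨_, μ, V, ![Wm 0, Wm 1, Wp], fun x => T x + P, fun x => X x + (1 - P), h, hV,
    fun j hj => ?_, hV2, ?_, ?_, ?_, ?_, fun _ => rfl, rfl⟩
  · rw [e, e, hq, Matrix.smul_mulVec, p0 j hj, smul_zero]
  · intro j
    fin_cases j
    · exact hWm 0 (by decide)
    · exact hWm 1 (by decide)
    · exact hWp
  · have : Tendsto (fun x => T x + P) atBot (𝓝 (1 - P + P)) := hT0.add_const P
    simpa using this
  · have : Tendsto (fun x => X x + (1 - P)) atTop (𝓝 (P + (1 - P))) := hF.limX.add_const (1 - P)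
    simpa using this
  · intro j hj x
    fin_cases j
    · rfl
    · rfl
    · exact absurd rfl hj

theorem exists_isEvansValue {C θ : ℝ} (hθ : 0 < θ) (hA : AsymConst A A₀ C θ)
    (h : IsGapSpectrum A₀ μ) (hF : FastPair A (μ 2) (gapProj A₀ μ) X Y) :
    ∃ δ, IsEvansValue A A₀ δ := by
  rcases le_total (μ 0).re (μ 1).re with hle | hle
  · exact exists_isEvansValue_of_le hθ hA h hF hle
  · refine exists_isEvansValue_of_le (X := X) (Y := Y) hθ hA h.swap ?_ hle
    rw [h.gapProj_unique h.swap]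
    exact hF

end EvansValue

section Vanishing
open scoped Matrix.Norms.Operator

variable {A : ℝ → Mat3} {A₀ : Mat3} {μ : Fin 3 → ℂ} {C θ : ℝ}

theorem eq_zero_of_linear_ode (hθ : 0 < θ) (hA : AsymConst A A₀ C θ) {W : ℝ → Fin 3 → ℂ}
    (hW : ∀ x, HasDerivAt W ((A x).mulVec (W x)) x) {x₀ : ℝ} (h0 : W x₀ = 0) : W = 0 := by
  have hC : 0 ≤ C := by
    have := (norm_nonneg _).trans (hA.bound 0)
    simpa using this
  have hb : ∀ x, ‖A x‖ ≤ ‖A₀‖ + C := fun x => by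
    have h1 := hA.bound x
    have h2 : Real.exp (-θ * |x|) ≤ 1 := Real.exp_le_one_iff.2 (by
      have := mul_nonneg hθ.le (abs_nonneg x)
      linarith)
    have h3 : ‖A x‖ ≤ ‖A₀‖ + ‖A x - A₀‖ := by
      simpa using norm_add_le A₀ (A x - A₀)
    nlinarith
  refine ODE_solution_unique_univ (v := fun x w => (A x).mulVec w) (s := fun _ => univ)
    (K := (‖A₀‖ + C).toNNReal) (t₀ := x₀) (fun x => LipschitzOnWith.of_dist_le_mul fun a _ b _ => ?_)
    (fun x => ⟨hW x, trivial⟩) (fun x => ⟨by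
      rw [Pi.zero_apply, Matrix.mulVec_zero]; exact hasDerivAt_const x (0 : Fin 3 → ℂ), trivial⟩)
    h0
  rw [dist_eq_norm, dist_eq_norm, ← Matrix.mulVec_sub, Real.coe_toNNReal _ (by positivity)]
  exact (Matrix.linfty_opNorm_mulVec _ _).trans (mul_le_mul_of_nonneg_right (hb x) (norm_nonneg _))

theorem tendsto_exp_mulVec_atBot {a b : ℂ} (ha : 0 < a.re) (hb : 0 < b.re) {v : Fin 3 → ℂ}
    (hv : ((A₀ - a • 1) * (A₀ - b • 1)).mulVec v = 0) :
    Tendsto (fun x : ℝ => (NormedSpace.exp ((x : ℂ) • A₀)).mulVec v) atBot (𝓝 0) := by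
  set u := (A₀ - b • 1).mulVec v with hu
  have hau : A₀.mulVec u = a • u := by
    rw [← Matrix.mulVec_mulVec, ← hu, Matrix.sub_mulVec, Matrix.smul_mulVec, Matrix.one_mulVec,
      sub_eq_zero] at hv
    exact hv
  have hbv : A₀.mulVec v = b • v + u := by
    rw [hu, Matrix.sub_mulVec, Matrix.smul_mulVec, Matrix.one_mulVec]; abel
  set η := min a.re b.re / 2 with hη
  have hη0 : 0 < η := by have := lt_min ha hb; linarith
  have ha' : 2 * η ≤ a.re := by have := min_le_left a.re b.re; linarith
  have hb' : 2 * η ≤ b.re := by have := min_le_right a.re b.re; linarith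
  set E : ℝ → Mat3 := fun x => NormedSpace.exp ((x : ℂ) • A₀) with hE
  have hy : ∀ t : ℝ, HasDerivAt (fun t => (E (-t)).mulVec v)
      (-b • (E (-t)).mulVec v + -(E (-t)).mulVec u) t := fun t => by
    have h1 : HasDerivAt (fun t => (E t).mulVec v) ((E (-t) * A₀).mulVec v) (-t) := by
      convert! hasDerivAt_mulVec (hasDerivAt_exp_ofReal_smul' A₀ (-t))
        (hasDerivAt_const (-t) v) using 1
      rw [Matrix.mulVec_zero, add_zero]
    have := h1.scomp t (hasDerivAt_neg t)
    rw [← Matrix.mulVec_mulVec, hbv, Matrix.mulVec_add, Matrix.mulVec_smul] at this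
    convert! this using 1
    rw [neg_smul]
    exact (neg_add _ _).symm.trans (neg_one_smul ℝ _).symm
  have key : ∀ t : ℝ, 0 ≤ t → ‖(E (-t)).mulVec v‖ ≤ (‖v‖ + ‖u‖ / η) * Real.exp (-η * t) := by
    intro t ht
    have := norm_le_of_hasDerivAt_smul_add (κ := -η) (B := ‖u‖) hη0 (by simp; linarith) hy
      (fun t ht => by
        rw [norm_neg, exp_mulVec_eigenvector hau, norm_smul, Complex.norm_exp, mul_comm]
        gcongr
        simp
        nlinarith) ht
    simpa [hE] using this
  have h0 : Tendsto (fun x : ℝ => (‖v‖ + ‖u‖ / η) * Real.exp (η * x)) atBot (𝓝 0) := by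
    simpa using (tendsto_exp_mul_atBot hη0).const_mul (‖v‖ + ‖u‖ / η)
  refine squeeze_zero_norm' ?_ h0
  filter_upwards [eventually_le_atBot 0] with x hx
  have := key (-x) (by linarith)
  rwa [neg_neg, neg_mul_neg] at this

/-- A vanishing Evans value gives a solution that decays at both ends. -/
theorem IsEvansValue.exists_decaying_solution (hθ : 0 < θ) (hA : AsymConst A A₀ C θ)
    (h : IsGapSpectrum A₀ μ) (h2 : (μ 2).re < 0) (h0 : 0 < (μ 0).re) (h1 : 0 < (μ 1).re)
    (hδ : IsEvansValue A A₀ 0) :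
    ∃ W : ℝ → Fin 3 → ℂ, (∀ x, HasDerivAt W ((A x).mulVec (W x)) x) ∧ (∀ x, W x ≠ 0) ∧
      Tendsto W atTop (𝓝 0) ∧ Tendsto W atBot (𝓝 0) := by
  obtain ⟨μ', V, W, Θm, Θp, h', hV, hV0, hV2, hW, hΘm, hΘp, hWm, hWp, hdet⟩ := hδ
  obtain ⟨e2, -, -⟩ := h.unique h'
  rw [e2] at hV2
  have hd := isUnit_det_of_linearIndependent hV
  have hdet0 : (Matrix.of fun i j => W j 0 i).det = 0 := by
    rcases div_eq_zero_iff.1 hdet.symm with h | h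
    · exact h
    · exact absurd h hd
  obtain ⟨c, hc, hcW⟩ := Matrix.exists_mulVec_eq_zero_iff.2 hdet0
  set E : ℝ → Mat3 := fun x => NormedSpace.exp ((x : ℂ) • A₀) with hE
  have hsum : ∀ x, c 0 • W 0 x + c 1 • W 1 x + c 2 • W 2 x = 0 := by
    refine fun x => congrFun (eq_zero_of_linear_ode hθ hA (x₀ := 0)
      (W := fun x => c 0 • W 0 x + c 1 • W 1 x + c 2 • W 2 x) (fun x => ?_) ?_) x
    · convert! (((hW 0 x).const_smul (c 0)).add ((hW 1 x).const_smul (c 1))).add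
        ((hW 2 x).const_smul (c 2)) using 1
      simp only [Matrix.mulVec_add, Matrix.mulVec_smul]
    · ext i
      have := congrFun hcW i
      simp only [Matrix.mulVec, dotProduct, Fin.sum_univ_three, Matrix.of_apply,
        Pi.zero_apply] at this
      simp only [Pi.add_apply, Pi.smul_apply, smul_eq_mul, Pi.zero_apply]
      linear_combination this
  have hinv : ∀ᶠ x in atBot, IsUnit (Θm x) := by
    have : Tendsto (fun x => (Θm x).det) atBot (𝓝 (1 : Mat3).det) :=
      ((continuous_id.matrix_det).tendsto _).comp hΘm
    rw [Matrix.det_one] at this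
    filter_upwards [this.eventually_ne one_ne_zero] with x hx
    exact (Matrix.isUnit_iff_isUnit_det _).2 (isUnit_iff_ne_zero.2 hx)
  set v := c 0 • V 0 + c 1 • V 1 with hv
  have hWv : ∀ x, c 0 • W 0 x + c 1 • W 1 x = (Θm x * E x).mulVec v := fun x => by
    rw [hWm 0 (by decide), hWm 1 (by decide), hv, Matrix.mulVec_add, Matrix.mulVec_smul,
      Matrix.mulVec_smul]
  have hW2v : ∀ x, c 2 • W 2 x = -(Θm x * E x).mulVec v := fun x => by
    rw [← hWv]; exact eq_neg_of_add_eq_zero_right (hsum x)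
  have hc2 : c 2 ≠ 0 := by
    intro hc2
    obtain ⟨x, hx⟩ := hinv.exists
    have e1 := hW2v x
    rw [hc2, zero_smul, eq_comm, neg_eq_zero] at e1
    obtain ⟨N, hN⟩ := (hx.mul (Matrix.isUnit_exp ((x : ℂ) • A₀))).exists_left_inv
    have e2 := congrArg N.mulVec e1
    rw [Matrix.mulVec_mulVec, hN, Matrix.one_mulVec, Matrix.mulVec_zero] at e2
    refine hc ?_
    have := Fintype.linearIndependent_iff.1 hV c (by
      rw [Fin.sum_univ_three, hc2, zero_smul, add_zero]
      exact e2)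
    exact funext this
  have hV2ne : V 2 ≠ 0 := hV.ne_zero 2
  refine ⟨W 2, hW 2, fun x hx => ?_, ?_, ?_⟩
  · have hz := eq_zero_of_linear_ode hθ hA (hW 2) hx
    have hinvp : ∀ᶠ x in atTop, IsUnit (Θp x) := by
      have : Tendsto (fun x => (Θp x).det) atTop (𝓝 (1 : Mat3).det) :=
        ((continuous_id.matrix_det).tendsto _).comp hΘp
      rw [Matrix.det_one] at this
      filter_upwards [this.eventually_ne one_ne_zero] with x hx
      exact (Matrix.isUnit_iff_isUnit_det _).2 (isUnit_iff_ne_zero.2 hx)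
    obtain ⟨y, hy⟩ := hinvp.exists
    have e1 := hWp y
    rw [hz, Pi.zero_apply] at e1
    obtain ⟨N, hN⟩ := (hy.mul (Matrix.isUnit_exp ((y : ℂ) • A₀))).exists_left_inv
    have e2 := congrArg N.mulVec e1
    rw [Matrix.mulVec_mulVec, hN, Matrix.one_mulVec, Matrix.mulVec_zero] at e2
    exact hV2ne e2.symm
  · have e : W 2 = fun x : ℝ => Complex.exp (μ 2 * x) • (Θp x).mulVec (V 2) := funext fun x => by
      rw [hWp, ← Matrix.mulVec_mulVec, exp_mulVec_eigenvector hV2, Matrix.mulVec_smul]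
    rw [e]
    have t1 : Tendsto (fun x : ℝ => Complex.exp (μ 2 * x)) atTop (𝓝 0) := by
      rw [tendsto_zero_iff_norm_tendsto_zero]
      simp only [Complex.norm_exp, Complex.mul_re, Complex.ofReal_re, Complex.ofReal_im, mul_zero,
        sub_zero]
      exact Real.tendsto_exp_atBot.comp (tendsto_id.const_mul_atTop_of_neg h2)
    have t2 := t1.smul (((continuous_id.matrix_mulVec continuous_const).tendsto _).comp hΘp
      : Tendsto (fun x => (Θp x).mulVec (V 2)) atTop (𝓝 ((1 : Mat3).mulVec (V 2))))
    simpa using t2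
  · have e : W 2 = fun x => -(c 2)⁻¹ • (Θm x).mulVec ((E x).mulVec v) := funext fun x => by
      rw [Matrix.mulVec_mulVec, neg_smul, ← smul_neg, ← hW2v, smul_smul, inv_mul_cancel₀ hc2,
        one_smul]
    have hPv : ((A₀ - μ 0 • 1) * (A₀ - μ 1 • 1)).mulVec v = 0 := by
      have e0 : ∀ j, j ≠ 2 → (gapProj A₀ μ).mulVec (V j) = 0 := fun j hj => by
        rw [← h.gapProj_unique h']; exact gapProj_mulVec_eq_zero (hV0 j hj)
      have hq : (A₀ - μ 0 • 1) * (A₀ - μ 1 • 1) = ((μ 2 - μ 0) * (μ 2 - μ 1)) • gapProj A₀ μ := by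
        rw [gapProj, smul_smul, mul_inv_cancel₀ h.den_ne_zero, one_smul]
      rw [hq, hv, Matrix.smul_mulVec, Matrix.mulVec_add, Matrix.mulVec_smul, Matrix.mulVec_smul,
        e0 0 (by decide), e0 1 (by decide)]
      simp
    have t1 := tendsto_exp_mulVec_atBot h0 h1 hPv
    rw [e]
    have hc' : Continuous fun q : Mat3 × (Fin 3 → ℂ) => q.1.mulVec q.2 :=
      continuous_fst.matrix_mulVec continuous_snd
    have t2 := (hc'.tendsto (1, 0)).comp (hΘm.prodMk_nhds t1)
    have t3 := t2.const_smul (-(c 2)⁻¹)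
    rw [Matrix.mulVec_zero, smul_zero] at t3
    exact t3

end Vanishing

section Profile
open scoped Matrix.Norms.Operator

variable {P : Params} {c q τ₀ : ℝ} {Z : ℝ → ℝ × ℝ}

/-- The source term `τ^(s+1) (q - c τ)^r` of the profile equation. -/
def source (P : Params) (c q t : ℝ) : ℝ := t ^ (P.s + 1) * (q - c * t) ^ P.r

theorem hasDerivAt_source {t : ℝ} (ht : 0 < t) (hu : 0 < q - c * t) :
    HasDerivAt (source P c q)
      (t ^ P.s * (q - c * t) ^ (P.r - 1) * ((P.s + 1) * (q - c * t) - c * P.r * t)) t := by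
  have h1 : HasDerivAt (fun t : ℝ => t ^ (P.s + 1)) ((P.s + 1) * t ^ P.s) t := by
    simpa using Real.hasDerivAt_rpow_const (p := P.s + 1) (Or.inl ht.ne')
  have h2 : HasDerivAt (fun t : ℝ => q - c * t) (-c) t := by
    simpa using ((hasDerivAt_id t).const_mul c).const_sub q
  have h3 : HasDerivAt (fun t : ℝ => (q - c * t) ^ P.r) (-c * P.r * (q - c * t) ^ (P.r - 1)) t :=
    h2.rpow_const (Or.inl hu.ne')
  convert! h1.mul h3 using 1
  have e1 : t ^ (P.s + 1) = t ^ P.s * t := by rw [Real.rpow_add_one ht.ne']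
  have e2 : (q - c * t) ^ P.r = (q - c * t) ^ (P.r - 1) * (q - c * t) := by
    rw [← Real.rpow_add_one hu.ne', sub_add_cancel]
  rw [e1, e2]
  ring

theorem profileField_snd (P : Params) (c q : ℝ) (z : ℝ × ℝ) :
    (profileField P c q z).2 = z.1 ^ 2 / (c * P.ν) *
        (1 - source P c q z.1 - (c ^ 2 - 1 / (P.F * z.1 ^ 3)) * z.2) + 2 * z.2 ^ 2 / z.1 := rfl

theorem contDiffAt_profileField (P : Params) (c q : ℝ) {z : ℝ × ℝ} (ht : 0 < z.1)
    (hu : 0 < q - c * z.1) : ContDiffAt ℝ 2 (profileField P c q) z := by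
  have hF := P.F_pos
  unfold profileField
  refine ContDiffAt.prodMk contDiffAt_snd ?_
  have h1 : ContDiffAt ℝ 2 (fun z : ℝ × ℝ => z.1 ^ (P.s + 1)) z :=
    contDiffAt_fst.rpow_const_of_ne ht.ne'
  have h2 : ContDiffAt ℝ 2 (fun z : ℝ × ℝ => (q - c * z.1) ^ P.r) z :=
    (contDiffAt_const.sub (contDiffAt_const.mul contDiffAt_fst)).rpow_const_of_ne hu.ne'
  refine ContDiffAt.add (ContDiffAt.mul ((contDiffAt_fst.pow 2).div_const _) (((contDiffAt_const.sub
    (h1.mul h2)).sub (ContDiffAt.mul (contDiffAt_const.sub (contDiffAt_const.div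
    (contDiffAt_const.mul (contDiffAt_fst.pow 3)) (by positivity))) contDiffAt_snd))))
    ((contDiffAt_const.mul (contDiffAt_snd.pow 2)).div contDiffAt_fst ht.ne')

/-- The linearization of the profile equation at a saddle. -/
theorem IsSaddle.linearization (h : IsSaddle P c q τ₀) (hc : c ≠ 0) :
    source P c q τ₀ = 1 ∧
    0 < (c * (P.r * τ₀ ^ (P.s + 1) * (q - c * τ₀) ^ (P.r - 1))
      - (P.s + 1) * τ₀ ^ P.s * (q - c * τ₀) ^ P.r) / c ∧
    ∃ μs μu : ℝ, μs < 0 ∧ 0 < μu ∧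
      HasFDerivAt (fun z => (profileField P c q z).2)
        (-(μs * μu) • ContinuousLinearMap.fst ℝ ℝ ℝ + (μs + μu) • ContinuousLinearMap.snd ℝ ℝ ℝ)
        (τ₀, 0) := by
  have ht := h.tau_pos
  have hu := h.u_pos
  have hν := P.ν_pos
  have hd : HasFDerivAt (profileField P c q) (fderiv ℝ (profileField P c q) (τ₀, 0)) (τ₀, 0) :=
    ((contDiffAt_profileField P c q (z := (τ₀, 0)) ht hu).differentiableAt (by norm_num)).hasFDerivAt
  set D := fderiv ℝ (profileField P c q) (τ₀, 0) with hD
  have hsrc : source P c q τ₀ = 1 := by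
    have := congrArg Prod.snd h.rest
    rw [profileField_snd] at this
    have h0 : τ₀ ^ 2 / (c * P.ν) * (1 - source P c q τ₀) = 0 := by simpa using this
    have := (mul_eq_zero.1 h0).resolve_left (by positivity)
    linarith
  have hfst : ∀ v, (D v).1 = v.2 := by
    have h1 : HasFDerivAt (fun z => (profileField P c q z).1)
      ((ContinuousLinearMap.fst ℝ ℝ ℝ).comp D) (τ₀, 0) := hd.fst
    have h2 : HasFDerivAt (fun z : ℝ × ℝ => (profileField P c q z).1)
      (ContinuousLinearMap.snd ℝ ℝ ℝ) (τ₀, 0) := hasFDerivAt_snd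
    exact fun v => DFunLike.congr_fun (h1.unique h2) v
  have hsnd : ∀ v, (D v).2 = (D (1, 0)).2 * v.1 + (D (0, 1)).2 * v.2 := by
    intro v
    have : v = v.1 • ((1 : ℝ), (0 : ℝ)) + v.2 • ((0 : ℝ), (1 : ℝ)) := by ext <;> simp
    conv_lhs => rw [this, map_add, map_smul, map_smul]
    simp [mul_comm]
  have eig : ∀ μ : ℝ, Module.End.HasEigenvalue D.toLinearMap μ →
      (D (1, 0)).2 + (D (0, 1)).2 * μ = μ ^ 2 := by
    intro μ hμ
    obtain ⟨v, hv⟩ := hμ.exists_hasEigenvector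
    have hDv : D v = μ • v := hv.apply_eq_smul
    have e1 := hfst v
    have e2 := hsnd v
    rw [hDv] at e1 e2
    simp only [Prod.smul_fst, Prod.smul_snd, smul_eq_mul] at e1 e2
    have hv1 : v.1 ≠ 0 := fun h0 => hv.2 (by
      ext
      · exact h0
      · rw [← e1, h0]; simp)
    refine mul_right_cancel₀ hv1 ?_
    rw [← e1] at e2
    linear_combination -e2
  obtain ⟨μs, hs, hs'⟩ := h.neg_eigenvalue
  obtain ⟨μu, hu0, hu'⟩ := h.pos_eigenvalue
  have es := eig μs hs'
  have eu := eig μu hu'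
  have hp : (D (0, 1)).2 = μs + μu := by
    have : (μu - μs) * ((D (0, 1)).2 - (μs + μu)) = 0 := by linear_combination eu - es
    have := (mul_eq_zero.1 this).resolve_left (by linarith)
    linarith
  have ht' : (D (1, 0)).2 = -(μs * μu) := by rw [hp] at es; linear_combination es
  have hder : (D (1, 0)).2 = τ₀ ^ 2 / (c * P.ν) * -(τ₀ ^ P.s * (q - c * τ₀) ^ (P.r - 1) *
      ((P.s + 1) * (q - c * τ₀) - c * P.r * τ₀)) := by
    have h1 : HasDerivAt (fun t : ℝ => (profileField P c q (t, 0)).2) (D (1, 0)).2 τ₀ := by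
      have e : HasDerivAt (fun t : ℝ => (t, (0 : ℝ))) (1, 0) τ₀ :=
        (hasDerivAt_id τ₀).prodMk (hasDerivAt_const τ₀ 0)
      exact (hd.comp_hasDerivAt (f := fun t : ℝ => (t, (0 : ℝ))) τ₀ e).snd
    have h2 := ((hasDerivAt_pow 2 τ₀).div_const (c * P.ν)).mul
      ((hasDerivAt_source (P := P) ht hu).const_sub 1)
    have h3 : (fun t : ℝ => (profileField P c q (t, 0)).2)
        = (fun t => t ^ 2 / (c * P.ν)) * fun t => 1 - source P c q t := by
      funext t
      rw [profileField_snd]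
      simp
    rw [h3] at h1
    rw [h1.unique h2, hsrc]
    simp
  refine ⟨hsrc, ?_, μs, μu, hs, hu0, ?_⟩
  · have hneg : 0 < (D (1, 0)).2 := by rw [ht']; nlinarith
    rw [hder] at hneg
    have e1 : τ₀ ^ (P.s + 1) = τ₀ ^ P.s * τ₀ := by rw [Real.rpow_add_one ht.ne']
    have e2 : (q - c * τ₀) ^ P.r = (q - c * τ₀) ^ (P.r - 1) * (q - c * τ₀) := by
      rw [← Real.rpow_add_one hu.ne', sub_add_cancel]
    have hfac : 0 < τ₀ ^ 2 / P.ν := by positivity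
    have : τ₀ ^ 2 / (c * P.ν) * -(τ₀ ^ P.s * (q - c * τ₀) ^ (P.r - 1) *
      ((P.s + 1) * (q - c * τ₀) - c * P.r * τ₀)) = (τ₀ ^ 2 / P.ν) *
      ((c * (P.r * τ₀ ^ (P.s + 1) * (q - c * τ₀) ^ (P.r - 1))
      - (P.s + 1) * τ₀ ^ P.s * (q - c * τ₀) ^ P.r) / c) := by
      rw [e1, e2]; field_simp; ring
    rw [this] at hneg
    exact (mul_pos_iff_of_pos_left hfac).1 hneg
  · have := hd.snd
    refine this.congr_fderiv ?_
    refine ContinuousLinearMap.ext fun v => ?_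
    have := hsnd v
    rw [ht', hp] at this
    simpa using this

theorem IsHomoclinic.hasDerivAt_fst (h : IsHomoclinic P c q τ₀ Z) (x : ℝ) :
    HasDerivAt (fun x => (Z x).1) (Z x).2 x := (h.ode x).fst

theorem IsHomoclinic.hasDerivAt_snd (h : IsHomoclinic P c q τ₀ Z) (x : ℝ) :
    HasDerivAt (fun x => (Z x).2) (profileField P c q (Z x)).2 x := (h.ode x).snd

theorem IsHomoclinic.continuous (h : IsHomoclinic P c q τ₀ Z) : Continuous Z :=
  continuous_iff_continuousAt.2 fun x => (h.ode x).continuousAt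

theorem IsHomoclinic.tendsto_cocompact (h : IsHomoclinic P c q τ₀ Z) :
    Tendsto (fun x => (Z x).1) (cocompact ℝ) (𝓝 τ₀) := by
  rw [cocompact_eq_atBot_atTop, tendsto_sup]
  exact ⟨(continuous_fst.tendsto _).comp h.tendsto_atBot,
    (continuous_fst.tendsto _).comp h.tendsto_atTop⟩

/-- At a local maximum the second derivative is not positive. -/
theorem deriv_nonpos_of_isLocalMax {f g : ℝ → ℝ} {g' x : ℝ} (hf : ∀ y, HasDerivAt f (g y) y)
    (hg : HasDerivAt g g' x) (hm : IsLocalMax f x) : g x = 0 ∧ g' ≤ 0 := by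
  have hd : deriv f = g := funext fun y => (hf y).deriv
  have h0 : g x = 0 := hm.hasDerivAt_eq_zero (hf x)
  refine ⟨h0, not_lt.1 fun hpos => ?_⟩
  have hmin : IsLocalMin f x := isLocalMin_of_deriv_deriv_pos (by rw [hd, hg.deriv]; exact hpos)
    (by rw [hd, h0]) (hf x).continuousAt
  have hconst : f =ᶠ[𝓝 x] fun _ => f x := by
    filter_upwards [hm, hmin] with y h1 h2 using le_antisymm h1 h2
  have hgz : g =ᶠ[𝓝 x] fun _ => 0 := by
    filter_upwards [hconst.eventuallyEq_nhds] with y hy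
    exact (hf y).unique ((hasDerivAt_const y (f x)).congr_of_eventuallyEq hy)
  have := hg.unique ((hasDerivAt_const x (0 : ℝ)).congr_of_eventuallyEq hgz)
  linarith

theorem profileField_snd_of_snd_eq_zero {z : ℝ × ℝ} (h0 : z.2 = 0) :
    (profileField P c q z).2 = z.1 ^ 2 / (c * P.ν) * (1 - source P c q z.1) := by
  rw [profileField_snd, h0]
  simp

theorem IsHomoclinic.speed_pos (h : IsHomoclinic P c q τ₀ Z) (hs : IsSaddle P c q τ₀)
    (hc : c ≠ 0) : 0 < c := by
  by_contra hcn
  have hc0 : c < 0 := lt_of_le_of_ne (not_lt.1 hcn) hc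
  obtain ⟨hsrc, -, -⟩ := hs.linearization hc
  have hν := P.ν_pos
  have hmono : StrictMonoOn (source P c q) {t | 0 < t ∧ 0 < q - c * t} := by
    have hconv : Convex ℝ {t : ℝ | 0 < t ∧ 0 < q - c * t} := by
      intro a ha b hb x y hx hy hxy
      refine ⟨?_, ?_⟩
      · exact (convex_Ioi (0 : ℝ)) ha.1 hb.1 hx hy hxy
      · have e : q - c * (x • a + y • b) = x • (q - c * a) + y • (q - c * b) := by
          simp only [smul_eq_mul]; linear_combination (-q) * hxy
        rw [e]
        exact (convex_Ioi (0 : ℝ)) ha.2 hb.2 hx hy hxy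
    refine strictMonoOn_of_deriv_pos hconv
      (fun t ht => (hasDerivAt_source ht.1 ht.2).continuousAt.continuousWithinAt) fun t ht => ?_
    obtain ⟨ht1, ht2⟩ := interior_subset ht
    rw [(hasDerivAt_source ht1 ht2).deriv]
    have h1 : 0 < P.s + 1 := by linarith [P.s_nonneg]
    have h2 : 0 < P.r := by linarith [P.one_le_r]
    have h3 : 0 < -c * P.r * t := mul_pos (mul_pos (neg_pos.2 hc0) h2) ht1
    have h4 := mul_pos h1 ht2
    exact mul_pos (mul_pos (Real.rpow_pos_of_pos ht1 _) (Real.rpow_pos_of_pos ht2 _)) (by linarith)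
  have hτ₀ : τ₀ ∈ {t : ℝ | 0 < t ∧ 0 < q - c * t} := ⟨hs.tau_pos, hs.u_pos⟩
  have hcont : Continuous fun x => (Z x).1 := continuous_fst.comp h.continuous
  have hle : ∀ x, (Z x).1 ≤ τ₀ := by
    by_contra! hex
    obtain ⟨x₀, hx₀⟩ := hex
    obtain ⟨x, hx⟩ := hcont.exists_forall_ge' x₀
      ((h.tendsto_cocompact.eventually_le_const hx₀))
    obtain ⟨e0, e1⟩ := deriv_nonpos_of_isLocalMax h.hasDerivAt_fst (h.hasDerivAt_snd x)
      (Eventually.of_forall hx)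
    rw [profileField_snd_of_snd_eq_zero e0] at e1
    have := hmono hτ₀ ⟨h.tau_pos x, h.u_pos x⟩ (hx₀.trans_le (hx x₀))
    have hp := pow_pos (h.tau_pos x) 2
    have : 0 < (Z x).1 ^ 2 / (c * P.ν) * (1 - source P c q (Z x).1) :=
      mul_pos_of_neg_of_neg (div_neg_of_pos_of_neg hp (mul_neg_of_neg_of_pos hc0 hν)) (by linarith)
    linarith
  have hge : ∀ x, τ₀ ≤ (Z x).1 := by
    by_contra! hex
    obtain ⟨x₀, hx₀⟩ := hex
    obtain ⟨x, hx⟩ := hcont.exists_forall_le' x₀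
      ((h.tendsto_cocompact.eventually_const_le hx₀))
    obtain ⟨e0, e1⟩ := deriv_nonpos_of_isLocalMax (fun y => (h.hasDerivAt_fst y).neg)
      (h.hasDerivAt_snd x).neg (Eventually.of_forall fun y => neg_le_neg (hx y))
    rw [neg_eq_zero] at e0
    rw [profileField_snd_of_snd_eq_zero e0] at e1
    have := hmono ⟨h.tau_pos x, h.u_pos x⟩ hτ₀ ((hx x₀).trans_lt hx₀)
    have hp := pow_pos (h.tau_pos x) 2
    have : (Z x).1 ^ 2 / (c * P.ν) * (1 - source P c q (Z x).1) < 0 :=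
      mul_neg_of_neg_of_pos (div_neg_of_pos_of_neg hp (mul_neg_of_neg_of_pos hc0 hν)) (by linarith)
    linarith
  obtain ⟨x, hx⟩ := h.nontrivial
  have heq : (fun x => (Z x).1) = fun _ => τ₀ := funext fun x => le_antisymm (hle x) (hge x)
  refine hx (Prod.ext (congrFun heq x) ?_)
  have := h.hasDerivAt_fst x
  rw [heq] at this
  exact this.unique (hasDerivAt_const x τ₀)

theorem source_lt_one (hs : IsSaddle P c q τ₀) (hc : 0 < c) {t : ℝ} (ht : τ₀ < t)
    (hu : 0 < q - c * t) : source P c q t < 1 := by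
  obtain ⟨hsrc, hpos, -⟩ := hs.linearization hc.ne'
  have ht0 := hs.tau_pos
  have hr : 0 < P.r := by linarith [P.one_le_r]
  have hs1 : 0 < P.s + 1 := by linarith [P.s_nonneg]
  have hb : (P.s + 1) * (q - c * τ₀) - c * P.r * τ₀ < 0 := by
    have e1 : τ₀ ^ (P.s + 1) = τ₀ ^ P.s * τ₀ := by rw [Real.rpow_add_one ht0.ne']
    have e2 : (q - c * τ₀) ^ P.r = (q - c * τ₀) ^ (P.r - 1) * (q - c * τ₀) := by
      rw [← Real.rpow_add_one hs.u_pos.ne', sub_add_cancel]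
    have h1 := (div_pos_iff_of_pos_right hc).1 hpos
    rw [e1, e2] at h1
    have h2 : 0 < (τ₀ ^ P.s * (q - c * τ₀) ^ (P.r - 1)) *
        -((P.s + 1) * (q - c * τ₀) - c * P.r * τ₀) := by linarith
    have := (mul_pos_iff_of_pos_left (mul_pos (Real.rpow_pos_of_pos ht0 _)
      (Real.rpow_pos_of_pos hs.u_pos _))).1 h2
    linarith
  have hdom : ∀ y ∈ Icc τ₀ t, 0 < y ∧ 0 < q - c * y := fun y hy =>
    ⟨ht0.trans_le hy.1, by nlinarith [hy.2]⟩
  have hanti : StrictAntiOn (source P c q) (Icc τ₀ t) := by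
    refine strictAntiOn_of_deriv_neg (convex_Icc _ _)
      (fun y hy => (hasDerivAt_source (hdom y hy).1 (hdom y hy).2).continuousAt.continuousWithinAt)
      fun y hy => ?_
    have hy' := interior_subset hy
    obtain ⟨h1, h2⟩ := hdom y hy'
    rw [(hasDerivAt_source h1 h2).deriv]
    refine mul_neg_of_pos_of_neg (mul_pos (Real.rpow_pos_of_pos h1 _) (Real.rpow_pos_of_pos h2 _)) ?_
    have h3 : 0 ≤ (y - τ₀) * (c * (P.s + 1 + P.r)) :=
      mul_nonneg (by linarith [hy'.1]) (mul_pos hc (by linarith)).le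
    nlinarith
  rw [← hsrc]
  exact hanti (left_mem_Icc.2 ht.le) (right_mem_Icc.2 ht.le) ht

theorem IsHomoclinic.eq_rest_of_eq (h : IsHomoclinic P c q τ₀ Z) (hs : IsSaddle P c q τ₀) {x₀ : ℝ}
    (h0 : Z x₀ = (τ₀, 0)) : ∀ x, Z x = (τ₀, 0) := by
  have hopen : IsOpen {x | Z x = (τ₀, 0)} := by
    rw [isOpen_iff_mem_nhds]
    intro y hy
    obtain ⟨K, s, hs', hK⟩ := ((contDiffAt_profileField P c q (z := (τ₀, 0)) hs.tau_pos
      hs.u_pos).of_le (by norm_num : (1 : WithTop ℕ∞) ≤ 2)).exists_lipschitzOnWith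
    have hmem : ∀ᶠ x in 𝓝 y, Z x ∈ s := by
      have := h.continuous.continuousAt (x := y)
      rw [ContinuousAt, show Z y = (τ₀, 0) from hy] at this
      exact this hs'
    have := ODE_solution_unique_of_eventually (v := fun _ => profileField P c q) (s := fun _ => s)
      (f := Z) (g := fun _ => (τ₀, 0)) (t₀ := y) (K := K) (Eventually.of_forall fun _ => hK)
      (hmem.mono fun x hx => ⟨h.ode x, hx⟩) (Eventually.of_forall fun x => ⟨by
        rw [hs.rest]; exact hasDerivAt_const x _, mem_of_mem_nhds hs'⟩) hy
    exact this
  have hclosed : IsClosed {x | Z x = (τ₀, 0)} := isClosed_eq h.continuous continuous_const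
  have := IsClopen.eq_univ ⟨hclosed, hopen⟩ ⟨x₀, h0⟩
  exact fun x => (this ▸ mem_univ x : x ∈ {x | Z x = (τ₀, 0)})

/-- The homoclinic stays on one side of its end state. -/
theorem IsHomoclinic.fst_lt (h : IsHomoclinic P c q τ₀ Z) (hs : IsSaddle P c q τ₀) (hc : 0 < c)
    (x : ℝ) : (Z x).1 < τ₀ := by
  have hν := P.ν_pos
  have hcont : Continuous fun x => (Z x).1 := continuous_fst.comp h.continuous
  have hle : ∀ x, (Z x).1 ≤ τ₀ := by
    by_contra! hex
    obtain ⟨x₀, hx₀⟩ := hex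
    obtain ⟨x, hx⟩ := hcont.exists_forall_ge' x₀
      ((h.tendsto_cocompact.eventually_le_const hx₀))
    obtain ⟨e0, e1⟩ := deriv_nonpos_of_isLocalMax h.hasDerivAt_fst (h.hasDerivAt_snd x)
      (Eventually.of_forall hx)
    rw [profileField_snd_of_snd_eq_zero e0] at e1
    have := source_lt_one hs hc (hx₀.trans_le (hx x₀)) (h.u_pos x)
    have hp := pow_pos (h.tau_pos x) 2
    have : 0 < (Z x).1 ^ 2 / (c * P.ν) * (1 - source P c q (Z x).1) :=
      mul_pos (div_pos hp (mul_pos hc hν)) (by linarith)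
    linarith
  refine lt_of_le_of_ne (hle x) fun heq => ?_
  have h2 : (Z x).2 = 0 := by
    have hm : IsLocalMax (fun x => (Z x).1) x := Eventually.of_forall fun y => by
      change (Z y).1 ≤ (Z x).1
      rw [heq]; exact hle y
    exact hm.hasDerivAt_eq_zero (h.hasDerivAt_fst x)
  obtain ⟨y, hy⟩ := h.nontrivial
  exact hy (h.eq_rest_of_eq hs (Prod.ext heq h2) y)

end Profile

section Decay
open scoped Matrix.Norms.Operator

/-- Solutions converging to a hyperbolic rest point do so exponentially. -/
theorem exponential_decay_of_cone {a b a' b' : ℝ → ℝ} {κ : ℝ} (hκ : 0 < κ)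
    (ha : ∀ x, HasDerivAt a (a' x) x) (hb : ∀ x, HasDerivAt b (b' x) x)
    {lu ls : ℝ} (hlu : κ ≤ lu) (hls : κ ≤ ls)
    (hea : ∀ᶠ x in atTop, |a' x - lu * a x| ≤ κ / 8 * (|a x| + |b x|))
    (heb : ∀ᶠ x in atTop, |b' x + ls * b x| ≤ κ / 8 * (|a x| + |b x|))
    (ha0 : Tendsto a atTop (𝓝 0)) (hb0 : Tendsto b atTop (𝓝 0)) :
    ∃ C, ∀ᶠ x in atTop, |a x| + |b x| ≤ C * Real.exp (-(κ / 4) * x) := by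
  obtain ⟨N, hN⟩ := eventually_atTop.1 (hea.and heb)
  have hf : ∀ x, HasDerivAt (fun x => a x ^ 2 - b x ^ 2) (2 * a x * a' x - 2 * b x * b' x) x :=
    fun x => by
      convert! ((ha x).pow 2).sub ((hb x).pow 2) using 1
      simp
  have hmono : MonotoneOn (fun x => a x ^ 2 - b x ^ 2) (Ici N) := by
    refine monotoneOn_of_deriv_nonneg (convex_Ici N)
      (fun x _ => (hf x).continuousAt.continuousWithinAt)
      (fun x _ => (hf x).differentiableAt.differentiableWithinAt) fun x hx => ?_
    rw [(hf x).deriv]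
    obtain ⟨e1, e2⟩ := hN x (interior_subset hx)
    have f1 : -(|a x| * (κ / 8 * (|a x| + |b x|))) ≤ a x * (a' x - lu * a x) := by
      refine (neg_le_neg ?_).trans (neg_abs_le _)
      rw [abs_mul]; gcongr
    have f2 : b x * (b' x + ls * b x) ≤ |b x| * (κ / 8 * (|a x| + |b x|)) := by
      refine (le_abs_self _).trans ?_
      rw [abs_mul]; gcongr
    have f3 : κ * a x ^ 2 ≤ lu * a x ^ 2 := by gcongr
    have f4 : κ * b x ^ 2 ≤ ls * b x ^ 2 := by gcongr
    have g1 : (|a x| + |b x|) * (|a x| + |b x|) ≤ 2 * (a x ^ 2 + b x ^ 2) := by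
      have h1 := sq_abs (a x); have h2 := sq_abs (b x)
      nlinarith [sq_nonneg (|a x| - |b x|)]
    nlinarith [sq_nonneg (a x), sq_nonneg (b x)]
  have hle : ∀ x, N ≤ x → a x ^ 2 ≤ b x ^ 2 := by
    intro x hx
    have h0 : Tendsto (fun x => a x ^ 2 - b x ^ 2) atTop (𝓝 0) := by
      simpa using (ha0.pow 2).sub (hb0.pow 2)
    have := ge_of_tendsto h0 (by
      filter_upwards [eventually_ge_atTop x] with y hy
      exact hmono hx (hx.trans hy) hy)
    linarith
  have habs : ∀ x, N ≤ x → |a x| ≤ |b x| := fun x hx => sq_le_sq.1 (hle x hx)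
  have hg : ∀ x, HasDerivAt (fun x => b x ^ 2 * Real.exp (κ / 2 * x))
      ((2 * b x * b' x + κ / 2 * b x ^ 2) * Real.exp (κ / 2 * x)) x := fun x => by
    have h1 : HasDerivAt (fun x : ℝ => Real.exp (κ / 2 * x)) (Real.exp (κ / 2 * x) * (κ / 2)) x := by
      simpa using ((hasDerivAt_id x).const_mul (κ / 2)).exp
    convert! ((hb x).pow 2).mul h1 using 1
    simp; ring
  have hanti : AntitoneOn (fun x => b x ^ 2 * Real.exp (κ / 2 * x)) (Ici N) := by
    refine antitoneOn_of_deriv_nonpos (convex_Ici N)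
      (fun x _ => (hg x).continuousAt.continuousWithinAt)
      (fun x _ => (hg x).differentiableAt.differentiableWithinAt) fun x hx => ?_
    rw [(hg x).deriv]
    refine mul_nonpos_of_nonpos_of_nonneg ?_ (Real.exp_pos _).le
    obtain ⟨-, e2⟩ := hN x (interior_subset hx)
    have e3 := habs x (interior_subset hx)
    have f2 : b x * (b' x + ls * b x) ≤ |b x| * (κ / 8 * (|b x| + |b x|)) := by
      refine (le_abs_self _).trans ?_
      rw [abs_mul]
      exact mul_le_mul_of_nonneg_left (e2.trans (by gcongr)) (abs_nonneg _)
    have f4 : κ * b x ^ 2 ≤ ls * b x ^ 2 := by gcongr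
    have h2 := sq_abs (b x)
    nlinarith [sq_nonneg (b x)]
  refine ⟨2 * Real.sqrt (b N ^ 2 * Real.exp (κ / 2 * N)), ?_⟩
  filter_upwards [eventually_ge_atTop N] with x hx
  have h1 : b x ^ 2 * Real.exp (κ / 2 * x) ≤ b N ^ 2 * Real.exp (κ / 2 * N) :=
    hanti (mem_Ici.2 le_rfl) hx hx
  have h2 : |b x| * Real.exp (κ / 4 * x) ≤ Real.sqrt (b N ^ 2 * Real.exp (κ / 2 * N)) := by
    refine Real.le_sqrt_of_sq_le (le_of_eq_of_le ?_ h1)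
    rw [mul_pow, sq_abs, ← Real.exp_nat_mul]
    ring_nf
  have h3 : |b x| ≤ Real.sqrt (b N ^ 2 * Real.exp (κ / 2 * N)) * Real.exp (-(κ / 4) * x) := by
    rw [neg_mul, Real.exp_neg, ← div_eq_mul_inv, le_div_iff₀ (Real.exp_pos _)]
    exact h2
  linarith [habs x hx]

theorem exists_global_exp_bound {E : Type*} [NormedAddCommGroup E] {f : ℝ → E} (hf : Continuous f)
    {C θ : ℝ} (h1 : ∀ᶠ x in atTop, ‖f x‖ ≤ C * Real.exp (-θ * |x|))
    (h2 : ∀ᶠ x in atBot, ‖f x‖ ≤ C * Real.exp (-θ * |x|)) :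
    ∃ C', ∀ x, ‖f x‖ ≤ C' * Real.exp (-θ * |x|) := by
  have hc : Continuous fun x => ‖f x‖ * Real.exp (θ * |x|) := by fun_prop
  have hb : ∀ᶠ x in cocompact ℝ, ‖f x‖ * Real.exp (θ * |x|) ≤ C := by
    rw [cocompact_eq_atBot_atTop, eventually_sup]
    have e : ∀ x, ‖f x‖ ≤ C * Real.exp (-θ * |x|) → ‖f x‖ * Real.exp (θ * |x|) ≤ C := fun x hx => by
      rw [neg_mul, Real.exp_neg, ← div_eq_mul_inv, le_div_iff₀ (Real.exp_pos _)] at hx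
      exact hx
    exact ⟨h2.mono e, h1.mono e⟩
  obtain ⟨s, hs, hsC⟩ := mem_cocompact.1 hb
  obtain ⟨C₁, hC₁⟩ := hs.exists_bound_of_continuousOn hc.continuousOn
  refine ⟨max C C₁, fun x => ?_⟩
  rw [neg_mul, Real.exp_neg, ← div_eq_mul_inv, le_div_iff₀ (Real.exp_pos _)]
  by_cases hx : x ∈ s
  · exact ((le_abs_self _).trans (hC₁ x hx)).trans (le_max_right _ _)
  · exact (hsC hx : _ ≤ C).trans (le_max_left _ _)

variable {P : Params} {c q τ₀ : ℝ} {Z : ℝ → ℝ × ℝ}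

theorem IsHomoclinic.exists_exp_bound (h : IsHomoclinic P c q τ₀ Z) (hs : IsSaddle P c q τ₀)
    (hc : c ≠ 0) : ∃ C θ, 0 < θ ∧ ∀ x, ‖Z x - (τ₀, 0)‖ ≤ C * Real.exp (-θ * |x|) := by
  obtain ⟨-, -, μs, μu, hμs, hμu, hd⟩ := hs.linearization hc
  set κ := min (-μs) μu with hκdef
  have hκ : 0 < κ := lt_min (by linarith) hμu
  have hκs : κ ≤ -μs := min_le_left _ _
  have hκu : κ ≤ μu := min_le_right _ _
  have hD : 0 < μu - μs := by linarith
  let a : ℝ → ℝ := fun x => (Z x).2 - μs * ((Z x).1 - τ₀)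
  let b : ℝ → ℝ := fun x => (Z x).2 - μu * ((Z x).1 - τ₀)
  let G : ℝ → ℝ := fun x => (profileField P c q (Z x)).2
  have ha : ∀ x, HasDerivAt a (G x - μs * (Z x).2) x := fun x =>
    (h.hasDerivAt_snd x).sub (((h.hasDerivAt_fst x).sub_const τ₀).const_mul μs)
  have hb : ∀ x, HasDerivAt b (G x - μu * (Z x).2) x := fun x =>
    (h.hasDerivAt_snd x).sub (((h.hasDerivAt_fst x).sub_const τ₀).const_mul μu)
  set M := (1 + |μu| + |μs|) / (μu - μs) with hM
  have hM0 : 0 < M := by positivity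
  have hZ : ∀ x, ‖Z x - (τ₀, 0)‖ ≤ M * (|a x| + |b x|) := by
    intro x
    have e1 : (Z x).1 - τ₀ = (a x - b x) / (μu - μs) := by
      simp only [a, b]; field_simp; ring
    have e2 : (Z x).2 = (μu * a x - μs * b x) / (μu - μs) := by
      simp only [a, b]; field_simp; ring
    have n1 := abs_nonneg (a x); have n2 := abs_nonneg (b x)
    have n3 := abs_nonneg μu; have n4 := abs_nonneg μs
    rw [Prod.norm_def, Prod.fst_sub, Prod.snd_sub, sub_zero, e1, e2, Real.norm_eq_abs,
      Real.norm_eq_abs, abs_div, abs_div, abs_of_pos hD, hM, div_mul_eq_mul_div]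
    refine max_le ?_ ?_
    · gcongr
      have := abs_sub (a x) (b x)
      nlinarith [mul_nonneg n3 n1, mul_nonneg n3 n2, mul_nonneg n4 n1, mul_nonneg n4 n2]
    · gcongr
      have := abs_sub (μu * a x) (μs * b x)
      rw [abs_mul, abs_mul] at this
      nlinarith [mul_nonneg n3 n1, mul_nonneg n3 n2, mul_nonneg n4 n1, mul_nonneg n4 n2]
  have hlin : ∀ l : Filter ℝ, Tendsto Z l (𝓝 (τ₀, 0)) → ∀ᶠ x in l,
      |G x - (-(μs * μu) * ((Z x).1 - τ₀) + (μs + μu) * (Z x).2)| ≤ κ / 8 * (|a x| + |b x|) := by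
    intro l hl
    have h1 := hd.isLittleO.def (show 0 < κ / 8 / M by positivity)
    filter_upwards [hl.eventually h1] with x hx
    have h0 : (profileField P c q (τ₀, 0)).2 = 0 := by rw [hs.rest]; rfl
    rw [h0] at hx
    have e : ‖(profileField P c q (Z x)).2 - 0 - (-(μs * μu) • ContinuousLinearMap.fst ℝ ℝ ℝ
      + (μs + μu) • ContinuousLinearMap.snd ℝ ℝ ℝ) (Z x - (τ₀, 0))‖
      = |G x - (-(μs * μu) * ((Z x).1 - τ₀) + (μs + μu) * (Z x).2)| := by
      simp [G, Real.norm_eq_abs]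
    rw [e] at hx
    refine hx.trans ((mul_le_mul_of_nonneg_left (hZ x) (by positivity)).trans (le_of_eq ?_))
    field_simp
  have hlim : ∀ l : Filter ℝ, Tendsto Z l (𝓝 (τ₀, 0)) → Tendsto a l (𝓝 0) ∧ Tendsto b l (𝓝 0) := by
    intro l hl
    have t1 := (continuous_fst.tendsto _).comp hl
    have t2 := (continuous_snd.tendsto _).comp hl
    have t3 : ∀ μ : ℝ, Tendsto (fun x => (Z x).2 - μ * ((Z x).1 - τ₀)) l (𝓝 0) := fun μ => by
      simpa using t2.sub ((t1.sub_const τ₀).const_mul μ)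
    exact ⟨t3 μs, t3 μu⟩
  obtain ⟨C₁, hC₁⟩ := exponential_decay_of_cone hκ ha hb hκu hκs (by
      filter_upwards [hlin _ h.tendsto_atTop] with x hx
      convert hx using 2
      simp only [a]; ring) (by
      filter_upwards [hlin _ h.tendsto_atTop] with x hx
      convert hx using 2
      simp only [b]; ring) (hlim _ h.tendsto_atTop).1 (hlim _ h.tendsto_atTop).2
  have hn := tendsto_neg_atTop_atBot (G := ℝ)
  obtain ⟨C₂, hC₂⟩ := exponential_decay_of_cone (a := fun x => b (-x)) (b := fun x => a (-x)) hκ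
    (fun x => by simpa [Function.comp_def] using (hb (-x)).scomp x (hasDerivAt_neg x))
    (fun x => by simpa [Function.comp_def] using (ha (-x)).scomp x (hasDerivAt_neg x)) hκs hκu (by
      filter_upwards [hn.eventually (hlin _ h.tendsto_atBot)] with x hx
      rw [add_comm |b (-x)|]
      refine le_of_eq_of_le ?_ hx
      rw [← abs_neg]
      congr 1
      simp only [b]; ring) (by
      filter_upwards [hn.eventually (hlin _ h.tendsto_atBot)] with x hx
      rw [add_comm |b (-x)|]
      refine le_of_eq_of_le ?_ hx
      rw [← abs_neg]
      congr 1
      simp only [a]; ring) ((hlim _ h.tendsto_atBot).2.comp hn) ((hlim _ h.tendsto_atBot).1.comp hn)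
  have hC0 : ∀ C : ℝ, C ≤ max C₁ C₂ → ∀ x s, |a x| + |b x| ≤ C * Real.exp s →
      ‖Z x - (τ₀, 0)‖ ≤ M * max C₁ C₂ * Real.exp s := fun C hC x s hx => by
    rw [mul_assoc]
    refine (hZ x).trans (mul_le_mul_of_nonneg_left (hx.trans ?_) hM0.le)
    gcongr
  obtain ⟨C, hC⟩ := exists_global_exp_bound (f := fun x => Z x - (τ₀, 0)) (C := M * max C₁ C₂)
    (θ := κ / 4) (h.continuous.sub continuous_const) (by
      filter_upwards [hC₁, eventually_ge_atTop 0] with x hx hx0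
      rw [abs_of_nonneg hx0]
      exact hC0 C₁ (le_max_left _ _) x _ hx) (by
      filter_upwards [tendsto_neg_atBot_atTop.eventually hC₂, eventually_le_atBot 0] with x hx hx0
      rw [abs_of_nonpos hx0]
      simp only [neg_neg] at hx
      rw [add_comm] at hx
      exact hC0 C₂ (le_max_right _ _) x _ hx)
  exact ⟨C, κ / 4, by positivity, hC⟩

/-- Differentiable functions of the profile inherit its exponential convergence. -/
theorem exists_exp_bound_comp {E : Type*} [NormedAddCommGroup E] [NormedSpace ℝ E]
    {g : ℝ × ℝ → E} {z₀ : ℝ × ℝ} {C θ : ℝ} (hθ : 0 < θ)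
    (hZ : ∀ x, ‖Z x - z₀‖ ≤ C * Real.exp (-θ * |x|)) (hg : DifferentiableAt ℝ g z₀)
    (hcont : Continuous fun x => g (Z x)) :
    ∃ C', ∀ x, ‖g (Z x) - g z₀‖ ≤ C' * Real.exp (-θ * |x|) := by
  obtain ⟨K, hK0, hK⟩ := hg.isBigO_sub.exists_pos
  have hlim : ∀ l : Filter ℝ, Tendsto (fun x => |x|) l atTop → Tendsto Z l (𝓝 z₀) := fun l hl => by
    rw [tendsto_iff_norm_sub_tendsto_zero]
    refine squeeze_zero (fun x => norm_nonneg _) hZ ?_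
    have := (Real.tendsto_exp_atBot.comp (hl.const_mul_atTop_of_neg (neg_neg_of_pos hθ))).const_mul C
    simpa using this
  have key : ∀ l : Filter ℝ, Tendsto (fun x => |x|) l atTop →
      ∀ᶠ x in l, ‖g (Z x) - g z₀‖ ≤ K * C * Real.exp (-θ * |x|) := fun l hl => by
    filter_upwards [(hlim l hl).eventually hK.bound] with x hx
    rw [mul_assoc]
    exact hx.trans (mul_le_mul_of_nonneg_left (hZ x) hK0.le)
  exact exists_global_exp_bound (hcont.sub continuous_const) (key _ tendsto_abs_atTop_atTop)
    (key _ tendsto_abs_atBot_atTop)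

end Decay

section Coefficients
open scoped Matrix.Norms.Operator

variable {P : Params} {c q τ₀ : ℝ} {Z : ℝ → ℝ × ℝ}

theorem profileMatrix_eq_add_smul (x : ℝ) (lam : ℂ) :
    profileMatrix P c q Z x lam = profileMatrix P c q Z x 0
      + lam • (profileMatrix P c q Z x 1 - profileMatrix P c q Z x 0) := by
  ext i j
  fin_cases i <;> fin_cases j <;> simp [profileMatrix, coeffMatrix] <;> ring

theorem limitMatrix_eq_add_smul (lam : ℂ) :
    limitMatrix P c q τ₀ lam = limitMatrix P c q τ₀ 0
      + lam • (limitMatrix P c q τ₀ 1 - limitMatrix P c q τ₀ 0) := by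
  ext i j
  fin_cases i <;> fin_cases j <;> simp [limitMatrix, coeffMatrix] <;> ring

theorem differentiableAt_coeffMatrix {z : ℝ × ℝ} (ht : 0 < z.1) (hu : 0 < q - c * z.1) (lam : ℂ) :
    DifferentiableAt ℝ
      (fun z : ℝ × ℝ => coeffMatrix P c q z.1 z.2 (profileField P c q z).2 lam) z := by
  have d1 : ContDiffAt ℝ 1 (fun z : ℝ × ℝ => z.1) z := contDiffAt_fst
  have d2 : ContDiffAt ℝ 1 (fun z : ℝ × ℝ => z.2) z := contDiffAt_snd
  have d3 : ContDiffAt ℝ 1 (fun z : ℝ × ℝ => (profileField P c q z).2) z :=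
    contDiffAt_snd.comp z ((contDiffAt_profileField P c q ht hu).of_le (by norm_num))
  have du : ContDiffAt ℝ 1 (fun z : ℝ × ℝ => q - c * z.1) z :=
    contDiffAt_const.sub (contDiffAt_const.mul d1)
  have dt : ∀ e : ℝ, ContDiffAt ℝ 1 (fun z : ℝ × ℝ => z.1 ^ e) z :=
    fun e => d1.rpow_const_of_ne ht.ne'
  have duu : ∀ e : ℝ, ContDiffAt ℝ 1 (fun z : ℝ × ℝ => (q - c * z.1) ^ e) z :=
    fun e => du.rpow_const_of_ne hu.ne'
  have of : ∀ {f : ℝ × ℝ → ℝ}, ContDiffAt ℝ 1 f z →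
      ContDiffAt ℝ 1 (fun z => ((f z : ℝ) : ℂ)) z := fun hf =>
    Complex.ofRealCLM.contDiff.contDiffAt.comp z hf
  have dnum : ContDiffAt ℝ 1 (fun z : ℝ × ℝ => 1 / P.F + 2 * c * P.ν * z.2) z :=
    contDiffAt_const.add (contDiffAt_const.mul d2)
  have dα : ContDiffAt ℝ 1 (fun z : ℝ × ℝ => (1 / P.F + 2 * c * P.ν * z.2) / z.1 ^ 3) z :=
    dnum.div (d1.pow 3) (pow_ne_zero _ ht.ne')
  have dα₁ : ContDiffAt ℝ 1 (fun z : ℝ × ℝ =>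
      -3 * z.2 * (1 / P.F + 2 * c * P.ν * z.2) / z.1 ^ 4
        + 2 * c * P.ν * (profileField P c q z).2 / z.1 ^ 3) z :=
    (((contDiffAt_const.mul d2).mul dnum).div (d1.pow 4) (pow_ne_zero _ ht.ne')).add
      ((contDiffAt_const.mul d3).div (d1.pow 3) (pow_ne_zero _ ht.ne'))
  have dgτ : ContDiffAt ℝ 1
      (fun z : ℝ × ℝ => (P.s + 1) * z.1 ^ P.s * (q - c * z.1) ^ P.r) z :=
    (contDiffAt_const.mul (dt _)).mul (duu _)
  have dgu : ContDiffAt ℝ 1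
      (fun z : ℝ × ℝ => P.r * z.1 ^ (P.s + 1) * (q - c * z.1) ^ (P.r - 1)) z :=
    (contDiffAt_const.mul (dt _)).mul (duu _)
  have dsq : ContDiffAt ℝ 1 (fun z : ℝ × ℝ => z.1 ^ 2) z := d1.pow 2
  refine differentiableAt_pi.2 fun i => differentiableAt_pi.2 fun j => ?_
  refine ContDiffAt.differentiableAt (n := 1) ?_ one_ne_zero
  fin_cases i <;> fin_cases j
  · exact contDiffAt_const
  · exact contDiffAt_const
  · exact of (dsq.div_const c).neg
  · exact contDiffAt_const
  · exact contDiffAt_const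
  · exact of dsq
  · exact (((of dgτ).sub (of dα₁)).sub (((of dα).mul contDiffAt_const).div_const _)).div_const _
  · exact (contDiffAt_const.add (of dgu)).div_const _
  · exact of (((contDiffAt_const.mul dsq).add ((dα.mul dsq).div_const c)).div_const _)

theorem continuous_profileMatrix (h : IsHomoclinic P c q τ₀ Z) (lam : ℂ) :
    Continuous fun x => profileMatrix P c q Z x lam :=
  continuous_iff_continuousAt.2 fun x =>
    ((differentiableAt_coeffMatrix (P := P) (c := c) (q := q) (z := Z x) (h.tau_pos x) (h.u_pos x)
      lam).continuousAt.comp (f := Z) h.continuous.continuousAt :)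

theorem exists_asymConst (h : IsHomoclinic P c q τ₀ Z) (hs : IsSaddle P c q τ₀) (hc : c ≠ 0) :
    ∃ C θ, 0 < θ ∧ 0 ≤ C ∧ ∀ lam, AsymConst (fun x => profileMatrix P c q Z x lam)
      (limitMatrix P c q τ₀ lam) (C * (1 + ‖lam‖)) θ := by
  obtain ⟨C, θ, hθ, hC⟩ := h.exists_exp_bound hs hc
  have hrest : (profileField P c q (τ₀, 0)).2 = 0 := by rw [hs.rest]; rfl
  have key : ∀ lam, ∃ C', ∀ x, ‖profileMatrix P c q Z x lam - limitMatrix P c q τ₀ lam‖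
      ≤ C' * Real.exp (-θ * |x|) := fun lam => by
    obtain ⟨C', hC'⟩ := exists_exp_bound_comp (E := Mat3) hθ hC (differentiableAt_coeffMatrix
      (P := P) (c := c) (q := q) (z := (τ₀, 0)) hs.tau_pos hs.u_pos lam)
      (continuous_profileMatrix h lam)
    simp only [hrest] at hC'
    exact ⟨C', hC'⟩
  obtain ⟨C₀, h0⟩ := key 0
  obtain ⟨C₁, h1⟩ := key 1
  have p0 : 0 ≤ C₀ := by simpa using (norm_nonneg _).trans (h0 0)
  have p1 : 0 ≤ C₁ := by simpa using (norm_nonneg _).trans (h1 0)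
  refine ⟨C₀ + C₁, θ, hθ, by positivity, fun lam => ⟨continuous_profileMatrix h lam, fun x => ?_⟩⟩
  have e : profileMatrix P c q Z x lam - limitMatrix P c q τ₀ lam
      = (profileMatrix P c q Z x 0 - limitMatrix P c q τ₀ 0)
        + lam • ((profileMatrix P c q Z x 1 - limitMatrix P c q τ₀ 1)
        - (profileMatrix P c q Z x 0 - limitMatrix P c q τ₀ 0)) := by
    rw [profileMatrix_eq_add_smul, limitMatrix_eq_add_smul]; module
  rw [e]
  refine (norm_add_le _ _).trans ?_
  rw [norm_smul]
  have e1 := norm_sub_le (profileMatrix P c q Z x 1 - limitMatrix P c q τ₀ 1)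
    (profileMatrix P c q Z x 0 - limitMatrix P c q τ₀ 0)
  have e2 := mul_le_mul_of_nonneg_left (e1.trans (add_le_add (h1 x) (h0 x))) (norm_nonneg lam)
  refine (add_le_add (h0 x) e2).trans ?_
  have := mul_nonneg p1 (Real.exp_pos (-θ * |x|)).le
  nlinarith

/-- The trace of `A(x, λ) - A₀(λ)`. -/
def traceDefect (P : Params) (c τ₀ : ℝ) (Z : ℝ → ℝ × ℝ) (x : ℝ) : ℝ :=
  (-c * (Z x).1 ^ 2 + (1 / P.F + 2 * c * P.ν * (Z x).2) / (Z x).1 ^ 3 * (Z x).1 ^ 2 / c) / P.ν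
    - (-c * τ₀ ^ 2 + (1 / P.F) / τ₀ ^ 3 * τ₀ ^ 2 / c) / P.ν

theorem trace_sub_trace (x : ℝ) (lam : ℂ) :
    (profileMatrix P c q Z x lam).trace - (limitMatrix P c q τ₀ lam).trace
      = (traceDefect P c τ₀ Z x : ℂ) := by
  simp only [profileMatrix, limitMatrix, coeffMatrix, Matrix.trace_fin_three, traceDefect]
  simp

/-- An integrating factor for an exponentially decaying coefficient. -/
theorem exists_integrating_factor {f : ℝ → ℝ} {C θ : ℝ} (hθ : 0 < θ) (hf : Continuous f)
    (hb : ∀ x, |f x| ≤ C * Real.exp (-θ * |x|)) :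
    ∃ (k : ℝ → ℝ) (K B : ℝ), 0 < K ∧ k 0 = 1 ∧ (∀ x, HasDerivAt k (-(f x) * k x) x) ∧
      Tendsto k atBot (𝓝 K) ∧ ∀ x, 0 < k x ∧ k x ≤ B := by
  have hint : Integrable f := by
    rw [← integrableOn_univ, ← Iic_union_Ioi (a := (0 : ℝ)), integrableOn_union]
    constructor
    · refine Integrable.mono' ((integrableOn_exp_mul_Iic hθ 0).const_mul C) hf.aestronglyMeasurable ?_
      filter_upwards [ae_restrict_mem measurableSet_Iic] with x hx
      have := hb x
      rwa [abs_of_nonpos (show x ≤ 0 from hx), neg_mul_neg] at this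
    · refine Integrable.mono' ((integrableOn_exp_mul_Ioi (neg_lt_zero.2 hθ) 0).const_mul C)
        hf.aestronglyMeasurable ?_
      filter_upwards [ae_restrict_mem measurableSet_Ioi] with x hx
      have := hb x
      rwa [abs_of_pos (show 0 < x from hx)] at this
  refine ⟨fun x => Real.exp (-∫ t in (0 : ℝ)..x, f t), Real.exp (∫ t in Iic 0, f t),
    Real.exp (∫ t, |f t|), Real.exp_pos _, by simp, fun x => ?_, ?_, fun x => ⟨Real.exp_pos _, Real.exp_le_exp.2 ?_⟩⟩
  · have := (intervalIntegral.integral_hasDerivAt_right (hf.intervalIntegrable 0 x)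
      (hf.stronglyMeasurableAtFilter _ _) hf.continuousAt).neg.exp
    rwa [mul_comm] at this
  · refine (Real.continuous_exp.tendsto _).comp ?_
    have := intervalIntegral_tendsto_integral_Iic 0 hint.integrableOn tendsto_id
    refine this.congr fun x => ?_
    rw [id, intervalIntegral.integral_symm]
  · refine (neg_le_abs _).trans (le_trans (intervalIntegral.norm_integral_le_integral_norm_uIoc (f := f)) ?_)
    exact setIntegral_le_integral hint.norm (Eventually.of_forall fun x => norm_nonneg _)

end Coefficients

section LocalGap
open scoped Matrix.Norms.Operator

/-- Uniform spectral data on an open set, depending holomorphically on the parameter. -/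
structure GapFamily (M : ℂ → Mat3) (μ : ℂ → Fin 3 → ℂ) (U : Set ℂ) (g D : ℝ) : Prop where
  gap : ∀ z ∈ U, IsGapSpectrum (M z) (μ z)
  diff : DifferentiableOn ℂ (fun z => μ z 2) U
  diffProj : DifferentiableOn ℂ (fun z => gapProj (M z) (μ z)) U
  normProj : ∀ z ∈ U, ‖gapProj (M z) (μ z)‖ ≤ D
  normSub : ∀ z ∈ U, ‖M z - μ z 2 • 1‖ ≤ D
  le_zero : ∀ z ∈ U, g ≤ (μ z 0 - μ z 2).re
  le_one : ∀ z ∈ U, g ≤ (μ z 1 - μ z 2).re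
  norm_zero : ∀ z ∈ U, ‖μ z 0 - μ z 2‖ ≤ D
  norm_one : ∀ z ∈ U, ‖μ z 1 - μ z 2‖ ≤ D

/-- Sum of the principal minors of order two. -/
def minorSum (M : Mat3) : ℂ :=
  M 0 0 * M 1 1 - M 0 1 * M 1 0 + (M 0 0 * M 2 2 - M 0 2 * M 2 0)
    + (M 1 1 * M 2 2 - M 1 2 * M 2 1)

theorem charpoly_eval_eq (M : Mat3) (z : ℂ) :
    M.charpoly.eval z = z ^ 3 - M.trace * z ^ 2 + minorSum M * z - M.det := by
  rw [charpoly_eval_fin_three, Matrix.trace_fin_three, minorSum]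

theorem IsGapSpectrum.eval_charpoly {M : Mat3} {μ : Fin 3 → ℂ} (h : IsGapSpectrum M μ) (z : ℂ) :
    M.charpoly.eval z = (z - μ 0) * (z - μ 1) * (z - μ 2) := by
  rw [h.1]; simp [Fin.prod_univ_three]

theorem abs_re_le_of_sq {s s₀ d d₀ : ℂ} (h : s ^ 2 = d) (h₀ : s₀ ^ 2 = d₀) :
    |s.re| ≤ |s₀.re| + Real.sqrt ‖d - d₀‖ := by
  have hprod : ‖s - s₀‖ * ‖s + s₀‖ = ‖d - d₀‖ := by
    rw [← norm_mul, ← h, ← h₀]; congr 1; ring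
  rcases le_total ‖s - s₀‖ ‖s + s₀‖ with hle | hle
  · have h1 : ‖s - s₀‖ ≤ Real.sqrt ‖d - d₀‖ := Real.le_sqrt_of_sq_le (by
      rw [← hprod, sq]; exact mul_le_mul_of_nonneg_left hle (norm_nonneg _))
    have h2 := (Complex.abs_re_le_norm (s - s₀)).trans h1
    have h3 := abs_add_le (s - s₀).re s₀.re
    rw [Complex.sub_re, sub_add_cancel] at h3
    rw [Complex.sub_re] at h2
    linarith
  · have h1 : ‖s + s₀‖ ≤ Real.sqrt ‖d - d₀‖ := Real.le_sqrt_of_sq_le (by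
      rw [← hprod, sq]; exact mul_le_mul_of_nonneg_right hle (norm_nonneg _))
    have h2 := (Complex.abs_re_le_norm (s + s₀)).trans h1
    have h3 := abs_sub (s + s₀).re s₀.re
    rw [Complex.add_re, add_sub_cancel_right] at h3
    rw [Complex.add_re] at h2
    linarith

/-- A simple eigenvalue of a holomorphic family of matrices continues holomorphically. -/
theorem exists_local_eigenvalue {B E : Mat3} {z₀ : ℂ} {μ : Fin 3 → ℂ}
    (h : IsGapSpectrum (B + z₀ • E) μ) :
    ∃ m : ℂ → ℂ, m z₀ = μ 2 ∧ (∀ᶠ z in 𝓝 z₀, DifferentiableAt ℂ m z) ∧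
      ∀ᶠ z in 𝓝 z₀, (B + z • E).charpoly.eval (m z) = 0 := by
  set f : ℂ × ℂ → ℂ := fun v => (B + v.1 • E).charpoly.eval v.2 with hf
  have hfc : ContDiff ℂ 1 f := by
    simp only [hf, charpoly_eval_fin_three, Matrix.det_fin_three, Matrix.add_apply,
      Matrix.smul_apply, smul_eq_mul]
    fun_prop
  have hval : f (z₀, μ 2) = 0 := by simp only [hf, h.eval_charpoly]; ring
  have hder : fderiv ℂ f (z₀, μ 2) (0, 1) = (μ 2 - μ 0) * (μ 2 - μ 1) := by
    have h1 : HasDerivAt (fun w : ℂ => f (z₀, w)) (fderiv ℂ f (z₀, μ 2) (0, 1)) (μ 2) :=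
      ((hfc.differentiable (by norm_num)) (z₀, μ 2)).hasFDerivAt.comp_hasDerivAt (μ 2)
        ((hasDerivAt_const (μ 2) z₀).prodMk (hasDerivAt_id (μ 2)))
    have h2 : HasDerivAt (fun w : ℂ => (w - μ 0) * (w - μ 1) * (w - μ 2))
        ((μ 2 - μ 0) * (μ 2 - μ 1)) (μ 2) := by
      have := (((hasDerivAt_id (μ 2)).sub_const (μ 0)).mul
        ((hasDerivAt_id (μ 2)).sub_const (μ 1))).mul ((hasDerivAt_id (μ 2)).sub_const (μ 2))
      convert! this using 1
      simp
    have e : (fun w : ℂ => f (z₀, w)) = fun w => (w - μ 0) * (w - μ 1) * (w - μ 2) :=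
      funext fun w => h.eval_charpoly w
    rw [e] at h1
    exact h1.unique h2
  have hinv : (fderiv ℂ f (z₀, μ 2) ∘L .inr ℂ ℂ ℂ).IsInvertible := by
    refine ⟨ContinuousLinearEquiv.unitsEquivAut ℂ (Units.mk0 _ h.den_ne_zero), ?_⟩
    ext
    simp [hder]
  have cdf : ContDiffAt ℂ 1 f (z₀, μ 2) := hfc.contDiffAt
  refine ⟨cdf.implicitFunction one_ne_zero hinv, cdf.implicitFunction_apply_self _ _, ?_, ?_⟩
  · have := (cdf.contDiffAt_implicitFunction one_ne_zero hinv).eventually (by simp)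
    exact this.mono fun z hz => hz.differentiableAt one_ne_zero
  · have := cdf.eventually_apply_implicitFunction one_ne_zero hinv
    rwa [hval] at this

theorem exists_gapFamily {B E : Mat3} {z₀ : ℂ} {μ₀ : Fin 3 → ℂ}
    (h : IsGapSpectrum (B + z₀ • E) μ₀) :
    ∃ (U : Set ℂ) (μ : ℂ → Fin 3 → ℂ) (g D : ℝ), IsOpen U ∧ z₀ ∈ U ∧ 0 < g ∧
      GapFamily (fun z => B + z • E) μ U g D := by
  obtain ⟨m, hm0, hmd, hmz⟩ := exists_local_eigenvalue h
  set M : ℂ → Mat3 := fun z => B + z • E with hM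
  have hTd : Differentiable ℂ fun z => (M z).trace := by
    simp only [hM, Matrix.trace_fin_three, Matrix.add_apply, Matrix.smul_apply, smul_eq_mul]
    fun_prop
  have hSd : Differentiable ℂ fun z => minorSum (M z) := by
    simp only [hM, minorSum, Matrix.add_apply, Matrix.smul_apply, smul_eq_mul]
    fun_prop
  have hMd : Differentiable ℂ M := (differentiable_id.smul_const E).const_add B
  set b : ℂ → ℂ := fun z => m z - (M z).trace with hb
  set e : ℂ → ℂ := fun z => minorSum (M z) + m z * b z with he
  have hbd : ∀ᶠ z in 𝓝 z₀, DifferentiableAt ℂ b z := hmd.mono fun z hz => hz.sub (hTd z)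
  have hed : ∀ᶠ z in 𝓝 z₀, DifferentiableAt ℂ e z := by
    filter_upwards [hmd, hbd] with z h1 h2 using (hSd z).add (h1.mul h2)
  choose s hs using fun z => IsAlgClosed.exists_pow_nat_eq (b z ^ 2 - 4 * e z) (n := 2) two_pos
  let μ : ℂ → Fin 3 → ℂ := fun z => ![(-b z + s z) / 2, (-b z - s z) / 2, m z]
  have hsum : ∀ z, μ z 0 + μ z 1 = -b z := fun z => by simp [μ]; ring
  have hprod : ∀ z, μ z 0 * μ z 1 = e z := fun z => by
    simp only [μ, Matrix.cons_val_zero, Matrix.cons_val_one]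
    linear_combination (-1 / 4) * hs z
  have hb0 : b z₀ = -(μ₀ 0 + μ₀ 1) := by
    have := h.trace
    simp only [hb, hM, hm0, this]; ring
  have he0 : e z₀ = μ₀ 0 * μ₀ 1 := by
    have := h.coeffs.2.1
    simp only [he, hb0, hm0]
    rw [show minorSum (M z₀) = _ from this]
    ring
  have hcont : ∀ {f : ℂ → ℂ}, (∀ᶠ z in 𝓝 z₀, DifferentiableAt ℂ f z) → ContinuousAt f z₀ :=
    fun hf => hf.self_of_nhds.continuousAt
  have cb := hcont hbd
  have ce := hcont hed
  have cm := hcont hmd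
  set gap := min (μ₀ 0).re (μ₀ 1).re - (μ₀ 2).re with hgap
  have hgap0 : 0 < gap := by
    have := lt_min h.2.1 h.2.2
    linarith
  have hfac : ∀ z, (M z).charpoly.eval (m z) = 0 →
      (M z).charpoly = ∏ j, (Polynomial.X - Polynomial.C (μ z j)) := by
    intro z hz
    have h1 := hsum z
    have h2 := hprod z
    rw [charpoly_eval_eq] at hz
    have e2 : μ z 2 = m z := rfl
    refine Polynomial.funext fun w => ?_
    rw [charpoly_eval_eq]
    simp only [Fin.prod_univ_three, Polynomial.eval_mul, Polynomial.eval_sub, Polynomial.eval_X,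
      Polynomial.eval_C, e2]
    have hee : e z = minorSum (M z) + m z * (m z - (M z).trace) := rfl
    have hbb : b z = m z - (M z).trace := rfl
    rw [hee] at h2
    rw [hbb] at h1
    linear_combination (w - m z) * w * h1 - (w - m z) * h2 + hz
  -- lower bound for the real parts
  set G : ℂ → ℝ := fun z => -(b z).re / 2 - (|(μ₀ 0 - μ₀ 1).re|
    + Real.sqrt ‖(b z ^ 2 - 4 * e z) - (b z₀ ^ 2 - 4 * e z₀)‖) / 2 - (m z).re with hG
  have hGc : ContinuousAt G z₀ := by fun_prop
  have hG0 : G z₀ = gap := by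
    simp only [hG, sub_self, norm_zero, Real.sqrt_zero, hb0, hm0, hgap]
    rcases le_total (μ₀ 0).re (μ₀ 1).re with hle | hle
    · rw [min_eq_left hle, Complex.sub_re, abs_of_nonpos (by linarith)]
      simp; ring
    · rw [min_eq_right hle, Complex.sub_re, abs_of_nonneg (by linarith)]
      simp; ring
  have hs0 : (μ₀ 0 - μ₀ 1) ^ 2 = b z₀ ^ 2 - 4 * e z₀ := by rw [hb0, he0]; ring
  have hle : ∀ z, G z ≤ (μ z 0 - μ z 2).re ∧ G z ≤ (μ z 1 - μ z 2).re := by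
    intro z
    have h1 := abs_re_le_of_sq (hs z) hs0
    have h2 := neg_abs_le (s z).re
    have h3 := le_abs_self (s z).re
    have e0 : (μ z 0 - μ z 2).re = (-(b z).re + (s z).re) / 2 - (m z).re := by
      simp [μ]
    have e1 : (μ z 1 - μ z 2).re = (-(b z).re - (s z).re) / 2 - (m z).re := by
      simp [μ]
    rw [e0, e1]
    constructor <;> simp only [hG] <;> linarith
  have hGpos : ∀ᶠ z in 𝓝 z₀, gap / 2 < G z := by
    refine hGc.eventually (lt_mem_nhds ?_)
    rw [hG0]; linarith
  -- upper bounds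
  have hsn : ∀ z, ‖s z‖ ≤ 1 + ‖b z ^ 2 - 4 * e z‖ := fun z => by
    have := congrArg norm (hs z)
    rw [norm_pow] at this
    nlinarith [norm_nonneg (s z), sq_nonneg (‖s z‖ - 1)]
  set H : ℂ → ℝ := fun z => ‖b z‖ + (1 + ‖b z ^ 2 - 4 * e z‖) + ‖m z‖ with hH
  have hHc : ContinuousAt H z₀ := by fun_prop
  have hupper : ∀ z, ‖μ z 0 - μ z 2‖ ≤ H z ∧ ‖μ z 1 - μ z 2‖ ≤ H z := by
    intro z
    have h1 := hsn z
    have n1 := norm_nonneg (b z)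
    have n2 := norm_nonneg (s z)
    have e0 : μ z 0 - μ z 2 = (-b z + s z) / 2 - m z := rfl
    have e1 : μ z 1 - μ z 2 = (-b z - s z) / 2 - m z := rfl
    have f0 : ‖(-b z + s z) / 2‖ ≤ (‖b z‖ + ‖s z‖) / 2 := by
      rw [norm_div, Complex.norm_ofNat]
      have := norm_add_le (-b z) (s z)
      rw [norm_neg] at this
      linarith
    have f1 : ‖(-b z - s z) / 2‖ ≤ (‖b z‖ + ‖s z‖) / 2 := by
      rw [norm_div, Complex.norm_ofNat]
      have := norm_sub_le (-b z) (s z)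
      rw [norm_neg] at this
      linarith
    rw [e0, e1]
    constructor
    · have := norm_sub_le ((-b z + s z) / 2) (m z)
      simp only [hH]; linarith
    · have := norm_sub_le ((-b z - s z) / 2) (m z)
      simp only [hH]; linarith
  have hN : ContinuousAt (fun z => ‖M z - m z • (1 : Mat3)‖) z₀ :=
    ((hMd.continuous.continuousAt).sub (cm.smul continuousAt_const)).norm
  set Q : ℂ → Mat3 := fun z => (m z ^ 2 + b z * m z + e z)⁻¹ •
    (M z * M z + b z • M z + e z • (1 : Mat3)) with hQ
  have hPQ : ∀ z, gapProj (M z) (μ z) = Q z := fun z => by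
    rw [gapProj_eq, hsum, hprod, hQ]
    have e2 : μ z 2 = m z := rfl
    rw [e2]
    simp only [neg_mul, neg_smul, sub_neg_eq_add]
  have hQd : ∀ᶠ z in 𝓝 z₀, DifferentiableAt ℂ Q z := by
    filter_upwards [hmd, hbd, hed, hGpos] with z h1 h2 h3 h4
    have hne : m z ^ 2 + b z * m z + e z ≠ 0 := by
      have e0 : m z ^ 2 + b z * m z + e z = (m z - μ z 0) * (m z - μ z 1) := by
        rw [← hprod, show b z = -(μ z 0 + μ z 1) by rw [hsum, neg_neg]]; ring
      rw [e0]
      refine mul_ne_zero (sub_ne_zero.2 fun hh => ?_) (sub_ne_zero.2 fun hh => ?_)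
      · have := (hle z).1
        rw [← hh, show μ z 2 = m z from rfl, sub_self, Complex.zero_re] at this
        linarith
      · have := (hle z).2
        rw [← hh, show μ z 2 = m z from rfl, sub_self, Complex.zero_re] at this
        linarith
    exact ((((h1.pow 2).add (h2.mul h1)).add h3).inv hne).smul
      ((((hMd z).mul (hMd z)).add (h2.smul (hMd z))).add (h3.smul_const 1))
  have hQc : ContinuousAt (fun z => ‖Q z‖) z₀ := hQd.self_of_nhds.continuousAt.norm
  set D := max (H z₀ + 1) (max (‖M z₀ - m z₀ • (1 : Mat3)‖ + 1) (‖Q z₀‖ + 1)) with hD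
  have hall : ∀ᶠ z in 𝓝 z₀, DifferentiableAt ℂ m z ∧ (M z).charpoly.eval (m z) = 0 ∧
      gap / 2 < G z ∧ DifferentiableAt ℂ Q z ∧ H z < H z₀ + 1 ∧
      ‖M z - m z • (1 : Mat3)‖ < ‖M z₀ - m z₀ • (1 : Mat3)‖ + 1 ∧ ‖Q z‖ < ‖Q z₀‖ + 1 :=
    hmd.and (hmz.and (hGpos.and (hQd.and ((hHc.eventually (gt_mem_nhds (lt_add_one _))).and
      ((hN.eventually (gt_mem_nhds (lt_add_one _))).and
        (hQc.eventually (gt_mem_nhds (lt_add_one _))))))))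
  obtain ⟨U, hU, hUo, hUz⟩ := eventually_nhds_iff.1 hall
  refine ⟨U, μ, gap / 2, D, hUo, hUz, by positivity, ⟨fun z hz => ⟨hfac z (hU z hz).2.1, ?_, ?_⟩,
    fun z hz => (hU z hz).1.differentiableWithinAt, ?_, fun z hz => ?_, fun z hz => ?_,
    fun z hz => (hU z hz).2.2.1.le.trans (hle z).1, fun z hz => (hU z hz).2.2.1.le.trans (hle z).2,
    fun z hz => ((hupper z).1.trans (hU z hz).2.2.2.2.1.le).trans (le_max_left _ _),
    fun z hz => ((hupper z).2.trans (hU z hz).2.2.2.2.1.le).trans (le_max_left _ _)⟩⟩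
  · have := (hU z hz).2.2.1.le.trans (hle z).1
    rw [Complex.sub_re] at this; linarith
  · have := (hU z hz).2.2.1.le.trans (hle z).2
    rw [Complex.sub_re] at this; linarith
  · simp only [hPQ]
    exact fun z hz => (hU z hz).2.2.2.1.differentiableWithinAt
  · rw [hPQ]
    exact (hU z hz).2.2.2.2.2.2.le.trans ((le_max_right _ _).trans (le_max_right _ _))
  · exact (hU z hz).2.2.2.2.2.1.le.trans ((le_max_left _ _).trans (le_max_right _ _))

end LocalGap

section Evans
open scoped Matrix.Norms.Operator

theorem GapFamily.mono {M : ℂ → Mat3} {μ : ℂ → Fin 3 → ℂ} {U V : Set ℂ} {g D : ℝ}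
    (h : GapFamily M μ U g D) (hV : V ⊆ U) : GapFamily M μ V g D :=
  ⟨fun z hz => h.gap z (hV hz), h.diff.mono hV, h.diffProj.mono hV,
    fun z hz => h.normProj z (hV hz), fun z hz => h.normSub z (hV hz),
    fun z hz => h.le_zero z (hV hz), fun z hz => h.le_one z (hV hz),
    fun z hz => h.norm_zero z (hV hz), fun z hz => h.norm_one z (hV hz)⟩

theorem AsymConst.mono {A : ℝ → Mat3} {A₀ : Mat3} {C C' θ : ℝ} (h : AsymConst A A₀ C θ)
    (hC : C ≤ C') : AsymConst A A₀ C' θ :=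
  ⟨h.cont, fun x => (h.bound x).trans (mul_le_mul_of_nonneg_right hC (Real.exp_pos _).le)⟩

theorem GapFamily.exists_fastPair {A : ℂ → ℝ → Mat3} {A₀ : ℂ → Mat3} {μ : ℂ → Fin 3 → ℂ}
    {U : Set ℂ} {C θ g D : ℝ} (hU : IsOpen U) (hθ : 0 < θ) (hg : 0 < g)
    (h : GapFamily A₀ μ U g D) (hA : ∀ z ∈ U, AsymConst (A z) (A₀ z) C θ)
    (hAd : ∀ x, DifferentiableOn ℂ (fun z => A z x) U) (hA₀ : DifferentiableOn ℂ A₀ U) :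
    ∃ X Y : ℂ → ℝ → Mat3,
      (∀ z ∈ U, FastPair (A z) (μ z 2) (gapProj (A₀ z) (μ z)) (X z) (Y z)) ∧
      (∀ x, DifferentiableOn ℂ (fun z => X z x) U) ∧
      (∀ x, DifferentiableOn ℂ (fun z => Y z x) U) ∧
      ∃ B, ∀ z ∈ U, (∀ x, 0 ≤ x → ‖X z x‖ ≤ B) ∧ ∀ x ≤ 0, ‖Y z x‖ ≤ B :=
  StVenant.exists_fastPair (𝔸 := Mat3) hU hθ hg hA hAd hA₀ (fun z hz => (h.gap z hz).cubic)
    (fun z hz => (h.gap z hz).sub_mul_gapProj) (fun z hz => (h.gap z hz).gapProj_mul_sub) h.diff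
    h.diffProj h.normProj h.normSub h.le_zero h.le_one h.norm_zero h.norm_one

variable {P : Params} {c q τ₀ : ℝ} {Z : ℝ → ℝ × ℝ}

/-- The eigenvalue parameters at which the spectrum of the limiting matrix splits. -/
def gapSet (P : Params) (c q τ₀ : ℝ) : Set ℂ :=
  {lam | ∃ μ, IsGapSpectrum (limitMatrix P c q τ₀ lam) μ}

theorem extendedSplittingRegion_subset : extendedSplittingRegion P c q τ₀ ⊆ gapSet P c q τ₀ := by
  rintro lam ⟨S, -, hS, -, h⟩
  exact h lam hS

theorem limitMatrix_eq : limitMatrix P c q τ₀ = fun lam => limitMatrix P c q τ₀ 0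
      + lam • (limitMatrix P c q τ₀ 1 - limitMatrix P c q τ₀ 0) :=
  funext limitMatrix_eq_add_smul

theorem differentiable_profileMatrix (x : ℝ) :
    Differentiable ℂ fun lam => profileMatrix P c q Z x lam := by
  have e : (fun lam => profileMatrix P c q Z x lam) = fun lam => profileMatrix P c q Z x 0
      + lam • (profileMatrix P c q Z x 1 - profileMatrix P c q Z x 0) :=
    funext (profileMatrix_eq_add_smul x)
  rw [e]
  exact (differentiable_id.smul_const _).const_add _

theorem differentiable_limitMatrix : Differentiable ℂ (limitMatrix P c q τ₀) := by
  rw [limitMatrix_eq]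
  exact (differentiable_id.smul_const _).const_add _

/-- Local holomorphic families of normalized fast solutions for the linearization. -/
structure LocalFamily (P : Params) (c q τ₀ : ℝ) (Z : ℝ → ℝ × ℝ) (U : Set ℂ)
    (μ : ℂ → Fin 3 → ℂ) (X Y : ℂ → ℝ → Mat3) (g D B : ℝ) : Prop where
  isOpen : IsOpen U
  pos : 0 < g
  family : GapFamily (limitMatrix P c q τ₀) μ U g D
  fast : ∀ z ∈ U, FastPair (fun x => profileMatrix P c q Z x z) (μ z 2)
    (gapProj (limitMatrix P c q τ₀ z) (μ z)) (X z) (Y z)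
  diffX : ∀ x, DifferentiableOn ℂ (fun z => X z x) U
  diffY : ∀ x, DifferentiableOn ℂ (fun z => Y z x) U
  boundX : ∀ z ∈ U, ∀ x, 0 ≤ x → ‖X z x‖ ≤ B
  boundY : ∀ z ∈ U, ∀ x ≤ 0, ‖Y z x‖ ≤ B

theorem exists_localFamily (h : IsHomoclinic P c q τ₀ Z) (hs : IsSaddle P c q τ₀) (hc : c ≠ 0)
    {lam : ℂ} (hlam : lam ∈ gapSet P c q τ₀) :
    ∃ U μ X Y g D B, lam ∈ U ∧ LocalFamily P c q τ₀ Z U μ X Y g D B := by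
  obtain ⟨μ₀, hμ₀⟩ := hlam
  rw [limitMatrix_eq_add_smul] at hμ₀
  obtain ⟨U, μ, g, D, hU, hlU, hg, hF⟩ := exists_gapFamily hμ₀
  rw [← limitMatrix_eq] at hF
  obtain ⟨C, θ, hθ, hC, hA⟩ := exists_asymConst h hs hc
  have hF' := hF.mono (inter_subset_left (t := Metric.ball lam 1))
  obtain ⟨X, Y, h1, h2, h3, B, h4⟩ := hF'.exists_fastPair
    (A := fun z x => profileMatrix P c q Z x z) (C := C * (2 + ‖lam‖))
    (hU.inter Metric.isOpen_ball) hθ hg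
    (fun z hz => (hA z).mono (by
      have : ‖z‖ ≤ 1 + ‖lam‖ := by
        have h1 : ‖z - lam‖ < 1 := by simpa [dist_eq_norm] using hz.2
        have h2 := norm_add_le (z - lam) lam
        rw [sub_add_cancel] at h2
        linarith
      exact mul_le_mul_of_nonneg_left (by linarith) hC))
    (fun x => (differentiable_profileMatrix x).differentiableOn)
    differentiable_limitMatrix.differentiableOn
  exact ⟨_, μ, X, Y, g, D, B, mem_inter hlU (Metric.mem_ball_self one_pos),
    hU.inter Metric.isOpen_ball, hg, hF', h1, h2, h3, fun z hz => (h4 z hz).1, fun z hz => (h4 z hz).2⟩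

theorem continuous_traceDefect (h : IsHomoclinic P c q τ₀ Z) :
    Continuous (traceDefect P c τ₀ Z) := by
  have h1 : Continuous fun x => (Z x).1 := continuous_fst.comp h.continuous
  have h2 : Continuous fun x => (Z x).2 := continuous_snd.comp h.continuous
  have h3 : ∀ x, (Z x).1 ^ 3 ≠ 0 := fun x => pow_ne_zero _ (h.tau_pos x).ne'
  unfold traceDefect
  refine Continuous.sub (Continuous.div_const (Continuous.add (by fun_prop) (Continuous.div_const
    (Continuous.mul (Continuous.div (by fun_prop) (by fun_prop) h3) (by fun_prop)) _)) _)
    continuous_const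

/-- The Evans function in terms of normalized fast solutions. -/
theorem exists_evans_eq_trace (h : IsHomoclinic P c q τ₀ Z) (hs : IsSaddle P c q τ₀) (hc : c ≠ 0) :
    ∃ K : ℝ, 0 < K ∧ ∀ lam μ X Y, IsGapSpectrum (limitMatrix P c q τ₀ lam) μ →
      FastPair (fun x => profileMatrix P c q Z x lam) (μ 2)
        (gapProj (limitMatrix P c q τ₀ lam) μ) X Y →
      (∀ δ, IsEvansValue (fun x => profileMatrix P c q Z x lam) (limitMatrix P c q τ₀ lam) δ ↔
        δ = K * (Y 0 * X 0).trace) ∧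
      evans P c q τ₀ Z lam = K * (Y 0 * X 0).trace := by
  obtain ⟨C, θ, hθ, hC, hA⟩ := exists_asymConst h hs hc
  obtain ⟨k, K, -, hK, hk0, hk, hkK, -⟩ := exists_integrating_factor (f := traceDefect P c τ₀ Z)
    (C := C * (1 + ‖(0 : ℂ)‖) * 3) (θ := θ) hθ (continuous_traceDefect h) (fun x => by
      have h1 := (hA 0).bound x
      have h2 : ∀ M : Mat3, ‖M.trace‖ ≤ 3 * ‖M‖ := fun M => by
        have e : ∀ i, ‖M i i‖ ≤ ‖M‖ := fun i => by
          have h1 := Matrix.linfty_opNorm_mulVec M (Pi.single i 1)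
          have h2 : ‖(Pi.single i 1 : Fin 3 → ℂ)‖ = 1 := by
            rw [Pi.norm_single, norm_one]
          rw [h2, mul_one] at h1
          refine le_trans ?_ h1
          have := norm_le_pi_norm (M.mulVec (Pi.single i 1)) i
          simpa using this
        rw [Matrix.trace_fin_three]
        have := norm_add₃_le (a := M 0 0) (b := M 1 1) (c := M 2 2)
        linarith [e 0, e 1, e 2]
      have h3 := h2 (profileMatrix P c q Z x 0 - limitMatrix P c q τ₀ 0)
      rw [Matrix.trace_sub, trace_sub_trace, Complex.norm_real, Real.norm_eq_abs] at h3
      refine h3.trans ((mul_le_mul_of_nonneg_left h1 (by norm_num)).trans (le_of_eq ?_))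
      ring)
  refine ⟨K, hK, fun lam μ X Y hμ hF => ?_⟩
  have hex := exists_isEvansValue hθ (hA lam) hμ hF
  have key : ∀ δ, IsEvansValue (fun x => profileMatrix P c q Z x lam) (limitMatrix P c q τ₀ lam) δ →
      δ = K * (Y 0 * X 0).trace := fun δ hδ => by
    refine IsEvansValue.eq_trace hμ hF (k := fun x => (k x : ℂ))
      (f := fun x => (traceDefect P c τ₀ Z x : ℂ)) (fun x => trace_sub_trace x lam) (by simp [hk0])
      (fun x => ?_) ((Complex.continuous_ofReal.tendsto K).comp hkK) hδ
    have := (hk x).ofReal_comp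
    simpa using this
  refine ⟨fun δ => ⟨key δ, ?_⟩, ?_⟩
  · rintro rfl
    obtain ⟨δ, hδ⟩ := hex
    rwa [← key δ hδ]
  · rw [evans, dif_pos hex]
    exact key _ hex.choose_spec

theorem existsUnique_isEvansValue (h : IsHomoclinic P c q τ₀ Z) (hs : IsSaddle P c q τ₀)
    (hc : c ≠ 0) {lam : ℂ} (hlam : lam ∈ gapSet P c q τ₀) :
    ∃! δ, IsEvansValue (fun x => profileMatrix P c q Z x lam) (limitMatrix P c q τ₀ lam) δ := by
  obtain ⟨U, μ, X, Y, g, D, B, hl, hL⟩ := exists_localFamily h hs hc hlam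
  obtain ⟨K, hK, hev⟩ := exists_evans_eq_trace h hs hc
  have := (hev lam _ _ _ (hL.family.gap lam hl) (hL.fast lam hl)).1
  exact ⟨_, (this _).2 rfl, fun δ hδ => (this δ).1 hδ⟩

theorem analyticAt_evans (h : IsHomoclinic P c q τ₀ Z) (hs : IsSaddle P c q τ₀)
    (hc : c ≠ 0) {lam : ℂ} (hlam : lam ∈ gapSet P c q τ₀) :
    AnalyticAt ℂ (evans P c q τ₀ Z) lam := by
  obtain ⟨U, μ, X, Y, g, D, B, hl, hL⟩ := exists_localFamily h hs hc hlam
  obtain ⟨K, hK, hev⟩ := exists_evans_eq_trace h hs hc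
  have hd : DifferentiableOn ℂ (fun z => (K : ℂ) * (Y z 0 * X z 0).trace) U := by
    have h1 : DifferentiableOn ℂ (fun z => Y z 0 * X z 0) U := (hL.diffY 0).mul (hL.diffX 0)
    have h2 : ∀ i, DifferentiableOn ℂ (fun z => (Y z 0 * X z 0) i i) U := fun i =>
      differentiableOn_pi.1 (differentiableOn_pi.1 h1 i) i
    simp only [Matrix.trace_fin_three]
    exact (((h2 0).add (h2 1)).add (h2 2)).const_mul _
  have ha := hd.analyticAt (hL.isOpen.mem_nhds hl)
  refine ha.congr ?_
  filter_upwards [hL.isOpen.mem_nhds hl] with z hz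
  exact (hev z _ _ _ (hL.family.gap z hz) (hL.fast z hz)).2.symm

/-! ### Reflection symmetry -/

/-- Entrywise complex conjugation. -/
def conjMat (M : Mat3) : Mat3 := M.map (starRingEnd ℂ)

theorem conjMat_mul (M N : Mat3) : conjMat (M * N) = conjMat M * conjMat N := Matrix.map_mul
theorem conjMat_sub (M N : Mat3) : conjMat (M - N) = conjMat M - conjMat N := by
  ext; simp [conjMat]
theorem conjMat_neg (M : Mat3) : conjMat (-M) = -conjMat M := by
  ext; simp [conjMat]
theorem conjMat_smul (a : ℂ) (M : Mat3) : conjMat (a • M) = starRingEnd ℂ a • conjMat M := by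
  ext; simp [conjMat]
theorem conjMat_one : conjMat 1 = 1 := Matrix.map_one _ (map_zero _) (map_one _)
theorem conjMat_conjMat (M : Mat3) : conjMat (conjMat M) = M := by
  ext; simp [conjMat]
theorem conjMat_zero : conjMat 0 = 0 := by ext; simp [conjMat]
theorem trace_conjMat (M : Mat3) : (conjMat M).trace = starRingEnd ℂ M.trace := by
  simp [conjMat, Matrix.trace_fin_three]
theorem continuous_conjMat : Continuous conjMat :=
  continuous_id.matrix_map Complex.continuous_conj

theorem hasDerivAt_conjMat {M : ℝ → Mat3} {M' : Mat3} {x : ℝ} (h : HasDerivAt M M' x) :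
    HasDerivAt (fun x => conjMat (M x)) (conjMat M') x := by
  rw [hasDerivAt_matrix_iff] at h ⊢
  exact fun i j => (Complex.conjCLE.toContinuousLinearMap.hasFDerivAt.comp_hasDerivAt x (h i j) :)

theorem FastPair.conj {A : ℝ → Mat3} {m : ℂ} {p : Mat3} {X Y : ℝ → Mat3}
    (h : FastPair A m p X Y) :
    FastPair (fun x => conjMat (A x)) (starRingEnd ℂ m) (conjMat p) (fun x => conjMat (X x))
      (fun x => conjMat (Y x)) := by
  have e : ∀ x, conjMat (A x - m • 1) = conjMat (A x) - starRingEnd ℂ m • 1 := fun x => by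
    rw [conjMat_sub, conjMat_smul, conjMat_one]
  have e' : ∀ x, A x - m • 1 = conjMat (conjMat (A x) - starRingEnd ℂ m • 1) := fun x => by
    rw [← e, conjMat_conjMat]
  refine ⟨fun x => ?_, (continuous_conjMat.tendsto _).comp h.limX, fun x => ?_,
    (continuous_conjMat.tendsto _).comp h.limY, fun w hw hw0 x => ?_, fun w hw hw0 x => ?_⟩
  · rw [← e, ← conjMat_mul]; exact hasDerivAt_conjMat (h.derivX x)
  · rw [← e, ← conjMat_mul, ← conjMat_neg]; exact hasDerivAt_conjMat (h.derivY x)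
  · have := h.uniqueX (fun x => conjMat (w x)) (fun x => by
      rw [e', ← conjMat_mul]; exact hasDerivAt_conjMat (hw x)) (by
      have := (continuous_conjMat.tendsto _).comp hw0
      rwa [conjMat_zero] at this) x
    rw [← conjMat_conjMat (w x), this, conjMat_zero]
  · have := h.uniqueY (fun x => conjMat (w x)) (fun x => by
      rw [e', ← conjMat_mul, ← conjMat_neg]; exact hasDerivAt_conjMat (hw x)) (by
      have := (continuous_conjMat.tendsto _).comp hw0
      rwa [conjMat_zero] at this) x
    rw [← conjMat_conjMat (w x), this, conjMat_zero]

theorem IsGapSpectrum.conj {M : Mat3} {μ : Fin 3 → ℂ} (h : IsGapSpectrum M μ) :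
    IsGapSpectrum (conjMat M) (fun j => starRingEnd ℂ (μ j)) := by
  obtain ⟨h1, h2, h3⟩ := h.coeffs
  refine ⟨eq_prod_of_charpoly_coeffs ?_ ?_ ?_, by simpa using h.2.1, by simpa using h.2.2⟩
  · simpa [conjMat] using congrArg (starRingEnd ℂ) h1
  · simpa [conjMat] using congrArg (starRingEnd ℂ) h2
  · rw [← map_mul, ← map_mul, ← h3]
    exact ((starRingEnd ℂ).map_det M).symm

theorem gapProj_conj (M : Mat3) (μ : Fin 3 → ℂ) :
    gapProj (conjMat M) (fun j => starRingEnd ℂ (μ j)) = conjMat (gapProj M μ) := by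
  rw [gapProj, gapProj, conjMat_smul, conjMat_mul, conjMat_sub, conjMat_sub, conjMat_smul,
    conjMat_smul, conjMat_one]
  simp

theorem coeffMatrix_conj (t t₁ t₂ : ℝ) (lam : ℂ) :
    conjMat (coeffMatrix P c q t t₁ t₂ lam) = coeffMatrix P c q t t₁ t₂ (starRingEnd ℂ lam) := by
  ext i j
  fin_cases i <;> fin_cases j <;> simp [conjMat, coeffMatrix, map_ofNat]

theorem evans_conj (h : IsHomoclinic P c q τ₀ Z) (hs : IsSaddle P c q τ₀) (hc : c ≠ 0) {lam : ℂ}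
    (hlam : lam ∈ gapSet P c q τ₀) :
    evans P c q τ₀ Z (starRingEnd ℂ lam) = starRingEnd ℂ (evans P c q τ₀ Z lam) := by
  obtain ⟨U, μ, X, Y, g, D, B, hl, hL⟩ := exists_localFamily h hs hc hlam
  obtain ⟨K, hK, hev⟩ := exists_evans_eq_trace h hs hc
  have e1 := (hev lam _ _ _ (hL.family.gap lam hl) (hL.fast lam hl)).2
  have hg := (hL.family.gap lam hl).conj
  have hf := (hL.fast lam hl).conj
  rw [← gapProj_conj] at hf
  simp only [profileMatrix, limitMatrix, coeffMatrix_conj] at hg hf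
  have e2 := (hev (starRingEnd ℂ lam) _ _ _ hg hf).2
  rw [e2, e1, ← conjMat_mul, trace_conjMat, map_mul, Complex.conj_ofReal]

end Evans

section RealAxis

variable {P : Params} {c q τ₀ : ℝ}

theorem exists_neg_root_cubic {T p₁ p₀ : ℝ} (h1 : p₁ < 0) (h0 : 0 ≤ p₀) :
    ∃ m < 0, m ^ 3 - T * m ^ 2 + p₁ * m + p₀ = 0 := by
  set f : ℝ → ℝ := fun z => z ^ 3 - T * z ^ 2 + p₁ * z + p₀ with hf
  have hc : Continuous f := by fun_prop
  have hT : 0 ≤ |T| := abs_nonneg T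
  have hT1 := neg_abs_le T
  have hT2 := le_abs_self T
  obtain ⟨ε, hε0, hε1, hε2⟩ : ∃ ε : ℝ, 0 < ε ∧ ε ≤ 1 ∧ ε * (1 + |T|) ≤ -p₁ / 2 := by
    refine ⟨min 1 (-p₁ / 2 / (1 + |T|)), lt_min one_pos (div_pos (by linarith) (by linarith)),
      min_le_left _ _, ?_⟩
    rw [← le_div_iff₀ (by linarith)]
    exact min_le_right _ _
  have hfε : 0 < f (-ε) := by
    have e : f (-ε) = ε * (-p₁ - T * ε - ε * ε) + p₀ := by simp only [hf]; ring
    rw [e]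
    have : 0 < -p₁ - T * ε - ε * ε := by nlinarith
    positivity
  set N := 1 + |T| + |p₁| + |p₀| with hN
  have hp1 := abs_nonneg p₁
  have hp0 := abs_nonneg p₀
  have hN1 : 1 ≤ N := by linarith
  have hfN : f (-N) < 0 := by
    have e : f (-N) = -(N ^ 2 * (N + T)) - p₁ * N + p₀ := by simp only [hf]; ring
    rw [e]
    have h2 : 1 + |p₁| + |p₀| ≤ N + T := by linarith
    have h3 : N ^ 2 * (1 + |p₁| + |p₀|) ≤ N ^ 2 * (N + T) :=
      mul_le_mul_of_nonneg_left h2 (sq_nonneg N)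
    have h4 : N ≤ N ^ 2 := by nlinarith
    have h5 : -p₁ * N ≤ |p₁| * N ^ 2 := by
      have := neg_le_abs p₁
      calc -p₁ * N ≤ |p₁| * N := by gcongr
        _ ≤ _ := by gcongr
    have h6 : p₀ ≤ |p₀| * N ^ 2 := by
      have := le_abs_self p₀
      nlinarith
    nlinarith
  obtain ⟨m, hm, hm0⟩ := intermediate_value_Icc (a := -N) (b := -ε) (by linarith) hc.continuousOn
    (⟨hfN.le, hfε.le⟩ : (0 : ℝ) ∈ Icc (f (-N)) (f (-ε)))
  exact ⟨m, by linarith [hm.2], hm0⟩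

theorem re_roots_nonneg {b e : ℝ} {s : ℂ} (hb : b < 0) (he : 0 ≤ e)
    (hs : s ^ 2 = (b : ℂ) ^ 2 - 4 * (e : ℂ)) :
    |s.re| ≤ -b ∧ (0 < e → |s.re| < -b) := by
  have h1 : s.re * s.re - s.im * s.im = b ^ 2 - 4 * e := by
    have := congrArg Complex.re hs
    simpa [sq] using this
  have h2 : s.re * s.im = 0 := by
    have := congrArg Complex.im hs
    simp [sq] at this
    linarith
  have key : s.re = 0 ∨ s.re ^ 2 = b ^ 2 - 4 * e := by
    rcases mul_eq_zero.1 h2 with h | h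
    · exact Or.inl h
    · right; rw [h] at h1; linarith
  rcases key with h | h
  · rw [h, abs_zero]; exact ⟨by linarith, fun _ => by linarith⟩
  · exact ⟨abs_le_of_sq_le_sq (by nlinarith) (by linarith),
      fun he' => abs_lt_of_sq_lt_sq (by nlinarith) (by linarith)⟩

theorem limitMatrix_coeffs (hc : c ≠ 0) (ht : 0 < τ₀) (lam : ℂ) :
    let gτ : ℝ := (P.s + 1) * τ₀ ^ P.s * (q - c * τ₀) ^ P.r
    let gu : ℝ := P.r * τ₀ ^ (P.s + 1) * (q - c * τ₀) ^ (P.r - 1)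
    (limitMatrix P c q τ₀ lam).trace
      = lam / c + ((-c * τ₀ ^ 2 + 1 / (P.F * τ₀) / c) / P.ν : ℝ) ∧
    minorSum (limitMatrix P c q τ₀ lam)
      = -(2 * τ₀ ^ 2 / P.ν : ℝ) * lam - (τ₀ ^ 2 / P.ν * ((c * gu - gτ) / c) : ℝ) ∧
    (limitMatrix P c q τ₀ lam).det = -((τ₀ ^ 2 / (c * P.ν) : ℝ) * (lam * (lam + gu))) := by
  have hc' : (c : ℂ) ≠ 0 := Complex.ofReal_ne_zero.2 hc
  have ht' : (τ₀ : ℂ) ≠ 0 := Complex.ofReal_ne_zero.2 ht.ne'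
  have hν : (P.ν : ℂ) ≠ 0 := Complex.ofReal_ne_zero.2 P.ν_pos.ne'
  have hF : (P.F : ℂ) ≠ 0 := Complex.ofReal_ne_zero.2 P.F_pos.ne'
  intro gτ gu
  refine ⟨?_, ?_, ?_⟩
  · simp [Matrix.trace_fin_three, limitMatrix, coeffMatrix]
    field_simp
  · simp [minorSum, limitMatrix, coeffMatrix, gτ, gu]
    field_simp
    ring
  · simp [Matrix.det_fin_three, limitMatrix, coeffMatrix, gu]
    field_simp

theorem exists_gapSpectrum_real (hs : IsSaddle P c q τ₀) (hc : 0 < c) {t : ℝ} (ht : 0 ≤ t) :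
    ∃ μ, IsGapSpectrum (limitMatrix P c q τ₀ t) μ ∧ (μ 2).re < 0 ∧ (μ 2).im = 0 ∧
      0 ≤ (μ 0).re ∧ 0 ≤ (μ 1).re ∧ (0 < t → 0 < (μ 0).re ∧ 0 < (μ 1).re) := by
  obtain ⟨-, hpos, -⟩ := hs.linearization hc.ne'
  obtain ⟨e1, e2, e3⟩ := limitMatrix_coeffs (P := P) (q := q) hc.ne' hs.tau_pos t
  set gτ : ℝ := (P.s + 1) * τ₀ ^ P.s * (q - c * τ₀) ^ P.r with hgτ
  set gu : ℝ := P.r * τ₀ ^ (P.s + 1) * (q - c * τ₀) ^ (P.r - 1) with hgu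
  have hν := P.ν_pos
  have hτ := hs.tau_pos
  have hgu0 : 0 < gu := mul_pos (mul_pos (by linarith [P.one_le_r]) (Real.rpow_pos_of_pos hτ _))
    (Real.rpow_pos_of_pos hs.u_pos _)
  set T : ℝ := t / c + (-c * τ₀ ^ 2 + 1 / (P.F * τ₀) / c) / P.ν with hT
  set p₁ : ℝ := -(2 * τ₀ ^ 2 / P.ν) * t - τ₀ ^ 2 / P.ν * ((c * gu - gτ) / c) with hp₁
  set p₀ : ℝ := τ₀ ^ 2 / (c * P.ν) * (t * (t + gu)) with hp₀
  have f1 : (limitMatrix P c q τ₀ t).trace = (T : ℂ) := by rw [e1, hT]; push_cast; ring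
  have f2 : minorSum (limitMatrix P c q τ₀ t) = (p₁ : ℂ) := by rw [e2, hp₁]; push_cast; ring
  have f3 : (limitMatrix P c q τ₀ t).det = -(p₀ : ℂ) := by rw [e3, hp₀]; push_cast; ring
  have hp1 : p₁ < 0 := by
    have h1 : 0 < τ₀ ^ 2 / P.ν * ((c * gu - gτ) / c) := mul_pos (by positivity) hpos
    have h2 : 0 ≤ 2 * τ₀ ^ 2 / P.ν * t := by positivity
    rw [hp₁]; linarith
  have hp0 : 0 ≤ p₀ := by positivity
  obtain ⟨m, hm, hroot⟩ := exists_neg_root_cubic (T := T) hp1 hp0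
  set b := m - T with hb
  set e := p₁ + m * b with he
  have hme : p₀ = -m * e := by rw [he, hb]; linear_combination hroot
  have he0 : 0 ≤ e := by
    by_contra! hneg
    nlinarith
  have hb0 : b < 0 := by
    by_contra! hnn
    nlinarith
  obtain ⟨s, hs2⟩ := IsAlgClosed.exists_pow_nat_eq ((b : ℂ) ^ 2 - 4 * (e : ℂ)) (n := 2) two_pos
  obtain ⟨g1, g2⟩ := re_roots_nonneg hb0 he0 hs2
  have hr0 : ((-(b : ℂ) + s) / 2).re = (-b + s.re) / 2 := by simp
  have hr1 : ((-(b : ℂ) - s) / 2).re = (-b - s.re) / 2 := by simp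
  have a1 := neg_abs_le s.re
  have a2 := le_abs_self s.re
  refine ⟨![(-(b : ℂ) + s) / 2, (-(b : ℂ) - s) / 2, (m : ℂ)], ⟨?_, ?_, ?_⟩, ?_, ?_, ?_, ?_, ?_⟩
  · refine Polynomial.funext fun w => ?_
    rw [charpoly_eval_eq, f1, f2, f3]
    simp only [Fin.prod_univ_three, Polynomial.eval_mul, Polynomial.eval_sub, Polynomial.eval_X,
      Polynomial.eval_C, Matrix.cons_val_zero, Matrix.cons_val_one, Matrix.cons_val]
    have hroot' : (m : ℂ) ^ 3 - T * m ^ 2 + p₁ * m + p₀ = 0 := by exact_mod_cast hroot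
    have hb' : (b : ℂ) = m - T := by rw [hb]; push_cast; ring
    have he' : (e : ℂ) = p₁ + m * b := by rw [he]; push_cast; ring
    rw [he', hb'] at hs2
    rw [hb']
    linear_combination (w - m) / 4 * hs2 + hroot'
  · change ((m : ℂ)).re < ((-(b : ℂ) + s) / 2).re
    rw [hr0, Complex.ofReal_re]; linarith
  · change ((m : ℂ)).re < ((-(b : ℂ) - s) / 2).re
    rw [hr1, Complex.ofReal_re]; linarith
  · change ((m : ℂ)).re < 0
    rwa [Complex.ofReal_re]
  · exact Complex.ofReal_im m
  · change 0 ≤ ((-(b : ℂ) + s) / 2).re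
    rw [hr0]; linarith
  · change 0 ≤ ((-(b : ℂ) - s) / 2).re
    rw [hr1]; linarith
  · intro htp
    have he1 : 0 < e := by
      have : 0 < p₀ := by positivity
      by_contra! hneg
      nlinarith
    have := g2 he1
    constructor
    · change 0 < ((-(b : ℂ) + s) / 2).re
      rw [hr0]; linarith
    · change 0 < ((-(b : ℂ) - s) / 2).re
      rw [hr1]; linarith

theorem ofReal_mem_gapSet (hs : IsSaddle P c q τ₀) (hc : 0 < c) {t : ℝ} (ht : 0 ≤ t) :
    (t : ℂ) ∈ gapSet P c q τ₀ := by
  obtain ⟨μ, h, -⟩ := exists_gapSpectrum_real hs hc ht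
  exact ⟨μ, h⟩

theorem ofReal_mem_extendedSplittingRegion (hs : IsSaddle P c q τ₀) (hc : 0 < c) {t : ℝ}
    (ht : 0 ≤ t) : (t : ℂ) ∈ extendedSplittingRegion P c q τ₀ := by
  refine ⟨Complex.ofReal '' Ici 0, isPreconnected_Ici.image _ Complex.continuous_ofReal.continuousOn,
    ⟨t, ht, rfl⟩, ⟨0, fun x hx => ⟨x, hx.le, rfl⟩⟩, ?_⟩
  rintro _ ⟨x, hx, rfl⟩
  exact ofReal_mem_gapSet hs hc hx

end RealAxis

section Lyapunov

/-- The factor `1 ∓ i` with the sign opposite to that of the imaginary part. -/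
def signFactor (l : ℂ) : ℂ := if 0 ≤ l.im then 1 - Complex.I else 1 + Complex.I

theorem signFactor_re (l : ℂ) : (signFactor l).re = 1 := by
  unfold signFactor; split_ifs <;> simp

theorem norm_signFactor_le (l : ℂ) : ‖signFactor l‖ ≤ 2 := by
  unfold signFactor
  split_ifs
  · exact (norm_sub_le _ _).trans (by simp; norm_num)
  · exact (norm_add_le _ _).trans (by simp; norm_num)

theorem norm_le_signFactor_mul_re {l : ℂ} (h : 0 ≤ l.re) : ‖l‖ ≤ (signFactor l * l).re := by
  have h1 := Complex.norm_le_abs_re_add_abs_im l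
  rw [abs_of_nonneg h] at h1
  unfold signFactor
  split_ifs with hi
  · rw [abs_of_nonneg hi] at h1
    simpa using h1
  · rw [abs_of_neg (not_le.1 hi)] at h1
    simpa [sub_eq_add_neg] using h1

/-- The Lyapunov form controlling solutions of the eigenvalue equations for large `|λ|`. -/
def lyapunov (c ε ψ φ : ℝ) (l T u h : ℂ) : ℝ :=
  ((c / 2 * ψ : ℝ) * (T * starRingEnd ℂ T)
    + (c / starRingEnd ℂ l) * φ * (h * starRingEnd ℂ T)
    + ε * signFactor l * (h * starRingEnd ℂ u)).re

theorem lyapunov_smul (c ε ψ φ : ℝ) (l T u h a : ℂ) :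
    lyapunov c ε ψ φ l (a * T) (a * u) (a * h) = ‖a‖ ^ 2 * lyapunov c ε ψ φ l T u h := by
  have e : a * starRingEnd ℂ a = ((‖a‖ ^ 2 : ℝ) : ℂ) := by
    rw [Complex.mul_conj, Complex.normSq_eq_norm_sq]
  unfold lyapunov
  rw [← Complex.re_ofReal_mul, ← e]
  congr 1
  simp only [map_mul]
  ring

theorem lyapunov_estimate {c M ρ₀ b₀ : ℝ} (hc : 0 < c) (hM : 1 ≤ M) (hρ₀ : 0 < ρ₀) (hb₀ : 0 < b₀) :
    ∃ ε κ R : ℝ, 0 < ε ∧ 0 < κ ∧ 0 < R ∧ ∀ L A B H : ℝ, R ≤ L → 0 ≤ A → 0 ≤ B → 0 ≤ H →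
      κ * (A ^ 2 + B ^ 2 + H ^ 2) ≤ b₀ * A ^ 2 + ε * (L - M) * B ^ 2 + ε * ρ₀ * H ^ 2
        - (c * M / L * (H * A) + c * M ^ 2 / L * A ^ 2 + c * M * (L + M) / L * (A * B)
          + c * M ^ 2 / L * (H * A) + M ^ 2 / L * (H * A) + M ^ 2 / L * H ^ 2
          + 2 * ε * M * (A * B) + 2 * ε * M * (H * B) + 2 * ε * M * (H * A)) := by
  set ε := b₀ * ρ₀ / (4 * M ^ 2) with hε
  have hε0 : 0 < ε := by positivity
  set κ := min b₀ (ε * ρ₀) / 8 with hκ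
  have hκ0 : 0 < κ := by have := lt_min hb₀ (mul_pos hε0 hρ₀); positivity
  have hκ1 : 8 * κ ≤ b₀ := by have := min_le_left b₀ (ε * ρ₀); linarith
  have hκ2 : 8 * κ ≤ ε * ρ₀ := by have := min_le_right b₀ (ε * ρ₀); linarith
  set S := c * M + 2 * c * M ^ 2 + 2 * M ^ 2 with hS
  have hS0 : 0 < S := by positivity
  set N := 2 * c * M + 2 * ε * M with hN
  have hN0 : 0 < N := by positivity
  have hM0 : 0 < M := by linarith
  refine ⟨ε, κ, max (max M (S / κ)) (M + (κ + N ^ 2 / κ) / ε), hε0, hκ0,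
    lt_max_of_lt_left (lt_max_of_lt_left hM0), fun L A B H hL hA hB hH => ?_⟩
  have hLM : M ≤ L := (le_max_left _ _).trans ((le_max_left _ _).trans hL)
  have hL0 : 0 < L := by linarith
  have hLS : S / L ≤ κ := by
    rw [div_le_iff₀ hL0, mul_comm, ← div_le_iff₀ hκ0]
    exact (le_max_right _ _).trans ((le_max_left _ _).trans hL)
  have hLB : κ + N ^ 2 / κ ≤ ε * (L - M) := by
    have := (le_max_right _ _).trans hL
    rw [← div_le_iff₀' hε0]
    linarith
  have hHA : H * A ≤ A ^ 2 + H ^ 2 := by nlinarith [sq_nonneg (A - H), mul_nonneg hA hH]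
  have t1 : c * M / L * (H * A) + c * M ^ 2 / L * A ^ 2 + c * M ^ 2 / L * (H * A)
      + M ^ 2 / L * (H * A) + M ^ 2 / L * H ^ 2 ≤ κ * (A ^ 2 + H ^ 2) := by
    have e : c * M / L * (H * A) + c * M ^ 2 / L * A ^ 2 + c * M ^ 2 / L * (H * A)
      + M ^ 2 / L * (H * A) + M ^ 2 / L * H ^ 2
      ≤ S / L * (A ^ 2 + H ^ 2) := by
      have f1 : 0 ≤ c * M / L := by positivity
      have f2 : 0 ≤ c * M ^ 2 / L := by positivity
      have f3 : 0 ≤ M ^ 2 / L := by positivity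
      have e1 := mul_le_mul_of_nonneg_left hHA f1
      have e2 := mul_le_mul_of_nonneg_left hHA f2
      have e3 := mul_le_mul_of_nonneg_left hHA f3
      have e4 : S / L = c * M / L + 2 * (c * M ^ 2 / L) + 2 * (M ^ 2 / L) := by
        rw [hS]; ring
      rw [e4]
      nlinarith [mul_nonneg f2 (sq_nonneg H), mul_nonneg f3 (sq_nonneg A)]
    exact e.trans (mul_le_mul_of_nonneg_right hLS (by positivity))
  have t2 : c * M * (L + M) / L * (A * B) + 2 * ε * M * (A * B) ≤ κ * A ^ 2 + N ^ 2 / (2 * κ) * B ^ 2 := by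
    have e1 : c * M * (L + M) / L ≤ 2 * c * M := by
      rw [div_le_iff₀ hL0]
      nlinarith [mul_pos hc hM0]
    have e2 : c * M * (L + M) / L * (A * B) + 2 * ε * M * (A * B) ≤ N * (A * B) := by
      have := mul_le_mul_of_nonneg_right e1 (mul_nonneg hA hB)
      rw [hN]; linarith
    refine e2.trans ?_
    have e3 : κ * A ^ 2 + N ^ 2 / (2 * κ) * B ^ 2 - N * (A * B)
        = κ / 2 * A ^ 2 + (1 / (2 * κ)) * (κ * A - N * B) ^ 2 := by field_simp; ring
    have : 0 ≤ κ / 2 * A ^ 2 + (1 / (2 * κ)) * (κ * A - N * B) ^ 2 := by positivity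
    linarith
  have t3 : 2 * ε * M * (H * B) ≤ κ * H ^ 2 + N ^ 2 / (2 * κ) * B ^ 2 := by
    have e2 : 2 * ε * M * (H * B) ≤ N * (H * B) := by
      have : 0 ≤ 2 * c * M * (H * B) := by positivity
      rw [hN]; linarith
    refine e2.trans ?_
    have e3 : κ * H ^ 2 + N ^ 2 / (2 * κ) * B ^ 2 - N * (H * B)
        = κ / 2 * H ^ 2 + (1 / (2 * κ)) * (κ * H - N * B) ^ 2 := by field_simp; ring
    have : 0 ≤ κ / 2 * H ^ 2 + (1 / (2 * κ)) * (κ * H - N * B) ^ 2 := by positivity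
    linarith
  have t4 : 2 * ε * M * (H * A) ≤ b₀ / 2 * A ^ 2 + ε * ρ₀ / 2 * H ^ 2 := by
    have hsq : (2 * ε * M) ^ 2 = b₀ * (ε * ρ₀) := by rw [hε]; field_simp; ring
    have e3 : b₀ / 2 * A ^ 2 + ε * ρ₀ / 2 * H ^ 2 - 2 * ε * M * (H * A)
        = (b₀ * A - 2 * ε * M * H) ^ 2 / (2 * b₀) := by
      field_simp
      linear_combination (-(H ^ 2)) * hsq
    have : 0 ≤ (b₀ * A - 2 * ε * M * H) ^ 2 / (2 * b₀) := by positivity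
    linarith
  have t5 := mul_le_mul_of_nonneg_right hLB (sq_nonneg B)
  have e6 : (κ + N ^ 2 / κ) * B ^ 2 = κ * B ^ 2 + N ^ 2 / (2 * κ) * B ^ 2 + N ^ 2 / (2 * κ) * B ^ 2 := by
    field_simp; ring
  have t7 := mul_le_mul_of_nonneg_right hκ1 (sq_nonneg A)
  have t8 := mul_le_mul_of_nonneg_right hκ2 (sq_nonneg H)
  have t9 := mul_nonneg hκ0.le (sq_nonneg A)
  have t10 := mul_nonneg hκ0.le (sq_nonneg H)
  linarith

theorem hasDerivAt_conj {f : ℝ → ℂ} {f' : ℂ} {x : ℝ} (h : HasDerivAt f f' x) :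
    HasDerivAt (fun x => starRingEnd ℂ (f x)) (starRingEnd ℂ f') x :=
  (Complex.conjCLE.toContinuousLinearMap.hasFDerivAt.comp_hasDerivAt x h :)

theorem hasDerivAt_lyapunov {c ε : ℝ} {l : ℂ} {ψ φ : ℝ → ℝ} {T u h : ℝ → ℂ} {ψ' φ' : ℝ}
    {T' u' h' : ℂ} {x : ℝ} (hψ : HasDerivAt ψ ψ' x) (hφ : HasDerivAt φ φ' x)
    (hT : HasDerivAt T T' x) (hu : HasDerivAt u u' x) (hh : HasDerivAt h h' x) :
    HasDerivAt (fun x => lyapunov c ε (ψ x) (φ x) l (T x) (u x) (h x))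
      ((c / 2 * ψ' : ℝ) * (T x * starRingEnd ℂ (T x)) + ψ x * (c * T' * starRingEnd ℂ (T x))
        + (c / starRingEnd ℂ l) * φ' * (h x * starRingEnd ℂ (T x))
        + (c / starRingEnd ℂ l) * φ x * (h' * starRingEnd ℂ (T x) + h x * starRingEnd ℂ T')
        + ε * signFactor l * (h' * starRingEnd ℂ (u x) + h x * starRingEnd ℂ u')).re x := by
  have h1 := (((hψ.const_mul (c / 2)).ofReal_comp).mul (hT.mul (hasDerivAt_conj hT)))
  have h2 := ((hφ.ofReal_comp).const_mul ((c : ℂ) / starRingEnd ℂ l)).mul (hh.mul (hasDerivAt_conj hT))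
  have h3 := (hh.mul (hasDerivAt_conj hu)).const_mul ((ε : ℂ) * signFactor l)
  have h4 := Complex.reCLM.hasFDerivAt.comp_hasDerivAt x ((h1.add h2).add h3)
  have e : ((c : ℂ) / 2 * (ψ x * (T' * starRingEnd ℂ (T x) + T x * starRingEnd ℂ T'))).re
      = (ψ x * (c * T' * starRingEnd ℂ (T x))).re := by
    simp
    ring
  refine (h4 : HasDerivAt _ _ x).congr_deriv ?_
  simp only [Complex.reCLM_apply, Complex.add_re, Pi.mul_apply]
  rw [← e]
  simp only [← Complex.add_re]
  congr 1
  push_cast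
  ring

/-- The growth estimate for the Lyapunov form along the eigenvalue equations. -/
theorem exists_lyapunov_growth {c M ρ₀ b₀ : ℝ} (hc : 0 < c) (hM : 1 ≤ M) (hρ₀ : 0 < ρ₀)
    (hb₀ : 0 < b₀) :
    ∃ ε κ R : ℝ, 0 < ε ∧ 0 < κ ∧ 0 < R ∧ ∀ (l : ℂ), 0 ≤ l.re → R ≤ ‖l‖ →
      ∀ (ρ ψ : ℝ → ℝ) (T u h : ℝ → ℂ) (x β k₁ k₂ k₃ ψ' φ' : ℝ) (T' u' h' : ℂ),
      HasDerivAt ψ ψ' x → HasDerivAt (fun x => ψ x * ρ x) φ' x →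
      HasDerivAt T T' x → HasDerivAt u u' x → HasDerivAt h h' x →
      c * T' = (l + β) * T x - ρ x * h x → u' = ρ x * h x - β * T x →
      h' = k₁ * T x + (l + k₂) * u x + k₃ * h x →
      |β| ≤ M → |k₁| ≤ M → |k₂| ≤ M → |k₃| ≤ M → ρ₀ ≤ ρ x → ρ x ≤ M → |ψ x * ρ x| ≤ M →
      |φ'| ≤ M → b₀ ≤ c / 2 * ψ' + ψ x * (l.re + β) →
      ∃ D, HasDerivAt (fun x => lyapunov c ε (ψ x) (ψ x * ρ x) l (T x) (u x) (h x)) D x ∧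
        κ * (‖T x‖ ^ 2 + ‖u x‖ ^ 2 + ‖h x‖ ^ 2) ≤ D := by
  obtain ⟨ε, κ, R, hε, hκ, hR, hest⟩ := lyapunov_estimate hc hM hρ₀ hb₀
  refine ⟨ε, κ, R, hε, hκ, hR, ?_⟩
  intro l hl hRl ρ ψ T u h x β k₁ k₂ k₃ ψ' φ' T' u' h' hψ hφ hT hu hh eT eu eh bβ bk₁ bk₂ bk₃
    hρ hρM bφ bφ' hb
  refine ⟨_, hasDerivAt_lyapunov hψ hφ hT hu hh, ?_⟩
  set L := ‖l‖ with hL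
  have hL0 : 0 < L := hR.trans_le hRl
  refine (hest L ‖T x‖ ‖u x‖ ‖h x‖ hRl (norm_nonneg _) (norm_nonneg _) (norm_nonneg _)).trans ?_
  have hl0 : l ≠ 0 := norm_pos_iff.1 hL0
  have hlc : starRingEnd ℂ l ≠ 0 := (map_ne_zero _).2 hl0
  set ι : ℂ := (starRingEnd ℂ l)⁻¹ with hι
  have hιl : ι * starRingEnd ℂ l = 1 := inv_mul_cancel₀ hlc
  have hιn : ‖ι‖ = 1 / L := by rw [hι, norm_inv, RCLike.norm_conj, one_div]
  set s := signFactor l with hs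
  set t := T x with ht
  set v := u x with hv
  set w := h x with hw
  set φ := ψ x * ρ x with hφd
  have hcT : c * starRingEnd ℂ T' = (starRingEnd ℂ l + β) * starRingEnd ℂ t - ρ x * starRingEnd ℂ w := by
    have := congrArg (starRingEnd ℂ) eT
    simpa using this
  have hcu : starRingEnd ℂ u' = ρ x * starRingEnd ℂ w - β * starRingEnd ℂ t := by
    rw [eu]; simp
  have nn : ∀ z : ℂ, z * starRingEnd ℂ z = ((‖z‖ ^ 2 : ℝ) : ℂ) := fun z => by
    rw [Complex.mul_conj, Complex.normSq_eq_norm_sq]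
  have key : (c / 2 * ψ' : ℝ) * (t * starRingEnd ℂ t) + ψ x * (c * T' * starRingEnd ℂ t)
        + (c / starRingEnd ℂ l) * φ' * (w * starRingEnd ℂ t)
        + (c / starRingEnd ℂ l) * φ * (h' * starRingEnd ℂ t + w * starRingEnd ℂ T')
        + ε * s * (h' * starRingEnd ℂ v + w * starRingEnd ℂ u')
      = (c / 2 * ψ' + ψ x * (l + β)) * (t * starRingEnd ℂ t) + ε * (s * l + s * k₂) * (v * starRingEnd ℂ v)
        + ε * ρ x * s * (w * starRingEnd ℂ w)
        + ι * c * φ' * (w * starRingEnd ℂ t) + ι * c * φ * k₁ * (t * starRingEnd ℂ t)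
        + ι * c * φ * (l + k₂) * (v * starRingEnd ℂ t) + ι * c * φ * k₃ * (w * starRingEnd ℂ t)
        + ι * φ * β * (w * starRingEnd ℂ t) + -(ι * φ * ρ x * (w * starRingEnd ℂ w))
        + ε * s * k₁ * (t * starRingEnd ℂ v) + ε * s * k₃ * (w * starRingEnd ℂ v)
        + -(ε * s * β * (w * starRingEnd ℂ t)) := by
    have e1 : (c : ℂ) / starRingEnd ℂ l = ι * c := by rw [hι]; field_simp
    rw [eT, e1, eh, hcu]
    have e2 : (φ : ℂ) = ψ x * ρ x := by rw [hφd]; push_cast; ring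
    push_cast
    linear_combination (ι * φ * w) * hcT + (φ * w * starRingEnd ℂ t) * hιl
      + (w * starRingEnd ℂ t) * e2
  rw [key]
  have hre : ∀ z : ℂ, -‖z‖ ≤ z.re := fun z => (abs_le.1 (Complex.abs_re_le_norm z)).1
  simp only [Complex.add_re]
  have na : ∀ r : ℝ, ‖(r : ℂ)‖ = |r| := fun r => by rw [Complex.norm_real, Real.norm_eq_abs]
  have hs2 := norm_signFactor_le l
  rw [← hs] at hs2
  have hc' : ‖(c : ℂ)‖ = c := by rw [na, abs_of_pos hc]
  have hε' : ‖(ε : ℂ)‖ = ε := by rw [na, abs_of_pos hε]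
  have hM0 : 0 ≤ M := by linarith
  have hρ' : |ρ x| ≤ M := by rw [abs_of_pos (hρ₀.trans_le hρ)]; exact hρM
  have m1 : ((c / 2 * ψ' + ψ x * (l + β)) * (t * starRingEnd ℂ t)).re ≥ b₀ * ‖t‖ ^ 2 := by
    have e : ((c / 2 * ψ' + ψ x * (l + β)) * (t * starRingEnd ℂ t)).re
        = (c / 2 * ψ' + ψ x * (l.re + β)) * ‖t‖ ^ 2 := by
      rw [nn, Complex.re_mul_ofReal]
      congr 1
      simp
    rw [e]
    exact mul_le_mul_of_nonneg_right hb (sq_nonneg _)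
  have m2 : (ε * (s * l + s * k₂) * (v * starRingEnd ℂ v)).re ≥ ε * (L - M) * ‖v‖ ^ 2 := by
    rw [nn, Complex.re_mul_ofReal, Complex.re_ofReal_mul, Complex.add_re, Complex.re_mul_ofReal,
      signFactor_re, one_mul]
    have h1 := norm_le_signFactor_mul_re hl
    have h2 := (abs_le.1 bk₂).1
    refine mul_le_mul_of_nonneg_right (mul_le_mul_of_nonneg_left ?_ hε.le) (sq_nonneg _)
    linarith
  have m3 : (ε * ρ x * s * (w * starRingEnd ℂ w)).re ≥ ε * ρ₀ * ‖w‖ ^ 2 := by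
    rw [nn, Complex.re_mul_ofReal, ← Complex.ofReal_mul, Complex.re_ofReal_mul, signFactor_re,
      mul_one]
    gcongr
  have p1 : ‖ι * c * φ' * (w * starRingEnd ℂ t)‖ ≤ c * M / L * (‖w‖ * ‖t‖) := by
    simp only [norm_mul, hιn, hc', na, RCLike.norm_conj]
    calc 1 / L * c * |φ'| * (‖w‖ * ‖t‖) ≤ 1 / L * c * M * (‖w‖ * ‖t‖) := by gcongr
      _ = _ := by ring
  have p2 : ‖ι * c * φ * k₁ * (t * starRingEnd ℂ t)‖ ≤ c * M ^ 2 / L * ‖t‖ ^ 2 := by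
    simp only [norm_mul, hιn, hc', na, RCLike.norm_conj]
    calc 1 / L * c * |φ| * |k₁| * (‖t‖ * ‖t‖) ≤ 1 / L * c * M * M * (‖t‖ * ‖t‖) := by gcongr
      _ = _ := by ring
  have p3 : ‖ι * c * φ * (l + k₂) * (v * starRingEnd ℂ t)‖ ≤ c * M * (L + M) / L * (‖t‖ * ‖v‖) := by
    simp only [norm_mul, hιn, hc', na, RCLike.norm_conj]
    have : ‖l + k₂‖ ≤ L + M := (norm_add_le _ _).trans (by rw [na]; gcongr)
    calc 1 / L * c * |φ| * ‖l + k₂‖ * (‖v‖ * ‖t‖) ≤ 1 / L * c * M * (L + M) * (‖v‖ * ‖t‖) := by gcongr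
      _ = _ := by ring
  have p4 : ‖ι * c * φ * k₃ * (w * starRingEnd ℂ t)‖ ≤ c * M ^ 2 / L * (‖w‖ * ‖t‖) := by
    simp only [norm_mul, hιn, hc', na, RCLike.norm_conj]
    calc 1 / L * c * |φ| * |k₃| * (‖w‖ * ‖t‖) ≤ 1 / L * c * M * M * (‖w‖ * ‖t‖) := by gcongr
      _ = _ := by ring
  have p5 : ‖ι * φ * β * (w * starRingEnd ℂ t)‖ ≤ M ^ 2 / L * (‖w‖ * ‖t‖) := by
    simp only [norm_mul, hιn, na, RCLike.norm_conj]
    calc 1 / L * |φ| * |β| * (‖w‖ * ‖t‖) ≤ 1 / L * M * M * (‖w‖ * ‖t‖) := by gcongr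
      _ = _ := by ring
  have p6 : ‖-(ι * φ * ρ x * (w * starRingEnd ℂ w))‖ ≤ M ^ 2 / L * ‖w‖ ^ 2 := by
    simp only [norm_neg, norm_mul, hιn, na, RCLike.norm_conj]
    calc 1 / L * |φ| * |ρ x| * (‖w‖ * ‖w‖) ≤ 1 / L * M * M * (‖w‖ * ‖w‖) := by gcongr
      _ = _ := by ring
  have p7 : ‖ε * s * k₁ * (t * starRingEnd ℂ v)‖ ≤ 2 * ε * M * (‖t‖ * ‖v‖) := by
    simp only [norm_mul, hε', na, RCLike.norm_conj]
    calc ε * ‖s‖ * |k₁| * (‖t‖ * ‖v‖) ≤ ε * 2 * M * (‖t‖ * ‖v‖) := by gcongr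
      _ = _ := by ring
  have p8 : ‖ε * s * k₃ * (w * starRingEnd ℂ v)‖ ≤ 2 * ε * M * (‖w‖ * ‖v‖) := by
    simp only [norm_mul, hε', na, RCLike.norm_conj]
    calc ε * ‖s‖ * |k₃| * (‖w‖ * ‖v‖) ≤ ε * 2 * M * (‖w‖ * ‖v‖) := by gcongr
      _ = _ := by ring
  have p9 : ‖-(ε * s * β * (w * starRingEnd ℂ t))‖ ≤ 2 * ε * M * (‖w‖ * ‖t‖) := by
    simp only [norm_neg, norm_mul, hε', na, RCLike.norm_conj]
    calc ε * ‖s‖ * |β| * (‖w‖ * ‖t‖) ≤ ε * 2 * M * (‖w‖ * ‖t‖) := by gcongr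
      _ = _ := by ring
  linarith [(neg_le_neg p1).trans (hre _), (neg_le_neg p2).trans (hre _),
    (neg_le_neg p3).trans (hre _), (neg_le_neg p4).trans (hre _), (neg_le_neg p5).trans (hre _),
    (neg_le_neg p6).trans (hre _), (neg_le_neg p7).trans (hre _), (neg_le_neg p8).trans (hre _),
    (neg_le_neg p9).trans (hre _)]

end Lyapunov

section Growth
open scoped Matrix.Norms.Operator

theorem abs_lyapunov_le {c ε ψ φ N : ℝ} (hc : 0 ≤ c) (hε : 0 ≤ ε) (hψ : |ψ| ≤ N) (hφ : |φ| ≤ N)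
    (l T u h : ℂ) :
    |lyapunov c ε ψ φ l T u h| ≤ (c / 2 * N + c / ‖l‖ * N + ε * 2) * (‖T‖ + ‖u‖ + ‖h‖) ^ 2 := by
  have hN : 0 ≤ N := (abs_nonneg _).trans hψ
  have hT := norm_nonneg T
  have hu := norm_nonneg u
  have hh := norm_nonneg h
  refine (Complex.abs_re_le_norm _).trans (norm_add₃_le.trans ?_)
  simp only [norm_mul, norm_div, RCLike.norm_conj, Complex.norm_real, Real.norm_eq_abs,
    abs_of_nonneg hc, abs_of_nonneg hε]
  rw [add_mul, add_mul]
  have h1 : ‖T‖ * ‖T‖ ≤ (‖T‖ + ‖u‖ + ‖h‖) ^ 2 := by nlinarith [mul_nonneg hT hu, mul_nonneg hT hh, mul_nonneg hu hh]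
  have h2 : ‖h‖ * ‖T‖ ≤ (‖T‖ + ‖u‖ + ‖h‖) ^ 2 := by nlinarith [mul_nonneg hT hu, mul_nonneg hT hh, mul_nonneg hu hh]
  have h3 : ‖h‖ * ‖u‖ ≤ (‖T‖ + ‖u‖ + ‖h‖) ^ 2 := by nlinarith [mul_nonneg hT hu, mul_nonneg hT hh, mul_nonneg hu hh]
  have h4 := norm_signFactor_le l
  rw [abs_two]
  gcongr

/-- Pointwise coefficients of a system of the shape of the eigenvalue equations. -/
structure Coeffs where
  a : ℝ
  α : ℝ
  dα : ℝ
  g₁ : ℝ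
  g₂ : ℝ
  m : ℝ

/-- The matrix of the system with the given coefficients. -/
def Coeffs.matrix (c ν : ℝ) (k : Coeffs) (l : ℂ) : Mat3 :=
  !![l / c, 0, ((-(k.a / c) : ℝ) : ℂ);
     0, 0, (k.a : ℂ);
     (k.g₁ - k.α * l / c) / ν, (l + k.g₂) / ν, (k.m : ℂ)]

/-- The third component after the change of variables that removes `λ` from its coupling to the
first one. -/
def Coeffs.flux (ν : ℝ) (k : Coeffs) (W : Fin 3 → ℂ) : ℂ := ν * W 2 + k.α * W 0

/-- The Lyapunov form in the original variables. -/
def Coeffs.form (c ν ε ψ : ℝ) (k : Coeffs) (l : ℂ) (W : Fin 3 → ℂ) : ℝ :=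
  lyapunov c ε ψ (ψ * (k.a / ν)) l (W 0) (W 1) (k.flux ν W)

/-- Bounds on the coefficients under which the Lyapunov form grows. -/
structure GrowthData (c ν N a₀ b₀ r : ℝ) (ψ : ℝ → ℝ) (k : ℝ → Coeffs) : Prop where
  deriv_α : ∀ x, HasDerivAt (fun x => (k x).α) (k x).dα x
  deriv_ψ : ∀ x, ∃ ψ' φ', HasDerivAt ψ ψ' x ∧ HasDerivAt (fun x => ψ x * ((k x).a / ν)) φ' x ∧
    |φ'| ≤ N ∧ b₀ ≤ c / 2 * ψ' + ψ x * (r + (k x).a * (k x).α / ν)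
  ψ_nonneg : ∀ x, 0 ≤ ψ x
  ψ_le : ∀ x, ψ x ≤ N
  le_a : ∀ x, a₀ ≤ (k x).a
  a_le : ∀ x, (k x).a ≤ N
  α_le : ∀ x, |(k x).α| ≤ N
  dα_le : ∀ x, |(k x).dα| ≤ N
  g₁_le : ∀ x, |(k x).g₁| ≤ N
  g₂_le : ∀ x, |(k x).g₂| ≤ N
  m_le : ∀ x, |(k x).m| ≤ N

/-- Conclusion of the growth estimate. -/
structure GrowthAt (c ν N a₀ b₀ r ε κ : ℝ) (l : ℂ) : Prop where
  pos_ε : 0 < ε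
  pos_κ : 0 < κ
  growth : ∀ ψ k, GrowthData c ν N a₀ b₀ r ψ k → ∀ (W : ℝ → Fin 3 → ℂ) (x : ℝ),
    HasDerivAt W (((k x).matrix c ν l).mulVec (W x)) x →
    ∃ D, HasDerivAt (fun x => (k x).form c ν ε (ψ x) l (W x)) D x ∧
      κ * (‖W x 0‖ ^ 2 + ‖W x 1‖ ^ 2 + ‖(k x).flux ν (W x)‖ ^ 2) ≤ D

theorem exists_growthAt {c ν N a₀ b₀ : ℝ} (hc : 0 < c) (hν : 0 < ν) (hN : 0 ≤ N) (ha₀ : 0 < a₀)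
    (hb₀ : 0 < b₀) : ∃ ε κ R : ℝ, 0 < R ∧ ∀ (r : ℝ) (l : ℂ), 0 ≤ l.re → r ≤ l.re → R ≤ ‖l‖ →
      GrowthAt c ν N a₀ b₀ r ε κ l := by
  set K := N + N * N / (c * ν) with hK
  have hK0 : 0 ≤ K := by positivity
  set M := 1 + N + N / ν + N * N / ν + N * (N / ν) + K + (N + N + K * N) with hM
  have q1 : 0 ≤ N / ν := by positivity
  have q2 : 0 ≤ N * N / ν := by positivity
  have q3 : 0 ≤ N * (N / ν) := by positivity
  have q4 : 0 ≤ K * N := by positivity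
  obtain ⟨ε, κ, R, hε, hκ, hR, H⟩ := exists_lyapunov_growth (M := M) (ρ₀ := a₀ / ν) (b₀ := b₀) hc
    (by linarith) (by positivity) hb₀
  refine ⟨ε, κ, R, hR, fun r l hl hrl hRl => ⟨hε, hκ, fun ψ k hk W x hW => ?_⟩⟩
  obtain ⟨ψ', φ', hψ, hφ, hφN, hb⟩ := hk.deriv_ψ x
  have hcC : (c : ℂ) ≠ 0 := Complex.ofReal_ne_zero.2 hc.ne'
  have hνC : (ν : ℂ) ≠ 0 := Complex.ofReal_ne_zero.2 hν.ne'
  have ha : |(k x).a| ≤ N := by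
    rw [abs_of_pos (ha₀.trans_le (hk.le_a x))]; exact hk.a_le x
  have hW' := hasDerivAt_pi.1 hW
  set β := (k x).a * (k x).α / ν with hβ
  have bβ : |β| ≤ N * N / ν := by
    rw [hβ, abs_div, abs_mul, abs_of_pos hν]
    have := hk.α_le x
    gcongr
  set k₃ := (k x).m - (k x).a * (k x).α / (c * ν) with hk₃
  have bk₃ : |k₃| ≤ K := by
    refine (abs_sub _ _).trans ?_
    rw [abs_div, abs_mul, abs_of_pos (mul_pos hc hν)]
    have := hk.α_le x
    have := hk.m_le x
    rw [hK]
    gcongr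
  set k₁ := (k x).g₁ + (k x).dα - k₃ * (k x).α with hk₁
  have bk₁ : |k₁| ≤ N + N + K * N := by
    refine (abs_sub _ _).trans ?_
    rw [abs_mul]
    have h1 := (abs_add_le (k x).g₁ (k x).dα).trans (add_le_add (hk.g₁_le x) (hk.dα_le x))
    have := hk.α_le x
    gcongr
  have bρ : (k x).a / ν ≤ N / ν := by have := hk.a_le x; gcongr
  have e0 := hW' 0
  have e1 := hW' 1
  have e2 := hW' 2
  simp only [Matrix.mulVec, dotProduct, Fin.sum_univ_three, Coeffs.matrix, Matrix.of_apply,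
    Matrix.cons_val', Matrix.cons_val_zero, Matrix.cons_val_one, Matrix.cons_val,
    Matrix.cons_val_fin_one] at e0 e1 e2
  have eh := (e2.const_mul (ν : ℂ)).add ((hk.deriv_α x).ofReal_comp.mul e0)
  refine H l hl hRl (fun x => (k x).a / ν) ψ (fun x => W x 0) (fun x => W x 1)
    (fun x => (k x).flux ν (W x)) x β k₁ (k x).g₂ k₃ ψ' φ' _ _ _ hψ hφ e0 e1 eh ?_ ?_ ?_
    (by linarith) (by linarith) ?_ (by linarith) ?_ (by linarith) ?_ (by linarith) ?_
  · simp only [Coeffs.flux, hβ]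
    push_cast
    field_simp
    ring
  · simp only [Coeffs.flux, hβ]
    push_cast
    field_simp
    ring
  · simp only [Coeffs.flux, hk₁, hk₃]
    push_cast
    field_simp
    ring
  · have := hk.g₂_le x; linarith
  · have := hk.le_a x; gcongr
  · rw [abs_mul, abs_of_nonneg (hk.ψ_nonneg x), abs_div, abs_of_pos hν]
    have := hk.ψ_le x
    have : ψ x * (|(k x).a| / ν) ≤ N * (N / ν) := by gcongr
    linarith
  · refine hb.trans ?_
    have := hk.ψ_nonneg x
    gcongr

variable {c ν N a₀ b₀ r ε κ : ℝ} {l : ℂ} {ψ : ℝ → ℝ} {k : ℝ → Coeffs} {W : ℝ → Fin 3 → ℂ}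

theorem GrowthAt.monotone (H : GrowthAt c ν N a₀ b₀ r ε κ l) (hk : GrowthData c ν N a₀ b₀ r ψ k)
    (hW : ∀ x, HasDerivAt W (((k x).matrix c ν l).mulVec (W x)) x) :
    Monotone fun x => (k x).form c ν ε (ψ x) l (W x) := by
  choose D hD hκD using fun x => H.growth ψ k hk W x (hW x)
  refine monotone_of_hasDerivAt_nonneg hD fun x => le_trans ?_ (hκD x)
  have := H.pos_κ
  positivity

theorem eq_zero_of_flux_eq_zero (hν : ν ≠ 0) {k : Coeffs} {v : Fin 3 → ℂ} (h0 : v 0 = 0) (h1 : v 1 = 0)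
    (h2 : k.flux ν v = 0) : v = 0 := by
  have hνC : (ν : ℂ) ≠ 0 := Complex.ofReal_ne_zero.2 hν
  have : v 2 = 0 := by simpa [Coeffs.flux, h0, hνC] using h2
  ext i; fin_cases i <;> simp [h0, h1, this]

theorem GrowthAt.eq_zero_of_deriv (H : GrowthAt c ν N a₀ b₀ r ε κ l)
    (hk : GrowthData c ν N a₀ b₀ r ψ k) (hν : ν ≠ 0) {x : ℝ}
    (hW : HasDerivAt W (((k x).matrix c ν l).mulVec (W x)) x)
    {D : ℝ} (hD : HasDerivAt (fun x => (k x).form c ν ε (ψ x) l (W x)) D x) (hD0 : D ≤ 0) :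
    W x = 0 := by
  obtain ⟨D', hD', hκ⟩ := H.growth ψ k hk W x hW
  have h1 : κ * (‖W x 0‖ ^ 2 + ‖W x 1‖ ^ 2 + ‖(k x).flux ν (W x)‖ ^ 2) ≤ 0 := by
    rw [hD'.unique hD] at hκ; linarith
  have h2 : ‖W x 0‖ ^ 2 + ‖W x 1‖ ^ 2 + ‖(k x).flux ν (W x)‖ ^ 2 ≤ 0 := by
    by_contra! h; have := mul_pos H.pos_κ h; linarith
  have p0 := sq_nonneg ‖W x 0‖
  have p1 := sq_nonneg ‖W x 1‖
  have p2 := sq_nonneg ‖(k x).flux ν (W x)‖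
  refine eq_zero_of_flux_eq_zero hν (k := k x) ?_ ?_ ?_ <;> rw [← norm_eq_zero, ← sq_eq_zero_iff] <;>
    linarith

theorem GrowthAt.tendsto_form (H : GrowthAt c ν N a₀ b₀ r ε κ l)
    (hk : GrowthData c ν N a₀ b₀ r ψ k) (hc : 0 < c) (hν : 0 < ν) (ha₀ : 0 < a₀) {f : Filter ℝ}
    (hW : Tendsto W f (𝓝 0)) : Tendsto (fun x => (k x).form c ν ε (ψ x) l (W x)) f (𝓝 0) := by
  have hN : 0 ≤ N := (hk.ψ_nonneg 0).trans (hk.ψ_le 0)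
  have t : ∀ i, Tendsto (fun x => ‖W x i‖) f (𝓝 0) := fun i => by
    simpa using (tendsto_pi_nhds.1 hW i).norm
  set B := max N (N * (N / ν)) with hB
  have t2 : Tendsto (fun x => ‖(k x).flux ν (W x)‖) f (𝓝 0) := by
    refine squeeze_zero (fun _ => norm_nonneg _) (g := fun x => ν * ‖W x 2‖ + N * ‖W x 0‖) (fun x => ?_) ?_
    · refine (norm_add_le _ _).trans ?_
      rw [norm_mul, norm_mul, Complex.norm_real, Complex.norm_real, Real.norm_eq_abs,
        Real.norm_eq_abs, abs_of_pos hν]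
      have := hk.α_le x
      gcongr
    · simpa using ((t 2).const_mul ν).add ((t 0).const_mul N)
  refine squeeze_zero_norm (fun x => ?_)
    (a := fun x => (c / 2 * B + c / ‖l‖ * B + ε * 2) * (‖W x 0‖ + ‖W x 1‖ + ‖(k x).flux ν (W x)‖) ^ 2) ?_
  · refine abs_lyapunov_le hc.le H.pos_ε.le ?_ ?_ _ _ _ _
    · rw [abs_of_nonneg (hk.ψ_nonneg x)]; exact (hk.ψ_le x).trans (le_max_left _ _)
    · refine le_trans ?_ (le_max_right _ _)
      have h1 := hk.a_le x
      have h2 := ha₀.le.trans (hk.le_a x)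
      have h3 := hk.ψ_le x
      have h4 := hk.ψ_nonneg x
      rw [abs_of_nonneg (by positivity)]
      gcongr
  · have := ((((t 0).add (t 1)).add t2).pow 2).const_mul (c / 2 * B + c / ‖l‖ * B + ε * 2)
    simpa using this

/-- Growth of the Lyapunov form excludes solutions decaying at both ends. -/
theorem GrowthAt.eq_zero_of_tendsto (H : GrowthAt c ν N a₀ b₀ r ε κ l)
    (hk : GrowthData c ν N a₀ b₀ r ψ k) (hc : 0 < c) (hν : 0 < ν) (ha₀ : 0 < a₀)
    (hW : ∀ x, HasDerivAt W (((k x).matrix c ν l).mulVec (W x)) x)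
    (h1 : Tendsto W atTop (𝓝 0)) (h2 : Tendsto W atBot (𝓝 0)) (x : ℝ) : W x = 0 := by
  have hm := H.monotone hk hW
  have e : (fun x => (k x).form c ν ε (ψ x) l (W x)) = fun _ => 0 := funext fun x =>
    le_antisymm (hm.ge_of_tendsto (H.tendsto_form hk hc hν ha₀ h1) x)
      (hm.le_of_tendsto (H.tendsto_form hk hc hν ha₀ h2) x)
  exact H.eq_zero_of_deriv hk hν.ne' (hW x) (D := 0) (by rw [e]; exact hasDerivAt_const x 0) le_rfl

/-! ### Signs of the real parts of the eigenvalues -/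

variable {k₀ : Coeffs} {ψ₀ : ℝ} {μ : Fin 3 → ℂ}

theorem form_smul (a : ℂ) (v : Fin 3 → ℂ) :
    k₀.form c ν ε ψ₀ l (a • v) = ‖a‖ ^ 2 * k₀.form c ν ε ψ₀ l v := by
  have e : k₀.flux ν (a • v) = a * k₀.flux ν v := by simp [Coeffs.flux]; ring
  rw [Coeffs.form, e, Coeffs.form, ← lyapunov_smul]
  rfl

theorem exists_eigenvector_of_gap {A₀ : Mat3} (h : IsGapSpectrum A₀ μ) (j : Fin 3) :
    ∃ v, v ≠ 0 ∧ A₀.mulVec v = μ j • v := by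
  have h1 : A₀.charpoly.eval (μ j) = 0 := by
    rw [h.eval_charpoly]; fin_cases j <;> simp
  rw [Matrix.eval_charpoly] at h1
  obtain ⟨v, hv, hv0⟩ := Matrix.exists_mulVec_eq_zero_iff.2 h1
  refine ⟨v, hv, ?_⟩
  rw [Matrix.sub_mulVec, sub_eq_zero] at hv0
  rw [← hv0]
  ext i
  simp [Matrix.scalar_apply, Matrix.mulVec_diagonal]

theorem hasDerivAt_cexp_smul_eigenvector {A₀ : Mat3} {m : ℂ} {v : Fin 3 → ℂ}
    (hv : A₀.mulVec v = m • v) (x : ℝ) :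
    HasDerivAt (fun x : ℝ => Complex.exp (m * x) • v)
      (A₀.mulVec (Complex.exp (m * x) • v)) x := by
  have := (hasDerivAt_cexp_mul m x).smul_const v
  convert! this using 1
  rw [Matrix.mulVec_smul, hv, smul_smul, mul_comm]

theorem tendsto_cexp_smul_atTop {m : ℂ} (hm : m.re < 0) (v : Fin 3 → ℂ) :
    Tendsto (fun x : ℝ => Complex.exp (m * x) • v) atTop (𝓝 0) := by
  have t1 : Tendsto (fun x : ℝ => Complex.exp (m * x)) atTop (𝓝 0) := by
    rw [tendsto_zero_iff_norm_tendsto_zero]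
    simp only [Complex.norm_exp, Complex.mul_re, Complex.ofReal_re, Complex.ofReal_im, mul_zero,
      sub_zero]
    exact Real.tendsto_exp_atBot.comp (tendsto_id.const_mul_atTop_of_neg hm)
  simpa using t1.smul_const v

theorem tendsto_cexp_smul_atBot {m : ℂ} (hm : 0 < m.re) (v : Fin 3 → ℂ) :
    Tendsto (fun x : ℝ => Complex.exp (m * x) • v) atBot (𝓝 0) := by
  have := (tendsto_cexp_smul_atTop (m := -m) (by simpa using hm) v).comp tendsto_neg_atBot_atTop
  refine this.congr fun x => ?_
  simp

theorem GrowthAt.re_ne_zero (H : GrowthAt c ν N a₀ b₀ r ε κ l)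
    (hk : GrowthData c ν N a₀ b₀ r (fun _ => ψ₀) (fun _ => k₀)) (hν : 0 < ν)
    {v : Fin 3 → ℂ} {m : ℂ} (hv : v ≠ 0) (hm : (k₀.matrix c ν l).mulVec v = m • v) : m.re ≠ 0 := by
  intro h0
  have hd := hasDerivAt_cexp_smul_eigenvector hm 0
  have e : (fun x : ℝ => k₀.form c ν ε ψ₀ l (Complex.exp (m * x) • v)) = fun _ => k₀.form c ν ε ψ₀ l v :=
    funext fun x => by simp [form_smul, Complex.norm_exp, h0]
  have := H.eq_zero_of_deriv hk hν.ne' hd (D := 0) (by rw [e]; exact hasDerivAt_const _ _) le_rfl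
  simp at this
  exact hv this

theorem GrowthAt.re_gap_neg (H : GrowthAt c ν N a₀ b₀ r ε κ l)
    (hk : GrowthData c ν N a₀ b₀ r (fun _ => ψ₀) (fun _ => k₀)) (hc : 0 < c) (hν : 0 < ν)
    (ha₀ : 0 < a₀) (h : IsGapSpectrum (k₀.matrix c ν l) μ) : (μ 2).re < 0 := by
  by_contra! hneg
  obtain ⟨v₂, hv₂, hv₂'⟩ := exists_eigenvector_of_gap h 2
  have h2 : 0 < (μ 2).re := lt_of_le_of_ne hneg (H.re_ne_zero hk hν hv₂ hv₂').symm
  set A₀ := k₀.matrix c ν l with hA₀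
  have hνC : (ν : ℂ) ≠ 0 := Complex.ofReal_ne_zero.2 hν.ne'
  let v : Fin 3 → ℂ := ![0, 1, -1 / ν]
  have hQ : k₀.form c ν ε ψ₀ l v = -ε := by
    have e : k₀.flux ν v = -1 := by simp [Coeffs.flux, v, hνC, mul_div_cancel₀]
    simp only [Coeffs.form, e, lyapunov]
    simp [v, signFactor_re]
  have ht : Tendsto (fun x : ℝ => (NormedSpace.exp ((x : ℂ) • A₀)).mulVec v) atBot (𝓝 0) := by
    set p := gapProj A₀ μ with hp
    have e : v = (v - p.mulVec v) + p.mulVec v := by abel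
    rw [e]
    simp only [Matrix.mulVec_add]
    have t1 := tendsto_exp_mulVec_atBot (A₀ := A₀) (a := μ 0) (b := μ 1) (h2.trans h.2.1)
      (h2.trans h.2.2) (v := v - p.mulVec v) (by
        have hq : (A₀ - μ 0 • 1) * (A₀ - μ 1 • 1) = ((μ 2 - μ 0) * (μ 2 - μ 1)) • gapProj A₀ μ := by
          rw [gapProj, smul_smul, mul_inv_cancel₀ h.den_ne_zero, one_smul]
        rw [hq, Matrix.smul_mulVec, Matrix.mulVec_sub, Matrix.mulVec_mulVec, h.gapProj_mul_self,
          sub_self, smul_zero])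
    have t2 : Tendsto (fun x : ℝ => (NormedSpace.exp ((x : ℂ) • A₀)).mulVec (p.mulVec v)) atBot (𝓝 0) := by
      have e2 : A₀.mulVec (p.mulVec v) = μ 2 • p.mulVec v := by
        rw [Matrix.mulVec_mulVec, h.mul_gapProj, Matrix.smul_mulVec]
      refine (tendsto_cexp_smul_atBot h2 (p.mulVec v)).congr fun x => ?_
      rw [exp_mulVec_eigenvector e2]
    simpa using t1.add t2
  have hd : ∀ x : ℝ, HasDerivAt (fun x : ℝ => (NormedSpace.exp ((x : ℂ) • A₀)).mulVec v)
      (A₀.mulVec ((NormedSpace.exp ((x : ℂ) • A₀)).mulVec v)) x := fun x => by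
    convert! hasDerivAt_mulVec (hasDerivAt_exp_ofReal_smul A₀ x) (hasDerivAt_const x v) using 1
    rw [Matrix.mulVec_zero, add_zero, Matrix.mulVec_mulVec]
  have := (H.monotone hk hd).le_of_tendsto (H.tendsto_form hk hc hν ha₀ ht) 0
  simp only [Complex.ofReal_zero, zero_smul, NormedSpace.exp_zero, Matrix.one_mulVec, hQ] at this
  linarith [H.pos_ε]

theorem GrowthAt.re_gap_pos_one (H : GrowthAt c ν N a₀ b₀ r ε κ l)
    (hk : GrowthData c ν N a₀ b₀ r (fun _ => ψ₀) (fun _ => k₀)) (hc : 0 < c) (hν : 0 < ν)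
    (ha₀ : 0 < a₀) (h : IsGapSpectrum (k₀.matrix c ν l) μ) : 0 < (μ 1).re := by
  have h2 := H.re_gap_neg hk hc hν ha₀ h
  by_contra! hneg
  obtain ⟨v₁, hv₁, hv₁'⟩ := exists_eigenvector_of_gap h 1
  obtain ⟨v₂, hv₂, hv₂'⟩ := exists_eigenvector_of_gap h 2
  have h1 : (μ 1).re < 0 := lt_of_le_of_ne hneg (H.re_ne_zero hk hν hv₁ hv₁')
  set A₀ := k₀.matrix c ν l with hA₀
  obtain ⟨a, b, hab, hne⟩ : ∃ a b : ℂ, a * k₀.flux ν v₁ + b * k₀.flux ν v₂ = 0 ∧ a • v₁ + b • v₂ ≠ 0 := by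
    by_cases hf : k₀.flux ν v₁ = 0
    · exact ⟨1, 0, by simp [hf], by simpa using hv₁⟩
    · refine ⟨-k₀.flux ν v₂ / k₀.flux ν v₁, 1, by field_simp; ring, fun h0 => ?_⟩
      set d := -k₀.flux ν v₂ / k₀.flux ν v₁
      have hv : v₂ = -d • v₁ := by
        rw [one_smul] at h0; rw [neg_smul]; exact eq_neg_of_add_eq_zero_right h0
      have h3 : (μ 1 - μ 2) • v₂ = 0 := by
        rw [sub_smul, ← hv₂', hv, Matrix.mulVec_smul, hv₁', smul_comm, sub_self]
      rcases smul_eq_zero.1 h3 with h4 | h4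
      · have := h.2.2
        rw [sub_eq_zero.1 h4] at this
        exact lt_irrefl _ this
      · exact hv₂ h4
  have hd : ∀ x : ℝ, HasDerivAt (fun x : ℝ => a • Complex.exp (μ 1 * x) • v₁ + b • Complex.exp (μ 2 * x) • v₂)
      (A₀.mulVec (a • Complex.exp (μ 1 * x) • v₁ + b • Complex.exp (μ 2 * x) • v₂)) x := fun x => by
    convert! ((hasDerivAt_cexp_smul_eigenvector hv₁' x).const_smul a).add
      ((hasDerivAt_cexp_smul_eigenvector hv₂' x).const_smul b) using 1
    rw [Matrix.mulVec_add, Matrix.mulVec_smul _ a, Matrix.mulVec_smul _ b]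
  have ht : Tendsto (fun x : ℝ => a • Complex.exp (μ 1 * x) • v₁ + b • Complex.exp (μ 2 * x) • v₂)
      atTop (𝓝 0) := by
    simpa using ((tendsto_cexp_smul_atTop h1 v₁).const_smul a).add
      ((tendsto_cexp_smul_atTop h2 v₂).const_smul b)
  have hle := fun x => (H.monotone hk hd).ge_of_tendsto (H.tendsto_form hk hc hν ha₀ ht) x
  have hge : 0 ≤ k₀.form c ν ε ψ₀ l (a • v₁ + b • v₂) := by
    have e : k₀.flux ν (a • v₁ + b • v₂) = 0 := by
      rw [← hab]; simp [Coeffs.flux]; ring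
    simp only [Coeffs.form, e, lyapunov, zero_mul, mul_zero, add_zero]
    rw [Complex.mul_conj, ← Complex.ofReal_mul, Complex.ofReal_re]
    have := hk.ψ_nonneg 0
    have := Complex.normSq_nonneg ((a • v₁ + b • v₂) 0)
    positivity
  obtain ⟨D, hD, -⟩ := H.growth _ _ hk _ 0 (hd 0)
  have hmax : IsLocalMax (fun x : ℝ => k₀.form c ν ε ψ₀ l
      (a • Complex.exp (μ 1 * x) • v₁ + b • Complex.exp (μ 2 * x) • v₂)) 0 :=
    Eventually.of_forall fun x => (hle x).trans (by simpa using hge)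
  have := H.eq_zero_of_deriv hk hν.ne' (hd 0) hD (hmax.hasDerivAt_eq_zero hD).le
  simp at this
  exact hne this

/-- No zero of the Evans function where the Lyapunov form grows. -/
theorem GrowthAt.not_isEvansValue (H : GrowthAt c ν N a₀ b₀ r ε κ l)
    (hk₀ : GrowthData c ν N a₀ b₀ r (fun _ => ψ₀) (fun _ => k₀)) (hk : GrowthData c ν N a₀ b₀ r ψ k)
    (hc : 0 < c) (hν : 0 < ν) (ha₀ : 0 < a₀) (h : IsGapSpectrum (k₀.matrix c ν l) μ) {C θ : ℝ}
    (hθ : 0 < θ) (hA : AsymConst (fun x => (k x).matrix c ν l) (k₀.matrix c ν l) C θ) :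
    ¬IsEvansValue (fun x => (k x).matrix c ν l) (k₀.matrix c ν l) 0 := fun h0 => by
  obtain ⟨W, hW, hne, t1, t2⟩ := IsEvansValue.exists_decaying_solution hθ hA h
    (H.re_gap_neg hk₀ hc hν ha₀ h) (H.re_gap_pos_one hk₀ hc hν ha₀ h.swap)
    (H.re_gap_pos_one hk₀ hc hν ha₀ h) h0
  exact hne 0 (H.eq_zero_of_tendsto hk hc hν ha₀ hW t1 t2 0)

end Growth

section HighFrequency
open scoped Matrix.Norms.Operator

variable {P : Params} {c q τ₀ : ℝ} {Z : ℝ → ℝ × ℝ}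

/-- The coefficients of the eigenvalue equations at a point of the phase plane. -/
def profileCoeffs (P : Params) (c q : ℝ) (z : ℝ × ℝ) : Coeffs where
  a := z.1 ^ 2
  α := (1 / P.F + 2 * c * P.ν * z.2) / z.1 ^ 3
  dα := -3 * z.2 * (1 / P.F + 2 * c * P.ν * z.2) / z.1 ^ 4
    + 2 * c * P.ν * (profileField P c q z).2 / z.1 ^ 3
  g₁ := (P.s + 1) * z.1 ^ P.s * (q - c * z.1) ^ P.r
    - (-3 * z.2 * (1 / P.F + 2 * c * P.ν * z.2) / z.1 ^ 4
      + 2 * c * P.ν * (profileField P c q z).2 / z.1 ^ 3)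
  g₂ := P.r * z.1 ^ (P.s + 1) * (q - c * z.1) ^ (P.r - 1)
  m := (-c * z.1 ^ 2 + (1 / P.F + 2 * c * P.ν * z.2) / z.1 ^ 3 * z.1 ^ 2 / c) / P.ν

theorem profileMatrix_eq_matrix (x : ℝ) (l : ℂ) :
    profileMatrix P c q Z x l = (profileCoeffs P c q (Z x)).matrix c P.ν l := by
  ext i j
  fin_cases i <;> fin_cases j <;> simp [profileMatrix, coeffMatrix, Coeffs.matrix, profileCoeffs]

theorem limitMatrix_eq_matrix (hs : IsSaddle P c q τ₀) (l : ℂ) :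
    limitMatrix P c q τ₀ l = (profileCoeffs P c q (τ₀, 0)).matrix c P.ν l := by
  have hrest : (profileField P c q (τ₀, 0)).2 = 0 := by rw [hs.rest]; rfl
  ext i j
  fin_cases i <;> fin_cases j <;>
    simp [limitMatrix, coeffMatrix, Coeffs.matrix, profileCoeffs, hrest]

/-- Bounds on the profile coefficients at a point. -/
structure CoeffBounds (P : Params) (c q N a₀ b₀ : ℝ) (z : ℝ × ℝ) : Prop where
  le_a : a₀ ≤ z.1 ^ 2
  a_le : z.1 ^ 2 ≤ N
  α_le : |(profileCoeffs P c q z).α| ≤ N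
  dα_le : |(profileCoeffs P c q z).dα| ≤ N
  g₁_le : |(profileCoeffs P c q z).g₁| ≤ N
  g₂_le : |(profileCoeffs P c q z).g₂| ≤ N
  m_le : |(profileCoeffs P c q z).m| ≤ N
  weight_le : (z.1 ^ 4)⁻¹ ≤ N
  da_le : |2 * z.1 * z.2 / P.ν| ≤ N
  dφ_le : |-(2 * z.2) / z.1 ^ 3 / P.ν| ≤ N
  le_b : b₀ ≤ 1 / (P.F * P.ν * z.1 ^ 5)

theorem exists_coeffBounds {K : Set (ℝ × ℝ)} (hK : IsCompact K) (hne : K.Nonempty)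
    (hpos : ∀ z ∈ K, 0 < z.1 ∧ 0 < q - c * z.1) :
    ∃ N a₀ b₀, 1 ≤ N ∧ 0 < a₀ ∧ 0 < b₀ ∧ ∀ z ∈ K, CoeffBounds P c q N a₀ b₀ z := by
  have hF := P.F_pos
  have hν := P.ν_pos
  have bd : ∀ f : ℝ × ℝ → ℝ, ContinuousOn f K → ∃ N, ∀ z ∈ K, |f z| ≤ N := fun f hf =>
    hK.exists_bound_of_continuousOn hf
  have low : ∀ f : ℝ × ℝ → ℝ, ContinuousOn f K → (∀ z ∈ K, 0 < f z) →
      ∃ a, 0 < a ∧ ∀ z ∈ K, a ≤ f z := fun f hf hf0 => by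
    obtain ⟨z, hz, hmin⟩ := hK.exists_isMinOn hne hf
    exact ⟨f z, hf0 z hz, fun w hw => hmin hw⟩
  have d1 : ContinuousOn (fun z : ℝ × ℝ => z.1) K := continuousOn_fst
  have d2 : ContinuousOn (fun z : ℝ × ℝ => z.2) K := continuousOn_snd
  have d3 : ContinuousOn (fun z : ℝ × ℝ => (profileField P c q z).2) K := fun z hz =>
    (continuousAt_snd.comp (contDiffAt_profileField P c q (hpos z hz).1
      (hpos z hz).2).continuousAt).continuousWithinAt
  have dt : ∀ e : ℝ, ContinuousOn (fun z : ℝ × ℝ => z.1 ^ e) K := fun e =>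
    d1.rpow_const fun z hz => Or.inl (hpos z hz).1.ne'
  have du : ∀ e : ℝ, ContinuousOn (fun z : ℝ × ℝ => (q - c * z.1) ^ e) K := fun e =>
    (continuousOn_const.sub (continuousOn_const.mul d1)).rpow_const fun z hz => Or.inl (hpos z hz).2.ne'
  have hn : ∀ n : ℕ, ∀ z ∈ K, z.1 ^ n ≠ 0 := fun n z hz => pow_ne_zero _ (hpos z hz).1.ne'
  have dnum : ContinuousOn (fun z : ℝ × ℝ => 1 / P.F + 2 * c * P.ν * z.2) K :=
    continuousOn_const.add (continuousOn_const.mul d2)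
  have dα : ContinuousOn (fun z => (profileCoeffs P c q z).α) K := dnum.div (d1.pow 3) (hn 3)
  have ddα : ContinuousOn (fun z => (profileCoeffs P c q z).dα) K :=
    (((continuousOn_const.mul d2).mul dnum).div (d1.pow 4) (hn 4)).add
      ((continuousOn_const.mul d3).div (d1.pow 3) (hn 3))
  have dg₁ : ContinuousOn (fun z => (profileCoeffs P c q z).g₁) K :=
    ((continuousOn_const.mul (dt _)).mul (du _)).sub ddα
  have dg₂ : ContinuousOn (fun z => (profileCoeffs P c q z).g₂) K :=
    (continuousOn_const.mul (dt _)).mul (du _)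
  have dm : ContinuousOn (fun z => (profileCoeffs P c q z).m) K :=
    ((continuousOn_const.mul (d1.pow 2)).add ((dα.mul (d1.pow 2)).div_const c)).div_const _
  obtain ⟨N₁, h1⟩ := bd _ (d1.pow 2)
  obtain ⟨N₂, h2⟩ := bd _ dα
  obtain ⟨N₃, h3⟩ := bd _ ddα
  obtain ⟨N₄, h4⟩ := bd _ dg₁
  obtain ⟨N₅, h5⟩ := bd _ dg₂
  obtain ⟨N₆, h6⟩ := bd _ dm
  obtain ⟨N₇, h7⟩ := bd _ ((d1.pow 4).inv₀ (hn 4))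
  obtain ⟨N₈, h8⟩ := bd (fun z => 2 * z.1 * z.2 / P.ν) (((continuousOn_const.mul d1).mul d2).div_const _)
  obtain ⟨N₉, h9⟩ := bd (fun z => -(2 * z.2) / z.1 ^ 3 / P.ν)
    (((continuousOn_const.mul d2).neg.div (d1.pow 3) (hn 3)).div_const _)
  obtain ⟨a₀, ha₀, ha⟩ := low _ (d1.pow 2) fun z hz => pow_pos (hpos z hz).1 2
  obtain ⟨b₀, hb₀, hb⟩ := low (fun z => 1 / (P.F * P.ν * z.1 ^ 5))
    (continuousOn_const.div (continuousOn_const.mul (d1.pow 5))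
      fun z hz => mul_ne_zero (mul_pos hF hν).ne' (hn 5 z hz))
    fun z hz => div_pos one_pos (mul_pos (mul_pos hF hν) (pow_pos (hpos z hz).1 5))
  obtain ⟨N, hN⟩ : ∃ N, ∀ M ∈ ({1, N₁, N₂, N₃, N₄, N₅, N₆, N₇, N₈, N₉} : Finset ℝ), M ≤ N :=
    (Finset.bddAbove _)
  simp only [Finset.mem_insert, Finset.mem_singleton, forall_eq_or_imp, forall_eq] at hN
  obtain ⟨m0, m1, m2, m3, m4, m5, m6, m7, m8, m9⟩ := hN
  exact ⟨N, a₀, b₀, m0, ha₀, hb₀, fun z hz => ⟨ha z hz, (le_abs_self _).trans ((h1 z hz).trans m1),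
    (h2 z hz).trans m2, (h3 z hz).trans m3, (h4 z hz).trans m4, (h5 z hz).trans m5,
    (h6 z hz).trans m6, (le_abs_self _).trans ((h7 z hz).trans m7), (h8 z hz).trans m8,
    (h9 z hz).trans m9, hb z hz⟩⟩

theorem hasDerivAt_profileCoeffs_α {Y : ℝ → ℝ × ℝ} {x : ℝ} (hY : HasDerivAt Y (profileField P c q (Y x)) x)
    (h0 : 0 < (Y x).1) :
    HasDerivAt (fun x => (profileCoeffs P c q (Y x)).α) (profileCoeffs P c q (Y x)).dα x := by
  have h1 : HasDerivAt (fun x => (Y x).1) (Y x).2 x := hY.fst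
  have h2 : HasDerivAt (fun x => (Y x).2) (profileField P c q (Y x)).2 x := hY.snd
  have h3 := ((h2.const_mul (2 * c * P.ν)).const_add (1 / P.F)).div (h1.pow 3) (pow_ne_zero 3 h0.ne')
  refine (h3 : HasDerivAt (fun x => (profileCoeffs P c q (Y x)).α) _ x).congr_deriv ?_
  simp only [profileCoeffs, Pi.pow_apply]
  have := h0.ne'
  push_cast
  field_simp
  ring

theorem growthData_profile {K : Set (ℝ × ℝ)} {N a₀ b₀ : ℝ}
    (hB : ∀ z ∈ K, CoeffBounds P c q N a₀ b₀ z) (hpos : ∀ z ∈ K, 0 < z.1 ∧ 0 < q - c * z.1)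
    {Y : ℝ → ℝ × ℝ} (hY : ∀ x, HasDerivAt Y (profileField P c q (Y x)) x) (hYK : ∀ x, Y x ∈ K) :
    GrowthData c P.ν N a₀ b₀ 0 (fun x => ((Y x).1 ^ 4)⁻¹) (fun x => profileCoeffs P c q (Y x)) where
  deriv_α x := hasDerivAt_profileCoeffs_α (hY x) (hpos _ (hYK x)).1
  deriv_ψ x := by
    have h0 := (hpos _ (hYK x)).1
    have h0' := h0.ne'
    have hν := P.ν_pos.ne'
    have hF := P.F_pos.ne'
    have h1 : HasDerivAt (fun x => (Y x).1) (Y x).2 x := (hY x).fst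
    have hψ := (h1.pow 4).inv (pow_ne_zero 4 h0')
    have hφ := hψ.mul ((h1.pow 2).div_const P.ν)
    refine ⟨_, -(2 * (Y x).2) / (Y x).1 ^ 3 / P.ν, hψ, ?_, (hB _ (hYK x)).dφ_le, ?_⟩
    · refine (hφ : HasDerivAt (fun x => ((Y x).1 ^ 4)⁻¹ * ((profileCoeffs P c q (Y x)).a / P.ν)) _
        x).congr_deriv ?_
      simp only [Pi.pow_apply, Pi.inv_apply]
      push_cast
      field_simp
      ring
    · refine (hB _ (hYK x)).le_b.trans (le_of_eq ?_)
      simp only [profileCoeffs, Pi.pow_apply]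
      push_cast
      field_simp
      ring
  ψ_nonneg x := by have := (hpos _ (hYK x)).1; positivity
  ψ_le x := (hB _ (hYK x)).weight_le
  le_a x := (hB _ (hYK x)).le_a
  a_le x := (hB _ (hYK x)).a_le
  α_le x := (hB _ (hYK x)).α_le
  dα_le x := (hB _ (hYK x)).dα_le
  g₁_le x := (hB _ (hYK x)).g₁_le
  g₂_le x := (hB _ (hYK x)).g₂_le
  m_le x := (hB _ (hYK x)).m_le

/-- The compact closure of the homoclinic orbit. -/
theorem IsHomoclinic.isCompact (h : IsHomoclinic P c q τ₀ Z) :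
    IsCompact (insert (τ₀, 0) (range Z)) := by
  refine Tendsto.isCompact_insert_range_of_cocompact ?_ h.continuous
  rw [cocompact_eq_atBot_atTop, tendsto_sup]
  exact ⟨h.tendsto_atBot, h.tendsto_atTop⟩

theorem IsHomoclinic.exists_coeffBounds (h : IsHomoclinic P c q τ₀ Z) (hs : IsSaddle P c q τ₀) :
    (∀ z ∈ insert (τ₀, 0) (range Z), 0 < z.1 ∧ 0 < q - c * z.1) ∧
    ∃ N a₀ b₀, 1 ≤ N ∧ 0 < a₀ ∧ 0 < b₀ ∧
      ∀ z ∈ insert (τ₀, 0) (range Z), CoeffBounds P c q N a₀ b₀ z := by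
  have hpos : ∀ z ∈ insert (τ₀, 0) (range Z), 0 < z.1 ∧ 0 < q - c * z.1 := by
    rintro z (rfl | ⟨x, rfl⟩)
    · exact ⟨hs.tau_pos, hs.u_pos⟩
    · exact ⟨h.tau_pos x, h.u_pos x⟩
  exact ⟨hpos, StVenant.exists_coeffBounds h.isCompact ⟨_, mem_insert _ _⟩ hpos⟩

theorem hasDerivAt_rest (hs : IsSaddle P c q τ₀) (x : ℝ) :
    HasDerivAt (fun _ : ℝ => ((τ₀, 0) : ℝ × ℝ)) (profileField P c q (τ₀, 0)) x := by
  rw [hs.rest]; exact hasDerivAt_const x _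

/-- The Evans function does not vanish for large `|λ|` in the closed right half-plane. -/
theorem exists_evans_ne_zero (h : IsHomoclinic P c q τ₀ Z) (hs : IsSaddle P c q τ₀) (hc : 0 < c) :
    ∃ R : ℝ, 0 < R ∧ ∀ l ∈ gapSet P c q τ₀, 0 ≤ l.re → R ≤ ‖l‖ → evans P c q τ₀ Z l ≠ 0 := by
  obtain ⟨hpos, N, a₀, b₀, hN, ha₀, hb₀, hB⟩ := h.exists_coeffBounds hs
  obtain ⟨ε, κ, R, hR, H⟩ := exists_growthAt (c := c) (ν := P.ν) hc P.ν_pos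
    (by linarith : 0 ≤ N) ha₀ hb₀
  refine ⟨R, hR, fun l hl hl0 hlR h0 => ?_⟩
  obtain ⟨C, θ, hθ, hC, hA⟩ := exists_asymConst h hs hc.ne'
  obtain ⟨δ, hδ, huniq⟩ := existsUnique_isEvansValue h hs hc.ne' hl
  have hδ0 : IsEvansValue (fun x => profileMatrix P c q Z x l) (limitMatrix P c q τ₀ l) 0 := by
    have hex : ∃ δ, IsEvansValue (fun x => profileMatrix P c q Z x l) (limitMatrix P c q τ₀ l) δ :=
      ⟨δ, hδ⟩
    rw [evans, dif_pos hex] at h0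
    rw [← h0]
    exact hex.choose_spec
  obtain ⟨μ, hμ⟩ := hl
  have hA' := hA l
  simp only [profileMatrix_eq_matrix, limitMatrix_eq_matrix hs] at hA' hδ0 hμ
  exact (H 0 l hl0 hl0 hlR).not_isEvansValue
    (growthData_profile hB hpos (Y := fun _ => (τ₀, 0)) (hasDerivAt_rest hs) (fun _ => mem_insert _ _))
    (growthData_profile hB hpos h.ode (fun x => mem_insert_of_mem _ ⟨x, rfl⟩))
    hc P.ν_pos ha₀ hμ hθ hA' hδ0

/-! ### The sign at real infinity -/

/-- Affine interpolation of coefficients. -/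
def Coeffs.interp (k₀ k : Coeffs) (t : ℝ) : Coeffs where
  a := k₀.a + t * (k.a - k₀.a)
  α := k₀.α + t * (k.α - k₀.α)
  dα := k₀.dα + t * (k.dα - k₀.dα)
  g₁ := k₀.g₁ + t * (k.g₁ - k₀.g₁)
  g₂ := k₀.g₂ + t * (k.g₂ - k₀.g₂)
  m := k₀.m + t * (k.m - k₀.m)

theorem Coeffs.matrix_interp (ν : ℝ) (k₀ k : Coeffs) (t : ℝ) (l : ℂ) :
    (k₀.interp k t).matrix c ν l = k₀.matrix c ν l + (t : ℂ) • (k.matrix c ν l - k₀.matrix c ν l) := by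
  ext i j
  fin_cases i <;> fin_cases j <;> simp [Coeffs.matrix, Coeffs.interp] <;> ring

theorem abs_interp_le {x y N t : ℝ} (hx : |x| ≤ N) (hy : |y| ≤ N) (h0 : 0 ≤ t) (h1 : t ≤ 1) :
    |x + t * (y - x)| ≤ N := by
  have e : x + t * (y - x) = (1 - t) * x + t * y := by ring
  rw [e]
  refine (abs_add_le _ _).trans ?_
  rw [abs_mul, abs_mul, abs_of_nonneg h0, abs_of_nonneg (sub_nonneg.2 h1)]
  nlinarith

theorem growthData_interp (hs : IsSaddle P c q τ₀) {K : Set (ℝ × ℝ)} {N a₀ b₀ : ℝ} (hN : 1 ≤ N)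
    (hB : ∀ z ∈ K, CoeffBounds P c q N a₀ b₀ z) (hpos : ∀ z ∈ K, 0 < z.1 ∧ 0 < q - c * z.1)
    (hK : (τ₀, 0) ∈ K)
    {Y : ℝ → ℝ × ℝ} (hY : ∀ x, HasDerivAt Y (profileField P c q (Y x)) x) (hYK : ∀ x, Y x ∈ K)
    {t : ℝ} (h0 : 0 ≤ t) (h1 : t ≤ 1) :
    GrowthData c P.ν N a₀ 1 (1 + N * N / P.ν) (fun _ => 1)
      (fun x => (profileCoeffs P c q (τ₀, 0)).interp (profileCoeffs P c q (Y x)) t) := by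
  have hν := P.ν_pos
  have b₀' := hB _ hK
  have hrest : (profileCoeffs P c q (τ₀, 0)).dα = 0 := by
    have : (profileField P c q (τ₀, 0)).2 = 0 := by rw [hs.rest]; rfl
    simp [profileCoeffs, this]
  have hα : ∀ x, |((profileCoeffs P c q (τ₀, 0)).interp (profileCoeffs P c q (Y x)) t).α| ≤ N :=
    fun x => abs_interp_le b₀'.α_le (hB _ (hYK x)).α_le h0 h1
  have aabs : ∀ z ∈ K, |(profileCoeffs P c q z).a| ≤ N := fun z hz => by
    exact (abs_of_nonneg (sq_nonneg z.1)).trans_le (hB z hz).a_le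
  have ha : ∀ x, |((profileCoeffs P c q (τ₀, 0)).interp (profileCoeffs P c q (Y x)) t).a| ≤ N :=
    fun x => abs_interp_le (aabs _ hK) (aabs _ (hYK x)) h0 h1
  refine ⟨fun x => ?_, fun x => ?_, fun _ => zero_le_one, fun _ => hN, fun x => ?_,
    fun x => (le_abs_self _).trans (ha x), hα, fun x => abs_interp_le b₀'.dα_le (hB _ (hYK x)).dα_le h0 h1,
    fun x => abs_interp_le b₀'.g₁_le (hB _ (hYK x)).g₁_le h0 h1,
    fun x => abs_interp_le b₀'.g₂_le (hB _ (hYK x)).g₂_le h0 h1,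
    fun x => abs_interp_le b₀'.m_le (hB _ (hYK x)).m_le h0 h1⟩
  · have := (((hasDerivAt_profileCoeffs_α (hY x) (hpos _ (hYK x)).1).sub_const
      (profileCoeffs P c q (τ₀, 0)).α).const_mul t).const_add (profileCoeffs P c q (τ₀, 0)).α
    refine this.congr_deriv ?_
    simp [Coeffs.interp, hrest]
  · have e1 : HasDerivAt (fun x => (Y x).1) (Y x).2 x := (hY x).fst
    have e2 := (((((e1.pow 2).sub_const (τ₀ ^ 2)).const_mul t).const_add (τ₀ ^ 2)).div_const
      P.ν).const_mul 1
    refine ⟨0, t * (2 * (Y x).1 * (Y x).2 / P.ν), hasDerivAt_const x 1,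
      (e2 : HasDerivAt (fun x => 1 * (((profileCoeffs P c q (τ₀, 0)).interp
        (profileCoeffs P c q (Y x)) t).a / P.ν)) _ x).congr_deriv ?_, ?_, ?_⟩
    · push_cast; ring
    · rw [abs_mul, abs_of_nonneg h0]
      have := (hB _ (hYK x)).da_le
      have := abs_nonneg (2 * (Y x).1 * (Y x).2 / P.ν)
      nlinarith
    · have e3 : |((profileCoeffs P c q (τ₀, 0)).interp (profileCoeffs P c q (Y x)) t).a
          * ((profileCoeffs P c q (τ₀, 0)).interp (profileCoeffs P c q (Y x)) t).α / P.ν| ≤ N * N / P.ν := by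
        rw [abs_div, abs_mul, abs_of_pos hν]
        have := ha x
        have := hα x
        gcongr
      have := (abs_le.1 e3).1
      linarith
  · have e1 := b₀'.le_a
    have e2 := (hB _ (hYK x)).le_a
    have e : ((profileCoeffs P c q (τ₀, 0)).interp (profileCoeffs P c q (Y x)) t).a
      = (1 - t) * (τ₀ ^ 2) + t * (Y x).1 ^ 2 := by simp [Coeffs.interp, profileCoeffs]; ring
    rw [e]
    have e1' : a₀ ≤ τ₀ ^ 2 := e1
    nlinarith

theorem conjMat_coeffs_matrix (ν : ℝ) (k : Coeffs) (l : ℂ) :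
    conjMat (k.matrix c ν l) = k.matrix c ν (starRingEnd ℂ l) := by
  ext i j
  fin_cases i <;> fin_cases j <;> simp [conjMat, Coeffs.matrix]

theorem FastPair.unique {A : ℝ → Mat3} {m : ℂ} {p : Mat3} {X Y X' Y' : ℝ → Mat3}
    (h : FastPair A m p X Y) (h' : FastPair A m p X' Y') (x : ℝ) : X x = X' x ∧ Y x = Y' x := by
  have h1 := h.uniqueX (fun x => X x - X' x) (fun x => by
    rw [mul_sub]; exact (h.derivX x).sub (h'.derivX x)) (by simpa using h.limX.sub h'.limX) x
  have h2 := h.uniqueY (fun x => Y x - Y' x) (fun x => by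
    convert! (h.derivY x).sub (h'.derivY x) using 1
    rw [sub_mul]; abel) (by simpa using h.limY.sub h'.limY) x
  exact ⟨sub_eq_zero.1 h1, sub_eq_zero.1 h2⟩

theorem norm_trace_le (M : Mat3) : ‖M.trace‖ ≤ 3 * ‖M‖ := by
  have e : ∀ i, ‖M i i‖ ≤ ‖M‖ := fun i => by
    have h1 := Matrix.linfty_opNorm_mulVec M (Pi.single i 1)
    have h2 : ‖(Pi.single i 1 : Fin 3 → ℂ)‖ = 1 := by
      rw [Pi.norm_single, norm_one]
    rw [h2, mul_one] at h1
    refine le_trans ?_ h1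
    have := norm_le_pi_norm (M.mulVec (Pi.single i 1)) i
    simpa using this
  rw [Matrix.trace_fin_three]
  have := norm_add₃_le (a := M 0 0) (b := M 1 1) (c := M 2 2)
  linarith [e 0, e 1, e 2]

theorem isEvansValue_zero_of_trace_eq_zero {A : ℝ → Mat3} {A₀ : Mat3} {μ : Fin 3 → ℂ} {C θ : ℝ}
    {X Y : ℝ → Mat3} {f : ℝ → ℝ}
    (hθ : 0 < θ) (hA : AsymConst A A₀ C θ) (hμ : IsGapSpectrum A₀ μ)
    (hF : FastPair A (μ 2) (gapProj A₀ μ) X Y) (hf : Continuous f)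
    (htr : ∀ x, (A x).trace - A₀.trace = f x) (h0 : (Y 0 * X 0).trace = 0) :
    IsEvansValue A A₀ 0 := by
  obtain ⟨k, K, -, hK, hk0, hk, hkK, -⟩ := exists_integrating_factor (f := f) (C := 3 * C) hθ hf (fun x => by
    have h1 := hA.bound x
    have h3 := norm_trace_le (A x - A₀)
    rw [Matrix.trace_sub, htr, Complex.norm_real, Real.norm_eq_abs] at h3
    linarith)
  obtain ⟨δ, hδ⟩ := exists_isEvansValue hθ hA hμ hF
  have := IsEvansValue.eq_trace hμ hF (k := fun x => (k x : ℂ)) (f := fun x => (f x : ℂ)) htr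
    (by simp [hk0]) (fun x => by simpa using (hk x).ofReal_comp)
    ((Complex.continuous_ofReal.tendsto K).comp hkK) hδ
  rw [h0, mul_zero] at this
  rwa [this] at hδ

theorem gapFamily_const {A₀ : Mat3} {μ : Fin 3 → ℂ} (h : IsGapSpectrum A₀ μ) (U : Set ℂ) :
    ∃ g D, 0 < g ∧ GapFamily (fun _ => A₀) (fun _ => μ) U g D := by
  obtain ⟨D, hD⟩ : ∃ D, ∀ x ∈ ({‖gapProj A₀ μ‖, ‖A₀ - μ 2 • 1‖, ‖μ 0 - μ 2‖, ‖μ 1 - μ 2‖} : Finset ℝ),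
      x ≤ D := Finset.bddAbove _
  simp only [Finset.mem_insert, Finset.mem_singleton, forall_eq_or_imp, forall_eq] at hD
  refine ⟨min (μ 0 - μ 2).re (μ 1 - μ 2).re, D, lt_min ?_ ?_, fun _ _ => h,
    differentiableOn_const _, differentiableOn_const _, fun _ _ => hD.1, fun _ _ => hD.2.1,
    fun _ _ => min_le_left _ _, fun _ _ => min_le_right _ _, fun _ _ => hD.2.2.1,
    fun _ _ => hD.2.2.2⟩
  · simpa using h.2.1
  · simpa using h.2.2

/-- The Evans function is positive for large real `λ`. -/
theorem exists_evans_pos (h : IsHomoclinic P c q τ₀ Z) (hs : IsSaddle P c q τ₀) (hc : 0 < c) :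
    ∃ R : ℝ, 0 < R ∧ ∀ l : ℝ, R ≤ l → 0 < (evans P c q τ₀ Z l).re := by
  obtain ⟨hpos, N, a₀, b₀, hN, ha₀, hb₀, hB⟩ := h.exists_coeffBounds hs
  obtain ⟨ε, κ, R, hR, H⟩ := exists_growthAt (c := c) (ν := P.ν) hc P.ν_pos
    (by linarith : 0 ≤ N) ha₀ one_pos
  obtain ⟨C, θ, hθ, hC, hAs⟩ := exists_asymConst h hs hc.ne'
  obtain ⟨K, hK, hev⟩ := exists_evans_eq_trace h hs hc.ne'
  refine ⟨max R (1 + N * N / P.ν), lt_max_of_lt_left hR, fun l hl => ?_⟩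
  have hlR := (le_max_left _ _).trans hl
  have hlr := (le_max_right _ _).trans hl
  have hl0 : 0 < l := hR.trans_le hlR
  obtain ⟨μ, hμ, -, him, -⟩ := exists_gapSpectrum_real hs hc hl0.le
  set k₀ := profileCoeffs P c q (τ₀, 0) with hk₀
  set A₀ := limitMatrix P c q τ₀ l with hA₀
  have hA₀k : A₀ = k₀.matrix c P.ν l := limitMatrix_eq_matrix hs _
  let A : ℂ → ℝ → Mat3 := fun z x => A₀ + z • (profileMatrix P c q Z x l - A₀)
  have hAC : ∀ z ∈ Metric.ball (0 : ℂ) 2, AsymConst (A z) A₀ (2 * (C * (1 + ‖(l : ℂ)‖))) θ :=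
    fun z hz => ⟨continuous_const.add (((continuous_profileMatrix h l).sub continuous_const).const_smul z),
      fun x => by
        have h1 := (hAs l).bound x
        have h2 : ‖z‖ ≤ 2 := by simpa using (Metric.mem_ball.1 hz).le
        simp only [A, add_sub_cancel_left, norm_smul]
        rw [mul_assoc]
        exact mul_le_mul h2 h1 (norm_nonneg _) zero_le_two⟩
  obtain ⟨g, D, hg, hG⟩ := gapFamily_const hμ (Metric.ball 0 2)
  obtain ⟨X, Y, hF, hX, hY, -⟩ := hG.exists_fastPair (A := A) Metric.isOpen_ball hθ hg hAC
    (fun x => ((differentiable_id.smul_const _).const_add _).differentiableOn)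
    (differentiableOn_const _)
  set e : ℂ → ℂ := fun z => (Y z 0 * X z 0).trace with he
  have hmem : ∀ t ∈ Icc (0 : ℝ) 1, (t : ℂ) ∈ Metric.ball (0 : ℂ) 2 := fun t ht => by
    rw [mem_ball_zero_iff, Complex.norm_real, Real.norm_eq_abs, abs_of_nonneg ht.1]
    linarith [ht.2]
  have hcont : ContinuousOn (fun t : ℝ => (e t).re) (Icc 0 1) := by
    have h1 : ContinuousOn (fun z => Y z 0 * X z 0) (Metric.ball 0 2) :=
      ((hY 0).mul (hX 0)).continuousOn
    have h2 : ContinuousOn e (Metric.ball 0 2) :=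
      (continuous_id.matrix_trace).comp_continuousOn h1
    exact Complex.continuous_re.comp_continuousOn
      (h2.comp Complex.continuous_ofReal.continuousOn hmem)
  have hAt : ∀ t : ℝ, A t = fun x => (k₀.interp (profileCoeffs P c q (Z x)) t).matrix c P.ν l :=
    fun t => funext fun x => by
      rw [Coeffs.matrix_interp, ← hA₀k, ← profileMatrix_eq_matrix]
  have hmc : starRingEnd ℂ (μ 2) = μ 2 := Complex.conj_eq_iff_im.2 him
  have hA₀c : conjMat A₀ = A₀ := by rw [hA₀k, conjMat_coeffs_matrix, Complex.conj_ofReal]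
  have hpc : conjMat (gapProj A₀ μ) = gapProj A₀ μ := by
    have h1 := hμ.conj
    rw [hA₀c] at h1
    rw [← gapProj_conj, hA₀c]
    exact hμ.gapProj_unique h1
  have him' : ∀ t ∈ Icc (0 : ℝ) 1, (e t).im = 0 := fun t ht => by
    have h1 := hF t (hmem t ht)
    have h2 := h1.conj
    have h3 : (fun x => conjMat (A t x)) = A t := by
      rw [hAt]; exact funext fun x => by rw [conjMat_coeffs_matrix, Complex.conj_ofReal]
    rw [h3, hmc, hpc] at h2
    obtain ⟨h4, h5⟩ := h1.unique h2 0
    refine Complex.conj_eq_iff_im.1 ?_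
    simp only [he]
    rw [← trace_conjMat, conjMat_mul, ← h4, ← h5]
  have hne : ∀ t ∈ Icc (0 : ℝ) 1, e t ≠ 0 := fun t ht h0 => by
    have h1 := isEvansValue_zero_of_trace_eq_zero hθ (hAC t (hmem t ht)) hμ (hF t (hmem t ht))
      (f := fun x => t * traceDefect P c τ₀ Z x) (continuous_const.mul (continuous_traceDefect h))
      (fun x => by
        simp only [A, Matrix.trace_add, Matrix.trace_smul, Matrix.trace_sub, trace_sub_trace, hA₀]
        push_cast
        rw [smul_eq_mul]; ring) h0
    have h2 := hAC t (hmem t ht)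
    have hG0 : ∀ s ∈ Icc (0 : ℝ) 1, GrowthData c P.ν N a₀ 1 (1 + N * N / P.ν) (fun _ => 1)
      (fun x => k₀.interp (profileCoeffs P c q (Z x)) s) := fun s hs' => growthData_interp hs hN hB hpos
        (mem_insert _ _) h.ode (fun x => mem_insert_of_mem _ ⟨x, rfl⟩) hs'.1 hs'.2
    have hG1 : GrowthData c P.ν N a₀ 1 (1 + N * N / P.ν) (fun _ => 1) (fun _ => k₀) := by
      have e0 : ∀ k, k₀.interp k 0 = k₀ := fun k => by simp [Coeffs.interp]
      have := hG0 0 ⟨le_rfl, zero_le_one⟩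
      simpa only [e0] using this
    rw [hAt, hA₀k] at h1 h2
    rw [hA₀k] at hμ
    exact (H (1 + N * N / P.ν) l (by simpa using hl0.le) (by simpa using hlr)
      (by rwa [Complex.norm_real, Real.norm_eq_abs, abs_of_pos hl0])).not_isEvansValue hG1 (hG0 t ht)
      hc P.ν_pos ha₀ hμ hθ h2 h1
  have e0 : e 0 = 1 := by
    have h1 := hF 0 (by simp)
    have h2 : FastPair (A 0) (μ 2) (gapProj A₀ μ) (fun _ => gapProj A₀ μ) (fun _ => gapProj A₀ μ) := by
      refine ⟨fun x => ?_, tendsto_const_nhds, fun x => ?_, tendsto_const_nhds, h1.uniqueX, h1.uniqueY⟩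
      · have : (A 0 x - μ 2 • 1) * gapProj A₀ μ = 0 := by
          simp only [A, zero_smul, add_zero]; exact hμ.sub_mul_gapProj
        rw [this]; exact hasDerivAt_const _ _
      · have : gapProj A₀ μ * (A 0 x - μ 2 • 1) = 0 := by
          simp only [A, zero_smul, add_zero]; exact hμ.gapProj_mul_sub
        rw [this, neg_zero]; exact hasDerivAt_const _ _
    obtain ⟨h3, h4⟩ := h1.unique h2 0
    simp only [he]
    rw [h3, h4, hμ.gapProj_mul_self, hμ.trace_gapProj]
  have hre : 0 < (e 1).re := by
    by_contra! hneg
    obtain ⟨t, ht, ht0⟩ := intermediate_value_Icc' zero_le_one hcont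
      (show (0 : ℝ) ∈ Icc (e ((1 : ℝ) : ℂ)).re (e ((0 : ℝ) : ℂ)).re by
        simp only [Complex.ofReal_one, Complex.ofReal_zero, e0, Complex.one_re]
        exact ⟨hneg, zero_le_one⟩)
    exact hne t ht (Complex.ext ht0 (him' t ht))
  have hF1 := hF 1 (by simp)
  have e1 : A 1 = fun x => profileMatrix P c q Z x l := funext fun x => by simp [A]
  rw [e1] at hF1
  rw [(hev l μ _ _ hμ hF1).2, Complex.re_ofReal_mul]
  exact mul_pos hK hre

end HighFrequency

section Linearization

variable {P : Params} {c q τ₀ : ℝ} {Z : ℝ → ℝ × ℝ}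

/-- The profile field as a function of the speed, with the end state kept fixed. -/
def speedField (P : Params) (c q τ₀ : ℝ) (p : ℝ × ℝ × ℝ) : ℝ × ℝ :=
  profileField P p.1 (q - c * τ₀ + p.1 * τ₀) p.2

/-- The second component of the derivative of `speedField` at `(c, z)` in the direction `(σ, ζ)`. -/
def linField (P : Params) (c q τ₀ : ℝ) (z : ℝ × ℝ) (σ : ℝ) (ζ : ℝ × ℝ) : ℝ :=
  (2 * ζ.1 / z.1 - σ / c) * ((profileField P c q z).2 - 2 * z.2 ^ 2 / z.1)
    + z.1 ^ 2 / (c * P.ν) *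
      (-((P.s + 1) * z.1 ^ P.s * (q - c * z.1) ^ P.r * ζ.1
        + P.r * z.1 ^ (P.s + 1) * (q - c * z.1) ^ (P.r - 1) * (σ * (τ₀ - z.1) - c * ζ.1))
      - (2 * c * σ + 3 * ζ.1 / (P.F * z.1 ^ 4)) * z.2 - (c ^ 2 - 1 / (P.F * z.1 ^ 3)) * ζ.2)
    + 4 * z.2 * ζ.2 / z.1 - 2 * z.2 ^ 2 * ζ.1 / z.1 ^ 2

theorem contDiffAt_speedField (hc : c ≠ 0) {z : ℝ × ℝ} (ht : 0 < z.1) (hu : 0 < q - c * z.1) :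
    ContDiffAt ℝ 1 (speedField P c q τ₀) (c, z) := by
  have hν := P.ν_pos.ne'
  have hF := P.F_pos.ne'
  have d0 : ContDiffAt ℝ 1 (fun p : ℝ × ℝ × ℝ => p.1) (c, z) := contDiffAt_fst
  have d1 : ContDiffAt ℝ 1 (fun p : ℝ × ℝ × ℝ => p.2.1) (c, z) := contDiffAt_fst.comp _ contDiffAt_snd
  have d2 : ContDiffAt ℝ 1 (fun p : ℝ × ℝ × ℝ => p.2.2) (c, z) := contDiffAt_snd.comp _ contDiffAt_snd
  have du : ContDiffAt ℝ 1 (fun p : ℝ × ℝ × ℝ => q - c * τ₀ + p.1 * τ₀ - p.1 * p.2.1) (c, z) :=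
    (contDiffAt_const.add (d0.mul contDiffAt_const)).sub (d0.mul d1)
  have hu' : q - c * τ₀ + c * τ₀ - c * z.1 ≠ 0 := by rw [sub_add_cancel]; exact hu.ne'
  have hz : ∀ n : ℕ, z.1 ^ n ≠ 0 := fun n => pow_ne_zero _ ht.ne'
  unfold speedField profileField
  refine ContDiffAt.prodMk d2 (ContDiffAt.add (ContDiffAt.mul ((d1.pow 2).div
    (d0.mul contDiffAt_const) (mul_ne_zero hc hν)) ?_) ((contDiffAt_const.mul (d2.pow 2)).div d1 ht.ne'))
  refine ContDiffAt.sub (contDiffAt_const.sub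
    ((d1.rpow_const_of_ne ht.ne').mul (du.rpow_const_of_ne hu'))) (ContDiffAt.mul ?_ d2)
  exact (d0.pow 2).sub (contDiffAt_const.div (contDiffAt_const.mul (d1.pow 3)) (mul_ne_zero hF (hz 3)))

theorem fderiv_speedField (hc : c ≠ 0) {z : ℝ × ℝ} (ht : 0 < z.1) (hu : 0 < q - c * z.1) (σ : ℝ)
    (ζ : ℝ × ℝ) : fderiv ℝ (speedField P c q τ₀) (c, z) (σ, ζ) = (ζ.2, linField P c q τ₀ z σ ζ) := by
  have hν := P.ν_pos.ne'
  have hF := P.F_pos.ne'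
  have hd := ((contDiffAt_speedField (P := P) (τ₀ := τ₀) hc ht hu).differentiableAt one_ne_zero).hasFDerivAt
  have l0 : HasDerivAt (fun s : ℝ => c + s * σ) σ 0 := by
    simpa using ((hasDerivAt_id (0 : ℝ)).mul_const σ).const_add c
  have l1 : HasDerivAt (fun s : ℝ => z.1 + s * ζ.1) ζ.1 0 := by
    simpa using ((hasDerivAt_id (0 : ℝ)).mul_const ζ.1).const_add z.1
  have l2 : HasDerivAt (fun s : ℝ => z.2 + s * ζ.2) ζ.2 0 := by
    simpa using ((hasDerivAt_id (0 : ℝ)).mul_const ζ.2).const_add z.2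
  have hcurve : HasDerivAt (fun s : ℝ => (c + s * σ, (z.1 + s * ζ.1, z.2 + s * ζ.2))) (σ, ζ) 0 :=
    l0.prodMk (l1.prodMk l2)
  have h0 : (fun s : ℝ => (c + s * σ, (z.1 + s * ζ.1, z.2 + s * ζ.2))) 0 = (c, z) := by simp
  rw [← h0] at hd
  have hcomp := hd.comp_hasDerivAt (0 : ℝ) hcurve
  rw [h0] at hcomp
  have lu : HasDerivAt (fun s : ℝ => q - c * τ₀ + (c + s * σ) * τ₀ - (c + s * σ) * (z.1 + s * ζ.1))
      (σ * (τ₀ - z.1) - c * ζ.1) 0 := by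
    convert! ((l0.mul_const τ₀).const_add (q - c * τ₀)).sub (l0.mul l1) using 1
    simp; ring
  have hz1 := ht.ne'
  have e1 : HasDerivAt (fun s : ℝ => (z.1 + s * ζ.1) ^ (P.s + 1)) ((P.s + 1) * z.1 ^ P.s * ζ.1) 0 := by
    have := l1.rpow_const (p := P.s + 1) (by left; simpa using hz1)
    simp only [zero_mul, add_zero, add_sub_cancel_right] at this
    convert this using 1; ring
  have e2 : HasDerivAt (fun s : ℝ => (q - c * τ₀ + (c + s * σ) * τ₀ - (c + s * σ) * (z.1 + s * ζ.1)) ^ P.r)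
      (P.r * (q - c * z.1) ^ (P.r - 1) * (σ * (τ₀ - z.1) - c * ζ.1)) 0 := by
    have := lu.rpow_const (p := P.r) (by left; simpa using hu.ne')
    simp only [zero_mul, add_zero, sub_add_cancel] at this
    convert this using 1; ring
  have e3 := ((l1.pow 2).div (l0.mul_const P.ν) (by simpa using ⟨hc, hν⟩))
  have e4 := (l0.pow 2).sub ((hasDerivAt_const (0 : ℝ) (1 : ℝ)).div ((l1.pow 3).const_mul P.F)
    (by simpa using ⟨hF, hz1⟩))
  have e5 := ((l2.pow 2).const_mul 2).div l1 (by simpa using hz1)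
  have hsnd := (e3.mul (((e1.mul e2).const_sub 1).sub (e4.mul l2))).add e5
  have hall := hcomp.unique (l2.prodMk hsnd :)
  refine hall.trans (Prod.ext rfl ?_)
  simp only [linField, profileField, Pi.pow_apply, Pi.mul_apply, Pi.div_apply, Pi.sub_apply, zero_mul,
    add_zero, sub_add_cancel]
  generalize z.1 ^ (P.s + 1) = g1
  generalize z.1 ^ P.s = g2
  generalize (q - c * z.1) ^ P.r = g3
  generalize (q - c * z.1) ^ (P.r - 1) = g4
  push_cast
  field_simp
  ring

/-- The solution of the eigenvalue equations built from a variation `ζ` of the profile and a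
variation `σ` of the speed. -/
def liftVec (c τ₀ : ℝ) (z : ℝ × ℝ) (σ : ℝ) (ζ : ℝ × ℝ) : Fin 3 → ℂ :=
  ![(ζ.1 : ℂ), ((-c * ζ.1 - σ * (z.1 - τ₀) : ℝ) : ℂ), ((-(c * ζ.2 + σ * z.2) / z.1 ^ 2 : ℝ) : ℂ)]

theorem hasDerivAt_liftVec (h : IsHomoclinic P c q τ₀ Z) (hc : c ≠ 0) {ζ : ℝ → ℝ × ℝ} {σ x : ℝ}
    (hζ : HasDerivAt ζ ((ζ x).2, linField P c q τ₀ (Z x) σ (ζ x)) x) :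
    HasDerivAt (fun x => liftVec c τ₀ (Z x) σ (ζ x))
      ((profileMatrix P c q Z x 0).mulVec (liftVec c τ₀ (Z x) σ (ζ x))
        - (σ : ℂ) • (profileMatrix P c q Z x 1 - profileMatrix P c q Z x 0).mulVec
          (liftVec c τ₀ (Z x) 0 (profileField P c q (Z x)))) x := by
  have hν := P.ν_pos.ne'
  have hF := P.F_pos.ne'
  have hz := (h.tau_pos x).ne'
  have hνC : (P.ν : ℂ) ≠ 0 := Complex.ofReal_ne_zero.2 hν
  have hFC : (P.F : ℂ) ≠ 0 := Complex.ofReal_ne_zero.2 hF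
  have hcC : (c : ℂ) ≠ 0 := Complex.ofReal_ne_zero.2 hc
  have hzC : ((Z x).1 : ℂ) ≠ 0 := Complex.ofReal_ne_zero.2 hz
  have d1 : HasDerivAt (fun x => (ζ x).1) (ζ x).2 x := hζ.fst
  have d2 : HasDerivAt (fun x => (ζ x).2) (linField P c q τ₀ (Z x) σ (ζ x)) x := hζ.snd
  have z1 := h.hasDerivAt_fst x
  have z2 := h.hasDerivAt_snd x
  have f1 : (profileField P c q (Z x)).1 = (Z x).2 := rfl
  rw [hasDerivAt_pi]
  intro i
  fin_cases i
  · refine d1.ofReal_comp.congr_deriv ?_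
    simp [profileMatrix, coeffMatrix, liftVec, f1]
    field_simp
    ring
  · refine ((d1.const_mul (-c)).sub ((z1.sub_const τ₀).const_mul σ)).ofReal_comp.congr_deriv ?_
    simp [profileMatrix, coeffMatrix, liftVec, f1]
    field_simp
    ring
  · refine (((d2.const_mul c).add (z2.const_mul σ)).neg.div (z1.pow 2)
      (pow_ne_zero 2 hz)).ofReal_comp.congr_deriv ?_
    simp [profileMatrix, coeffMatrix, liftVec, f1,
      linField]
    generalize (profileField P c q (Z x)).2 = y
    generalize (((Z x).1 ^ (P.s + 1) : ℝ) : ℂ) = g1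
    generalize (((Z x).1 ^ P.s : ℝ) : ℂ) = g2
    generalize (((q - c * (Z x).1) ^ P.r : ℝ) : ℂ) = g3
    generalize (((q - c * (Z x).1) ^ (P.r - 1) : ℝ) : ℂ) = g4
    field_simp
    ring

/-- The derivative of the profile solves the linearized equations. -/
theorem hasDerivAt_profileField_comp (h : IsHomoclinic P c q τ₀ Z) (hc : c ≠ 0) (x : ℝ) :
    HasDerivAt (fun x => profileField P c q (Z x))
      ((profileField P c q (Z x)).2, linField P c q τ₀ (Z x) 0 (profileField P c q (Z x))) x := by
  have hd := ((contDiffAt_speedField (P := P) (τ₀ := τ₀) hc (h.tau_pos x)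
    (h.u_pos x)).differentiableAt one_ne_zero).hasFDerivAt
  have := hd.comp_hasDerivAt (f := fun x => (c, Z x)) x ((hasDerivAt_const x c).prodMk (h.ode x))
  rw [fderiv_speedField hc (h.tau_pos x) (h.u_pos x)] at this
  have e : (speedField P c q τ₀ ∘ fun x => (c, Z x)) = fun x => profileField P c q (Z x) :=
    funext fun x => by simp [speedField]
  rwa [e] at this

end Linearization

section Variation

/-- Difference quotients of a strictly differentiable map along two convergent families. -/
theorem tendsto_smul_sub_of_hasStrictFDerivAt {ι E F : Type*} [NormedAddCommGroup E] [NormedSpace ℝ E]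
    [NormedAddCommGroup F] [NormedSpace ℝ F] {G : E → F} {G' : E →L[ℝ] F} {p : E}
    (hG : HasStrictFDerivAt G G' p) {f : Filter ι} {a b : ι → E} {s : ι → ℝ} {v : E}
    (ha : Tendsto a f (𝓝 p)) (hb : Tendsto b f (𝓝 p))
    (hs : Tendsto (fun i => s i • (a i - b i)) f (𝓝 v)) :
    Tendsto (fun i => s i • (G (a i) - G (b i))) f (𝓝 (G' v)) := by
  have h1 := hG.isLittleO.comp_tendsto (ha.prodMk_nhds hb)
  have h2 : (fun i => s i • (G (a i) - G (b i) - G' (a i - b i))) =o[f] fun i => s i • (a i - b i) :=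
    (Asymptotics.isBigO_refl s f).smul_isLittleO h1
  have h3 : Tendsto (fun i => s i • (G (a i) - G (b i) - G' (a i - b i))) f (𝓝 0) :=
    (Asymptotics.isLittleO_one_iff ℝ).1 (h2.trans_isBigO (hs.isBigO_one ℝ))
  have h4 := h3.add ((G'.continuous.tendsto v).comp hs)
  rw [zero_add] at h4
  refine h4.congr fun i => ?_
  rw [Function.comp_apply, map_smul, ← smul_add, sub_add_cancel]

variable {P : Params} {c q τ₀ : ℝ} {Z : ℝ → ℝ × ℝ} {I : Set ℝ} {l : Filter ℝ} {Y : ℝ → ℝ → ℝ × ℝ}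

/-- The variation of the invariant manifold with the speed solves the linearized equations. -/
theorem IsManifoldFamily.exists_variation (hY : IsManifoldFamily P c q τ₀ Z I l Y)
    (h : IsHomoclinic P c q τ₀ Z) (hc : c ≠ 0) [l.NeBot] (hI : I ∈ l)
    (hZ : Tendsto Z l (𝓝 (τ₀, 0))) :
    ∃ ζ : ℝ → ℝ × ℝ, ContinuousOn ζ I ∧
      (∀ x ∈ interior I, HasDerivAt ζ ((ζ x).2, linField P c q τ₀ (Z x) 1 (ζ x)) x) ∧
      Tendsto ζ l (𝓝 0) ∧ ∀ x ∈ I, HasDerivAt (fun c' => Y c' x) (ζ x) c := by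
  obtain ⟨ζ, hζ⟩ := hY.smooth
  set D : ℝ → ℝ → ℝ × ℝ := fun c' x => (c' - c)⁻¹ • (Y c' x - Z x) with hD
  have hne : ∀ᶠ c' in 𝓝[≠] c, c' ≠ c := self_mem_nhdsWithin
  have hU : TendstoUniformlyOn D ζ (𝓝[≠] c) I := by
    rw [Metric.tendstoUniformlyOn_iff]
    intro ε hε
    filter_upwards [(hζ (ε / 2) (half_pos hε)).filter_mono nhdsWithin_le_nhds, hne] with c' h1 h2 x hx
    have h3 := h1 x hx
    have h4 : c' - c ≠ 0 := sub_ne_zero.2 h2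
    rw [hY.base x hx] at h3
    rw [dist_comm, dist_eq_norm]
    have e : D c' x - ζ x = (c' - c)⁻¹ • (Y c' x - Z x - (c' - c) • ζ x) := by
      simp only [hD]
      rw [smul_sub _ (Y c' x - Z x), smul_smul, inv_mul_cancel₀ h4, one_smul]
    rw [e, norm_smul, norm_inv, Real.norm_eq_abs]
    calc |c' - c|⁻¹ * _ ≤ |c' - c|⁻¹ * (ε / 2 * |c' - c|) := by gcongr
      _ = ε / 2 := by field_simp
      _ < ε := half_lt_self hε
  have hode := hY.ode.filter_mono (nhdsWithin_le_nhds (s := {c}ᶜ))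
  have hcont : ContinuousOn ζ I := by
    refine hU.continuousOn (Eventually.frequently ?_)
    filter_upwards [hode] with c' h1
    have h2 : ContinuousOn (fun x => Y c' x - Z x) I := fun x hx =>
      (h1 x hx).continuousWithinAt.sub h.continuous.continuousWithinAt
    exact h2.const_smul (c' - c)⁻¹
  refine ⟨ζ, hcont, ?_, ?_, fun x hx => ?_⟩
  · set G := speedField P c q τ₀ with hG
    have hderiv : ∀ᶠ c' in 𝓝[≠] c, ∀ x ∈ interior I,
        HasDerivAt (D c') ((c' - c)⁻¹ • (G (c', Y c' x) - G (c, Z x))) x := by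
      filter_upwards [hode] with c' h1 x hx
      have h2 := (h1 x (interior_subset hx)).hasDerivAt (mem_interior_iff_mem_nhds.1 hx)
      have e : G (c, Z x) = profileField P c q (Z x) := by simp [hG, speedField]
      rw [e]
      exact (h2.sub (h.ode x)).const_smul (c' - c)⁻¹
    have hlu : TendstoLocallyUniformlyOn
        (fun c' x => (c' - c)⁻¹ • (G (c', Y c' x) - G (c, Z x)))
        (fun x => fderiv ℝ G (c, Z x) (1, ζ x)) (𝓝[≠] c) (interior I) := by
      rw [tendstoLocallyUniformlyOn_iff_forall_tendsto]
      intro x hx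
      have hxI := mem_interior_iff_mem_nhds.1 hx
      have hζx : ContinuousAt ζ x := hcont.continuousAt hxI
      have hGx := contDiffAt_speedField (P := P) (τ₀ := τ₀) hc (h.tau_pos x) (h.u_pos x)
      have hZx : Tendsto (fun y : ℝ × ℝ => Z y.2) (𝓝[≠] c ×ˢ 𝓝[interior I] x) (𝓝 (Z x)) :=
        (h.continuous.tendsto x).comp (tendsto_snd.mono_right nhdsWithin_le_nhds)
      have hD2 : Tendsto (fun y : ℝ × ℝ => D y.1 y.2) (𝓝[≠] c ×ˢ 𝓝[interior I] x) (𝓝 (ζ x)) := by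
        have h1 : Tendsto (fun y : ℝ × ℝ => ζ y.2) (𝓝[≠] c ×ˢ 𝓝[interior I] x) (𝓝 (ζ x)) :=
          (hζx.tendsto).comp (tendsto_snd.mono_right nhdsWithin_le_nhds)
        have h2 := (tendstoUniformlyOn_iff_tendsto.1 hU).mono_left
          (prod_mono le_rfl (le_principal_iff.2 (nhdsWithin_le_nhds hxI)) :
            𝓝[≠] c ×ˢ 𝓝[interior I] x ≤ 𝓝[≠] c ×ˢ 𝓟 I)
        exact h1.congr_uniformity h2
      have hy1 : Tendsto (fun y : ℝ × ℝ => y.1) (𝓝[≠] c ×ˢ 𝓝[interior I] x) (𝓝 c) :=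
        tendsto_fst.mono_right nhdsWithin_le_nhds
      have hyne : ∀ᶠ y in 𝓝[≠] c ×ˢ 𝓝[interior I] x, y.1 ≠ c := tendsto_fst.eventually hne
      have hY2 : Tendsto (fun y : ℝ × ℝ => Y y.1 y.2) (𝓝[≠] c ×ˢ 𝓝[interior I] x) (𝓝 (Z x)) := by
        have h1 := hZx.add (((hy1.sub_const c)).smul hD2)
        rw [sub_self, zero_smul, add_zero] at h1
        refine h1.congr' ?_
        filter_upwards [hyne] with y hy
        simp only [hD]
        rw [smul_smul, mul_inv_cancel₀ (sub_ne_zero.2 hy), one_smul]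
        abel
      have h3 := tendsto_smul_sub_of_hasStrictFDerivAt (hGx.hasStrictFDerivAt one_ne_zero)
        (a := fun y : ℝ × ℝ => (y.1, Y y.1 y.2)) (b := fun y : ℝ × ℝ => (c, Z y.2))
        (s := fun y => (y.1 - c)⁻¹) (v := (1, ζ x)) (hy1.prodMk_nhds hY2)
        (tendsto_const_nhds.prodMk_nhds hZx) (by
          refine (tendsto_const_nhds.prodMk_nhds hD2 : Tendsto (fun y : ℝ × ℝ => ((1 : ℝ), D y.1 y.2)) _
            (𝓝 (1, ζ x))).congr' ?_
          filter_upwards [hyne] with y hy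
          simp only [Prod.mk_sub_mk, Prod.smul_mk, smul_eq_mul, hD,
            inv_mul_cancel₀ (sub_ne_zero.2 hy)])
      have h4 : Tendsto (fun y : ℝ × ℝ => fderiv ℝ G (c, Z y.2) (1, ζ y.2))
          (𝓝[≠] c ×ˢ 𝓝[interior I] x) (𝓝 (fderiv ℝ G (c, Z x) (1, ζ x))) := by
        have h5 : ContinuousAt (fun y : ℝ => fderiv ℝ G (c, Z y)) x :=
          ContinuousAt.comp (g := fderiv ℝ G) (f := fun y : ℝ => (c, Z y))
            ((hGx.fderiv_right (m := 0) (by norm_num)).continuousAt)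
            (continuousAt_const.prodMk h.continuous.continuousAt)
        have h6 : ContinuousAt (fun y : ℝ => fderiv ℝ G (c, Z y) (1, ζ y)) x :=
          h5.clm_apply (continuousAt_const.prodMk hζx)
        exact h6.tendsto.comp (tendsto_snd.mono_right nhdsWithin_le_nhds)
      exact (h4.prodMk_nhds h3).mono_right (nhds_le_uniformity _)
    intro x hx
    have := hasDerivAt_of_tendstoLocallyUniformlyOn isOpen_interior hlu hderiv
      (fun y hy => hU.tendsto_at (interior_subset hy)) hx
    rwa [fderiv_speedField hc (h.tau_pos x) (h.u_pos x)] at this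
  · rw [Metric.tendsto_nhds]
    intro ε hε
    have h1 := (Metric.tendstoUniformlyOn_iff.1 hU (ε / 2) (half_pos hε))
    obtain ⟨c', h2, h3⟩ := (h1.and (hY.tendsto.filter_mono nhdsWithin_le_nhds)).exists
    have h4 : Tendsto (D c') l (𝓝 0) := by
      have := (h3.sub hZ).const_smul (c' - c)⁻¹
      simpa using this
    filter_upwards [hI, (Metric.tendsto_nhds.1 h4) (ε / 2) (half_pos hε)] with x hx h5
    exact (dist_triangle _ (D c' x) _).trans_lt (by linarith [h2 x hx])
  · rw [hasDerivAt_iff_isLittleO, Asymptotics.isLittleO_iff]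
    intro ε hε
    filter_upwards [hζ ε hε] with c' h1
    exact h1 x hx

/-- The Melnikov separation is differentiable, and its derivative is the determinant formed with the
variations of the two manifolds. -/
theorem hasDerivAt_melnikov {Yp Ym : ℝ → ℝ → ℝ × ℝ} {a b : ℝ × ℝ}
    (ha : HasDerivAt (fun c' => Yp c' 0) a c) (hb : HasDerivAt (fun c' => Ym c' 0) b c) :
    HasDerivAt (melnikov P c q Z Yp Ym)
      ((profileField P c q (Z 0)).1 * (a - b).2 - (a - b).1 * (profileField P c q (Z 0)).2) c := by
  have h1 : HasDerivAt (fun c' => Yp c' 0 - Ym c' 0) (a - b) c := ha.sub hb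
  have hf : HasDerivAt (fun c' => (Yp c' 0 - Ym c' 0).1) (a - b).1 c := h1.fst
  have hs : HasDerivAt (fun c' => (Yp c' 0 - Ym c' 0).2) (a - b).2 c := h1.snd
  refine ((hs.const_mul (profileField P c q (Z 0)).1).sub
    (hf.mul_const (profileField P c q (Z 0)).2)).congr_of_eventuallyEq (Eventually.of_forall fun c' => ?_)
  simp [melnikov, Matrix.det_fin_two]

end Variation

section ZeroMode
open scoped Matrix.Norms.Operator

theorem AsymConst.map {𝔸 : Type*} [NormedRing 𝔸] [NormedAlgebra ℂ 𝔸] [FiniteDimensional ℂ 𝔸]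
    {A : ℝ → 𝔸} {A₀ : 𝔸} {C θ : ℝ} (h : AsymConst A A₀ C θ) (L : 𝔸 →ₗ[ℂ] 𝔸) :
    ∃ C', AsymConst (fun x => L (A x)) (L A₀) C' θ := by
  set M := LinearMap.toContinuousLinearMap L
  refine ⟨‖M‖ * C, M.continuous.comp h.cont, fun x => ?_⟩
  rw [← map_sub, mul_assoc]
  exact M.le_opNorm_of_le (h.bound x)

theorem profileMatrix_zero_entries (x : ℝ) :
    profileMatrix P c q Z x 0 0 0 = 0 ∧ profileMatrix P c q Z x 0 0 1 = 0 ∧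
    profileMatrix P c q Z x 0 1 0 = 0 ∧ profileMatrix P c q Z x 0 1 1 = 0 ∧
    profileMatrix P c q Z x 0 0 2 = ((-((Z x).1 ^ 2 / c) : ℝ) : ℂ) ∧
    profileMatrix P c q Z x 0 1 2 = (((Z x).1 ^ 2 : ℝ) : ℂ) := by
  simp [profileMatrix, coeffMatrix]

/-- The trace of the limiting matrix at `0` lies above the stable eigenvalue. -/
theorem exists_trace_gt (hs : IsSaddle P c q τ₀) (hc : 0 < c) {μ : Fin 3 → ℂ}
    (hμ : IsGapSpectrum (limitMatrix P c q τ₀ 0) μ) :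
    ∃ m T : ℝ, μ 2 = m ∧ m < 0 ∧ (limitMatrix P c q τ₀ 0).trace = T ∧ m < T := by
  obtain ⟨μ', h', hneg, him, -⟩ := exists_gapSpectrum_real hs hc le_rfl
  rw [Complex.ofReal_zero] at h'
  obtain ⟨e2, -, -⟩ := hμ.unique h'
  obtain ⟨-, hpos, -⟩ := hs.linearization hc.ne'
  obtain ⟨t1, t2, t3⟩ := limitMatrix_coeffs (P := P) (q := q) hc.ne' hs.tau_pos 0
  have hm : μ 2 = ((μ 2).re : ℂ) := by
    rw [e2] at him
    exact Complex.ext rfl (by simp [him])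
  rw [zero_div, zero_add] at t1
  refine ⟨(μ 2).re, _, hm, by rw [← e2]; exact hneg, t1, ?_⟩
  set m := (μ 2).re with hmd
  set T : ℝ := (-c * τ₀ ^ 2 + 1 / (P.F * τ₀) / c) / P.ν
  have hroot := hμ.eval_charpoly (μ 2)
  rw [sub_self, mul_zero, charpoly_eval_eq, t1, t2, t3, hm] at hroot
  set J : ℝ := τ₀ ^ 2 / P.ν * ((c * (P.r * τ₀ ^ (P.s + 1) * (q - c * τ₀) ^ (P.r - 1))
    - (P.s + 1) * τ₀ ^ P.s * (q - c * τ₀) ^ P.r) / c) with hJ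
  have hJ0 : 0 < J := mul_pos (by have := hs.tau_pos; have := P.ν_pos; positivity) hpos
  have hm0 : m < 0 := by rw [hmd, ← e2]; exact hneg
  have hr : m ^ 3 - T * m ^ 2 - J * m = 0 := by
    have : ((m ^ 3 - T * m ^ 2 - J * m : ℝ) : ℂ) = 0 := by
      rw [← hroot]; push_cast; ring
    exact_mod_cast this
  have h2 : m * (m * (m - T) - J) = 0 := by linarith [hr]
  have h3 : m * (m - T) = J := by
    rcases mul_eq_zero.1 h2 with h | h
    · exact absurd h hm0.ne
    · linarith
  by_contra! hle
  nlinarith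

/-- The derivative of the profile as a solution of the eigenvalue equations at `0`. -/
def zeroMode (P : Params) (c q τ₀ : ℝ) (Z : ℝ → ℝ × ℝ) (x : ℝ) : Fin 3 → ℂ :=
  liftVec c τ₀ (Z x) 0 (profileField P c q (Z x))

theorem zeroMode_zero (x : ℝ) : zeroMode P c q τ₀ Z x 0 = ((Z x).2 : ℂ) := rfl

theorem zeroMode_one (x : ℝ) : zeroMode P c q τ₀ Z x 1 = -c * zeroMode P c q τ₀ Z x 0 := by
  simp [zeroMode, liftVec]

theorem zeroMode_two (x : ℝ) : zeroMode P c q τ₀ Z x 2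
    = ((-(c * (profileField P c q (Z x)).2) / (Z x).1 ^ 2 : ℝ) : ℂ) := by
  simp [zeroMode, liftVec]

theorem hasDerivAt_zeroMode (h : IsHomoclinic P c q τ₀ Z) (hc : c ≠ 0) (x : ℝ) :
    HasDerivAt (zeroMode P c q τ₀ Z)
      ((profileMatrix P c q Z x 0).mulVec (zeroMode P c q τ₀ Z x)) x := by
  have := hasDerivAt_liftVec h hc (σ := 0) (hasDerivAt_profileField_comp (τ₀ := τ₀) h hc x)
  rw [Complex.ofReal_zero, zero_smul, sub_zero] at this
  exact this

theorem tendsto_liftVec (hs : IsSaddle P c q τ₀) {l : Filter ℝ}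
    (hZ : Tendsto Z l (𝓝 (τ₀, 0))) {ζ : ℝ → ℝ × ℝ} (hζ : Tendsto ζ l (𝓝 0)) (σ : ℝ) :
    Tendsto (fun x => liftVec c τ₀ (Z x) σ (ζ x)) l (𝓝 0) := by
  have z1 : Tendsto (fun x => (Z x).1) l (𝓝 τ₀) := (continuous_fst.tendsto _).comp hZ
  have z2 : Tendsto (fun x => (Z x).2) l (𝓝 0) := (continuous_snd.tendsto _).comp hZ
  have y1 : Tendsto (fun x => (ζ x).1) l (𝓝 0) := (continuous_fst.tendsto _).comp hζ
  have y2 : Tendsto (fun x => (ζ x).2) l (𝓝 0) := (continuous_snd.tendsto _).comp hζ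
  have of : ∀ {f : ℝ → ℝ}, Tendsto f l (𝓝 0) → Tendsto (fun x => (f x : ℂ)) l (𝓝 0) := fun hf => by
    have := (Complex.continuous_ofReal.tendsto 0).comp hf
    rwa [Complex.ofReal_zero] at this
  rw [tendsto_pi_nhds]
  intro i
  fin_cases i
  · exact of y1
  · refine of ?_
    simpa using (y1.const_mul (-c)).sub ((z1.sub_const τ₀).const_mul σ)
  · refine of ?_
    have := ((y2.const_mul c).add (z2.const_mul σ)).neg.div (z1.pow 2) (pow_ne_zero 2 hs.tau_pos.ne')
    rw [mul_zero, mul_zero, add_zero, neg_zero, zero_div] at this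
    exact this

theorem tendsto_profileField (hs : IsSaddle P c q τ₀) {l : Filter ℝ}
    (hZ : Tendsto Z l (𝓝 (τ₀, 0))) : Tendsto (fun x => profileField P c q (Z x)) l (𝓝 0) := by
  have := (contDiffAt_profileField P c q (z := (τ₀, 0)) hs.tau_pos hs.u_pos).continuousAt.tendsto.comp hZ
  rwa [hs.rest] at this

theorem tendsto_zeroMode (hs : IsSaddle P c q τ₀) {l : Filter ℝ}
    (hZ : Tendsto Z l (𝓝 (τ₀, 0))) : Tendsto (zeroMode P c q τ₀ Z) l (𝓝 0) :=
  tendsto_liftVec hs hZ (tendsto_profileField hs hZ) 0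

theorem zeroMode_ne_zero (h : IsHomoclinic P c q τ₀ Z) (hs : IsSaddle P c q τ₀) (hc : 0 < c) (x : ℝ) :
    zeroMode P c q τ₀ Z x ≠ 0 := by
  obtain ⟨C, θ, hθ, hC, hA⟩ := exists_asymConst h hs hc.ne'
  intro h0
  have h1 := eq_zero_of_linear_ode hθ (hA 0) (hasDerivAt_zeroMode h hc.ne') h0
  have h2 : ∀ x, (Z x).2 = 0 := fun x => by
    have : zeroMode P c q τ₀ Z x 0 = 0 := congrFun (congrFun h1 x) 0
    rw [zeroMode_zero] at this
    exact_mod_cast this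
  have h3 : ∀ x y, (Z x).1 = (Z y).1 := is_const_of_deriv_eq_zero
    (fun x => (h.hasDerivAt_fst x).differentiableAt) (fun x => by rw [(h.hasDerivAt_fst x).deriv, h2])
  have h4 : Tendsto (fun x => (Z x).1) atTop (𝓝 τ₀) := (continuous_fst.tendsto _).comp h.tendsto_atTop
  have h5 : (fun x => (Z x).1) = fun _ => (Z 0).1 := funext fun x => h3 x 0
  rw [h5] at h4
  have := h.fst_lt hs hc 0
  rw [tendsto_nhds_unique tendsto_const_nhds h4] at this
  exact lt_irrefl _ this

/-- The Wronskian factor of the reduced system at `0`. -/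
theorem exists_wronskian_factor (h : IsHomoclinic P c q τ₀ Z) (hs : IsSaddle P c q τ₀) (hc : c ≠ 0)
    {T : ℝ} (hT : (limitMatrix P c q τ₀ 0).trace = T) :
    ∃ (g : ℝ → ℝ) (B : ℝ), g 0 = 1 ∧ (∀ x, 0 < g x ∧ g x ≤ B * Real.exp (-T * x)) ∧
      ∀ x, HasDerivAt (fun x => (g x : ℂ)) (-(profileMatrix P c q Z x 0 2 2) * g x) x := by
  obtain ⟨C, θ, hθ, hC, hA⟩ := exists_asymConst h hs hc
  obtain ⟨k, -, B, -, hk0, hk, -, hkB⟩ := exists_integrating_factor (f := traceDefect P c τ₀ Z)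
    (C := 3 * (C * (1 + ‖(0 : ℂ)‖))) hθ (continuous_traceDefect h) (fun x => by
      have h1 := (hA 0).bound x
      have h3 := norm_trace_le (profileMatrix P c q Z x 0 - limitMatrix P c q τ₀ 0)
      rw [Matrix.trace_sub, trace_sub_trace, Complex.norm_real, Real.norm_eq_abs] at h3
      linarith)
  refine ⟨fun x => k x * Real.exp (-T * x), B, by simp [hk0], fun x =>
    ⟨mul_pos (hkB x).1 (Real.exp_pos _), mul_le_mul_of_nonneg_right (hkB x).2 (Real.exp_pos _).le⟩,
    fun x => ?_⟩
  have h1 : HasDerivAt (fun x : ℝ => Real.exp (-T * x)) (Real.exp (-T * x) * -T) x := by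
    simpa using ((hasDerivAt_id x).const_mul (-T)).exp
  refine ((hk x).mul h1).ofReal_comp.congr_deriv ?_
  have h2 := trace_sub_trace (P := P) (c := c) (q := q) (τ₀ := τ₀) (Z := Z) x 0
  obtain ⟨e1, -, -, e2, -⟩ := profileMatrix_zero_entries (P := P) (c := c) (q := q) (Z := Z) x
  rw [hT, Matrix.trace_fin_three, e1, e2, zero_add, zero_add] at h2
  rw [sub_eq_iff_eq_add.1 h2]
  push_cast
  ring

theorem hasDerivAt_dotProduct {ι : Type*} [Fintype ι] {v w : ℝ → ι → ℂ} {v' w' : ι → ℂ} {x : ℝ}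
    (hv : HasDerivAt v v' x) (hw : HasDerivAt w w' x) :
    HasDerivAt (fun x => v x ⬝ᵥ w x) (v' ⬝ᵥ w x + v x ⬝ᵥ w') x := by
  have := HasDerivAt.fun_sum (u := Finset.univ) fun i _ =>
    (hasDerivAt_pi.1 hv i).mul (hasDerivAt_pi.1 hw i)
  simpa [dotProduct, Finset.sum_add_distrib] using this

theorem FastPair.hasDerivAt_col {A : ℝ → Mat3} {m : ℂ} {p : Mat3} {X Y : ℝ → Mat3}
    (h : FastPair A m p X Y) (v : Fin 3 → ℂ) (x : ℝ) :
    HasDerivAt (fun x : ℝ => Complex.exp (m * x) • (X x).mulVec v)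
      ((A x).mulVec (Complex.exp (m * x) • (X x).mulVec v)) x := by
  convert! (hasDerivAt_cexp_mul m x).smul (hasDerivAt_mulVec (h.derivX x) (hasDerivAt_const x v)) using 1
  rw [Matrix.mulVec_zero, add_zero, ← Matrix.mulVec_mulVec, Matrix.sub_mulVec, Matrix.smul_mulVec,
    Matrix.one_mulVec, Matrix.mulVec_smul]
  module

theorem FastPair.hasDerivAt_row {A : ℝ → Mat3} {m : ℂ} {p : Mat3} {X Y : ℝ → Mat3}
    (h : FastPair A m p X Y) (v : Fin 3 → ℂ) (x : ℝ) :
    HasDerivAt (fun x : ℝ => Complex.exp (-m * x) • Matrix.vecMul v (Y x))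
      (-Matrix.vecMul (Complex.exp (-m * x) • Matrix.vecMul v (Y x)) (A x)) x := by
  convert! (hasDerivAt_cexp_mul (-m) x).smul (hasDerivAt_vecMul (hasDerivAt_const x v) (h.derivY x)) using 1
  rw [Matrix.zero_vecMul, zero_add, Matrix.vecMul_neg, ← Matrix.vecMul_vecMul, Matrix.vecMul_sub,
    Matrix.vecMul_smul, Matrix.vecMul_one, Matrix.smul_vecMul]
  module

/-- A row solution paired with a column solution is constant. -/
theorem dotProduct_eq_of_solutions {A : ℝ → Mat3} {η w : ℝ → Fin 3 → ℂ}
    (hη : ∀ x, HasDerivAt η (-Matrix.vecMul (η x) (A x)) x)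
    (hw : ∀ x, HasDerivAt w ((A x).mulVec (w x)) x) (x y : ℝ) : η x ⬝ᵥ w x = η y ⬝ᵥ w y :=
  eq_of_forall_hasDerivAt_zero (f := fun x => η x ⬝ᵥ w x) (fun x => by
    convert! hasDerivAt_dotProduct (hη x) (hw x) using 1
    rw [neg_dotProduct, Matrix.dotProduct_mulVec, neg_add_cancel]) x y

theorem norm_vec_le (v : Fin 3 → ℂ) {B : ℝ} (h : ∀ i, ‖v i‖ ≤ B) : ‖v‖ ≤ B :=
  (pi_norm_le_iff_of_nonneg ((norm_nonneg _).trans (h 0))).2 h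

theorem hasDerivAt_reduced_col {w : ℝ → Fin 3 → ℂ} {x : ℝ}
    (hw : HasDerivAt w ((profileMatrix P c q Z x 0).mulVec (w x)) x) (h1 : w x 1 = -c * w x 0) :
    HasDerivAt (fun x => w x 0) (profileMatrix P c q Z x 0 0 2 * w x 2) x ∧
    HasDerivAt (fun x => w x 2) ((profileMatrix P c q Z x 0 2 0 - c * profileMatrix P c q Z x 0 2 1) * w x 0
      + profileMatrix P c q Z x 0 2 2 * w x 2) x := by
  obtain ⟨a00, a01, a10, a11, a02, a12⟩ := profileMatrix_zero_entries (P := P) (c := c) (q := q) (Z := Z) x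
  have := hasDerivAt_pi.1 hw
  simp only [Matrix.mulVec, dotProduct, Fin.sum_univ_three] at this
  refine ⟨(this 0).congr_deriv ?_, (this 2).congr_deriv ?_⟩
  · rw [a00, a01]; ring
  · rw [h1]; ring

/-- Any decaying solution at `0` lies in the invariant plane. -/
theorem one_eq_of_tendsto {w : ℝ → Fin 3 → ℂ} (hc : c ≠ 0)
    (hw : ∀ x, HasDerivAt w ((profileMatrix P c q Z x 0).mulVec (w x)) x)
    (h0 : Tendsto w atTop (𝓝 0)) (x : ℝ) : w x 1 = -c * w x 0 := by
  have hcC : (c : ℂ) ≠ 0 := Complex.ofReal_ne_zero.2 hc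
  have hd : ∀ x, HasDerivAt (fun x => c * w x 0 + w x 1) 0 x := fun x => by
    obtain ⟨a00, a01, a10, a11, a02, a12⟩ := profileMatrix_zero_entries (P := P) (c := c) (q := q) (Z := Z) x
    have := hasDerivAt_pi.1 (hw x)
    refine (((this 0).const_mul (c : ℂ)).add (this 1)).congr_deriv ?_
    simp only [Matrix.mulVec, dotProduct, Fin.sum_univ_three, a00, a01, a10, a11, a02, a12]
    push_cast
    field_simp
    ring
  have hlim : Tendsto (fun x => c * w x 0 + w x 1) atTop (𝓝 0) := by
    simpa using ((tendsto_pi_nhds.1 h0 0).const_mul (c : ℂ)).add (tendsto_pi_nhds.1 h0 1)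
  have hconst : (fun y => c * w y 0 + w y 1) = fun _ => c * w x 0 + w x 1 :=
    funext fun y => eq_of_forall_hasDerivAt_zero hd y x
  rw [hconst] at hlim
  have := tendsto_nhds_unique tendsto_const_nhds hlim
  linear_combination this

/-- The fast solution at `0` is the derivative of the profile. -/
theorem exists_mulVec_eq_zeroMode (h : IsHomoclinic P c q τ₀ Z) (hs : IsSaddle P c q τ₀) (hc : 0 < c)
    {μ : Fin 3 → ℂ} {X Y : ℝ → Mat3} (hμ : IsGapSpectrum (limitMatrix P c q τ₀ 0) μ)
    (hF : FastPair (fun x => profileMatrix P c q Z x 0) (μ 2) (gapProj (limitMatrix P c q τ₀ 0) μ) X Y) :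
    ∃ V : Fin 3 → ℂ, (gapProj (limitMatrix P c q τ₀ 0) μ).mulVec V = V ∧ V ≠ 0 ∧
      ∀ x : ℝ, Complex.exp (μ 2 * x) • (X x).mulVec V = zeroMode P c q τ₀ Z x := by
  obtain ⟨m, T, hm, hm0, hT, hmT⟩ := exists_trace_gt hs hc hμ
  obtain ⟨C, θ, hθ, hC, hA⟩ := exists_asymConst h hs hc.ne'
  obtain ⟨g, B, hg0, hgB, hg⟩ := exists_wronskian_factor h hs hc.ne' hT
  obtain ⟨V', hV', -, hV2⟩ := exists_frame hμ.gapProj_mul_self hμ.trace_gapProj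
  set p := gapProj (limitMatrix P c q τ₀ 0) μ
  set V₀ := V' 2
  have hV₀ : V₀ ≠ 0 := hV'.ne_zero 2
  set w : ℝ → Fin 3 → ℂ := fun x => Complex.exp (μ 2 * x) • (X x).mulVec V₀ with hw
  have hwd : ∀ x, HasDerivAt w ((profileMatrix P c q Z x 0).mulVec (w x)) x := hF.hasDerivAt_col V₀
  have hXV : Tendsto (fun x => (X x).mulVec V₀) atTop (𝓝 V₀) := by
    have := ((continuous_id.matrix_mulVec (continuous_const (y := V₀))).tendsto p).comp hF.limX
    rwa [id, hV2] at this
  have hexp : ∀ x : ℝ, ‖Complex.exp (μ 2 * x)‖ = Real.exp (m * x) := fun x => by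
    rw [Complex.norm_exp, hm, ← Complex.ofReal_mul, Complex.ofReal_re]
  have hwt : Tendsto w atTop (𝓝 0) := by
    have t1 : Tendsto (fun x : ℝ => Complex.exp (μ 2 * x)) atTop (𝓝 0) := by
      rw [tendsto_zero_iff_norm_tendsto_zero]
      simp only [hexp]
      exact Real.tendsto_exp_atBot.comp (tendsto_id.const_mul_atTop_of_neg hm0)
    simpa using t1.smul hXV
  have hw1 := one_eq_of_tendsto hc.ne' hwd hwt
  have hwne : ∀ x, w x ≠ 0 := fun x h0 => by
    have h1 := eq_zero_of_linear_ode hθ (hA 0) hwd h0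
    have h2 : (fun x => (X x).mulVec V₀) = fun _ => 0 := funext fun x => by
      have := congrFun h1 x
      simpa [hw] using this
    rw [h2] at hXV
    exact hV₀ (tendsto_nhds_unique tendsto_const_nhds hXV).symm
  set u := zeroMode P c q τ₀ Z with hu
  have hud : ∀ x, HasDerivAt u ((profileMatrix P c q Z x 0).mulVec (u x)) x := hasDerivAt_zeroMode h hc.ne'
  have hut : Tendsto u atTop (𝓝 0) := tendsto_zeroMode hs h.tendsto_atTop
  have hu1 : ∀ x, u x 1 = -c * u x 0 := zeroMode_one
  have hdet : u 0 0 * w 0 2 - u 0 2 * w 0 0 = 0 := by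
    have hd : ∀ x, HasDerivAt (fun x => (g x : ℂ) * (u x 0 * w x 2 - u x 2 * w x 0)) 0 x := fun x => by
      obtain ⟨d1, d2⟩ := hasDerivAt_reduced_col (hud x) (hu1 x)
      obtain ⟨e1, e2⟩ := hasDerivAt_reduced_col (hwd x) (hw1 x)
      refine ((hg x).mul ((d1.mul e2).sub (d2.mul e1))).congr_deriv ?_
      simp only [Pi.sub_apply, Pi.mul_apply]
      ring
    obtain ⟨N, hN⟩ : ∃ N, ∀ᶠ x in atTop, ‖(X x).mulVec V₀‖ ≤ N :=
      ⟨‖V₀‖ + 1, (hXV.norm.eventually (gt_mem_nhds (lt_add_one _))).mono fun x hx => hx.le⟩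
    have hB : 0 ≤ B := by
      have := (hgB 0).1.le.trans (hgB 0).2
      simpa using this
    have hbound : ∀ᶠ x in atTop, ∀ i, ‖(g x : ℂ) * w x i‖ ≤ B * N := by
      filter_upwards [hN, eventually_ge_atTop 0] with x hx hx0 i
      have h1 : ‖w x i‖ ≤ Real.exp (m * x) * N := by
        refine (norm_le_pi_norm _ i).trans ?_
        rw [hw, norm_smul, hexp]
        gcongr
      have hN0 : 0 ≤ N := (norm_nonneg _).trans hx
      rw [norm_mul, Complex.norm_real, Real.norm_eq_abs, abs_of_pos (hgB x).1]
      calc g x * ‖w x i‖ ≤ (B * Real.exp (-T * x)) * (Real.exp (m * x) * N) :=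
            mul_le_mul (hgB x).2 h1 (norm_nonneg _) (mul_nonneg hB (Real.exp_pos _).le)
        _ = B * N * Real.exp ((m - T) * x) := by
            rw [show (m - T) * x = -T * x + m * x by ring, Real.exp_add]; ring
        _ ≤ B * N * 1 := by
            gcongr
            exact Real.exp_le_one_iff.2 (mul_nonpos_of_nonpos_of_nonneg (by linarith) hx0)
        _ = B * N := mul_one _
    have hlim : Tendsto (fun x => (g x : ℂ) * (u x 0 * w x 2 - u x 2 * w x 0)) atTop (𝓝 0) := by
      have h0 : Tendsto (fun x => B * N * (‖u x 0‖ + ‖u x 2‖)) atTop (𝓝 0) := by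
        simpa using ((tendsto_pi_nhds.1 hut 0).norm.add (tendsto_pi_nhds.1 hut 2).norm).const_mul (B * N)
      refine squeeze_zero_norm' ?_ h0
      filter_upwards [hbound] with x hx
      have e : (g x : ℂ) * (u x 0 * w x 2 - u x 2 * w x 0)
          = (g x * w x 2) * u x 0 - (g x * w x 0) * u x 2 := by ring
      rw [e, mul_add]
      refine (norm_sub_le _ _).trans ?_
      rw [norm_mul (_ * _), norm_mul (_ * _)]
      exact add_le_add (mul_le_mul_of_nonneg_right (hx 2) (norm_nonneg _))
        (mul_le_mul_of_nonneg_right (hx 0) (norm_nonneg _))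
    have hconst : (fun x => (g x : ℂ) * (u x 0 * w x 2 - u x 2 * w x 0)) = fun _ =>
        (g 0 : ℂ) * (u 0 0 * w 0 2 - u 0 2 * w 0 0) :=
      funext fun y => eq_of_forall_hasDerivAt_zero hd y 0
    rw [hconst, hg0, Complex.ofReal_one, one_mul] at hlim
    exact tendsto_nhds_unique tendsto_const_nhds hlim
  obtain ⟨b, hb⟩ : ∃ b : ℂ, u 0 = b • w 0 := by
    by_cases h0 : w 0 0 = 0
    · have h2 : w 0 2 ≠ 0 := fun h2 => hwne 0 (by ext i; fin_cases i <;> simp [h0, h2, hw1])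
      have hu0 : u 0 0 = 0 := by
        rw [h0, mul_zero, sub_zero] at hdet
        exact (mul_eq_zero.1 hdet).resolve_right h2
      refine ⟨u 0 2 / w 0 2, ?_⟩
      ext i; fin_cases i
      · simp [h0, hu0]
      · simp [h0, hu0, hw1, hu1]
      · simp [h2]
    · refine ⟨u 0 0 / w 0 0, ?_⟩
      ext i; fin_cases i
      · simp [h0]
      · simp [hw1, hu1]; field_simp
      · simp only [Fin.reduceFinMk, Pi.smul_apply, smul_eq_mul]
        field_simp
        linear_combination -hdet
  have hall : ∀ x, u x = b • w x := fun x => by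
    have := eq_zero_of_linear_ode hθ (hA 0) (W := fun x => u x - b • w x) (x₀ := 0) (fun x => by
      rw [Matrix.mulVec_sub, Matrix.mulVec_smul]
      exact (hud x).sub ((hwd x).const_smul b)) (by simp [hb])
    exact sub_eq_zero.1 (congrFun this x)
  have hb0 : b ≠ 0 := fun h0 => zeroMode_ne_zero h hs hc 0 (by rw [← hu, hb, h0, zero_smul])
  refine ⟨b • V₀, by rw [Matrix.mulVec_smul, hV2], smul_ne_zero hb0 hV₀, fun x => ?_⟩
  rw [hall, Matrix.mulVec_smul, smul_comm]

end ZeroMode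

section CriticalRow
open scoped Matrix.Norms.Operator

variable {P : Params} {c q τ₀ : ℝ} {Z : ℝ → ℝ × ℝ}

theorem IsHomoclinic.not_eventually_pos (h : IsHomoclinic P c q τ₀ Z) (hs : IsSaddle P c q τ₀)
    (hc : 0 < c) {m : ℝ} (hm : m < 0) :
    ¬∀ᶠ x in atBot, m * (Z x).2 < (profileField P c q (Z x)).2 := by
  intro hev
  obtain ⟨N, hN⟩ := eventually_atBot.1 hev
  have hg : ∀ x, HasDerivAt (fun x => Real.exp (-m * x) * (Z x).2)
      (Real.exp (-m * x) * ((profileField P c q (Z x)).2 - m * (Z x).2)) x := fun x => by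
    have h1 : HasDerivAt (fun x : ℝ => Real.exp (-m * x)) (Real.exp (-m * x) * -m) x := by
      simpa using ((hasDerivAt_id x).const_mul (-m)).exp
    refine (h1.mul (h.hasDerivAt_snd x)).congr_deriv ?_
    ring
  have hmono : MonotoneOn (fun x => Real.exp (-m * x) * (Z x).2) (Iic N) := by
    refine monotoneOn_of_deriv_nonneg (convex_Iic N)
      (fun x _ => (hg x).continuousAt.continuousWithinAt)
      (fun x _ => (hg x).differentiableAt.differentiableWithinAt) fun x hx => ?_
    rw [(hg x).deriv]
    have := hN x (interior_subset (s := Iic N) hx)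
    exact mul_nonneg (Real.exp_pos _).le (by linarith)
  have hlim : Tendsto (fun x => Real.exp (-m * x) * (Z x).2) atBot (𝓝 0) := by
    have h1 := (tendsto_exp_mul_atBot (neg_pos.2 hm)).mul
      ((continuous_snd.tendsto (τ₀, (0 : ℝ))).comp h.tendsto_atBot)
    simpa using h1
  have hpos : ∀ x ≤ N, 0 ≤ (Z x).2 := fun x hx => by
    have h1 : 0 ≤ Real.exp (-m * x) * (Z x).2 := le_of_tendsto hlim (by
      filter_upwards [eventually_le_atBot x] with y hy
      exact hmono (hy.trans hx) hx hy)
    exact nonneg_of_mul_nonneg_right h1 (Real.exp_pos _)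
  have hmono2 : MonotoneOn (fun x => (Z x).1) (Iic N) := by
    refine monotoneOn_of_deriv_nonneg (convex_Iic N)
      (fun x _ => (h.hasDerivAt_fst x).continuousAt.continuousWithinAt)
      (fun x _ => (h.hasDerivAt_fst x).differentiableAt.differentiableWithinAt) fun x hx => ?_
    rw [(h.hasDerivAt_fst x).deriv]
    exact hpos x (interior_subset (s := Iic N) hx)
  have hlim2 : Tendsto (fun x => (Z x).1) atBot (𝓝 τ₀) := (continuous_fst.tendsto _).comp h.tendsto_atBot
  have : τ₀ ≤ (Z N).1 := le_of_tendsto hlim2 (by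
    filter_upwards [eventually_le_atBot N] with y hy
    exact hmono2 hy (mem_Iic.2 le_rfl) hy)
  exact (h.fst_lt hs hc N).not_ge this

theorem IsHomoclinic.not_eventually_neg (h : IsHomoclinic P c q τ₀ Z) (hs : IsSaddle P c q τ₀)
    (hc : 0 < c) : ¬∀ᶠ x in atTop, (Z x).2 < 0 := by
  intro hev
  obtain ⟨N, hN⟩ := eventually_atTop.1 hev
  have hanti : AntitoneOn (fun x => (Z x).1) (Ici N) := by
    refine antitoneOn_of_deriv_nonpos (convex_Ici N)
      (fun x _ => (h.hasDerivAt_fst x).continuousAt.continuousWithinAt)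
      (fun x _ => (h.hasDerivAt_fst x).differentiableAt.differentiableWithinAt) fun x hx => ?_
    rw [(h.hasDerivAt_fst x).deriv]
    exact (hN x (interior_subset hx)).le
  have hlim2 : Tendsto (fun x => (Z x).1) atTop (𝓝 τ₀) := (continuous_fst.tendsto _).comp h.tendsto_atTop
  have : τ₀ ≤ (Z N).1 := le_of_tendsto hlim2 (by
    filter_upwards [eventually_ge_atTop N] with y hy
    exact hanti (mem_Ici.2 le_rfl) hy hy)
  exact (h.fst_lt hs hc N).not_ge this

theorem exists_dual_row {p : Mat3} (hp : p * p = p) (ht : p.trace = 1) {V : Fin 3 → ℂ}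
    (hV : p.mulVec V = V) (hV0 : V ≠ 0) : ∃ ℓ, Matrix.vecMul ℓ p = ℓ ∧ ℓ ⬝ᵥ V = 1 := by
  obtain ⟨v, l, hPv, hlv⟩ := exists_eq_vecMulVec hp ht
  have h1 : V = (l ⬝ᵥ V) • v := by
    conv_lhs => rw [← hV, hPv]
    ext i
    simp [Matrix.vecMulVec, Matrix.mulVec, dotProduct, Fin.sum_univ_three]
    ring
  have h2 : l ⬝ᵥ V ≠ 0 := fun h0 => hV0 (by rw [h1, h0, zero_smul])
  refine ⟨(l ⬝ᵥ V)⁻¹ • l, ?_, by rw [smul_dotProduct, smul_eq_mul, inv_mul_cancel₀ h2]⟩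
  rw [Matrix.smul_vecMul, hPv]
  congr 1
  ext i
  simp only [Matrix.vecMul, Matrix.vecMulVec, dotProduct, Fin.sum_univ_three, Matrix.of_apply] at hlv ⊢
  linear_combination (l i) * hlv

/-- The reduced adjoint system at `0`, embedded in dimension three. -/
def adjointReduction (c : ℝ) : Mat3 →ₗ[ℂ] Mat3 where
  toFun M := !![0, 0, -(M 2 0 - c * M 2 1); 0, 0, 0; -M 0 2, 0, -M 2 2]
  map_add' M N := by
    ext i j
    fin_cases i <;> fin_cases j <;> simp <;> ring
  map_smul' a M := by
    ext i j
    fin_cases i <;> fin_cases j <;> simp; ring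

theorem hasDerivAt_reduced_row {η : ℝ → Fin 3 → ℂ} {x : ℝ} (hc : c ≠ 0)
    (hη : HasDerivAt η (-Matrix.vecMul (η x) (profileMatrix P c q Z x 0)) x) :
    HasDerivAt (fun x => ![η x 0 - c * η x 1, 0, η x 2])
      ((adjointReduction c (profileMatrix P c q Z x 0)).mulVec ![η x 0 - c * η x 1, 0, η x 2]) x ∧
    HasDerivAt (fun x => η x 1) (-(η x 2 * profileMatrix P c q Z x 0 2 1)) x := by
  obtain ⟨a00, a01, a10, a11, a02, a12⟩ := profileMatrix_zero_entries (P := P) (c := c) (q := q) (Z := Z) x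
  have hcC : (c : ℂ) ≠ 0 := Complex.ofReal_ne_zero.2 hc
  have := hasDerivAt_pi.1 hη
  simp only [Pi.neg_apply, Matrix.vecMul, dotProduct, Fin.sum_univ_three] at this
  refine ⟨hasDerivAt_pi.2 fun i => ?_, (this 1).congr_deriv ?_⟩
  · fin_cases i
    · refine ((this 0).sub ((this 1).const_mul (c : ℂ))).congr_deriv ?_
      simp [adjointReduction, a00, a01, a10, a11]
      ring
    · simpa [adjointReduction] using hasDerivAt_const x (0 : ℂ)
    · refine (this 2).congr_deriv ?_
      simp [adjointReduction, a02, a12]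
      field_simp
      ring
  · rw [a01, a11]; ring

/-- The adjoint solution at `0` on the invariant plane is the Wronskian with the derivative of the
profile. -/
theorem exists_row_eq_wronskian (h : IsHomoclinic P c q τ₀ Z) (hs : IsSaddle P c q τ₀) (hc : 0 < c)
    {g : ℝ → ℝ} (hg0 : g 0 = 1)
    (hg : ∀ x, HasDerivAt (fun x => (g x : ℂ)) (-(profileMatrix P c q Z x 0 2 2) * g x) x)
    {η : ℝ → Fin 3 → ℂ} (hη : ∀ x, HasDerivAt η (-Matrix.vecMul (η x) (profileMatrix P c q Z x 0)) x)
    (h0 : η 0 ⬝ᵥ zeroMode P c q τ₀ Z 0 = 0) :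
    ∃ b : ℂ, ∀ x, η x 0 - c * η x 1 = -(b * g x * zeroMode P c q τ₀ Z x 2) ∧
      η x 2 = b * g x * zeroMode P c q τ₀ Z x 0 := by
  obtain ⟨C, θ, hθ, hC, hA⟩ := exists_asymConst h hs hc.ne'
  obtain ⟨C', hA'⟩ := (hA 0).map (adjointReduction c)
  set u := zeroMode P c q τ₀ Z with hu
  have hud : ∀ x, HasDerivAt u ((profileMatrix P c q Z x 0).mulVec (u x)) x := hasDerivAt_zeroMode h hc.ne'
  have hu1 : ∀ x, u x 1 = -c * u x 0 := zeroMode_one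
  have h0' : (η 0 0 - c * η 0 1) * u 0 0 + η 0 2 * u 0 2 = 0 := by
    rw [← h0, dotProduct, Fin.sum_univ_three, hu1]; ring
  obtain ⟨b, hb0, hb2⟩ : ∃ b : ℂ, η 0 0 - c * η 0 1 = -(b * u 0 2) ∧ η 0 2 = b * u 0 0 := by
    by_cases hz : u 0 0 = 0
    · have h2 : u 0 2 ≠ 0 := fun h2 => zeroMode_ne_zero h hs hc 0 (by
        rw [← hu]; ext i; fin_cases i; all_goals simp [hz, h2, hu1])
      rw [hz, mul_zero, zero_add] at h0'
      refine ⟨-(η 0 0 - c * η 0 1) / u 0 2, by field_simp, ?_⟩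
      rw [hz, mul_zero]
      exact (mul_eq_zero.1 h0').resolve_right h2
    · refine ⟨η 0 2 / u 0 0, ?_, by field_simp⟩
      field_simp
      linear_combination h0'
  let N : ℝ → Fin 3 → ℂ := fun x => ![-(b * (g x * u x 2)), 0, b * (g x * u x 0)]
  have hN : ∀ x, HasDerivAt N ((adjointReduction c (profileMatrix P c q Z x 0)).mulVec (N x)) x := fun x => by
    obtain ⟨d1, d2⟩ := hasDerivAt_reduced_col (hud x) (hu1 x)
    refine hasDerivAt_pi.2 fun i => ?_
    fin_cases i
    · refine ((((hg x).mul d2).const_mul b).neg).congr_deriv ?_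
      simp [adjointReduction, N]
      ring
    · simpa [adjointReduction, N] using hasDerivAt_const x (0 : ℂ)
    · refine (((hg x).mul d1).const_mul b).congr_deriv ?_
      simp [adjointReduction, N]
      ring
  have := eq_zero_of_linear_ode hθ hA' (W := fun x => ![η x 0 - c * η x 1, 0, η x 2] - N x) (x₀ := 0)
    (fun x => by
      rw [Matrix.mulVec_sub]
      exact (hasDerivAt_reduced_row hc.ne' (hη x)).1.sub (hN x)) (by
      ext i; fin_cases i <;> simp [N, hg0, hb0, hb2])
  refine ⟨b, fun x => ⟨?_, ?_⟩⟩
  · have h1 := congrFun (congrFun this x) 0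
    simp [N] at h1
    linear_combination h1
  · have h1 := congrFun (congrFun this x) 2
    simp [N] at h1
    linear_combination h1

theorem AsymConst.norm_le {A : ℝ → Mat3} {A₀ : Mat3} {C θ : ℝ} (hA : AsymConst A A₀ C θ)
    (hC : 0 ≤ C) (hθ : 0 < θ) (x : ℝ) : ‖A x‖ ≤ ‖A₀‖ + C := by
  have h1 := hA.bound x
  have h2 : Real.exp (-θ * |x|) ≤ 1 := Real.exp_le_one_iff.2 (by
    have := abs_nonneg x; nlinarith)
  have h3 : ‖A x‖ ≤ ‖A₀‖ + ‖A x - A₀‖ := norm_le_insert' _ _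
  nlinarith

theorem norm_entry_le (M : Mat3) (i j : Fin 3) : ‖M i j‖ ≤ ‖M‖ := by
  have h1 := Matrix.linfty_opNorm_mulVec M (Pi.single j 1)
  rw [Pi.norm_single, norm_one, mul_one] at h1
  refine le_trans ?_ h1
  simpa using norm_le_pi_norm (M.mulVec (Pi.single j 1)) i

/-- A solution of the adjoint system is bounded if it is exponentially small on the invariant
plane. -/
theorem exists_row_bound (h : IsHomoclinic P c q τ₀ Z) (hs : IsSaddle P c q τ₀) (hc : 0 < c)
    {η : ℝ → Fin 3 → ℂ} (hη : ∀ x, HasDerivAt η (-Matrix.vecMul (η x) (profileMatrix P c q Z x 0)) x)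
    {K κ : ℝ} (hκ : 0 < κ) (h0 : ∀ x, 0 ≤ x → ‖η x 0 - c * η x 1‖ ≤ K * Real.exp (-κ * x))
    (h2 : ∀ x, 0 ≤ x → ‖η x 2‖ ≤ K * Real.exp (-κ * x)) : ∃ B, ∀ x, 0 ≤ x → ‖η x‖ ≤ B := by
  obtain ⟨C, θ, hθ, hC, hA⟩ := exists_asymConst h hs hc.ne'
  have hK : 0 ≤ K := by simpa using (norm_nonneg _).trans (h2 0 le_rfl)
  obtain ⟨M, hM⟩ : ∃ M, ∀ x, ‖profileMatrix P c q Z x 0 2 1‖ ≤ M :=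
    ⟨_, fun x => (norm_entry_le _ 2 1).trans ((hA 0).norm_le (by positivity) hθ x)⟩
  have hM0 : 0 ≤ M := (norm_nonneg _).trans (hM 0)
  have h1 : ∀ x, 0 ≤ x → ‖η x 1‖ ≤ ‖η 0 1‖ + K * M / κ := fun x hx => by
    have hd : ∀ y, HasDerivAt (fun y => -(K * M / κ) * Real.exp (-κ * y))
        (K * M * Real.exp (-κ * y)) y := fun y => by
      have := (((hasDerivAt_id y).const_mul (-κ)).exp).const_mul (-(K * M / κ))
      refine this.congr_deriv ?_
      simp only [id]
      field_simp
    have := image_norm_le_of_norm_deriv_right_le_deriv_boundary (a := 0) (b := x)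
      (f := fun y => η y 1 - η 0 1) (f' := fun y => -(η y 2 * profileMatrix P c q Z y 0 2 1))
      (B := fun y => K * M / κ + -(K * M / κ) * Real.exp (-κ * y))
      (B' := fun y => K * M * Real.exp (-κ * y))
      (fun y hy => ((hasDerivAt_reduced_row hc.ne' (hη y)).2.sub_const _).continuousAt.continuousWithinAt)
      (fun y hy => ((hasDerivAt_reduced_row hc.ne' (hη y)).2.sub_const _).hasDerivWithinAt)
      (by simp) (fun y => (hd y).const_add _) (fun y hy => by
        rw [norm_neg, norm_mul]
        calc ‖η y 2‖ * ‖profileMatrix P c q Z y 0 2 1‖ ≤ (K * Real.exp (-κ * y)) * M :=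
              mul_le_mul (h2 y hy.1) (hM y) (norm_nonneg _) (mul_nonneg hK (Real.exp_pos _).le)
          _ = _ := by ring)
      (right_mem_Icc.2 hx)
    have h3 : 0 ≤ K * M / κ * Real.exp (-κ * x) := by positivity
    have h4 := norm_le_insert' (η x 1) (η 0 1)
    linarith
  set B₁ := ‖η 0 1‖ + K * M / κ with hB₁
  have hB₁0 : 0 ≤ B₁ := by positivity
  refine ⟨K + (c + 1) * B₁, fun x hx => norm_vec_le _ fun i => ?_⟩
  have hexp : K * Real.exp (-κ * x) ≤ K := mul_le_of_le_one_right hK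
    (Real.exp_le_one_iff.2 (by nlinarith))
  have hh1 := h1 x hx
  have hcB : 0 ≤ c * B₁ := by positivity
  fin_cases i
  · have e : η x 0 = (η x 0 - c * η x 1) + c * η x 1 := by ring
    have hc1 : ‖(c : ℂ) * η x 1‖ ≤ c * B₁ := by
      rw [norm_mul, Complex.norm_real, Real.norm_eq_abs, abs_of_pos hc]
      gcongr
    show ‖η x 0‖ ≤ _
    rw [e]
    have := norm_add_le (η x 0 - c * η x 1) (c * η x 1)
    linarith [h0 x hx]
  · show ‖η x 1‖ ≤ _
    linarith
  · show ‖η x 2‖ ≤ _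
    linarith [h2 x hx]

/-- The normalized critical row at `0`: it is a positive multiple of the Wronskian with the
derivative of the profile on the invariant plane, and is bounded at `+∞`. -/
theorem exists_critical_row (h : IsHomoclinic P c q τ₀ Z) (hs : IsSaddle P c q τ₀) (hc : 0 < c)
    {μ : Fin 3 → ℂ} {X Y : ℝ → Mat3} (hμ : IsGapSpectrum (limitMatrix P c q τ₀ 0) μ)
    (hF : FastPair (fun x => profileMatrix P c q Z x 0) (μ 2) (gapProj (limitMatrix P c q τ₀ 0) μ) X Y)
    {V : Fin 3 → ℂ} (hV : (gapProj (limitMatrix P c q τ₀ 0) μ).mulVec V = V) (hV0 : V ≠ 0)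
    (hXV : ∀ x : ℝ, Complex.exp (μ 2 * x) • (X x).mulVec V = zeroMode P c q τ₀ Z x)
    {BX : ℝ} (hBX : ∀ x, 0 ≤ x → ‖X x‖ ≤ BX) :
    ∃ (ℓ : Fin 3 → ℂ) (β B : ℝ), ℓ ⬝ᵥ V = 1 ∧ 0 < β ∧
      (∀ v : Fin 3 → ℂ, v 1 = -c * v 0 → Matrix.vecMul ℓ (Y 0) ⬝ᵥ v
        = β * (zeroMode P c q τ₀ Z 0 2 * v 0 - zeroMode P c q τ₀ Z 0 0 * v 2)) ∧
      ∀ x : ℝ, 0 ≤ x → ‖Complex.exp (-μ 2 * x) • Matrix.vecMul ℓ (Y x)‖ ≤ B := by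
  obtain ⟨m, T, hm, hm0, hT, hmT⟩ := exists_trace_gt hs hc hμ
  obtain ⟨g, Bg, hg0, hgB, hg⟩ := exists_wronskian_factor h hs hc.ne' hT
  obtain ⟨ℓ, hℓ, hℓV⟩ := exists_dual_row hμ.gapProj_mul_self hμ.trace_gapProj hV hV0
  set u := zeroMode P c q τ₀ Z with hu
  set η : ℝ → Fin 3 → ℂ := fun x => Complex.exp (-μ 2 * x) • Matrix.vecMul ℓ (Y x) with hηd
  have hη : ∀ x, HasDerivAt η (-Matrix.vecMul (η x) (profileMatrix P c q Z x 0)) x := hF.hasDerivAt_row ℓ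
  have hud : ∀ x, HasDerivAt u ((profileMatrix P c q Z x 0).mulVec (u x)) x := hasDerivAt_zeroMode h hc.ne'
  have hexp : ∀ x : ℝ, Complex.exp (-μ 2 * x) = (Real.exp (-m * x) : ℂ) := fun x => by
    rw [hm]; push_cast; ring_nf
  have hYℓ : Tendsto (fun x => Matrix.vecMul ℓ (Y x)) atBot (𝓝 ℓ) := by
    have hcont : Continuous fun M : Mat3 => Matrix.vecMul ℓ M := continuous_const.matrix_vecMul continuous_id
    have := (hcont.tendsto _).comp hF.limY
    rwa [hℓ] at this
  have hηt : Tendsto η atBot (𝓝 0) := by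
    have t1 : Tendsto (fun x : ℝ => Complex.exp (-μ 2 * x)) atBot (𝓝 0) := by
      simp only [hexp]
      have := (Complex.continuous_ofReal.tendsto 0).comp (tendsto_exp_mul_atBot (neg_pos.2 hm0))
      rwa [Complex.ofReal_zero] at this
    have := t1.smul hYℓ
    rw [zero_smul] at this
    exact this
  have hut : Tendsto u atBot (𝓝 0) := tendsto_zeroMode hs h.tendsto_atBot
  have horth : ∀ x, η x ⬝ᵥ u x = 0 := fun x => by
    have h1 : Tendsto (fun y => η y ⬝ᵥ u y) atBot (𝓝 0) := by
      simp only [dotProduct]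
      simpa using tendsto_finsetSum Finset.univ fun i _ =>
        (tendsto_pi_nhds.1 hηt i).mul (tendsto_pi_nhds.1 hut i)
    have h2 : (fun y => η y ⬝ᵥ u y) = fun _ => η x ⬝ᵥ u x :=
      funext fun y => dotProduct_eq_of_solutions hη hud y x
    rw [h2] at h1
    exact tendsto_nhds_unique tendsto_const_nhds h1
  obtain ⟨b, hb⟩ := exists_row_eq_wronskian h hs hc hg0 hg hη (horth 0)
  have hη0 : η 0 = Matrix.vecMul ℓ (Y 0) := by simp [hηd]
  -- the limit direction
  have hAV : (limitMatrix P c q τ₀ 0).mulVec V = μ 2 • V := by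
    rw [← hV, Matrix.mulVec_mulVec, hμ.mul_gapProj, Matrix.smul_mulVec]
  have ht0 : (τ₀ : ℂ) ≠ 0 := Complex.ofReal_ne_zero.2 hs.tau_pos.ne'
  have hcC : (c : ℂ) ≠ 0 := Complex.ofReal_ne_zero.2 hc.ne'
  have hV2 : V 2 = -(c * m * V 0) / τ₀ ^ 2 := by
    have := congrFun hAV 0
    simp only [limitMatrix, coeffMatrix, Matrix.mulVec, dotProduct, Fin.sum_univ_three, Matrix.of_apply,
      Matrix.cons_val', Matrix.cons_val_zero, Matrix.cons_val_one, Matrix.cons_val,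
      Matrix.cons_val_fin_one, Pi.smul_apply, smul_eq_mul, hm, zero_mul, zero_div, zero_add, add_zero] at this
    push_cast at this
    field_simp at this ⊢
    linear_combination -this
  have hV1 : V 1 = -c * V 0 := by
    have h0 := congrFun hAV 0
    have h1 := congrFun hAV 1
    have hm' : (m : ℂ) ≠ 0 := Complex.ofReal_ne_zero.2 hm0.ne
    simp only [limitMatrix, coeffMatrix, Matrix.mulVec, dotProduct, Fin.sum_univ_three, Matrix.of_apply,
      Matrix.cons_val', Matrix.cons_val_zero, Matrix.cons_val_one, Matrix.cons_val,
      Matrix.cons_val_fin_one, Pi.smul_apply, smul_eq_mul, hm, zero_mul, zero_div, zero_add, add_zero] at h0 h1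
    push_cast at h0 h1
    field_simp at h0
    refine mul_left_cancel₀ hm' ?_
    linear_combination -h1 - h0
  have hXVt : Tendsto (fun x : ℝ => ((Real.exp (-m * x) * (Z x).2 : ℝ) : ℂ)) atTop (𝓝 (V 0)) := by
    have hcont : Continuous fun M : Mat3 => M.mulVec V := continuous_id.matrix_mulVec continuous_const
    have h1 := (hcont.tendsto _).comp hF.limX
    rw [hV] at h1
    refine (tendsto_pi_nhds.1 h1 0).congr fun x => ?_
    have h2 := congrFun (hXV x) 0
    rw [hu, zeroMode_zero] at h2
    push_cast
    rw [← h2, Pi.smul_apply, smul_eq_mul, ← mul_assoc, hm, ← Complex.exp_add]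
    simp
  obtain ⟨v, hv⟩ : ∃ v : ℝ, V 0 = v := by
    refine ⟨(V 0).re, Complex.ext rfl ?_⟩
    have := (Complex.continuous_im.tendsto _).comp hXVt
    simp only [Function.comp_def, Complex.ofReal_im] at this
    rw [Complex.ofReal_im]
    exact (tendsto_nhds_unique tendsto_const_nhds this).symm
  have hvt : Tendsto (fun x : ℝ => Real.exp (-m * x) * (Z x).2) atTop (𝓝 v) := by
    have := (Complex.continuous_re.tendsto _).comp hXVt
    rwa [hv] at this
  have hv0 : v ≠ 0 := fun h0 => hV0 (by
    rw [h0, Complex.ofReal_zero] at hv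
    ext i; fin_cases i <;> simp [hv, hV1, hV2])
  have hvpos : 0 < v := by
    refine lt_of_le_of_ne (not_lt.1 fun hneg => ?_) hv0.symm
    refine h.not_eventually_neg hs hc ?_
    filter_upwards [hvt.eventually (gt_mem_nhds hneg)] with x hx
    by_contra! hle
    exact absurd hx (not_lt.2 (mul_nonneg (Real.exp_pos _).le hle))
  -- the pairing with the limit direction
  set ρ : ℝ → ℝ := fun x => Real.exp (m * x) * g x * (c * v / (Z x).1 ^ 2)
    * ((profileField P c q (Z x)).2 - m * (Z x).2) with hρ
  have hρt : Tendsto (fun x => b * (ρ x : ℂ)) atBot (𝓝 1) := by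
    have z1 : Tendsto (fun x => (((Z x).1 : ℝ) : ℂ)) atBot (𝓝 τ₀) :=
      (Complex.continuous_ofReal.tendsto _).comp ((continuous_fst.tendsto _).comp h.tendsto_atBot)
    have hVt : Tendsto (fun x => ![V 0, V 1, -(c * m * V 0) / ((Z x).1 : ℂ) ^ 2]) atBot (𝓝 V) := by
      rw [tendsto_pi_nhds]
      intro i
      fin_cases i
      · exact tendsto_const_nhds
      · exact tendsto_const_nhds
      · show Tendsto _ _ (𝓝 (V 2))
        rw [hV2]
        exact tendsto_const_nhds.div (z1.pow 2) (pow_ne_zero 2 ht0)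
    have h1 : Tendsto (fun x => Matrix.vecMul ℓ (Y x) ⬝ᵥ ![V 0, V 1, -(c * m * V 0) / ((Z x).1 : ℂ) ^ 2])
        atBot (𝓝 (ℓ ⬝ᵥ V)) := by
      simp only [dotProduct]
      exact tendsto_finsetSum Finset.univ fun i _ =>
        (tendsto_pi_nhds.1 hYℓ i).mul (tendsto_pi_nhds.1 hVt i)
    rw [hℓV] at h1
    refine h1.congr fun x => ?_
    obtain ⟨b0, b2⟩ := hb x
    have e1 : Matrix.vecMul ℓ (Y x) = (Real.exp (m * x) : ℂ) • η x := by
      rw [hηd]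
      simp only [hexp]
      rw [smul_smul, ← Complex.ofReal_mul, ← Real.exp_add]
      simp
    have hz : ((Z x).1 : ℂ) ≠ 0 := Complex.ofReal_ne_zero.2 (h.tau_pos x).ne'
    rw [e1, smul_dotProduct, dotProduct, Fin.sum_univ_three]
    simp only [Matrix.cons_val_zero, Matrix.cons_val_one, Matrix.cons_val, smul_eq_mul]
    rw [b2, hV1, hv]
    have e2 : η x 0 * (v : ℂ) + η x 1 * (-c * v) = -(b * g x * u x 2) * v := by rw [← b0]; ring
    rw [e2, hu, zeroMode_zero, zeroMode_two, hρ]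
    push_cast
    field_simp
    ring
  have hbne : b ≠ 0 := fun h0 => by
    simp only [h0, zero_mul] at hρt
    exact zero_ne_one (tendsto_nhds_unique tendsto_const_nhds hρt)
  have hρt' : Tendsto (fun x => (ρ x : ℂ)) atBot (𝓝 b⁻¹) := by
    have := hρt.const_mul b⁻¹
    simpa [← mul_assoc, inv_mul_cancel₀ hbne] using this
  obtain ⟨d, hd⟩ : ∃ d : ℝ, b⁻¹ = d := by
    refine ⟨(b⁻¹).re, Complex.ext rfl ?_⟩
    have := (Complex.continuous_im.tendsto _).comp hρt'
    simp only [Function.comp_def, Complex.ofReal_im] at this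
    rw [Complex.ofReal_im]
    exact (tendsto_nhds_unique tendsto_const_nhds this).symm
  have hdne : d ≠ 0 := fun h0 => by
    rw [h0, Complex.ofReal_zero, inv_eq_zero] at hd; exact hbne hd
  have hρd : Tendsto ρ atBot (𝓝 d) := by
    have := (Complex.continuous_re.tendsto _).comp hρt'
    rwa [hd] at this
  have hdneg : d < 0 := by
    refine lt_of_le_of_ne (not_lt.1 fun hpos => ?_) hdne
    refine h.not_eventually_pos hs hc hm0 ?_
    filter_upwards [hρd.eventually (lt_mem_nhds hpos)] with x hx
    have h1 : 0 < Real.exp (m * x) * g x * (c * v / (Z x).1 ^ 2) := by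
      have := (hgB x).1
      have := h.tau_pos x
      positivity
    have := pos_of_mul_pos_right hx h1.le
    linarith
  have hbd : b = ((d⁻¹ : ℝ) : ℂ) := by rw [Complex.ofReal_inv, ← hd, inv_inv]
  have hBg : 0 ≤ Bg := by simpa using (hgB 0).1.le.trans (hgB 0).2
  have hBX0 : 0 ≤ BX := (norm_nonneg _).trans (hBX 0 le_rfl)
  have hbound : ∀ i, ∀ x : ℝ, 0 ≤ x → ‖b * g x * u x i‖ ≤ ‖b‖ * Bg * (BX * ‖V‖) * Real.exp (-(T - m) * x) :=
    fun i x hx => by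
    have h1 : ‖u x i‖ ≤ Real.exp (m * x) * (BX * ‖V‖) := by
      refine (norm_le_pi_norm _ i).trans ?_
      rw [← hXV, norm_smul, Complex.norm_exp, hm, ← Complex.ofReal_mul, Complex.ofReal_re]
      exact mul_le_mul_of_nonneg_left ((Matrix.linfty_opNorm_mulVec _ _).trans
        (mul_le_mul_of_nonneg_right (hBX x hx) (norm_nonneg _))) (Real.exp_pos _).le
    rw [norm_mul, norm_mul, Complex.norm_real, Real.norm_eq_abs, abs_of_pos (hgB x).1]
    calc ‖b‖ * g x * ‖u x i‖ ≤ ‖b‖ * (Bg * Real.exp (-T * x)) * (Real.exp (m * x) * (BX * ‖V‖)) :=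
          mul_le_mul (mul_le_mul_of_nonneg_left (hgB x).2 (norm_nonneg _)) h1 (norm_nonneg _)
            (by positivity)
      _ = _ := by
          rw [show -(T - m) * x = -T * x + m * x by ring, Real.exp_add]; ring
  obtain ⟨B, hB⟩ := exists_row_bound h hs hc hη (sub_pos.2 hmT)
    (fun x hx => by rw [(hb x).1, norm_neg]; exact hbound 2 x hx)
    (fun x hx => by rw [(hb x).2]; exact hbound 0 x hx)
  refine ⟨ℓ, -d⁻¹, B, hℓV, neg_pos.2 (inv_lt_zero.2 hdneg), fun w hw => ?_, hB⟩
  obtain ⟨b0, b2⟩ := hb 0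
  rw [hg0, Complex.ofReal_one, mul_one] at b0 b2
  rw [← hη0, dotProduct, Fin.sum_univ_three, hw, b2]
  have e2 : η 0 0 * w 0 + η 0 1 * (-c * w 0) = -(b * u 0 2) * w 0 := by rw [← b0]; ring
  rw [e2, hbd]
  push_cast
  ring

end CriticalRow

section QuadraticBound
open scoped Matrix.Norms.Operator

theorem norm_dotProduct_le (v w : Fin 3 → ℂ) : ‖v ⬝ᵥ w‖ ≤ 3 * ‖v‖ * ‖w‖ := by
  rw [dotProduct, Fin.sum_univ_three]
  have h : ∀ i, ‖v i * w i‖ ≤ ‖v‖ * ‖w‖ := fun i => by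
    rw [norm_mul]
    exact mul_le_mul (norm_le_pi_norm v i) (norm_le_pi_norm w i) (norm_nonneg _) (norm_nonneg _)
  have := norm_add₃_le (a := v 0 * w 0) (b := v 1 * w 1) (c := v 2 * w 2)
  linarith [h 0, h 1, h 2]

theorem continuousOn_dotProduct {s : Set ℝ} {v w : ℝ → Fin 3 → ℂ} (hv : ContinuousOn v s)
    (hw : ContinuousOn w s) : ContinuousOn (fun x => v x ⬝ᵥ w x) s :=
  (continuous_fst.dotProduct continuous_snd).comp_continuousOn (hv.prodMk hw)

theorem tendsto_dotProduct_zero {l : Filter ℝ} {v w : ℝ → Fin 3 → ℂ} {B : ℝ}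
    (hv : ∀ᶠ x in l, ‖v x‖ ≤ B) (hw : Tendsto w l (𝓝 0)) : Tendsto (fun x => v x ⬝ᵥ w x) l (𝓝 0) := by
  refine squeeze_zero_norm' (a := fun x => 3 * B * ‖w x‖) ?_ (by simpa using hw.norm.const_mul (3 * B))
  filter_upwards [hv] with x hx
  refine (norm_dotProduct_le _ _).trans ?_
  gcongr

theorem norm_le_of_deriv_exp_bound {φ φ' : ℝ → ℂ} {K κ : ℝ} (hK : 0 ≤ K) (hκ : 0 < κ)
    (hc : ContinuousOn φ (Ici 0)) (hφ : ∀ x, 0 < x → HasDerivAt φ (φ' x) x)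
    (hb : ∀ x, 0 < x → ‖φ' x‖ ≤ K * Real.exp (-κ * x)) (h0 : Tendsto φ atTop (𝓝 0)) :
    ‖φ 0‖ ≤ K / κ := by
  have hd : ∀ y, HasDerivAt (fun y => -(K / κ) * Real.exp (-κ * y)) (K * Real.exp (-κ * y)) y := fun y => by
    refine ((((hasDerivAt_id y).const_mul (-κ)).exp).const_mul (-(K / κ))).congr_deriv ?_
    simp only [id]
    field_simp
  have hKκ : 0 ≤ K / κ := by positivity
  have h1 : ∀ a, 0 < a → ∀ b, a ≤ b → ‖φ b - φ a‖ ≤ K / κ := fun a ha b hab => by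
    have := image_norm_le_of_norm_deriv_right_le_deriv_boundary (a := a) (b := b)
      (f := fun y => φ y - φ a) (f' := φ')
      (B := fun y => K / κ * Real.exp (-κ * a) + -(K / κ) * Real.exp (-κ * y))
      (B' := fun y => K * Real.exp (-κ * y))
      (fun y hy => ((hφ y (ha.trans_le hy.1)).sub_const _).continuousAt.continuousWithinAt)
      (fun y hy => ((hφ y (ha.trans_le hy.1)).sub_const _).hasDerivWithinAt)
      (by simp) (fun y => (hd y).const_add _) (fun y hy => hb y (ha.trans_le hy.1)) (right_mem_Icc.2 hab)
    refine this.trans ?_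
    have h2 : Real.exp (-κ * a) ≤ 1 := Real.exp_le_one_iff.2 (by nlinarith)
    have h3 := Real.exp_pos (-κ * b)
    nlinarith
  have h2 : ∀ a, 0 < a → ‖φ a‖ ≤ K / κ := fun a ha => by
    have ht : Tendsto (fun b => ‖φ b - φ a‖) atTop (𝓝 ‖φ a‖) := by
      simpa using (h0.sub_const (φ a)).norm
    exact le_of_tendsto ht (by filter_upwards [eventually_ge_atTop a] with b hb using h1 a ha b hb)
  have h3 : Tendsto (fun x => ‖φ x‖) (𝓝[>] 0) (𝓝 ‖φ 0‖) :=
    ((hc 0 (mem_Ici.2 le_rfl)).mono Ioi_subset_Ici_self).norm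
  exact le_of_tendsto h3 (by filter_upwards [self_mem_nhdsWithin] with x hx using h2 x hx)

theorem norm_le_of_deriv_exp_bound_left {φ φ' : ℝ → ℂ} {K κ : ℝ} (hK : 0 ≤ K) (hκ : 0 < κ)
    (hc : ContinuousOn φ (Iic 0)) (hφ : ∀ x < 0, HasDerivAt φ (φ' x) x)
    (hb : ∀ x < 0, ‖φ' x‖ ≤ K * Real.exp (κ * x)) (h0 : Tendsto φ atBot (𝓝 0)) :
    ‖φ 0‖ ≤ K / κ := by
  have := norm_le_of_deriv_exp_bound (φ := fun x => φ (-x)) (φ' := fun x => -φ' (-x)) hK hκ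
    (hc.comp continuous_neg.continuousOn fun x hx => by simpa using hx) (fun x hx => by
      have := (hφ (-x) (by linarith)).scomp x (hasDerivAt_neg x)
      simpa [Function.comp_def] using this) (fun x hx => by
      rw [norm_neg]
      refine (hb (-x) (by linarith)).trans_eq ?_
      ring_nf) (h0.comp tendsto_neg_atTop_atBot)
  simpa using this

theorem exists_bound_of_tendsto_atBot {E : Type*} [NormedAddCommGroup E] {f : ℝ → E}
    (hf : ContinuousOn f (Iic 0)) (h0 : Tendsto f atBot (𝓝 0)) : ∃ B, 0 ≤ B ∧ ∀ x ≤ 0, ‖f x‖ ≤ B := by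
  have h1 : ∀ᶠ x in atBot, ‖f x‖ ≤ 1 := by
    have := h0.norm
    rw [norm_zero] at this
    exact (this.eventually (gt_mem_nhds one_pos)).mono fun x hx => hx.le
  obtain ⟨N, hN⟩ := eventually_atBot.1 h1
  obtain ⟨B, hB⟩ := (isCompact_Icc (a := N) (b := 0)).exists_bound_of_continuousOn
    (hf.mono Icc_subset_Iic_self)
  refine ⟨max 1 B, by positivity, fun x hx => ?_⟩
  rcases le_total x N with h | h
  · exact (hN x h).trans (le_max_left _ _)
  · exact (hB x ⟨h, hx⟩).trans (le_max_right _ _)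

/-- Second-order expansion, at the parameter `0`, of the pairing of a row solution decaying at `-∞`
with a column solution decaying at `+∞`. -/
theorem exists_pairing_expansion {A B : ℝ → Mat3} {H W : ℂ → ℝ → Fin 3 → ℂ} {Up Um : ℝ → Fin 3 → ℂ}
    {ρ κ M C₁ C₂ C₃ C₄ : ℝ} (hρ : 0 < ρ) (hκ : 0 < κ) (hB : ∀ x, ‖B x‖ ≤ M)
    (hH : ∀ z ∈ Metric.ball (0 : ℂ) ρ, ∀ x, HasDerivAt (H z) (-Matrix.vecMul (H z x) (A x + z • B x)) x)
    (hW : ∀ z ∈ Metric.ball (0 : ℂ) ρ, ∀ x, HasDerivAt (W z) ((A x + z • B x).mulVec (W z x)) x)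
    (hUp : ∀ x, 0 < x → HasDerivAt Up ((A x).mulVec (Up x) + (B x).mulVec (W 0 x)) x)
    (hUpc : ContinuousOn Up (Ici 0)) (hUpt : Tendsto Up atTop (𝓝 0))
    (hUm : ∀ x < 0, HasDerivAt Um ((A x).mulVec (Um x) + (B x).mulVec (W 0 x)) x)
    (hUmc : ContinuousOn Um (Iic 0)) (hUmt : Tendsto Um atBot (𝓝 0))
    (hWb : ∀ z ∈ Metric.ball (0 : ℂ) ρ, ∀ x, 0 ≤ x → ‖W z x - W 0 x‖ ≤ C₁ * Real.exp (-κ * x) * ‖z‖)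
    (hHb : ∀ x, 0 ≤ x → ‖H 0 x‖ ≤ C₂)
    (hHm : ∀ z ∈ Metric.ball (0 : ℂ) ρ, ∀ x ≤ 0, ‖H z x‖ ≤ C₃ * Real.exp (κ * x))
    (hH0 : ∀ z ∈ Metric.ball (0 : ℂ) ρ, ‖H z 0 - H 0 0‖ ≤ C₄ * ‖z‖)
    (hC₁ : 0 ≤ C₁) (hC₃ : 0 ≤ C₃) (hC₄ : 0 ≤ C₄) (hW0 : Tendsto (W 0) atBot (𝓝 0)) :
    ∃ C, ∀ z ∈ Metric.ball (0 : ℂ) ρ,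
      ‖H z 0 ⬝ᵥ W z 0 - z * (H 0 0 ⬝ᵥ (Up 0 - Um 0))‖ ≤ C * ‖z‖ ^ 2 := by
  obtain ⟨Bm, hBm0, hBm⟩ := exists_bound_of_tendsto_atBot hUmc hUmt
  have hM : 0 ≤ M := (norm_nonneg _).trans (hB 0)
  have hC₂ : 0 ≤ C₂ := (norm_nonneg _).trans (hHb 0 le_rfl)
  have h0ρ : (0 : ℂ) ∈ Metric.ball (0 : ℂ) ρ := Metric.mem_ball_self hρ
  have hBv : ∀ x (v : Fin 3 → ℂ), ‖(B x).mulVec v‖ ≤ M * ‖v‖ := fun x v =>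
    (Matrix.linfty_opNorm_mulVec _ _).trans (mul_le_mul_of_nonneg_right (hB x) (norm_nonneg _))
  have hHc : ∀ z ∈ Metric.ball (0 : ℂ) ρ, Continuous (H z) := fun z hz =>
    continuous_iff_continuousAt.2 fun x => (hH z hz x).continuousAt
  have hWc : ∀ z ∈ Metric.ball (0 : ℂ) ρ, Continuous (W z) := fun z hz =>
    continuous_iff_continuousAt.2 fun x => (hW z hz x).continuousAt
  have hA0 : ∀ x, A x + (0 : ℂ) • B x = A x := fun x => by rw [zero_smul, add_zero]
  have hplus : ∀ z ∈ Metric.ball (0 : ℂ) ρ,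
      ‖H 0 0 ⬝ᵥ (W z 0 - W 0 0 - z • Up 0)‖ ≤ 3 * C₂ * M * C₁ * ‖z‖ ^ 2 / κ := fun z hz => by
    refine norm_le_of_deriv_exp_bound (φ := fun x => H 0 x ⬝ᵥ (W z x - W 0 x - z • Up x))
      (φ' := fun x => z * (H 0 x ⬝ᵥ (B x).mulVec (W z x - W 0 x))) (by positivity) hκ ?_ ?_ ?_ ?_
    · exact continuousOn_dotProduct (hHc 0 h0ρ).continuousOn ((((hWc z hz).continuousOn).sub
        (hWc 0 h0ρ).continuousOn).sub (hUpc.const_smul z))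
    · intro x hx
      refine (hasDerivAt_dotProduct (hH 0 h0ρ x) (((hW z hz x).sub (hW 0 h0ρ x)).sub
        ((hUp x hx).const_smul z))).congr_deriv ?_
      rw [hA0, neg_dotProduct, ← Matrix.dotProduct_mulVec]
      simp only [Pi.sub_apply, Pi.smul_apply, Matrix.add_mulVec, Matrix.smul_mulVec, Matrix.mulVec_sub, Matrix.mulVec_smul,
        dotProduct_sub, dotProduct_add, dotProduct_smul, smul_eq_mul]
      ring
    · intro x hx
      rw [norm_mul]
      have h1 := norm_dotProduct_le (H 0 x) ((B x).mulVec (W z x - W 0 x))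
      have h2 := hBv x (W z x - W 0 x)
      have h3 := hWb z hz x hx.le
      have h4 := hHb x hx.le
      calc ‖z‖ * ‖H 0 x ⬝ᵥ (B x).mulVec (W z x - W 0 x)‖
          ≤ ‖z‖ * (3 * C₂ * (M * (C₁ * Real.exp (-κ * x) * ‖z‖))) := by
            refine mul_le_mul_of_nonneg_left (h1.trans ?_) (norm_nonneg _)
            refine mul_le_mul (by gcongr) (h2.trans (by gcongr)) (norm_nonneg _) (by positivity)
        _ = _ := by ring
    · refine tendsto_dotProduct_zero (B := C₂) ?_ ?_
      · filter_upwards [eventually_ge_atTop 0] with x hx using hHb x hx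
      · have h1 : Tendsto (fun x => W z x - W 0 x) atTop (𝓝 0) := by
          refine squeeze_zero_norm' (a := fun x => C₁ * Real.exp (-κ * x) * ‖z‖) ?_ ?_
          · filter_upwards [eventually_ge_atTop 0] with x hx using hWb z hz x hx
          · have h2 : Tendsto (fun x => Real.exp (-κ * x)) atTop (𝓝 0) :=
              Real.tendsto_exp_atBot.comp (tendsto_id.const_mul_atTop_of_neg (neg_lt_zero.2 hκ))
            simpa only [mul_zero, zero_mul] using (h2.const_mul C₁).mul_const ‖z‖
        simpa only [smul_zero, sub_zero] using h1.sub (hUpt.const_smul z)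
  have hminus : ∀ z ∈ Metric.ball (0 : ℂ) ρ,
      ‖H z 0 ⬝ᵥ (W 0 0 + z • Um 0)‖ ≤ 3 * C₃ * M * Bm * ‖z‖ ^ 2 / κ := fun z hz => by
    refine norm_le_of_deriv_exp_bound_left (φ := fun x => H z x ⬝ᵥ (W 0 x + z • Um x))
      (φ' := fun x => -(z ^ 2 * (H z x ⬝ᵥ (B x).mulVec (Um x)))) (by positivity) hκ ?_ ?_ ?_ ?_
    · exact continuousOn_dotProduct (hHc z hz).continuousOn (((hWc 0 h0ρ).continuousOn).add (hUmc.const_smul z))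
    · intro x hx
      refine (hasDerivAt_dotProduct (hH z hz x) ((hW 0 h0ρ x).add ((hUm x hx).const_smul z))).congr_deriv ?_
      rw [hA0, neg_dotProduct, ← Matrix.dotProduct_mulVec]
      simp only [Pi.add_apply, Pi.smul_apply, Matrix.add_mulVec, Matrix.smul_mulVec, Matrix.mulVec_add, Matrix.mulVec_smul,
        dotProduct_add, dotProduct_smul, smul_eq_mul]
      ring
    · intro x hx
      rw [norm_neg, norm_mul, norm_pow]
      have h1 := norm_dotProduct_le (H z x) ((B x).mulVec (Um x))
      have h2 := hBv x (Um x)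
      have h3 := hBm x hx.le
      have h4 := hHm z hz x hx.le
      calc ‖z‖ ^ 2 * ‖H z x ⬝ᵥ (B x).mulVec (Um x)‖
          ≤ ‖z‖ ^ 2 * (3 * (C₃ * Real.exp (κ * x)) * (M * Bm)) := by
            refine mul_le_mul_of_nonneg_left (h1.trans ?_) (by positivity)
            refine mul_le_mul (by gcongr) (h2.trans (by gcongr)) (norm_nonneg _) (by positivity)
        _ = _ := by ring
    · refine tendsto_dotProduct_zero (B := C₃) ?_ ?_
      · filter_upwards [eventually_le_atBot 0] with x hx
        refine (hHm z hz x hx).trans (mul_le_of_le_one_right hC₃ (Real.exp_le_one_iff.2 ?_))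
        nlinarith
      · simpa only [smul_zero, add_zero] using hW0.add (hUmt.const_smul z)
  refine ⟨3 * C₄ * C₁ + 3 * C₂ * M * C₁ / κ + 3 * C₃ * M * Bm / κ + 3 * C₄ * Bm, fun z hz => ?_⟩
  have e : H z 0 ⬝ᵥ W z 0 - z * (H 0 0 ⬝ᵥ (Up 0 - Um 0))
      = (H z 0 - H 0 0) ⬝ᵥ (W z 0 - W 0 0) + H 0 0 ⬝ᵥ (W z 0 - W 0 0 - z • Up 0)
        + H z 0 ⬝ᵥ (W 0 0 + z • Um 0) + -(z * ((H z 0 - H 0 0) ⬝ᵥ Um 0)) := by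
    simp only [dotProduct_add, dotProduct_sub, sub_dotProduct, dotProduct_smul, smul_eq_mul]
    ring
  have n1 := norm_dotProduct_le (H z 0 - H 0 0) (W z 0 - W 0 0)
  have n2 := norm_dotProduct_le (H z 0 - H 0 0) (Um 0)
  have n3 := hWb z hz 0 le_rfl
  rw [mul_zero, Real.exp_zero, mul_one] at n3
  have n4 := hH0 z hz
  have n5 := hBm 0 le_rfl
  have n1' : ‖(H z 0 - H 0 0) ⬝ᵥ (W z 0 - W 0 0)‖ ≤ 3 * C₄ * C₁ * ‖z‖ ^ 2 := by
    calc _ ≤ _ := n1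
      _ ≤ 3 * (C₄ * ‖z‖) * (C₁ * ‖z‖) := by gcongr
      _ = _ := by ring
  have n2' : ‖-(z * ((H z 0 - H 0 0) ⬝ᵥ Um 0))‖ ≤ 3 * C₄ * Bm * ‖z‖ ^ 2 := by
    rw [norm_neg, norm_mul]
    calc _ ≤ ‖z‖ * (3 * (C₄ * ‖z‖) * Bm) := by gcongr; exact n2.trans (by gcongr)
      _ = _ := by ring
  rw [e]
  refine (norm_add_le _ _).trans ?_
  have m1 := norm_add₃_le (a := (H z 0 - H 0 0) ⬝ᵥ (W z 0 - W 0 0))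
    (b := H 0 0 ⬝ᵥ (W z 0 - W 0 0 - z • Up 0)) (c := H z 0 ⬝ᵥ (W 0 0 + z • Um 0))
  have m2 := hplus z hz
  have m3 := hminus z hz
  have e2 : (3 * C₄ * C₁ + 3 * C₂ * M * C₁ / κ + 3 * C₃ * M * Bm / κ + 3 * C₄ * Bm) * ‖z‖ ^ 2
      = 3 * C₄ * C₁ * ‖z‖ ^ 2 + 3 * C₂ * M * C₁ * ‖z‖ ^ 2 / κ + 3 * C₃ * M * Bm * ‖z‖ ^ 2 / κ
        + 3 * C₄ * Bm * ‖z‖ ^ 2 := by ring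
  rw [e2]
  linarith

theorem hasDerivAt_of_quadratic_bound {f : ℂ → ℂ} {S : ℂ} {ρ C : ℝ} (hρ : 0 < ρ)
    (h : ∀ z ∈ Metric.ball (0 : ℂ) ρ, ‖f z - z * S‖ ≤ C * ‖z‖ ^ 2) : f 0 = 0 ∧ HasDerivAt f S 0 := by
  have h0 : f 0 = 0 := by simpa using h 0 (Metric.mem_ball_self hρ)
  refine ⟨h0, ?_⟩
  rw [hasDerivAt_iff_isLittleO_nhds_zero]
  have h1 : (fun z : ℂ => f (0 + z) - f 0 - z • S) =O[𝓝 0] fun z => ‖z‖ ^ 2 := by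
    refine Asymptotics.IsBigO.of_bound C ?_
    filter_upwards [Metric.ball_mem_nhds 0 hρ] with z hz
    simpa [h0] using h z hz
  exact h1.trans_isLittleO (Asymptotics.isLittleO_norm_pow_id one_lt_two)

end QuadraticBound

section DerivAtZero
open scoped Matrix.Norms.Operator

variable {P : Params} {c q τ₀ : ℝ} {Z : ℝ → ℝ × ℝ}

theorem norm_sub_le_of_bound {f : ℂ → Fin 3 → ℂ} {ρ M : ℝ} (hρ : 0 < ρ)
    (hf : DifferentiableOn ℂ f (Metric.ball 0 ρ)) (hb : ∀ z ∈ Metric.ball (0 : ℂ) ρ, ‖f z‖ ≤ M) {z : ℂ}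
    (hz : z ∈ Metric.ball (0 : ℂ) ρ) : ‖f z - f 0‖ ≤ 2 * M / ρ * ‖z‖ := by
  have := Complex.dist_le_div_mul_dist_of_mapsTo_ball (R₂ := 2 * M) hf (fun w hw => by
    rw [mem_closedBall_iff_norm]
    have := norm_sub_le (f w) (f 0)
    linarith [hb w hw, hb 0 (Metric.mem_ball_self hρ)]) hz
  rwa [dist_eq_norm, dist_eq_norm, sub_zero] at this

theorem differentiableOn_mulVec {U : Set ℂ} {M : ℂ → Mat3} (hM : DifferentiableOn ℂ M U) (v : Fin 3 → ℂ) :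
    DifferentiableOn ℂ (fun z => (M z).mulVec v) U := by
  refine differentiableOn_pi.2 fun i => ?_
  simp only [Matrix.mulVec, dotProduct]
  exact DifferentiableOn.fun_sum fun j _ =>
    (differentiableOn_pi.1 (differentiableOn_pi.1 hM i) j).mul_const _

theorem differentiableOn_vecMul {U : Set ℂ} {M : ℂ → Mat3} (hM : DifferentiableOn ℂ M U) (v : Fin 3 → ℂ) :
    DifferentiableOn ℂ (fun z => Matrix.vecMul v (M z)) U := by
  refine differentiableOn_pi.2 fun i => ?_
  simp only [Matrix.vecMul, dotProduct]
  exact DifferentiableOn.fun_sum fun j _ =>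
    (differentiableOn_pi.1 (differentiableOn_pi.1 hM j) i).const_mul _

theorem norm_vecMul_le (ℓ : Fin 3 → ℂ) (M : Mat3) : ‖Matrix.vecMul ℓ M‖ ≤ 3 * ‖ℓ‖ * ‖M‖ := by
  refine norm_vec_le _ fun j => (norm_dotProduct_le _ _).trans ?_
  gcongr
  exact norm_vec_le _ fun i => norm_entry_le M i j

/-- Compressing to a rank-one projection multiplies by the trace. -/
theorem dotProduct_mulVec_of_rank_one {p M : Mat3} (hp : p * p = p) (ht : p.trace = 1) (hl : p * M = M)
    (hr : M * p = M) (ℓ v : Fin 3 → ℂ) : ℓ ⬝ᵥ M.mulVec v = M.trace * (ℓ ⬝ᵥ p.mulVec v) := by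
  obtain ⟨a, b, hP, hab⟩ := exists_eq_vecMulVec hp ht
  have h1 : M = (b ⬝ᵥ M.mulVec a) • p := by
    conv_lhs => rw [← hl, ← hr, hP, Matrix.mul_vecMulVec, Matrix.vecMulVec_mul_vecMulVec]
    rw [hP]
    ext i j
    simp only [Matrix.vecMulVec_apply, Matrix.smul_apply, Pi.smul_apply, smul_eq_mul]
    ring
  have h2 : M.trace = b ⬝ᵥ M.mulVec a := by
    conv_lhs => rw [h1]
    rw [Matrix.trace_smul, ht, smul_eq_mul, mul_one]
  rw [h2]
  conv_lhs => rw [h1]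
  rw [Matrix.smul_mulVec, dotProduct_smul, smul_eq_mul]

/-- The derivative of the Evans function at the origin is a negative multiple of the derivative of the
Melnikov separation. -/
theorem exists_hasDerivAt_evans_zero (h : IsHomoclinic P c q τ₀ Z) (hs : IsSaddle P c q τ₀) (hc : 0 < c)
    {Yp Ym : ℝ → ℝ → ℝ × ℝ} (hYp : IsManifoldFamily P c q τ₀ Z (Ici 0) atTop Yp)
    (hYm : IsManifoldFamily P c q τ₀ Z (Iic 0) atBot Ym) :
    DifferentiableAt ℝ (melnikov P c q Z Yp Ym) c ∧ evans P c q τ₀ Z 0 = 0 ∧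
    ∃ κ : ℝ, 0 < κ ∧
      HasDerivAt (evans P c q τ₀ Z) ((-(κ * deriv (melnikov P c q Z Yp Ym) c) : ℝ) : ℂ) 0 := by
  obtain ⟨a, hac, had, hat, ha⟩ := hYp.exists_variation h hc.ne' (Ici_mem_atTop 0) h.tendsto_atTop
  obtain ⟨b, hbc, hbd, hbt, hb⟩ := hYm.exists_variation h hc.ne' (Iic_mem_atBot 0) h.tendsto_atBot
  rw [interior_Ici] at had
  rw [interior_Iic] at hbd
  have hmel := hasDerivAt_melnikov (P := P) (q := q) (Z := Z) (ha 0 (mem_Ici.2 le_rfl))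
    (hb 0 (mem_Iic.2 le_rfl))
  refine ⟨hmel.differentiableAt, ?_⟩
  rw [hmel.deriv]
  have h0g : (0 : ℂ) ∈ gapSet P c q τ₀ := by
    simpa using ofReal_mem_gapSet hs hc (le_refl (0 : ℝ))
  obtain ⟨U, μ, X, Y, g, D, BX, h0U, hL⟩ := exists_localFamily h hs hc.ne' h0g
  obtain ⟨K, hK, hev⟩ := exists_evans_eq_trace h hs hc.ne'
  have hμ0 := hL.family.gap 0 h0U
  have hF0 := hL.fast 0 h0U
  obtain ⟨m, T, hm, hm0, -, -⟩ := exists_trace_gt hs hc hμ0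
  obtain ⟨V, hpV, hV0, hXV⟩ := exists_mulVec_eq_zeroMode h hs hc hμ0 hF0
  obtain ⟨ℓ, β, Bη, hℓV, hβ, hwr, hBη⟩ :=
    exists_critical_row h hs hc hμ0 hF0 hpV hV0 hXV (hL.boundX 0 h0U)
  have hCℓ := norm_vecMul_le ℓ
  set Cℓ := 3 * ‖ℓ‖
  have hCℓ0 : 0 ≤ Cℓ := by positivity
  have hBX0 : 0 ≤ BX := (norm_nonneg _).trans (hL.boundX 0 h0U 0 le_rfl)
  -- the neighbourhood of the origin
  obtain ⟨κ, hκ, ρ, hρ, hρU, hρμ⟩ : ∃ κ : ℝ, 0 < κ ∧ ∃ ρ : ℝ, 0 < ρ ∧ Metric.ball (0 : ℂ) ρ ⊆ U ∧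
      ∀ z ∈ Metric.ball (0 : ℂ) ρ, (μ z 2).re ≤ -κ := by
    have hcont : ContinuousAt (fun z => (μ z 2).re) 0 := Complex.continuous_re.continuousAt.comp
      ((hL.family.diff.continuousOn).continuousAt (hL.isOpen.mem_nhds h0U))
    have h1 : ∀ᶠ z in 𝓝 (0 : ℂ), (μ z 2).re < m / 2 := hcont.eventually (gt_mem_nhds (by
      show (μ 0 2).re < m / 2
      rw [hm, Complex.ofReal_re]; linarith))
    obtain ⟨ρ, hρ, h2⟩ := Metric.mem_nhds_iff.1 (h1.and (hL.isOpen.mem_nhds h0U))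
    exact ⟨-m / 2, by linarith, ρ, hρ, fun z hz => (h2 hz).2, fun z hz => by
      have := (h2 hz).1; linarith⟩
  set B : ℝ → Mat3 := fun x => profileMatrix P c q Z x 1 - profileMatrix P c q Z x 0 with hBdef
  set W : ℂ → ℝ → Fin 3 → ℂ := fun z x => Complex.exp (μ z 2 * x) • (X z x).mulVec V with hWdef
  set H : ℂ → ℝ → Fin 3 → ℂ := fun z x => Complex.exp (-μ z 2 * x) • Matrix.vecMul ℓ (Y z x) with hHdef
  set Up : ℝ → Fin 3 → ℂ := fun x => -liftVec c τ₀ (Z x) 1 (a x) with hUp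
  set Um : ℝ → Fin 3 → ℂ := fun x => -liftVec c τ₀ (Z x) 1 (b x) with hUm
  have hW00 : W 0 = zeroMode P c q τ₀ Z := funext hXV
  have hH0 : ∀ z, H z 0 = Matrix.vecMul ℓ (Y z 0) := fun z => by simp [hHdef]
  have hlift : ∀ {ζ : ℝ → ℝ × ℝ} {x : ℝ}, HasDerivAt ζ ((ζ x).2, linField P c q τ₀ (Z x) 1 (ζ x)) x →
      HasDerivAt (fun x => -liftVec c τ₀ (Z x) 1 (ζ x)) ((profileMatrix P c q Z x 0).mulVec
        (-liftVec c τ₀ (Z x) 1 (ζ x)) + (B x).mulVec (W 0 x)) x := fun {ζ x} hζ => by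
    refine (hasDerivAt_liftVec h hc.ne' hζ).fun_neg.congr_deriv ?_
    rw [hW00, Complex.ofReal_one, one_smul, Matrix.mulVec_neg]
    simp only [hBdef, zeroMode]
    abel
  have hliftc : ∀ {ζ : ℝ → ℝ × ℝ} {s : Set ℝ}, ContinuousOn ζ s →
      ContinuousOn (fun x => -liftVec c τ₀ (Z x) 1 (ζ x)) s := fun {ζ s} hζ => by
    have hz1 : ContinuousOn (fun x => (Z x).1) s := (continuous_fst.comp h.continuous).continuousOn
    have hz2 : ContinuousOn (fun x => (Z x).2) s := (continuous_snd.comp h.continuous).continuousOn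
    have hζ1 : ContinuousOn (fun x => (ζ x).1) s := continuous_fst.comp_continuousOn hζ
    have hζ2 : ContinuousOn (fun x => (ζ x).2) s := continuous_snd.comp_continuousOn hζ
    refine ContinuousOn.neg (continuousOn_pi.2 fun i => ?_)
    fin_cases i
    · exact Complex.continuous_ofReal.comp_continuousOn hζ1
    · exact Complex.continuous_ofReal.comp_continuousOn
        ((hζ1.const_mul (-c)).sub ((hz1.sub continuousOn_const).const_mul 1))
    · exact Complex.continuous_ofReal.comp_continuousOn
        ((((hζ2.const_mul c).add (hz2.const_mul 1)).neg).div (hz1.pow 2)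
          fun x _ => pow_ne_zero 2 (h.tau_pos x).ne')
  have hliftt : ∀ {ζ : ℝ → ℝ × ℝ} {l : Filter ℝ}, Tendsto Z l (𝓝 (τ₀, 0)) → Tendsto ζ l (𝓝 0) →
      Tendsto (fun x => -liftVec c τ₀ (Z x) 1 (ζ x)) l (𝓝 0) := fun hZ hζ => by
    simpa only [neg_zero] using (tendsto_liftVec hs hZ hζ 1).neg
  obtain ⟨CA, θ, hθ, hCA, hA⟩ := exists_asymConst h hs hc.ne'
  obtain ⟨M, hM⟩ : ∃ M, ∀ x, ‖B x‖ ≤ M := ⟨_, fun x => (norm_sub_le _ _).trans (add_le_add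
    ((hA 1).norm_le (by positivity) hθ x) ((hA 0).norm_le (by positivity) hθ x))⟩
  have hAz : ∀ z x, profileMatrix P c q Z x z = profileMatrix P c q Z x 0 + z • B x :=
    fun z x => profileMatrix_eq_add_smul x z
  have hWd : ∀ x, DifferentiableOn ℂ (fun z => W z x) (Metric.ball 0 ρ) := fun x =>
    (((hL.family.diff.mono hρU).mul_const (x : ℂ)).cexp).smul
      (differentiableOn_mulVec ((hL.diffX x).mono hρU) V)
  have hHd : DifferentiableOn ℂ (fun z => H z 0) (Metric.ball 0 ρ) := by
    simp only [hH0]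
    exact differentiableOn_vecMul ((hL.diffY 0).mono hρU) ℓ
  have hWb : ∀ z ∈ Metric.ball (0 : ℂ) ρ, ∀ x, 0 ≤ x → ‖W z x‖ ≤ Real.exp (-κ * x) * (BX * ‖V‖) :=
    fun z hz x hx => by
      rw [hWdef, norm_smul, Complex.norm_exp, Complex.re_mul_ofReal]
      refine mul_le_mul (Real.exp_le_exp.2 (mul_le_mul_of_nonneg_right (hρμ z hz) hx)) ?_
        (norm_nonneg _) (Real.exp_pos _).le
      exact (Matrix.linfty_opNorm_mulVec _ _).trans
        (mul_le_mul_of_nonneg_right (hL.boundX z (hρU hz) x hx) (norm_nonneg _))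
  have hHb : ∀ z ∈ Metric.ball (0 : ℂ) ρ, ∀ x ≤ 0, ‖H z x‖ ≤ Cℓ * BX * Real.exp (κ * x) :=
    fun z hz x hx => by
      rw [hHdef, norm_smul, Complex.norm_exp, Complex.re_mul_ofReal, Complex.neg_re, mul_comm]
      refine mul_le_mul ?_ (Real.exp_le_exp.2 ?_) (Real.exp_pos _).le (by positivity)
      · exact (hCℓ _).trans (mul_le_mul_of_nonneg_left (hL.boundY z (hρU hz) x hx) hCℓ0)
      · have := hρμ z hz
        nlinarith
  obtain ⟨C, hC⟩ := exists_pairing_expansion (A := fun x => profileMatrix P c q Z x 0) (B := B) (H := H)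
    (W := W) (Up := Up) (Um := Um) (C₁ := 2 * (BX * ‖V‖) / ρ) (C₂ := Bη) (C₃ := Cℓ * BX)
    (C₄ := 2 * (Cℓ * BX) / ρ) hρ hκ hM
    (fun z hz x => by rw [← hAz]; exact (hL.fast z (hρU hz)).hasDerivAt_row ℓ x)
    (fun z hz x => by rw [← hAz]; exact (hL.fast z (hρU hz)).hasDerivAt_col V x)
    (fun x hx => hlift (had x hx)) (hliftc hac) (hliftt h.tendsto_atTop hat)
    (fun x hx => hlift (hbd x hx)) (hliftc hbc) (hliftt h.tendsto_atBot hbt)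
    (fun z hz x hx => by
      refine (norm_sub_le_of_bound hρ (hWd x) (fun w hw => hWb w hw x hx) hz).trans_eq ?_
      ring)
    hBη hHb
    (fun z hz => norm_sub_le_of_bound hρ hHd (fun w hw => by
      simpa using hHb w hw 0 le_rfl) hz)
    (by positivity) (by positivity) (by positivity)
    (by rw [hW00]; exact tendsto_zeroMode hs h.tendsto_atBot)
  obtain ⟨hf0, hfd⟩ := hasDerivAt_of_quadratic_bound (f := fun z => H z 0 ⬝ᵥ W z 0) hρ hC
  -- the pairing is the Evans function up to a nonvanishing factor
  set e : ℂ → ℂ := fun z => ℓ ⬝ᵥ (gapProj (limitMatrix P c q τ₀ z) (μ z)).mulVec V with he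
  have he0 : e 0 = 1 := by rw [he]; simp only [hpV, hℓV]
  have hed : DifferentiableAt ℂ e 0 := by
    have h1 := differentiableOn_mulVec hL.family.diffProj V
    have h2 := differentiableOn_pi.1 h1
    have h3 : DifferentiableOn ℂ e U := by
      simp only [he, dotProduct]
      exact DifferentiableOn.fun_sum fun i _ => (h2 i).const_mul _
    exact h3.differentiableAt (hL.isOpen.mem_nhds h0U)
  have hpair : ∀ z ∈ U, H z 0 ⬝ᵥ W z 0 = (Y z 0 * X z 0).trace * e z := fun z hz => by
    have hg := hL.family.gap z hz
    have hW0 : W z 0 = (X z 0).mulVec V := by simp [hWdef]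
    rw [hH0, hW0, ← Matrix.dotProduct_mulVec, Matrix.mulVec_mulVec]
    refine dotProduct_mulVec_of_rank_one hg.gapProj_mul_self hg.trace_gapProj ?_ ?_ ℓ V
    · rw [← mul_assoc, (hL.fast z hz).mul_left_eq hg.gapProj_mul_self]
    · rw [mul_assoc, (hL.fast z hz).mul_right_eq hg.gapProj_mul_self]
  have hquot : evans P c q τ₀ Z =ᶠ[𝓝 0] fun z => K * ((H z 0 ⬝ᵥ W z 0) / e z) := by
    have hne : ∀ᶠ z in 𝓝 (0 : ℂ), e z ≠ 0 :=
      hed.continuousAt.eventually_ne (by rw [he0]; exact one_ne_zero)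
    filter_upwards [hne, hL.isOpen.mem_nhds h0U] with z hz hzU
    rw [(hev z _ _ _ (hL.family.gap z hzU) (hL.fast z hzU)).2, hpair z hzU, mul_div_cancel_right₀ _ hz]
  have hz0 : (Z 0).1 ≠ 0 := (h.tau_pos 0).ne'
  refine ⟨?_, K * (β * c / (Z 0).1 ^ 2), by have := h.tau_pos 0; positivity, ?_⟩
  · rw [hquot.self_of_nhds]
    simp [hf0]
  · have hd := ((hfd.div hed.hasDerivAt (by rw [he0]; exact one_ne_zero)).const_mul (K : ℂ)).congr_of_eventuallyEq hquot
    refine hd.congr_deriv ?_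
    have hdiff : Up 0 - Um 0 = -![(((a 0 - b 0).1 : ℝ) : ℂ), ((-c * (a 0 - b 0).1 : ℝ) : ℂ),
        ((-(c * (a 0 - b 0).2) / (Z 0).1 ^ 2 : ℝ) : ℂ)] := by
      ext i
      fin_cases i
      · simp [hUp, hUm, liftVec]; ring
      · simp [hUp, hUm, liftVec]; ring
      · simp [hUp, hUm, liftVec]; ring
    rw [hf0, he0, hdiff, hH0, dotProduct_neg, hwr _ (by simp), zeroMode_zero, zeroMode_two]
    have hz0C : (((Z 0).1 : ℝ) : ℂ) ≠ 0 := Complex.ofReal_ne_zero.2 hz0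
    have hF1 : (profileField P c q (Z 0)).1 = (Z 0).2 := rfl
    rw [hF1]
    simp only [Matrix.cons_val_zero, Matrix.cons_val]
    push_cast
    field_simp
    ring

end DerivAtZero

section Parity

/-- `f` is `(s - t) ^ n` times a continuous nonvanishing factor near `t`. -/
def HasVanishingOrder (f : ℝ → ℝ) (n : ℕ) (t : ℝ) : Prop :=
  ∃ k : ℝ → ℝ, ContinuousAt k t ∧ k t ≠ 0 ∧ ∀ᶠ s in 𝓝 t, f s = (s - t) ^ n * k s

theorem mul_pos_of_hasVanishingOrder {a b : ℝ} (T : Finset ℝ) : ∀ {f : ℝ → ℝ} {n : ℝ → ℕ},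
    (∀ t ∈ Icc a b, HasVanishingOrder f (n t) t) → (∀ t ∈ T, t ∈ Ioo a b) → (∀ t ∉ T, n t = 0) →
    a ≤ b → 0 < f a * f b * (-1) ^ ∑ t ∈ T, n t := by
  induction T using Finset.induction_on with
  | empty =>
    intro f n hf _ hn hab
    have hk : ∀ t ∈ Icc a b, ContinuousAt f t ∧ f t ≠ 0 := fun t ht => by
      obtain ⟨k, h1, h2, h3⟩ := hf t ht
      simp only [hn t (Finset.notMem_empty t), pow_zero, one_mul] at h3
      exact ⟨h1.congr (h3.mono fun _ h => h.symm), by rw [h3.self_of_nhds]; exact h2⟩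
    rw [Finset.sum_empty, pow_zero, mul_one]
    by_contra hneg
    have hneg' := not_lt.1 hneg
    have hc : ContinuousOn f (uIcc a b) := by
      rw [uIcc_of_le hab]; exact fun t ht => (hk t ht).1.continuousWithinAt
    have h0 : (0 : ℝ) ∈ uIcc (f a) (f b) := by
      rw [mem_uIcc]
      rcases le_total 0 (f a) with h | h <;> rcases le_total 0 (f b) with h' | h'
      · rcases mul_eq_zero.1 (le_antisymm hneg' (mul_nonneg h h')) with e | e
        · exact absurd e (hk a (left_mem_Icc.2 hab)).2
        · exact absurd e (hk b (right_mem_Icc.2 hab)).2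
      · exact Or.inr ⟨h', h⟩
      · exact Or.inl ⟨h, h'⟩
      · rcases mul_eq_zero.1 (le_antisymm hneg' (mul_nonneg_of_nonpos_of_nonpos h h')) with e | e
        · exact absurd e (hk a (left_mem_Icc.2 hab)).2
        · exact absurd e (hk b (right_mem_Icc.2 hab)).2
    obtain ⟨t, ht, ht0⟩ := intermediate_value_uIcc hc h0
    rw [uIcc_of_le hab] at ht
    exact (hk t ht).2 ht0
  | insert t₀ T ht₀ ih =>
    intro f n hf hT hn hab
    have hm := hT t₀ (Finset.mem_insert_self _ _)
    obtain ⟨k, hk1, hk2, hk3⟩ := hf t₀ (Ioo_subset_Icc_self hm)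
    set f₁ : ℝ → ℝ := fun s => if s = t₀ then k t₀ else f s / (s - t₀) ^ n t₀ with hf₁
    have hne : ∀ s, s ≠ t₀ → f₁ s = f s / (s - t₀) ^ n t₀ := fun s hs => by simp only [hf₁, if_neg hs]
    have hpne : ∀ s, s ≠ t₀ → (s - t₀) ^ n t₀ ≠ 0 := fun s hs => pow_ne_zero _ (sub_ne_zero.2 hs)
    have h1 := ih (f := f₁) (n := fun t => if t = t₀ then 0 else n t) (fun t ht => by
      by_cases htt : t = t₀
      · subst htt
        rw [if_pos rfl]
        refine ⟨k, hk1, hk2, ?_⟩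
        filter_upwards [hk3] with s hs
        by_cases hst : s = t
        · simp [hf₁, hst]
        · rw [hne s hst, hs, pow_zero, one_mul, mul_div_cancel_left₀ _ (hpne s hst)]
      · rw [if_neg htt]
        obtain ⟨k', h1, h2, h3⟩ := hf t ht
        have hcp : ContinuousAt (fun s : ℝ => (s - t₀) ^ n t₀) t := by fun_prop
        refine ⟨fun s => k' s / (s - t₀) ^ n t₀, h1.div hcp (hpne t htt),
          div_ne_zero h2 (hpne t htt), ?_⟩
        filter_upwards [h3, isOpen_ne.mem_nhds htt] with s hs hst
        rw [hne s hst, hs, mul_div_assoc])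
      (fun t ht => hT t (Finset.mem_insert_of_mem ht)) (fun t ht => by
        by_cases htt : t = t₀
        · simp only [if_pos htt]
        · simp only [if_neg htt]
          exact hn t (by simp [htt, ht])) hab
    have hsum : ∑ t ∈ T, (if t = t₀ then 0 else n t) = ∑ t ∈ T, n t :=
      Finset.sum_congr rfl fun t ht => if_neg fun e : t = t₀ => ht₀ (e ▸ ht)
    rw [hsum, hne a hm.1.ne, hne b hm.2.ne'] at h1
    have ea : f a = (a - t₀) ^ n t₀ * (f a / (a - t₀) ^ n t₀) :=
      (mul_div_cancel₀ _ (hpne a hm.1.ne)).symm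
    have eb : f b = (b - t₀) ^ n t₀ * (f b / (b - t₀) ^ n t₀) :=
      (mul_div_cancel₀ _ (hpne b hm.2.ne')).symm
    have e1 : (a - t₀) ^ n t₀ * (-1) ^ n t₀ = (t₀ - a) ^ n t₀ := by
      rw [← mul_pow]; ring_nf
    have hp : 0 < (t₀ - a) ^ n t₀ * (b - t₀) ^ n t₀ :=
      mul_pos (pow_pos (sub_pos.2 hm.1) _) (pow_pos (sub_pos.2 hm.2) _)
    rw [Finset.sum_insert ht₀, pow_add]
    calc 0 < ((t₀ - a) ^ n t₀ * (b - t₀) ^ n t₀)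
          * (f a / (a - t₀) ^ n t₀ * (f b / (b - t₀) ^ n t₀) * (-1) ^ ∑ t ∈ T, n t) := mul_pos hp h1
      _ = f a * f b * ((-1) ^ n t₀ * (-1) ^ ∑ t ∈ T, n t) := by
        conv_rhs => rw [ea, eb]
        rw [← e1]
        ring

theorem AnalyticAt.conj_conj {f : ℂ → ℂ} {z : ℂ} (hf : AnalyticAt ℂ f z) :
    AnalyticAt ℂ (fun w => starRingEnd ℂ (f (starRingEnd ℂ w))) (starRingEnd ℂ z) := by
  rw [Complex.analyticAt_iff_eventually_differentiableAt] at hf ⊢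
  have : Tendsto (starRingEnd ℂ) (𝓝 (starRingEnd ℂ z)) (𝓝 z) := by
    simpa using (Complex.continuous_conj.tendsto (starRingEnd ℂ z))
  filter_upwards [this.eventually hf] with w hw
  simpa [Function.comp_def] using hw.conj_conj

theorem analyticOrderNatAt_conj {f : ℂ → ℂ} {z : ℂ} (hf : AnalyticAt ℂ f z)
    (hf' : AnalyticAt ℂ f (starRingEnd ℂ z)) (htop : analyticOrderAt f z ≠ ⊤)
    (hsym : ∀ᶠ w in 𝓝 z, f (starRingEnd ℂ w) = starRingEnd ℂ (f w)) :
    analyticOrderNatAt f (starRingEnd ℂ z) = analyticOrderNatAt f z := by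
  obtain ⟨g, hg, hg0, hfg⟩ := hf.analyticOrderAt_ne_top.1 htop
  have ht : Tendsto (starRingEnd ℂ) (𝓝 (starRingEnd ℂ z)) (𝓝 z) := by
    simpa using (Complex.continuous_conj.tendsto (starRingEnd ℂ z))
  have : analyticOrderAt f (starRingEnd ℂ z) = (analyticOrderNatAt f z : ℕ) := by
    rw [hf'.analyticOrderAt_eq_natCast]
    refine ⟨_, AnalyticAt.conj_conj hg, by simpa using hg0, ?_⟩
    filter_upwards [ht.eventually hfg, ht.eventually hsym] with w h1 h2
    rw [Complex.conj_conj] at h2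
    rw [h2, h1]
    simp
  rw [analyticOrderNatAt, this, ENat.toNat_natCast]

theorem hasVanishingOrder_re {f : ℂ → ℂ} {t : ℝ} (hf : AnalyticAt ℂ f t)
    (htop : analyticOrderAt f t ≠ ⊤) (hreal : ∀ᶠ s : ℝ in 𝓝 t, (f s).im = 0) :
    HasVanishingOrder (fun s => (f s).re) (analyticOrderNatAt f t) t := by
  obtain ⟨g, hg, hg0, hfg⟩ := hf.analyticOrderAt_ne_top.1 htop
  have ho : Tendsto (fun s : ℝ => (s : ℂ)) (𝓝 t) (𝓝 (t : ℂ)) := Complex.continuous_ofReal.tendsto t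
  have hgc : ContinuousAt (fun s : ℝ => g s) t := hg.continuousAt.comp_of_eq
    Complex.continuous_ofReal.continuousAt rfl
  have hev : ∀ᶠ s : ℝ in 𝓝 t, f s = ((s - t : ℝ) ^ analyticOrderNatAt f t : ℝ) * g s := by
    filter_upwards [ho.eventually hfg] with s hs
    rw [hs]
    push_cast
    rw [smul_eq_mul]
  have him : (g t).im = 0 := by
    have h1 : Tendsto (fun s : ℝ => (g s).im) (𝓝[≠] t) (𝓝 (g t).im) :=
      ((Complex.continuous_im.continuousAt.comp hgc).tendsto).mono_left nhdsWithin_le_nhds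
    have h2 : ∀ᶠ s : ℝ in 𝓝[≠] t, (0 : ℝ) = (g s).im := by
      filter_upwards [nhdsWithin_le_nhds (hev.and hreal), self_mem_nhdsWithin] with s hs hst
      rw [hs.1, Complex.im_ofReal_mul] at hs
      exact ((mul_eq_zero.1 hs.2).resolve_left (pow_ne_zero _ (sub_ne_zero.2 hst))).symm
    exact (tendsto_nhds_unique (tendsto_const_nhds.congr' h2) h1).symm
  refine ⟨fun s => (g s).re, Complex.continuous_re.continuousAt.comp hgc,
    fun h0 => hg0 (Complex.ext h0 him), ?_⟩
  filter_upwards [hev] with s hs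
  rw [hs, Complex.re_ofReal_mul]

/-- A sum over a conjugation-invariant finite set has the parity of the sum over its real points. -/
theorem even_sum_iff_of_conj (S : Finset ℂ) (n : ℂ → ℕ) (hS : ∀ z ∈ S, starRingEnd ℂ z ∈ S)
    (hn : ∀ z ∈ S, n (starRingEnd ℂ z) = n z) :
    Even (∑ z ∈ S, n z) ↔ Even (∑ z ∈ S with z.im = 0, n z) := by
  have h1 := Finset.sum_filter_add_sum_filter_not S (fun z => z.im = 0) n
  have h2 := Finset.sum_filter_add_sum_filter_not (S.filter fun z => ¬z.im = 0) (fun z => 0 < z.im) n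
  have h3 : ∑ z ∈ (S.filter fun z => ¬z.im = 0) with 0 < z.im, n z
      = ∑ z ∈ (S.filter fun z => ¬z.im = 0) with ¬0 < z.im, n z := by
    refine Finset.sum_nbij' (starRingEnd ℂ) (starRingEnd ℂ) ?_ ?_ ?_ ?_ ?_
    · intro z hz
      simp only [Finset.mem_filter] at hz ⊢
      refine ⟨⟨hS z hz.1.1, by simpa using hz.1.2⟩, ?_⟩
      simp [hz.2.le]
    · intro z hz
      simp only [Finset.mem_filter] at hz ⊢
      refine ⟨⟨hS z hz.1.1, by simpa using hz.1.2⟩, ?_⟩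
      have := lt_of_le_of_ne (not_lt.1 hz.2) hz.1.2
      simpa using this
    · intro z _; simp
    · intro z _; simp
    · intro z hz
      exact (hn z (Finset.mem_filter.1 (Finset.mem_filter.1 hz).1).1).symm
  rw [← h1, ← h2, ← h3, Nat.even_add]
  simp

end Parity

section Index

variable {P : Params} {c q τ₀ : ℝ} {Z : ℝ → ℝ × ℝ}

theorem evans_ofReal_im (h : IsHomoclinic P c q τ₀ Z) (hs : IsSaddle P c q τ₀) (hc : 0 < c) {t : ℝ}
    (ht : 0 ≤ t) : (evans P c q τ₀ Z t).im = 0 := by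
  have := evans_conj h hs hc.ne' (ofReal_mem_gapSet hs hc ht)
  rw [Complex.conj_ofReal] at this
  exact Complex.conj_eq_iff_im.1 this.symm

theorem eventually_sign_evans (h : IsHomoclinic P c q τ₀ Z) (hs : IsSaddle P c q τ₀) (hc : 0 < c)
    {Yp Ym : ℝ → ℝ → ℝ × ℝ} (hYp : IsManifoldFamily P c q τ₀ Z (Ici 0) atTop Yp)
    (hYm : IsManifoldFamily P c q τ₀ Z (Iic 0) atBot Ym) :
    (0 < deriv (melnikov P c q Z Yp Ym) c → ∀ᶠ t : ℝ in 𝓝[>] 0, (evans P c q τ₀ Z t).re < 0) ∧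
    (deriv (melnikov P c q Z Yp Ym) c < 0 → ∀ᶠ t : ℝ in 𝓝[>] 0, 0 < (evans P c q τ₀ Z t).re) := by
  obtain ⟨-, h0, κ, hκ, hd⟩ := exists_hasDerivAt_evans_zero h hs hc hYp hYm
  have hr : HasDerivAt (fun t : ℝ => (evans P c q τ₀ Z t).re)
      (-(κ * deriv (melnikov P c q Z Yp Ym) c)) 0 := by
    have := HasDerivAt.real_of_complex (z := 0) (by rw [Complex.ofReal_zero]; exact hd)
    rwa [Complex.ofReal_re] at this
  have hslope := hasDerivAt_iff_tendsto_slope.1 hr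
  have hle : 𝓝[>] (0 : ℝ) ≤ 𝓝[≠] 0 := nhdsWithin_mono _ fun x hx => ne_of_gt hx
  have hsl : ∀ t : ℝ, slope (fun t : ℝ => (evans P c q τ₀ Z t).re) 0 t = (evans P c q τ₀ Z t).re / t :=
    fun t => by simp [slope_def_field, h0]
  constructor
  · intro hpos
    filter_upwards [hle (hslope.eventually (gt_mem_nhds (neg_lt_zero.2 (mul_pos hκ hpos)))), self_mem_nhdsWithin] with t ht ht0
    rw [hsl] at ht
    exact (div_neg_iff.1 ht).resolve_left (fun hh => absurd hh.2 (not_lt.2 (le_of_lt ht0))) |>.1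
  · intro hneg
    filter_upwards [hle (hslope.eventually (lt_mem_nhds (neg_pos.2 (mul_neg_of_pos_of_neg hκ hneg)))), self_mem_nhdsWithin] with t ht ht0
    rw [hsl] at ht
    exact (div_pos_iff.1 ht).resolve_right (fun hh => absurd hh.2 (not_lt.2 (le_of_lt ht0))) |>.1

theorem deriv_melnikov_neg_of_stable (h : IsHomoclinic P c q τ₀ Z) (hs : IsSaddle P c q τ₀) (hc : 0 < c)
    {Yp Ym : ℝ → ℝ → ℝ × ℝ} (hYp : IsManifoldFamily P c q τ₀ Z (Ici 0) atTop Yp)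
    (hYm : IsManifoldFamily P c q τ₀ Z (Iic 0) atBot Ym) (hst : StablePointSpectrum P c q τ₀ Z) :
    deriv (melnikov P c q Z Yp Ym) c < 0 := by
  rcases lt_trichotomy (deriv (melnikov P c q Z Yp Ym) c) 0 with hd | hd | hd
  · exact hd
  · exfalso
    obtain ⟨-, h0, κ, -, hev⟩ := exists_hasDerivAt_evans_zero h hs hc hYp hYm
    rw [hd, mul_zero, neg_zero, Complex.ofReal_zero] at hev
    have h0g : (0 : ℂ) ∈ gapSet P c q τ₀ := by simpa using ofReal_mem_gapSet hs hc (le_refl (0 : ℝ))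
    have han := analyticAt_evans h hs hc.ne' h0g
    obtain ⟨g, hg, hg0, hfg⟩ := (han.analyticOrderAt_eq_natCast (n := 1)).1 (by exact_mod_cast hst.2)
    have h1 : HasDerivAt (evans P c q τ₀ Z) (1 * g 0 + id 0 * deriv g 0) 0 :=
      ((hasDerivAt_id (0 : ℂ)).mul hg.differentiableAt.hasDerivAt).congr_of_eventuallyEq
        (hfg.mono fun z hz => by simpa using hz)
    have h2 := h1.unique hev
    rw [id, zero_mul, add_zero, one_mul] at h2
    exact hg0 h2
  · exfalso
    obtain ⟨R, hR, hpos⟩ := exists_evans_pos h hs hc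
    obtain ⟨a, ha, ha0, haR⟩ := (((eventually_sign_evans h hs hc hYp hYm).1 hd).and
      (Ioo_mem_nhdsGT hR)).exists
    have hcont : ContinuousOn (fun t : ℝ => (evans P c q τ₀ Z t).re) (Icc a R) := fun t ht =>
      (Complex.continuous_re.continuousAt.comp (ContinuousAt.comp (f := fun t : ℝ => (t : ℂ))
        (analyticAt_evans h hs hc.ne' (ofReal_mem_gapSet hs hc (ha0.le.trans ht.1))).continuousAt
        Complex.continuous_ofReal.continuousAt)).continuousWithinAt
    obtain ⟨t, ht, ht0⟩ := intermediate_value_Icc haR.le hcont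
      (show (0 : ℝ) ∈ Icc _ _ from ⟨ha.le, (hpos R le_rfl).le⟩)
    have htpos : 0 < t := ha0.trans_le ht.1
    have := hst.1 t ⟨ofReal_mem_extendedSplittingRegion hs hc htpos.le,
      Complex.ext ht0 (evans_ofReal_im h hs hc htpos.le)⟩ (by simpa using htpos.le)
    exact htpos.ne' (Complex.ofReal_eq_zero.1 this)

theorem ExtendedConsistentSplitting.subset_gapSet (hE : ExtendedConsistentSplitting P c q τ₀)
    (hs : IsSaddle P c q τ₀) (hc : 0 < c) : {l : ℂ | 0 ≤ l.re} ⊆ gapSet P c q τ₀ := fun l hl => by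
  by_cases h0 : l = 0
  · simpa [h0] using ofReal_mem_gapSet hs hc (le_refl (0 : ℝ))
  · exact extendedSplittingRegion_subset (hE ⟨hl, h0⟩)

theorem ExtendedConsistentSplitting.analyticOnNhd (hE : ExtendedConsistentSplitting P c q τ₀)
    (h : IsHomoclinic P c q τ₀ Z) (hs : IsSaddle P c q τ₀) (hc : 0 < c) :
    AnalyticOnNhd ℂ (evans P c q τ₀ Z) {l | 0 ≤ l.re} := fun _ hl =>
  analyticAt_evans h hs hc.ne' (hE.subset_gapSet hs hc hl)

theorem isPreconnected_re_nonneg : IsPreconnected {l : ℂ | 0 ≤ l.re} :=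
  (convex_halfSpace_re_ge 0).isPreconnected

theorem ExtendedConsistentSplitting.analyticOrderAt_ne_top (hE : ExtendedConsistentSplitting P c q τ₀)
    (h : IsHomoclinic P c q τ₀ Z) (hs : IsSaddle P c q τ₀) (hc : 0 < c) {l : ℂ} (hl : 0 ≤ l.re) :
    analyticOrderAt (evans P c q τ₀ Z) l ≠ ⊤ := fun htop => by
  obtain ⟨R, hR, hpos⟩ := exists_evans_pos h hs hc
  have := (hE.analyticOnNhd h hs hc).eqOn_zero_of_preconnected_of_eventuallyEq_zero
    isPreconnected_re_nonneg hl (analyticOrderAt_eq_top.1 htop)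
    (show (R : ℂ) ∈ {l : ℂ | 0 ≤ l.re} by simpa using hR.le)
  have h1 := hpos R le_rfl
  rw [this] at h1
  simp at h1

theorem ExtendedConsistentSplitting.finite_unstableRoots (hE : ExtendedConsistentSplitting P c q τ₀)
    (h : IsHomoclinic P c q τ₀ Z) (hs : IsSaddle P c q τ₀) (hc : 0 < c) :
    (unstableRoots P c q τ₀ Z).Finite := by
  obtain ⟨R, hR, hne⟩ := exists_evans_ne_zero h hs hc
  by_contra hinf
  have hK : IsCompact (Metric.closedBall (0 : ℂ) R ∩ {l : ℂ | 0 ≤ l.re}) :=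
    (isCompact_closedBall 0 R).inter_right (isClosed_le continuous_const Complex.continuous_re)
  have hsub : unstableRoots P c q τ₀ Z ⊆ Metric.closedBall (0 : ℂ) R ∩ {l : ℂ | 0 ≤ l.re} := fun l hl => by
    refine ⟨?_, hl.2.le⟩
    rw [mem_closedBall_zero_iff]
    by_contra hlt
    exact hne l (extendedSplittingRegion_subset hl.1.1) hl.2.le (not_le.1 hlt).le hl.1.2
  obtain ⟨z, hz, hacc⟩ := Set.Infinite.exists_accPt_of_subset_isCompact hinf hK hsub
  refine hE.analyticOrderAt_ne_top h hs hc hz.2 (analyticOrderAt_eq_top.2 ?_)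
  refine (hE.analyticOnNhd h hs hc z hz.2).frequently_zero_iff_eventually_zero.1 ?_
  exact (accPt_iff_frequently_nhdsNE.1 hacc).mono fun w hw => hw.1.2

theorem ExtendedConsistentSplitting.eventually_evans_mul_pos (hE : ExtendedConsistentSplitting P c q τ₀)
    (h : IsHomoclinic P c q τ₀ Z) (hs : IsSaddle P c q τ₀) (hc : 0 < c) :
    ∀ᶠ a : ℝ in 𝓝[>] 0, 0 < (evans P c q τ₀ Z a).re * (-1) ^ unstableCount P c q τ₀ Z := by
  have hfin := hE.finite_unstableRoots h hs hc
  obtain ⟨R, hR, hpos⟩ := exists_evans_pos h hs hc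
  have hmem : ∀ {l : ℂ}, l ∈ unstableRoots P c q τ₀ Z ↔ 0 < l.re ∧ evans P c q τ₀ Z l = 0 := by
    intro l
    refine ⟨fun hl => ⟨hl.2, hl.1.2⟩, fun hl => ⟨⟨hE ⟨hl.1.le, fun h0 => ?_⟩, hl.2⟩, hl.1⟩⟩
    rw [mem_singleton_iff] at h0
    simp [h0] at hl
  have han : ∀ {l : ℂ}, 0 ≤ l.re → AnalyticAt ℂ (evans P c q τ₀ Z) l := fun hl => hE.analyticOnNhd h hs hc _ hl
  have htop : ∀ {l : ℂ}, 0 ≤ l.re → analyticOrderAt (evans P c q τ₀ Z) l ≠ ⊤ :=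
    fun hl => hE.analyticOrderAt_ne_top h hs hc hl
  have hconj : ∀ {l : ℂ}, 0 ≤ l.re → evans P c q τ₀ Z (starRingEnd ℂ l) = starRingEnd ℂ (evans P c q τ₀ Z l) :=
    fun hl => evans_conj h hs hc.ne' (hE.subset_gapSet hs hc hl)
  set N : ℂ → ℕ := analyticOrderNatAt (evans P c q τ₀ Z) with hN
  have hcount : unstableCount P c q τ₀ Z = ∑ z ∈ hfin.toFinset, N z := finsum_mem_eq_finite_toFinset_sum _ hfin
  have heven := even_sum_iff_of_conj hfin.toFinset N (fun z hz => by
      rw [hfin.mem_toFinset, hmem] at hz ⊢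
      exact ⟨by simpa using hz.1, by rw [hconj hz.1.le, hz.2, map_zero]⟩) (fun z hz => by
      rw [hfin.mem_toFinset, hmem] at hz
      refine analyticOrderNatAt_conj (han hz.1.le) (han (by simpa using hz.1.le)) (htop hz.1.le) ?_
      have : ∀ᶠ w : ℂ in 𝓝 z, 0 < w.re := Complex.continuous_re.continuousAt.eventually (lt_mem_nhds hz.1)
      exact this.mono fun w hw => hconj hw.le)
  rw [← hcount] at heven
  set T : Finset ℝ := (hfin.toFinset.filter fun z => z.im = 0).image Complex.re with hT
  have hTmem : ∀ {t : ℝ}, t ∈ T ↔ 0 < t ∧ evans P c q τ₀ Z t = 0 := fun {t} => by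
    simp only [hT, Finset.mem_image, Finset.mem_filter, hfin.mem_toFinset, hmem]
    constructor
    · rintro ⟨z, ⟨⟨h1, h2⟩, h3⟩, rfl⟩
      have : ((z.re : ℝ) : ℂ) = z := Complex.ext (by simp) (by simp [h3])
      exact ⟨h1, by rw [this]; exact h2⟩
    · rintro ⟨h1, h2⟩
      exact ⟨t, ⟨⟨by simpa using h1, h2⟩, by simp⟩, by simp⟩
  have hsum : ∑ z ∈ hfin.toFinset with z.im = 0, N z = ∑ t ∈ T, N (t : ℂ) := by
    rw [hT, Finset.sum_image]
    · refine Finset.sum_congr rfl fun z hz => ?_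
      rw [show ((z.re : ℝ) : ℂ) = z from Complex.ext (by simp) (by simp [(Finset.mem_filter.1 hz).2])]
    · intro z hz w hw hzw
      exact Complex.ext hzw (by
        rw [(Finset.mem_filter.1 (Finset.mem_coe.1 hz)).2, (Finset.mem_filter.1 (Finset.mem_coe.1 hw)).2])
  rw [hsum] at heven
  have hpar : ((-1 : ℝ)) ^ unstableCount P c q τ₀ Z = (-1) ^ ∑ t ∈ T, N (t : ℂ) := by
    rcases Nat.even_or_odd (unstableCount P c q τ₀ Z) with he | ho
    · rw [he.neg_one_pow, (heven.1 he).neg_one_pow]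
    · have : Odd (∑ t ∈ T, N (t : ℂ)) := by
        rw [← Nat.not_even_iff_odd] at ho ⊢
        exact fun hh => ho (heven.2 hh)
      rw [ho.neg_one_pow, this.neg_one_pow]
  have hsmall : ∀ᶠ a : ℝ in 𝓝[>] 0, ∀ t ∈ T, a < t := by
    rw [Filter.eventually_all_finset]
    exact fun t ht => nhdsWithin_le_nhds (gt_mem_nhds (hTmem.1 ht).1)
  filter_upwards [hsmall, self_mem_nhdsWithin, Ioo_mem_nhdsGT hR] with a haT ha0 haR
  obtain ⟨b, hb1, hb2⟩ : ∃ b, R ≤ b ∧ ∀ t ∈ T, t < b := by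
    obtain ⟨M, hM⟩ := T.bddAbove
    exact ⟨max R (M + 1), le_max_left _ _, fun t ht =>
      lt_of_lt_of_le (by linarith [hM (Finset.mem_coe.2 ht)]) (le_max_right _ _)⟩
  have hab : a ≤ b := haR.2.le.trans hb1
  have hfinal := mul_pos_of_hasVanishingOrder (a := a) (b := b) T
    (f := fun t : ℝ => (evans P c q τ₀ Z t).re) (n := fun t => if t ∈ T then N (t : ℂ) else 0)
    (fun t ht => by
      have ht0 : 0 < t := lt_of_lt_of_le ha0 ht.1
      have htr : 0 ≤ ((t : ℝ) : ℂ).re := by simpa using ht0.le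
      have := hasVanishingOrder_re (han htr) (htop htr) (by
        filter_upwards [lt_mem_nhds ht0] with s hs0 using evans_ofReal_im h hs hc hs0.le)
      by_cases htT : t ∈ T
      · rw [if_pos htT]; exact this
      · rw [if_neg htT]
        have hz : evans P c q τ₀ Z t ≠ 0 := fun h0 => htT (hTmem.2 ⟨ht0, h0⟩)
        have : N t = 0 := by
          rw [hN, analyticOrderNatAt, (han htr).analyticOrderAt_eq_zero.2 hz]; rfl
        rw [← this]; assumption)
    (fun t ht => ⟨haT t ht, hb2 t ht⟩) (fun t ht => if_neg ht) hab
  rw [Finset.sum_congr rfl fun t ht => if_pos ht, ← hpar] at hfinal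
  have hb := hpos b hb1
  have e : (evans P c q τ₀ Z a).re * (evans P c q τ₀ Z b).re * (-1) ^ unstableCount P c q τ₀ Z
      = (evans P c q τ₀ Z b).re * ((evans P c q τ₀ Z a).re * (-1) ^ unstableCount P c q τ₀ Z) := by ring
  simp only [e] at hfinal
  exact pos_of_mul_pos_right hfinal hb.le

end Index

end StVenant

end

theorem mainTheorem3 (P : StVenant.Params) (c q τ₀ : ℝ) (hc : c ≠ 0)
    (hsaddle : StVenant.IsSaddle P c q τ₀)
    (Z : ℝ → ℝ × ℝ) (hZ : StVenant.IsHomoclinic P c q τ₀ Z)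
    (Yp Ym : ℝ → ℝ → ℝ × ℝ)
    (hYp : StVenant.IsManifoldFamily P c q τ₀ Z (Set.Ici 0) atTop Yp)
    (hYm : StVenant.IsManifoldFamily P c q τ₀ Z (Set.Iic 0) atBot Ym) :
    -- the Evans function is well defined and analytic on the region of extended splitting,
    -- which contains the nonnegative real axis
    (∀ lam ∈ StVenant.extendedSplittingRegion P c q τ₀,
      (∃! δ, StVenant.IsEvansValue (fun x => StVenant.profileMatrix P c q Z x lam)
        (StVenant.limitMatrix P c q τ₀ lam) δ) ∧
      AnalyticAt ℂ (StVenant.evans P c q τ₀ Z) lam) ∧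
    (∀ t : ℝ, 0 ≤ t → (t : ℂ) ∈ StVenant.extendedSplittingRegion P c q τ₀) ∧
    -- necessary condition for stability of the point spectrum
    DifferentiableAt ℝ (StVenant.melnikov P c q Z Yp Ym) c ∧
    (StVenant.StablePointSpectrum P c q τ₀ Z →
      deriv (StVenant.melnikov P c q Z Yp Ym) c < 0) ∧
    -- parity of the number of roots with positive real part
    (StVenant.ExtendedConsistentSplitting P c q τ₀ →
      (StVenant.unstableRoots P c q τ₀ Z).Finite ∧
      (deriv (StVenant.melnikov P c q Z Yp Ym) c < 0 →
        Even (StVenant.unstableCount P c q τ₀ Z)) ∧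
      (0 < deriv (StVenant.melnikov P c q Z Yp Ym) c →
        Odd (StVenant.unstableCount P c q τ₀ Z))) := by
  have hc0 : 0 < c := hZ.speed_pos hsaddle hc
  refine ⟨fun lam hlam => ?_, fun t ht => StVenant.ofReal_mem_extendedSplittingRegion hsaddle hc0 ht,
    (StVenant.exists_hasDerivAt_evans_zero hZ hsaddle hc0 hYp hYm).1,
    StVenant.deriv_melnikov_neg_of_stable hZ hsaddle hc0 hYp hYm, fun hE => ?_⟩
  · have hg := StVenant.extendedSplittingRegion_subset hlam
    exact ⟨StVenant.existsUnique_isEvansValue hZ hsaddle hc hg, StVenant.analyticAt_evans hZ hsaddle hc hg⟩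
  · have hsign := StVenant.eventually_sign_evans hZ hsaddle hc0 hYp hYm
    have hcount := hE.eventually_evans_mul_pos hZ hsaddle hc0
    refine ⟨hE.finite_unstableRoots hZ hsaddle hc0, fun hd => ?_, fun hd => ?_⟩
    · obtain ⟨a, h1, h2⟩ := (hcount.and (hsign.2 hd)).exists
      by_contra hodd
      rw [(Nat.not_even_iff_odd.1 hodd).neg_one_pow] at h1
      linarith
    · obtain ⟨a, h1, h2⟩ := (hcount.and (hsign.1 hd)).exists
      by_contra heven
      rw [(Nat.not_odd_iff_even.1 heven).neg_one_pow] at h1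
      linarith
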